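/- Let $G$ be a reductive algebraic group over $\mathbb{Q}$, not necessarily connected; that is, $G$ is an affine group scheme of finite type over $\mathbb{Q}$ all of whose finite-dimensional representations are completely reducible. Let $w:\mathbb{G}_m\to G$ be an injective central cocharacter. For a $G$-representation $V$ (an algebraic representation on a $\mathbb{Q}$-vector space, possibly of infinite dimension), the part of weight $r$ is the subspace on which $w(t)$ acts as $t^r$, and the part $V\langle r\rangle$ of Adams degree $r$ is the part of weight $-r$. A *cdga over $G$* is a cochain complex $A=(A^n,d)_{n\in\mathbb{Z}}$ of $G$-representations with a $G$-equivariant, associative, graded commutative and unital multiplication, for which $d$ satisfies the graded Leibniz rule $d(ab)=da\cdot b+(-1)^{\deg a}a\cdot db$, such that the trivial representation $\mathbb{Q}=\mathbb{Q}\cdot 1$, as a complex concentrated in degree $0$, is a direct summand of the complex of representations $A\langle 0\rangle$. It is *Adams connected* if $A=\bigoplus_{r\ge 0}A\langle r\rangle$ and $A\langle 0\rangle=\mathbb{Q}\cdot 1$. A *dg $A$-module over $G$* is a complex $M$ of $G$-representations with a $G$-equivariant graded $A$-module structure such that $d(am)=da\cdot m+(-1)^{\deg a}a\,dm$. Morphisms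 are the $G$-equivariant $A$-linear maps of complexes. Let $\mathcal{K}_A^G$ be the category of dg $A$-modules over $G$ and homotopy classes of morphisms, where $f\sim g$ if $f-g=dh+hd$ for a $G$-equivariant map $h$ of degree $-1$ with $h(am)=(-1)^{\deg a}a\,h(m)$. Let $\mathcal{D}_A^G$ be the localization of $\mathcal{K}_A^G$ at the quasi-isomorphisms. The derived tensor product $\otimes^{\mathbb{L}}_A$ on $\mathcal{D}_A^G$, with unit $A$, is computed by means of flat resolutions, where a dg module $P$ is flat if $P\otimes_A-$ and $-\otimes_AP$ preserve quasi-isomorphisms (for example, all cell modules, defined below, are flat). An object $M$ of $\mathcal{D}_A^G$ is *rigid* if there are an object $N$ and morphisms $\delta:A\to M\otimes^{\mathbb{L}}_AN$ and $\varepsilon:N\otimes^{\mathbb{L}}_AM\to A$ in $\mathcal{D}_A^G$ such that the composites $$M\cong A\otimes^{\mathbb{L}}_AM\xrightarrow{\delta\otimes 1}M\otimes^{\mathbb{L}}_AN\otimes^{\mathbb{L}}_AM\xrightarrow{1\otimes\varepsilon}M\otimes^{\mathbb{L}}_AA\cong M,$$ $$N\cong N\otimes^{\mathbb{L}}_AA\xrightarrow{1\otimes\delta}N\otimes^{\mathbb{L}}_AM\otimes^{\mathbb{L}}_AN\xrightarrow{\varepsilon\otimes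 1}A\otimes^{\mathbb{L}}_AN\cong N$$ are the identities. A dg $A$-module $M$ is a *cell module* if, as a graded $A$-module in $G$-representations, it is a direct sum $\bigoplus_{j\in J}A[-n_j]\otimes V_j$ with $n_j\in\mathbb{Z}$ and finite-dimensional $G$-representations $V_j$, and if $J$ is the union of an increasing sequence of subsets $\emptyset=J_{-1}\subset J_0\subset J_1\subset\cdots$ such that $d$ maps $1\otimes V_j$, for $j\in J_n$, to the $A$-submodule generated by the $1\otimes V_i$ with $i\in J_{n-1}$. It is a *finite cell module* if $J$ can be taken finite. Let $\mathcal{D}_A^{G,f}\subset\mathcal{D}_A^G$ be the full subcategory of the objects that are isomorphic in $\mathcal{D}_A^G$ to a finite cell module. A cell module $N$ is a *summand up to homotopy* of a cell module $M$ if $M$ is homotopy equivalent, that is, isomorphic in $\mathcal{K}_A^G$, to $N\oplus N'$ for some cell module $N'$. Let $\mathcal{KFCM}_A^G\subset\mathcal{K}_A^G$ be the full subcategory of the cell modules that are summands up to homotopy of finite cell modules. **Theorem.** Let $A$ be an Adams connected cdga over $G$. Then: 1. an object $M$ of $\mathcal{D}_A^G$ is rigid if and only if it lies in $\mathcal{D}_A^{G,f}$;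 2. the localization functor $\mathcal{K}_A^G\to\mathcal{D}_A^G$ maps $\mathcal{KFCM}_A^G$ into $\mathcal{D}_A^{G,f}$ and restricts to an equivalence of categories $\mathcal{KFCM}_A^G\to\mathcal{D}_A^{G,f}$; 3. $\mathcal{D}_A^{G,f}$ is idempotent complete. -/

import Mathlib

open CategoryTheory
open scoped TensorProduct LaurentPolynomial

universe u

noncomputable section

section Reps

variable {H : Type u} [CommRing H] [HopfAlgebra ℚ H]

/-- `ρ : M → M ⊗ H` is a (right) coaction of the Hopf algebra `H = 𝒪(G)`: this is the same thing as
an algebraic linear representation of the affine group scheme `G = Spec H` on `M`. -/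
structure IsCoaction {M : Type u} [AddCommGroup M] [Module ℚ M] (ρ : M →ₗ[ℚ] M ⊗[ℚ] H) :
    Prop where
  counit : ∀ x, TensorProduct.rid ℚ M ((Coalgebra.counit (R := ℚ) (A := H)).lTensor M (ρ x)) = x
  coassoc : ∀ x, TensorProduct.assoc ℚ M H H (ρ.rTensor H (ρ x)) =
    (Coalgebra.comul (R := ℚ) (A := H)).lTensor M (ρ x)

/-- The subspace `W` is a subrepresentation. -/
def IsSubrep {M : Type u} [AddCommGroup M] [Module ℚ M] (ρ : M →ₗ[ℚ] M ⊗[ℚ] H)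
    (W : Submodule ℚ M) : Prop :=
  ∀ x ∈ W, ρ x ∈ LinearMap.range (W.subtype.rTensor H)

variable (H) in
/-- `G = Spec H` is a reductive group over `ℚ` (not necessarily connected): every
finite-dimensional representation is completely reducible. -/
def IsReductive : Prop :=
  ∀ (V : Type u) [AddCommGroup V] [Module ℚ V] [FiniteDimensional ℚ V] (ρ : V →ₗ[ℚ] V ⊗[ℚ] H),
    IsCoaction ρ → ∀ W : Submodule ℚ V, IsSubrep ρ W → ∃ W', IsSubrep ρ W' ∧ IsCompl W W'

/-- The cocharacter `𝔾ₘ → G` with comorphism `w` is central: the morphisms `𝔾ₘ × G → G`,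
`(t, g) ↦ w(t) g` and `(t, g) ↦ g w(t)`, agree. -/
def IsCentralCochar (w : H →ₐc[ℚ] ℚ[T;T⁻¹]) : Prop :=
  ∀ x : H, (w : H →ₗ[ℚ] ℚ[T;T⁻¹]).rTensor H (Coalgebra.comul (R := ℚ) x) =
    TensorProduct.comm ℚ H ℚ[T;T⁻¹]
      ((w : H →ₗ[ℚ] ℚ[T;T⁻¹]).lTensor H (Coalgebra.comul (R := ℚ) x))

/-- The subspace of weight `r`, on which `w(t)` acts as `t ^ r`. -/
def weightPart {M : Type u} [AddCommGroup M] [Module ℚ M] (ρ : M →ₗ[ℚ] M ⊗[ℚ] H)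
    (w : H →ₐc[ℚ] ℚ[T;T⁻¹]) (r : ℤ) : Submodule ℚ M :=
  LinearMap.ker ((w : H →ₗ[ℚ] ℚ[T;T⁻¹]).lTensor M ∘ₗ ρ -
    (TensorProduct.mk ℚ M ℚ[T;T⁻¹]).flip (LaurentPolynomial.T r))

/-- The part of Adams degree `r`, that is, of weight `-r`. -/
def adamsPart {M : Type u} [AddCommGroup M] [Module ℚ M] (ρ : M →ₗ[ℚ] M ⊗[ℚ] H)
    (w : H →ₐc[ℚ] ℚ[T;T⁻¹]) (r : ℤ) : Submodule ℚ M :=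
  weightPart ρ w (-r)

variable (H) in
/-- The structure of a cochain complex of representations of `G = Spec H` on the vector space `M`,
which is the direct sum of the terms `gr n`, `n ∈ ℤ`, of the complex. -/
structure GComplex (M : Type u) [AddCommGroup M] [Module ℚ M] where
  gr : ℤ → Submodule ℚ M
  isInternal : DirectSum.IsInternal gr
  d : M →ₗ[ℚ] M
  d_mem : ∀ {n x}, x ∈ gr n → d x ∈ gr (n + 1)
  d_d : ∀ x, d (d x) = 0
  ρ : M →ₗ[ℚ] M ⊗[ℚ] H
  isCoaction : IsCoaction ρ
  isSubrep : ∀ n, IsSubrep ρ (gr n)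
  ρ_d : ∀ x, ρ (d x) = d.rTensor H (ρ x)

end Reps

section Glue

variable {H : Type u} [CommRing H] [HopfAlgebra ℚ H]
variable {M : Type u} [AddCommGroup M] [Module ℚ M] (S : GComplex H M)
variable {P : Type*} [AddCommMonoid P] [Module ℚ P]

theorem GComplex.bijective : Function.Bijective (DirectSum.coeLinearMap S.gr) := S.isInternal

/-- The linear map with prescribed restrictions to the homogeneous parts. -/
def GComplex.glue (f : ∀ n, S.gr n →ₗ[ℚ] P) : M →ₗ[ℚ] P :=
  DirectSum.toModule ℚ ℤ P f ∘ₗ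
    (LinearEquiv.ofBijective (DirectSum.coeLinearMap S.gr) S.bijective).symm.toLinearMap

theorem GComplex.glue_apply (f : ∀ n, S.gr n →ₗ[ℚ] P) {n : ℤ} {x : M} (hx : x ∈ S.gr n) :
    S.glue f x = f n ⟨x, hx⟩ := by
  have h : (LinearEquiv.ofBijective (DirectSum.coeLinearMap S.gr) S.bijective).symm x =
      DirectSum.lof ℚ ℤ (fun n => S.gr n) n ⟨x, hx⟩ := by
    rw [LinearEquiv.symm_apply_eq, LinearEquiv.ofBijective_apply, DirectSum.coeLinearMap_lof]
  simp only [GComplex.glue, LinearMap.comp_apply, LinearEquiv.coe_coe, h, DirectSum.toModule_lof]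

theorem GComplex.induction {p : M → Prop} (hom : ∀ n, ∀ x ∈ S.gr n, p x)
    (zero : p 0) (add : ∀ x y, p x → p y → p (x + y)) (x : M) : p x := by
  have hx : x ∈ iSup S.gr := by rw [S.isInternal.submodule_iSup_eq_top]; trivial
  exact Submodule.iSup_induction S.gr (motive := p) hx hom zero add

theorem GComplex.hom_ext {f g : M →ₗ[ℚ] P} (h : ∀ n, ∀ x ∈ S.gr n, f x = g x) : f = g := by
  ext x
  refine S.induction (p := fun x => f x = g x) h (by simp) ?_ x
  intro x y hx hy
  rw [map_add, map_add, hx, hy]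

theorem GComplex.isInternal_of {gr : ℤ → Submodule ℚ M} (f : M →ₗ[ℚ] ℤ →₀ M)
    (h₁ : ∀ x, x ∈ iSup gr) (h₂ : ∀ n, ∀ x ∈ gr n, f x = Finsupp.single n x) :
    DirectSum.IsInternal gr := by
  have key : ∀ (z : DirectSum ℤ fun n => gr n) (n : ℤ),
      f (DirectSum.coeLinearMap gr z) n = (z n : M) := by
    intro z n
    induction z using DirectSum.induction_on with
    | zero => simp
    | of i x =>
      have e : DirectSum.coeLinearMap gr (DirectSum.of (fun n => gr n) i x) = x :=
        DirectSum.coeLinearMap_of gr i x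
      rw [e, h₂ i x x.2]
      by_cases h : i = n
      · subst h; simp
      · rw [Finsupp.single_eq_of_ne (Ne.symm h), DirectSum.of_eq_of_ne _ _ _ (Ne.symm h)]; rfl
    | add x y hx hy => simp [hx, hy]
  constructor
  · intro z z' h
    refine DFinsupp.ext fun n => Subtype.ext ?_
    have h' : DirectSum.coeLinearMap gr z = DirectSum.coeLinearMap gr z' := h
    exact (key z n).symm.trans (by rw [h', key])
  · intro x
    have hx : x ∈ LinearMap.range (DirectSum.coeLinearMap gr) := by
      rw [DirectSum.range_coeLinearMap]
      exact h₁ x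
    exact hx

/-- The sign operator `x ↦ (-1) ^ n x` for `x` of degree `n`. -/
def GComplex.sgn : M →ₗ[ℚ] M := S.glue fun n => (-1 : ℚ) ^ n • (S.gr n).subtype

theorem GComplex.sgn_apply {n : ℤ} {x : M} (hx : x ∈ S.gr n) : S.sgn x = (-1 : ℚ) ^ n • x := by
  rw [GComplex.sgn, S.glue_apply _ hx]; rfl

/-- The pairing `(x ⊗ h, y ⊗ k) ↦ b (x, y) ⊗ h k` induced by a bilinear map `b`. -/
def pairH (H : Type u) [CommRing H] [HopfAlgebra ℚ H] {M N P : Type u} [AddCommGroup M]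
    [Module ℚ M] [AddCommGroup N] [Module ℚ N] [AddCommGroup P] [Module ℚ P]
    (b : M →ₗ[ℚ] N →ₗ[ℚ] P) : M ⊗[ℚ] H →ₗ[ℚ] N ⊗[ℚ] H →ₗ[ℚ] P ⊗[ℚ] H :=
  TensorProduct.map₂ b (LinearMap.mul ℚ H)

@[simp] theorem pairH_tmul {N P : Type u}
    [AddCommGroup N] [Module ℚ N] [AddCommGroup P] [Module ℚ P]
    (b : M →ₗ[ℚ] N →ₗ[ℚ] P) (x : M) (h : H) (y : N) (k : H) :
    pairH H b (x ⊗ₜ h) (y ⊗ₜ k) = b x y ⊗ₜ (h * k) := by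
  simp [pairH]

end Glue

/-- A commutative differential graded algebra over `G = Spec H`. -/
structure CDGA (H : Type u) [CommRing H] [HopfAlgebra ℚ H] where
  carrier : Type u
  [ring : Ring carrier]
  [algebra : Algebra ℚ carrier]
  str : GComplex H carrier
  one_mem : (1 : carrier) ∈ str.gr 0
  mul_mem : ∀ {p q a b}, a ∈ str.gr p → b ∈ str.gr q → a * b ∈ str.gr (p + q)
  comm : ∀ {p q a b}, a ∈ str.gr p → b ∈ str.gr q → a * b = (-1 : ℚ) ^ (p * q) • (b * a)
  leibniz : ∀ {p a} (b), a ∈ str.gr p → str.d (a * b) = str.d a * b + (-1 : ℚ) ^ p • (a * str.d b)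
  ρ_one : str.ρ 1 = 1 ⊗ₜ 1
  ρ_mul : ∀ a b, str.ρ (a * b) = str.ρ a * str.ρ b
  /-- The trivial representation `ℚ · 1`, placed in degree `0`, is a direct summand. -/
  unit_summand : ∃ π : carrier →ₗ[ℚ] ℚ, π 1 = 1 ∧ (∀ n ≠ 0, ∀ a ∈ str.gr n, π a = 0) ∧
    (∀ a, π (str.d a) = 0) ∧ ∀ a, π.rTensor H (str.ρ a) = π a ⊗ₜ 1

attribute [instance] CDGA.ring CDGA.algebra

instance (H : Type u) [CommRing H] [HopfAlgebra ℚ H] : CoeSort (CDGA H) (Type u) :=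
  ⟨CDGA.carrier⟩

variable {H : Type u} [CommRing H] [HopfAlgebra ℚ H]

/-- `A` is Adams connected: `A` is the sum of its parts of Adams degree `r ≥ 0`, and its part of
Adams degree `0` is `ℚ`. -/
structure CDGA.IsAdamsConnected (A : CDGA H) (w : H →ₐc[ℚ] ℚ[T;T⁻¹]) : Prop where
  nonneg : ⨆ r : ℕ, adamsPart A.str.ρ w r = ⊤
  zero : adamsPart A.str.ρ w 0 = Submodule.span ℚ {1}

/-- Dg modules over `A`, in representations of `G = Spec H`. -/
structure DGMod (A : CDGA H) where
  carrier : Type u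
  [addCommGroup : AddCommGroup carrier]
  [moduleRat : Module ℚ carrier]
  [module : Module A carrier]
  [isScalarTower : IsScalarTower ℚ A carrier]
  str : GComplex H carrier
  smul_mem : ∀ {p q : ℤ} {a : A} {x : carrier},
    a ∈ A.str.gr p → x ∈ str.gr q → a • x ∈ str.gr (p + q)
  leibniz : ∀ {p : ℤ} {a : A} (x : carrier), a ∈ A.str.gr p →
    str.d (a • x) = A.str.d a • x + (-1 : ℚ) ^ p • (a • str.d x)
  ρ_smul : ∀ (a : A) (x : carrier),
    str.ρ (a • x) = pairH H (Algebra.lsmul ℚ ℚ carrier).toLinearMap (A.str.ρ a) (str.ρ x)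

attribute [instance] DGMod.addCommGroup DGMod.moduleRat DGMod.module DGMod.isScalarTower

variable {A : CDGA H}

namespace DGMod

instance : CoeSort (DGMod A) (Type u) := ⟨DGMod.carrier⟩

/-- Morphisms of dg modules over `A`. -/
@[ext]
structure Hom (M N : DGMod A) where
  toLin : M →ₗ[A] N
  mem : ∀ {n x}, x ∈ M.str.gr n → toLin x ∈ N.str.gr n
  d : ∀ x, toLin (M.str.d x) = N.str.d (toLin x)
  ρ : ∀ x, N.str.ρ (toLin x) = (toLin.restrictScalars ℚ).rTensor H (M.str.ρ x)

@[simps id_toLin comp_toLin]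
instance : Category (DGMod A) where
  Hom := Hom
  id M :=
    { toLin := LinearMap.id
      mem := id
      d := fun _ => rfl
      ρ := fun x => by
        change _ = (LinearMap.id : M →ₗ[ℚ] M).rTensor H _
        simp }
  comp f g :=
    { toLin := g.toLin ∘ₗ f.toLin
      mem := fun h => g.mem (f.mem h)
      d := fun x => by simp [f.d, g.d]
      ρ := fun x => by
        change _ = (g.toLin.restrictScalars ℚ ∘ₗ f.toLin.restrictScalars ℚ).rTensor H _
        rw [LinearMap.rTensor_comp, LinearMap.comp_apply, LinearMap.comp_apply, g.ρ, f.ρ] }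

variable {M N P : DGMod A}

theorem hom_ext {f g : M ⟶ N} (h : ∀ x, f.toLin x = g.toLin x) : f = g :=
  Hom.ext (LinearMap.ext h)

@[simp] theorem id_apply (x : M) : Hom.toLin (𝟙 M) x = x := rfl

@[simp] theorem comp_apply (f : M ⟶ N) (g : N ⟶ P) (x : M) :
    Hom.toLin (f ≫ g) x = g.toLin (f.toLin x) := rfl

end DGMod


theorem negOne_sq (n : ℤ) : (-1 : ℚ) ^ n * (-1 : ℚ) ^ n = 1 := by
  rw [← mul_zpow]; norm_num

theorem negOne_add (m n : ℤ) : (-1 : ℚ) ^ (m + n) = (-1 : ℚ) ^ m * (-1 : ℚ) ^ n :=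
  zpow_add₀ (by norm_num) m n

theorem negOne_succ (m : ℤ) : (-1 : ℚ) ^ (m + 1) = -(-1 : ℚ) ^ m := by
  rw [negOne_add]; simp

namespace DGMod

section Tensor

variable (M N : DGMod A)

/-- The relations `x a ⊗ y = x ⊗ a y`, where `x a = (-1) ^ (|a| |x|) a x`. -/
def tensorRel : Submodule ℚ (M ⊗[ℚ] N) :=
  Submodule.span ℚ {z | ∃ (p q : ℤ) (a : A) (x : M) (y : N), a ∈ A.str.gr p ∧ x ∈ M.str.gr q ∧
    z = ((-1 : ℚ) ^ (p * q) • (a • x)) ⊗ₜ[ℚ] y - x ⊗ₜ[ℚ] (a • y)}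

/-- The vector space underlying `M ⊗_A N`. -/
abbrev Tens : Type u := (M ⊗[ℚ] N) ⧸ tensorRel M N

variable {M N}

/-- The class of `x ⊗ y` in `M ⊗_A N`. -/
def tmk : M →ₗ[ℚ] N →ₗ[ℚ] Tens M N := (TensorProduct.mk ℚ M N).compr₂ (tensorRel M N).mkQ

variable {X : Type*} [AddCommGroup X] [Module ℚ X]

/-- A bilinear map `b` with `b (x a, y) = b (x, a y)`. -/
def Balanced (b : M →ₗ[ℚ] N →ₗ[ℚ] X) : Prop :=
  ∀ {p q : ℤ} {a : A} {x : M} (y : N), a ∈ A.str.gr p → x ∈ M.str.gr q →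
    b x (a • y) = (-1 : ℚ) ^ (p * q) • b (a • x) y

theorem tmk_balanced : Balanced (tmk : M →ₗ[ℚ] N →ₗ[ℚ] Tens M N) := by
  intro p q a x y ha hx
  symm
  rw [← LinearMap.smul_apply, ← map_smul]
  exact (Submodule.Quotient.eq _).2 (Submodule.subset_span ⟨p, q, a, x, y, ha, hx, rfl⟩)

/-- The linear map on `M ⊗_A N` induced by a balanced bilinear map. -/
def tlift (b : M →ₗ[ℚ] N →ₗ[ℚ] X) (hb : Balanced b) : Tens M N →ₗ[ℚ] X :=
  (tensorRel M N).liftQ (TensorProduct.lift b) (by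
    refine Submodule.span_le.2 ?_
    rintro _ ⟨p, q, a, x, y, ha, hx, rfl⟩
    rw [SetLike.mem_coe, LinearMap.mem_ker, map_sub, TensorProduct.lift.tmul,
      TensorProduct.lift.tmul]
    rw [hb y ha hx, map_smul, LinearMap.smul_apply, sub_self])

@[simp] theorem tlift_tmk (b : M →ₗ[ℚ] N →ₗ[ℚ] X) (hb : Balanced b) (x : M) (y : N) :
    tlift b hb (tmk x y) = b x y := by
  rfl

theorem tens_induction {p : Tens M N → Prop} (hom : ∀ x y, p (tmk x y))
    (zero : p 0) (add : ∀ s t, p s → p t → p (s + t)) (t : Tens M N) : p t := by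
  obtain ⟨z, rfl⟩ := Submodule.Quotient.mk_surjective _ t
  induction z using TensorProduct.induction_on with
  | zero => exact zero
  | tmul x y => exact hom x y
  | add s t hs ht => exact add _ _ hs ht

theorem tens_ext {f g : Tens M N →ₗ[ℚ] X} (h : ∀ x y, f (tmk x y) = g (tmk x y)) : f = g := by
  exact LinearMap.ext (tens_induction (p := fun t => f t = g t) h (by simp)
    fun s t hs ht => by rw [map_add, map_add, hs, ht])

theorem tens_ext_hom {f g : Tens M N →ₗ[ℚ] X}
    (h : ∀ p q, ∀ x ∈ M.str.gr p, ∀ y ∈ N.str.gr q, f (tmk x y) = g (tmk x y)) : f = g := by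
  have : tmk.compr₂ f = (tmk : M →ₗ[ℚ] N →ₗ[ℚ] Tens M N).compr₂ g :=
    M.str.hom_ext fun p x hx => N.str.hom_ext fun q y hy => h p q x hx y hy
  exact tens_ext fun x y => LinearMap.congr_fun₂ this x y

/-- The grading of `M ⊗_A N`. -/
def tgr (M N : DGMod A) (n : ℤ) : Submodule ℚ (Tens M N) :=
  Submodule.span ℚ {z | ∃ (p q : ℤ) (x : M) (y : N), x ∈ M.str.gr p ∧ y ∈ N.str.gr q ∧
    p + q = n ∧ z = tmk x y}

theorem tmk_mem {p q n : ℤ} {x : M} {y : N} (hx : x ∈ M.str.gr p) (hy : y ∈ N.str.gr q)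
    (h : p + q = n) : tmk x y ∈ tgr M N n :=
  Submodule.subset_span ⟨p, q, x, y, hx, hy, h, rfl⟩

theorem tgr_induction {n : ℤ} {P : Tens M N → Prop}
    (hom : ∀ p q x y, x ∈ M.str.gr p → y ∈ N.str.gr q → p + q = n → P (tmk x y))
    (zero : P 0) (add : ∀ s t, P s → P t → P (s + t)) (smul : ∀ (c : ℚ) s, P s → P (c • s))
    {t : Tens M N} (ht : t ∈ tgr M N n) : P t := by
  refine Submodule.span_induction (p := fun t _ => P t) ?_ zero (fun s t _ _ => add s t)
    (fun c s _ => smul c s) ht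
  rintro _ ⟨p, q, x, y, hx, hy, h, rfl⟩
  exact hom p q x y hx hy h

/-- The component of degree `p` in the first variable of the decomposition of `M ⊗_A N`. -/
def tdecAux (p : ℤ) : M.str.gr p →ₗ[ℚ] N →ₗ[ℚ] ℤ →₀ Tens M N where
  toFun x := N.str.glue fun q =>
    Finsupp.lsingle (p + q) ∘ₗ tmk (x : M) ∘ₗ (N.str.gr q).subtype
  map_add' x x' := N.str.hom_ext fun q y hy => by
    rw [LinearMap.add_apply]
    simp only [N.str.glue_apply _ hy]
    simp
  map_smul' c x := N.str.hom_ext fun q y hy => by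
    rw [LinearMap.smul_apply]
    simp only [N.str.glue_apply _ hy]
    simp

/-- The decomposition of `x ⊗ y` into homogeneous components. -/
def tdec₀ (M N : DGMod A) : M →ₗ[ℚ] N →ₗ[ℚ] ℤ →₀ Tens M N :=
  M.str.glue tdecAux

theorem tdec₀_apply {p q : ℤ} {x : M} {y : N} (hx : x ∈ M.str.gr p) (hy : y ∈ N.str.gr q) :
    tdec₀ M N x y = Finsupp.single (p + q) (tmk x y) := by
  rw [tdec₀, M.str.glue_apply _ hx]
  change N.str.glue _ y = _
  rw [N.str.glue_apply _ hy]
  rfl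

theorem tdec₀_balanced : Balanced (tdec₀ M N) := by
  intro p q a x y ha hx
  refine N.str.induction (p := fun y => tdec₀ M N x (a • y) =
    (-1 : ℚ) ^ (p * q) • tdec₀ M N (a • x) y) ?_ (by simp) ?_ y
  · intro r y hy
    rw [tdec₀_apply hx (N.smul_mem ha hy), tdec₀_apply (M.smul_mem ha hx) hy,
      tmk_balanced y ha hx, Finsupp.smul_single, show q + (p + r) = p + q + r by ring]
  · intro y y' h h'
    rw [smul_add, map_add, map_add, h, h', smul_add]

theorem tgr_isInternal : DirectSum.IsInternal (tgr M N) := by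
  refine GComplex.isInternal_of (tlift _ (tdec₀_balanced (M := M) (N := N))) ?_ ?_
  · refine tens_induction (fun x y => ?_) (zero_mem _) (fun s t => add_mem)
    refine M.str.induction (p := fun x => tmk x y ∈ iSup (tgr M N)) ?_ (by simp) ?_ x
    · intro p x hx
      refine N.str.induction (p := fun y => tmk x y ∈ iSup (tgr M N)) ?_ (by simp) ?_ y
      · intro q y hy
        exact Submodule.mem_iSup_of_mem (p + q) (tmk_mem hx hy rfl)
      · intro y y' h h'
        rw [map_add]
        exact add_mem h h'
    · intro x x' h h'
      rw [map_add, LinearMap.add_apply]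
      exact add_mem h h'
  · intro n t ht
    refine tgr_induction (P := fun t => tlift _ (tdec₀_balanced (M := M) (N := N)) t =
      Finsupp.single n t) ?_ (by simp) ?_ ?_ ht
    · intro p q x y hx hy h
      rw [tlift_tmk, tdec₀_apply hx hy, h]
    · intro s t hs ht
      rw [map_add, hs, ht, Finsupp.single_add]
    · intro c s hs
      rw [map_smul, hs, Finsupp.smul_single]

/-- The differential `d (x ⊗ y) = d x ⊗ y + (-1) ^ |x| x ⊗ d y` before passing to the quotient. -/
def td₀ (M N : DGMod A) : M →ₗ[ℚ] N →ₗ[ℚ] Tens M N :=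
  tmk ∘ₗ M.str.d + tmk.compl₁₂ M.str.sgn N.str.d

theorem td₀_apply {p : ℤ} {x : M} (hx : x ∈ M.str.gr p) (y : N) :
    td₀ M N x y = tmk (M.str.d x) y + (-1 : ℚ) ^ p • tmk x (N.str.d y) := by
  simp [td₀, M.str.sgn_apply hx]

theorem td₀_balanced : Balanced (td₀ M N) := by
  intro p q a x y ha hx
  rw [td₀_apply hx, td₀_apply (M.smul_mem ha hx), M.leibniz x ha, N.leibniz y ha,
    tmk_balanced y ha (M.str.d_mem hx)]
  simp only [map_add, map_smul, LinearMap.add_apply, LinearMap.smul_apply]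
  rw [tmk_balanced y (A.str.d_mem ha) hx, tmk_balanced (N.str.d y) ha hx]
  have h1 : (-1 : ℚ) ^ (p * (q + 1)) = (-1 : ℚ) ^ (p * q) * (-1 : ℚ) ^ p := by
    rw [mul_add, mul_one, negOne_add]
  have h2 : (-1 : ℚ) ^ ((p + 1) * q) = (-1 : ℚ) ^ (p * q) * (-1 : ℚ) ^ q := by
    rw [add_mul, one_mul, negOne_add]
  have h3 := negOne_sq q
  rw [h1, h2, negOne_add p q]
  simp only [smul_add, smul_smul]
  rw [show (-1 : ℚ) ^ q * ((-1 : ℚ) ^ (p * q) * (-1 : ℚ) ^ q) = (-1 : ℚ) ^ (p * q) by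
    linear_combination (-1 : ℚ) ^ (p * q) * h3]
  rw [show (-1 : ℚ) ^ q * ((-1 : ℚ) ^ p * (-1 : ℚ) ^ (p * q)) =
    (-1 : ℚ) ^ (p * q) * ((-1 : ℚ) ^ p * (-1 : ℚ) ^ q) by ring]
  abel

/-- The differential of `M ⊗_A N`. -/
def td (M N : DGMod A) : Tens M N →ₗ[ℚ] Tens M N := tlift _ td₀_balanced

theorem td_tmk {p : ℤ} {x : M} (hx : x ∈ M.str.gr p) (y : N) :
    td M N (tmk x y) = tmk (M.str.d x) y + (-1 : ℚ) ^ p • tmk x (N.str.d y) := by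
  rw [td, tlift_tmk, td₀_apply hx]

theorem td_mem {n : ℤ} {t : Tens M N} (ht : t ∈ tgr M N n) : td M N t ∈ tgr M N (n + 1) := by
  refine tgr_induction (P := fun t => td M N t ∈ tgr M N (n + 1)) ?_ (by simp) (fun s t hs ht => by rw [map_add (td M N)]; exact add_mem hs ht)
    (fun c s hs => by rw [map_smul (td M N)]; exact Submodule.smul_mem _ c hs) ht
  intro p q x y hx hy h
  rw [td_tmk hx]
  exact add_mem (tmk_mem (M.str.d_mem hx) hy (by rw [← h]; ring))
    (Submodule.smul_mem _ _ (tmk_mem hx (N.str.d_mem hy) (by rw [← h]; ring)))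

theorem td_td (t : Tens M N) : td M N (td M N t) = 0 := by
  refine LinearMap.congr_fun (f := td M N ∘ₗ td M N) (g := 0) (tens_ext_hom ?_) t
  intro p q x hx y hy
  rw [LinearMap.comp_apply, td_tmk hx, map_add, map_smul, td_tmk (M.str.d_mem hx), td_tmk hx,
    M.str.d_d, N.str.d_d, negOne_succ]
  simp

theorem tsmul_balanced (a : A) :
    Balanced (tmk ∘ₗ Algebra.lsmul ℚ ℚ M a : M →ₗ[ℚ] N →ₗ[ℚ] Tens M N) := by
  intro p q b x y hb hx
  refine A.str.induction (p := fun a => (tmk ∘ₗ Algebra.lsmul ℚ ℚ M a) x (b • y) =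
    (-1 : ℚ) ^ (p * q) • (tmk ∘ₗ Algebra.lsmul ℚ ℚ M a) (b • x) y) ?_ (by simp) ?_ a
  · intro r a ha
    simp only [LinearMap.comp_apply, Algebra.lsmul_coe]
    have e : b • a • x = (-1 : ℚ) ^ (p * r) • (a • b • x) := by
      rw [smul_smul, A.comm hb ha, smul_assoc, mul_smul]
    rw [tmk_balanced y hb (M.smul_mem ha hx), e, map_smul, LinearMap.smul_apply, smul_smul,
      mul_add, negOne_add]
    congr 1
    linear_combination (-1 : ℚ) ^ (p * q) * negOne_sq (p * r)
  · intro a a' h h'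
    simp only [map_add, LinearMap.comp_add, LinearMap.add_apply, smul_add, h, h']

/-- The action of `a` on `M ⊗_A N`. -/
def tsmul (M N : DGMod A) (a : A) : Tens M N →ₗ[ℚ] Tens M N := tlift _ (tsmul_balanced a)

@[simp] theorem tsmul_tmk (a : A) (x : M) (y : N) : tsmul M N a (tmk x y) = tmk (a • x) y :=
  tlift_tmk _ (tsmul_balanced a) x y

instance : Module A (Tens M N) where
  smul a t := tsmul M N a t
  one_smul t := by
    change tsmul M N 1 t = (LinearMap.id : Tens M N →ₗ[ℚ] Tens M N) t
    exact LinearMap.congr_fun (tens_ext fun x y => by simp) t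
  mul_smul a b t := by
    change tsmul M N (a * b) t = (tsmul M N a ∘ₗ tsmul M N b) t
    exact LinearMap.congr_fun (tens_ext fun x y => by simp [mul_smul]) t
  smul_zero a := map_zero (tsmul M N a)
  smul_add a := map_add (tsmul M N a)
  add_smul a b t := by
    change tsmul M N (a + b) t = (tsmul M N a + tsmul M N b) t
    exact LinearMap.congr_fun (tens_ext fun x y => by simp [add_smul]) t
  zero_smul t := by
    change tsmul M N 0 t = (0 : Tens M N →ₗ[ℚ] Tens M N) t
    exact LinearMap.congr_fun (tens_ext fun x y => by simp) t

@[simp] theorem smul_tmk (a : A) (x : M) (y : N) :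
    a • (tmk x y : Tens M N) = tmk (a • x) y := tsmul_tmk a x y

instance : IsScalarTower ℚ A (Tens M N) where
  smul_assoc c a t := by
    change tsmul M N (c • a) t = (c • tsmul M N a) t
    exact LinearMap.congr_fun (tens_ext fun x y => by simp) t


/-! ### The coaction on the tensor product -/

variable {V W Z : Type u} [AddCommGroup V] [Module ℚ V] [AddCommGroup W] [Module ℚ W]
  [AddCommGroup Z] [Module ℚ Z]

theorem pairH_mem {b : V →ₗ[ℚ] W →ₗ[ℚ] Z} {V' : Submodule ℚ V} {W' : Submodule ℚ W}
    {Z' : Submodule ℚ Z} (hb : ∀ x ∈ V', ∀ y ∈ W', b x y ∈ Z') {ξ : V ⊗[ℚ] H} {η : W ⊗[ℚ] H}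
    (hξ : ξ ∈ LinearMap.range (V'.subtype.rTensor H))
    (hη : η ∈ LinearMap.range (W'.subtype.rTensor H)) :
    pairH H b ξ η ∈ LinearMap.range (Z'.subtype.rTensor H) := by
  obtain ⟨ξ, rfl⟩ := hξ
  obtain ⟨η, rfl⟩ := hη
  induction ξ using TensorProduct.induction_on with
  | zero => simp
  | add s t hs ht => rw [map_add, map_add, LinearMap.add_apply]; exact add_mem hs ht
  | tmul x h =>
    induction η using TensorProduct.induction_on with
    | zero => simp
    | add s t hs ht => rw [map_add, map_add]; exact add_mem hs ht
    | tmul y k =>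
      exact ⟨(⟨b x y, hb x x.2 y y.2⟩ : Z') ⊗ₜ (h * k), by simp⟩

theorem pairH_balanced {b : M →ₗ[ℚ] N →ₗ[ℚ] Z} (hb : Balanced b) {p q : ℤ}
    {α : A ⊗[ℚ] H} {ξ : M ⊗[ℚ] H} (η : N ⊗[ℚ] H)
    (hα : α ∈ LinearMap.range ((A.str.gr p).subtype.rTensor H))
    (hξ : ξ ∈ LinearMap.range ((M.str.gr q).subtype.rTensor H)) :
    pairH H b ξ (pairH H (Algebra.lsmul ℚ ℚ N).toLinearMap α η) =
      (-1 : ℚ) ^ (p * q) • pairH H b (pairH H (Algebra.lsmul ℚ ℚ M).toLinearMap α ξ) η := by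
  obtain ⟨α, rfl⟩ := hα
  obtain ⟨ξ, rfl⟩ := hξ
  induction α using TensorProduct.induction_on with
  | zero => simp
  | add s t hs ht =>
    simp only [map_add, LinearMap.add_apply, smul_add, hs, ht]
  | tmul a h =>
    induction ξ using TensorProduct.induction_on with
    | zero => simp
    | add s t hs ht => simp only [map_add, LinearMap.add_apply, smul_add, hs, ht]
    | tmul x k =>
      induction η using TensorProduct.induction_on with
      | zero => simp
      | add s t hs ht => simp only [map_add, smul_add, hs, ht]
      | tmul y l =>
        have := hb y a.2 x.2
        simp only [LinearMap.rTensor_tmul, Submodule.subtype_apply, pairH_tmul]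
        change b _ ((a : A) • y) ⊗ₜ _ = _ • b ((a : A) • (x : M)) y ⊗ₜ _
        rw [this, TensorProduct.smul_tmul']
        congr 1
        ring

/-- A trilinear associativity, extended to the coefficients. -/
theorem pairH_assoc {U V W X Y Z : Type u} [AddCommGroup U] [Module ℚ U] [AddCommGroup V]
    [Module ℚ V] [AddCommGroup W] [Module ℚ W] [AddCommGroup X] [Module ℚ X] [AddCommGroup Y]
    [Module ℚ Y] [AddCommGroup Z] [Module ℚ Z] {b : U →ₗ[ℚ] V →ₗ[ℚ] X} {c : X →ₗ[ℚ] W →ₗ[ℚ] Z}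
    {b' : V →ₗ[ℚ] W →ₗ[ℚ] Y} {c' : U →ₗ[ℚ] Y →ₗ[ℚ] Z}
    (h : ∀ x y z, c (b x y) z = c' x (b' y z)) (ξ : U ⊗[ℚ] H) (η : V ⊗[ℚ] H) (ζ : W ⊗[ℚ] H) :
    pairH H c (pairH H b ξ η) ζ = pairH H c' ξ (pairH H b' η ζ) := by
  induction ξ using TensorProduct.induction_on with
  | zero => simp
  | add s t hs ht => simp only [map_add, LinearMap.add_apply, hs, ht]
  | tmul x k =>
    induction η using TensorProduct.induction_on with
    | zero => simp
    | add s t hs ht => simp only [map_add, LinearMap.add_apply, hs, ht]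
    | tmul y l =>
      induction ζ using TensorProduct.induction_on with
      | zero => simp
      | add s t hs ht => simp only [map_add, hs, ht]
      | tmul z m => simp only [pairH_tmul, h, mul_assoc]

theorem pairH_counit (b : V →ₗ[ℚ] W →ₗ[ℚ] Z) (ξ : V ⊗[ℚ] H) (η : W ⊗[ℚ] H) :
    TensorProduct.rid ℚ Z ((Coalgebra.counit (R := ℚ) (A := H)).lTensor Z (pairH H b ξ η)) =
      b (TensorProduct.rid ℚ V ((Coalgebra.counit (R := ℚ) (A := H)).lTensor V ξ))
        (TensorProduct.rid ℚ W ((Coalgebra.counit (R := ℚ) (A := H)).lTensor W η)) := by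
  induction ξ using TensorProduct.induction_on with
  | zero => simp
  | add s t hs ht => simp only [map_add, LinearMap.add_apply, hs, ht]
  | tmul x h =>
    induction η using TensorProduct.induction_on with
    | zero => simp
    | add s t hs ht => simp only [map_add, hs, ht]
    | tmul y k =>
      simp only [pairH_tmul, LinearMap.lTensor_tmul, TensorProduct.rid_tmul, Bialgebra.counit_mul,
        mul_smul, map_smul, LinearMap.smul_apply]
      rw [smul_comm]

/-- The pairing with values in `Z ⊗ (H ⊗ H)`. -/
def pairHH (H : Type u) [CommRing H] [HopfAlgebra ℚ H] (b : V →ₗ[ℚ] W →ₗ[ℚ] Z) :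
    V ⊗[ℚ] (H ⊗[ℚ] H) →ₗ[ℚ] W ⊗[ℚ] (H ⊗[ℚ] H) →ₗ[ℚ] Z ⊗[ℚ] (H ⊗[ℚ] H) :=
  TensorProduct.map₂ b (LinearMap.mul ℚ (H ⊗[ℚ] H))

@[simp] theorem pairHH_tmul (b : V →ₗ[ℚ] W →ₗ[ℚ] Z) (x : V) (h : H ⊗[ℚ] H) (y : W)
    (k : H ⊗[ℚ] H) : pairHH H b (x ⊗ₜ h) (y ⊗ₜ k) = b x y ⊗ₜ (h * k) := by
  simp [pairHH]

theorem pairH_comul (b : V →ₗ[ℚ] W →ₗ[ℚ] Z) (ξ : V ⊗[ℚ] H) (η : W ⊗[ℚ] H) :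
    (Coalgebra.comul (R := ℚ) (A := H)).lTensor Z (pairH H b ξ η) =
      pairHH H b ((Coalgebra.comul (R := ℚ) (A := H)).lTensor V ξ)
        ((Coalgebra.comul (R := ℚ) (A := H)).lTensor W η) := by
  induction ξ using TensorProduct.induction_on with
  | zero => simp
  | add s t hs ht => simp only [map_add, LinearMap.add_apply, hs, ht]
  | tmul x h =>
    induction η using TensorProduct.induction_on with
    | zero => simp
    | add s t hs ht => simp only [map_add, hs, ht]
    | tmul y k => simp [Bialgebra.comul_mul]

theorem pairH_assocHH (b : V →ₗ[ℚ] W →ₗ[ℚ] Z) (ξ : V ⊗[ℚ] H) (η : W ⊗[ℚ] H) (h k : H) :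
    TensorProduct.assoc ℚ Z H H (pairH H b ξ η ⊗ₜ (h * k)) =
      pairHH H b (TensorProduct.assoc ℚ V H H (ξ ⊗ₜ h)) (TensorProduct.assoc ℚ W H H (η ⊗ₜ k)) := by
  induction ξ using TensorProduct.induction_on with
  | zero => simp
  | add s t hs ht => simp only [map_add, LinearMap.add_apply, TensorProduct.add_tmul, hs, ht]
  | tmul x h =>
    induction η using TensorProduct.induction_on with
    | zero => simp
    | add s t hs ht => simp only [map_add, TensorProduct.add_tmul, hs, ht]
    | tmul y k => simp

theorem pairH_rTensor {b : V →ₗ[ℚ] W →ₗ[ℚ] Z} {ρV : V →ₗ[ℚ] V ⊗[ℚ] H} {ρW : W →ₗ[ℚ] W ⊗[ℚ] H}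
    {ρZ : Z →ₗ[ℚ] Z ⊗[ℚ] H} (hb : ∀ x y, ρZ (b x y) = pairH H b (ρV x) (ρW y))
    (ξ : V ⊗[ℚ] H) (η : W ⊗[ℚ] H) :
    TensorProduct.assoc ℚ Z H H (ρZ.rTensor H (pairH H b ξ η)) =
      pairHH H b (TensorProduct.assoc ℚ V H H (ρV.rTensor H ξ))
        (TensorProduct.assoc ℚ W H H (ρW.rTensor H η)) := by
  induction ξ using TensorProduct.induction_on with
  | zero => simp
  | add s t hs ht => simp only [map_add, LinearMap.add_apply, hs, ht]
  | tmul x h =>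
    induction η using TensorProduct.induction_on with
    | zero => simp
    | add s t hs ht => simp only [map_add, hs, ht]
    | tmul y k => rw [pairH_tmul, LinearMap.rTensor_tmul, hb, pairH_assocHH]; rfl

/-- Naturality of the pairing. -/
theorem pairH_map {V' W' Z' : Type u} [AddCommGroup V'] [Module ℚ V'] [AddCommGroup W']
    [Module ℚ W'] [AddCommGroup Z'] [Module ℚ Z'] {b : V →ₗ[ℚ] W →ₗ[ℚ] Z}
    {b' : V' →ₗ[ℚ] W' →ₗ[ℚ] Z'} {f : V →ₗ[ℚ] V'} {g : W →ₗ[ℚ] W'} {e : Z →ₗ[ℚ] Z'}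
    (hb : ∀ x y, e (b x y) = b' (f x) (g y)) (ξ : V ⊗[ℚ] H) (η : W ⊗[ℚ] H) :
    e.rTensor H (pairH H b ξ η) = pairH H b' (f.rTensor H ξ) (g.rTensor H η) := by
  induction ξ using TensorProduct.induction_on with
  | zero => simp
  | add s t hs ht => simp only [map_add, LinearMap.add_apply, hs, ht]
  | tmul x h =>
    induction η using TensorProduct.induction_on with
    | zero => simp
    | add s t hs ht => simp only [map_add, hs, ht]
    | tmul y k => simp [hb]

/-- The differential of the pairing of cochain complexes. -/
theorem pairH_d {p : ℤ} {V' : Submodule ℚ V} {b : V →ₗ[ℚ] W →ₗ[ℚ] Z} {dV : V →ₗ[ℚ] V}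
    {dW : W →ₗ[ℚ] W} {dZ : Z →ₗ[ℚ] Z}
    (hb : ∀ x ∈ V', ∀ y, dZ (b x y) = b (dV x) y + (-1 : ℚ) ^ p • b x (dW y))
    {ξ : V ⊗[ℚ] H} (hξ : ξ ∈ LinearMap.range (V'.subtype.rTensor H)) (η : W ⊗[ℚ] H) :
    dZ.rTensor H (pairH H b ξ η) =
      pairH H b (dV.rTensor H ξ) η + (-1 : ℚ) ^ p • pairH H b ξ (dW.rTensor H η) := by
  obtain ⟨ξ, rfl⟩ := hξ
  induction ξ using TensorProduct.induction_on with
  | zero => simp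
  | add s t hs ht =>
    simp only [map_add, LinearMap.add_apply, hs, ht, smul_add]
    abel
  | tmul x h =>
    induction η using TensorProduct.induction_on with
    | zero => simp
    | add s t hs ht =>
      simp only [map_add, hs, ht, smul_add]
      abel
    | tmul y k =>
      simp only [LinearMap.rTensor_tmul, Submodule.subtype_apply, pairH_tmul]
      rw [hb x x.2, TensorProduct.add_tmul, TensorProduct.smul_tmul']

theorem tρ_balanced : Balanced ((pairH H (tmk : M →ₗ[ℚ] N →ₗ[ℚ] Tens M N)).compl₁₂
    M.str.ρ N.str.ρ) := by
  intro p q a x y ha hx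
  rw [LinearMap.compl₁₂_apply, LinearMap.compl₁₂_apply, M.ρ_smul, N.ρ_smul]
  exact pairH_balanced tmk_balanced _ (A.str.isSubrep p a ha) (M.str.isSubrep q x hx)

/-- The coaction `x ⊗ y ↦ x₀ ⊗ y₀ ⊗ x₁ y₁` on `M ⊗_A N`. -/
def tρ (M N : DGMod A) : Tens M N →ₗ[ℚ] Tens M N ⊗[ℚ] H := tlift _ tρ_balanced

@[simp] theorem tρ_tmk (x : M) (y : N) :
    tρ M N (tmk x y) = pairH H tmk (M.str.ρ x) (N.str.ρ y) :=
  tlift_tmk _ tρ_balanced x y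

theorem tρ_isCoaction : IsCoaction (tρ M N) where
  counit t := by
    refine tens_induction (p := fun t => TensorProduct.rid ℚ _
      ((Coalgebra.counit (R := ℚ) (A := H)).lTensor _ (tρ M N t)) = t) ?_ (by simp) ?_ t
    · intro x y
      rw [tρ_tmk, pairH_counit, M.str.isCoaction.counit, N.str.isCoaction.counit]
    · intro s t hs ht
      simp only [map_add, hs, ht]
  coassoc t := by
    refine tens_induction (p := fun t => TensorProduct.assoc ℚ _ H H
      ((tρ M N).rTensor H (tρ M N t)) =
      (Coalgebra.comul (R := ℚ) (A := H)).lTensor _ (tρ M N t)) ?_ (by simp) ?_ t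
    · intro x y
      rw [tρ_tmk, pairH_rTensor tρ_tmk, M.str.isCoaction.coassoc, N.str.isCoaction.coassoc,
        pairH_comul]
    · intro s t hs ht
      simp only [map_add, hs, ht]

/-- The cochain complex of representations underlying `M ⊗_A N`. -/
def tstr (M N : DGMod A) : GComplex H (Tens M N) where
  gr := tgr M N
  isInternal := tgr_isInternal
  d := td M N
  d_mem := td_mem
  d_d := td_td
  ρ := tρ M N
  isCoaction := tρ_isCoaction
  isSubrep n t ht := by
    refine tgr_induction (P := fun t => tρ M N t ∈ LinearMap.range _) ?_ ?_ ?_ ?_ ht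
    · intro p q x y hx hy h
      rw [tρ_tmk]
      exact pairH_mem (fun x hx y hy => tmk_mem hx hy h) (M.str.isSubrep p x hx)
        (N.str.isSubrep q y hy)
    · rw [map_zero]; exact zero_mem _
    · intro s t hs ht
      rw [map_add]
      exact add_mem hs ht
    · intro c s hs
      rw [map_smul]
      exact Submodule.smul_mem _ c hs
  ρ_d t := by
    refine LinearMap.congr_fun (f := tρ M N ∘ₗ td M N) (g := (td M N).rTensor H ∘ₗ tρ M N)
      (tens_ext_hom ?_) t
    intro p q x hx y hy
    rw [LinearMap.comp_apply, LinearMap.comp_apply, tρ_tmk, td_tmk hx, map_add, map_smul, tρ_tmk,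
      tρ_tmk, M.str.ρ_d, N.str.ρ_d, pairH_d (fun x hx y => td_tmk hx y) (M.str.isSubrep p x hx)]

/-- The dg module `M ⊗_A N`. -/
def tensor (M N : DGMod A) : DGMod A where
  carrier := Tens M N
  str := tstr M N
  smul_mem {p q a t} ha ht := by
    refine tgr_induction (P := fun t => a • t ∈ tgr M N (p + q)) ?_ ?_ ?_ ?_ ht
    · intro i j x y hx hy h
      rw [smul_tmk]
      exact tmk_mem (M.smul_mem ha hx) hy (by rw [← h]; ring)
    · rw [smul_zero]; exact zero_mem _
    · intro s t hs ht
      rw [smul_add]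
      exact add_mem hs ht
    · intro c s hs
      rw [smul_comm]
      exact Submodule.smul_mem _ c hs
  leibniz {p a} t ha := by
    refine LinearMap.congr_fun (f := td M N ∘ₗ tsmul M N a)
      (g := tsmul M N (A.str.d a) + (-1 : ℚ) ^ p • (tsmul M N a ∘ₗ td M N)) (tens_ext_hom ?_) t
    intro i j x hx y hy
    simp only [LinearMap.add_apply, LinearMap.smul_apply, LinearMap.comp_apply, tsmul_tmk,
      td_tmk hx, td_tmk (M.smul_mem ha hx), M.leibniz x ha, map_add, map_smul, negOne_add,
      smul_add, mul_smul]
    abel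
  ρ_smul a t := by
    refine tens_induction (p := fun t => tρ M N (a • t) =
      pairH H (Algebra.lsmul ℚ ℚ (Tens M N)).toLinearMap (A.str.ρ a) (tρ M N t)) ?_ (by simp) ?_ t
    · intro x y
      rw [smul_tmk, tρ_tmk, tρ_tmk, M.ρ_smul]
      exact pairH_assoc (fun a x y => (smul_tmk a x y).symm) _ _ _
    · intro s t hs ht
      simp only [smul_add, map_add, hs, ht]

/-- The class of `x ⊗ y`, as an element of `M ⊗_A N`. -/
def tm (M N : DGMod A) : M →ₗ[ℚ] N →ₗ[ℚ] tensor M N := tmk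

theorem tm_balanced : Balanced (tm M N) := tmk_balanced

theorem smul_tm (a : A) (x : M) (y : N) : a • tm M N x y = tm M N (a • x) y := smul_tmk a x y

theorem tm_mem {p q n : ℤ} {x : M} {y : N} (hx : x ∈ M.str.gr p) (hy : y ∈ N.str.gr q)
    (h : p + q = n) : tm M N x y ∈ (tensor M N).str.gr n := tmk_mem hx hy h

theorem tm_induction {p : tensor M N → Prop} (hom : ∀ x y, p (tm M N x y))
    (zero : p 0) (add : ∀ s t, p s → p t → p (s + t)) (t : tensor M N) : p t :=
  tens_induction (p := p) hom zero add t

theorem tm_induction_hom {p : tensor M N → Prop}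
    (hom : ∀ i j x y, x ∈ M.str.gr i → y ∈ N.str.gr j → p (tm M N x y))
    (zero : p 0) (add : ∀ s t, p s → p t → p (s + t)) (t : tensor M N) : p t := by
  refine tm_induction (fun x y => ?_) zero add t
  refine M.str.induction (p := fun x => p (tm M N x y)) ?_ (by simpa using zero) ?_ x
  · intro i x hx
    refine N.str.induction (p := fun y => p (tm M N x y)) ?_ (by simpa using zero) ?_ y
    · exact fun j y hy => hom i j x y hx hy
    · intro y y' h h'
      rw [map_add]
      exact add _ _ h h'
  · intro x x' h h'
    rw [map_add, LinearMap.add_apply]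
    exact add _ _ h h'

theorem tm_gr_induction {n : ℤ} {P : tensor M N → Prop}
    (hom : ∀ p q x y, x ∈ M.str.gr p → y ∈ N.str.gr q → p + q = n → P (tm M N x y))
    (zero : P 0) (add : ∀ s t, P s → P t → P (s + t)) (smul : ∀ (c : ℚ) s, P s → P (c • s))
    {t : tensor M N} (ht : t ∈ (tensor M N).str.gr n) : P t :=
  tgr_induction (P := P) hom zero add smul ht

theorem d_tm {p : ℤ} {x : M} (hx : x ∈ M.str.gr p) (y : N) :
    (tensor M N).str.d (tm M N x y) =
      tm M N (M.str.d x) y + (-1 : ℚ) ^ p • tm M N x (N.str.d y) := td_tmk hx y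

theorem ρ_tm (x : M) (y : N) :
    (tensor M N).str.ρ (tm M N x y) = pairH H (tm M N) (M.str.ρ x) (N.str.ρ y) := tρ_tmk x y

/-- The linear map on `M ⊗_A N` induced by a balanced bilinear map. -/
def mlift (b : M →ₗ[ℚ] N →ₗ[ℚ] X) (hb : Balanced b) : tensor M N →ₗ[ℚ] X := tlift b hb

theorem mlift_tm (b : M →ₗ[ℚ] N →ₗ[ℚ] X) (hb : Balanced b) (x : M) (y : N) :
    mlift b hb (tm M N x y) = b x y := tlift_tmk b hb x y

end Tensor

end DGMod


namespace DGMod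

section Monoidal

/-- Balanced bilinear maps `M × N → P` which are compatible with all the structure; these are
represented by `M ⊗_A N`. -/
structure BiHom (M N P : DGMod A) where
  toLin : M →ₗ[ℚ] N →ₗ[ℚ] P
  balanced : Balanced toLin
  smul : ∀ (a : A) x y, toLin (a • x) y = a • toLin x y
  mem : ∀ {p q x y}, x ∈ M.str.gr p → y ∈ N.str.gr q → toLin x y ∈ P.str.gr (p + q)
  d : ∀ {p x} (y), x ∈ M.str.gr p → P.str.d (toLin x y) =
    toLin (M.str.d x) y + (-1 : ℚ) ^ p • toLin x (N.str.d y)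
  ρ : ∀ x y, P.str.ρ (toLin x y) = pairH H toLin (M.str.ρ x) (N.str.ρ y)

variable {M N P : DGMod A}

/-- The morphism on `M ⊗_A N` induced by a bilinear map. -/
def BiHom.lift (b : BiHom M N P) : tensor M N ⟶ P where
  toLin :=
    { mlift b.toLin b.balanced with
      map_smul' := fun a t => by
        refine tm_induction (p := fun t => mlift b.toLin b.balanced (a • t) =
          a • mlift b.toLin b.balanced t) ?_ (by simp) ?_ t
        · intro x y
          rw [smul_tm, mlift_tm, mlift_tm, b.smul]
        · intro s t hs ht
          rw [smul_add, map_add, map_add, hs, ht, smul_add] }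
  mem {n t} ht := by
    refine tm_gr_induction (P := fun t => mlift b.toLin b.balanced t ∈ P.str.gr n) ?_ ?_ ?_ ?_ ht
    · intro p q x y hx hy h
      rw [mlift_tm, ← h]
      exact b.mem hx hy
    · rw [map_zero]; exact zero_mem _
    · intro s t hs ht
      rw [map_add]
      exact add_mem hs ht
    · intro c s hs
      rw [map_smul]
      exact Submodule.smul_mem _ c hs
  d t := by
    refine tm_induction_hom (p := fun t => mlift b.toLin b.balanced ((tensor M N).str.d t) =
      P.str.d (mlift b.toLin b.balanced t)) ?_ (by simp) ?_ t
    · intro p q x y hx hy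
      rw [d_tm hx, map_add, map_smul, mlift_tm, mlift_tm, mlift_tm, b.d y hx]
    · intro s t hs ht
      simp only [map_add, hs, ht]
  ρ t := by
    refine tm_induction (p := fun t => P.str.ρ (mlift b.toLin b.balanced t) =
      (mlift b.toLin b.balanced).rTensor H ((tensor M N).str.ρ t)) ?_ (by simp) ?_ t
    · intro x y
      rw [mlift_tm, ρ_tm, b.ρ, pairH_map (b' := b.toLin) (f := LinearMap.id)
        (g := LinearMap.id) (fun x y => mlift_tm _ b.balanced x y)]
      simp
    · intro s t hs ht
      simp only [map_add, hs, ht]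

theorem BiHom.lift_tm (b : BiHom M N P) (x : M) (y : N) :
    b.lift.toLin (tm M N x y) = b.toLin x y :=
  mlift_tm b.toLin b.balanced x y

theorem tensor_hom_ext {f g : tensor M N ⟶ P}
    (h : ∀ (x : M) (y : N), f.toLin (tm M N x y) = g.toLin (tm M N x y)) : f = g :=
  hom_ext fun t => tm_induction (p := fun t => f.toLin t = g.toLin t) h
    (by rw [map_zero, map_zero]) (fun s t hs ht => by rw [map_add, map_add, hs, ht]) t

/-- The tensor product of two morphisms. -/
def tensorHom {M' N' : DGMod A} (f : M ⟶ M') (g : N ⟶ N') : tensor M N ⟶ tensor M' N' :=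
  BiHom.lift
    { toLin := (tm M' N').compl₁₂ (f.toLin.restrictScalars ℚ) (g.toLin.restrictScalars ℚ)
      balanced := fun {p q a x} y ha hx => by
        simp only [LinearMap.compl₁₂_apply, LinearMap.restrictScalars_apply, map_smul]
        exact tm_balanced _ ha (f.mem hx)
      smul := fun a x y => by
        simp only [LinearMap.compl₁₂_apply, LinearMap.restrictScalars_apply, map_smul]
        rw [smul_tm]
      mem := fun hx hy => tm_mem (f.mem hx) (g.mem hy) rfl
      d := fun {p x} y hx => by
        simp only [LinearMap.compl₁₂_apply, LinearMap.restrictScalars_apply, f.d, g.d]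
        exact d_tm (f.mem hx) _
      ρ := fun x y => by
        simp only [LinearMap.compl₁₂_apply, LinearMap.restrictScalars_apply]
        rw [ρ_tm, f.ρ, g.ρ, ← pairH_map (b := (tm M' N').compl₁₂
          (f.toLin.restrictScalars ℚ) (g.toLin.restrictScalars ℚ)) (e := LinearMap.id)
          (fun x y => rfl)]
        simp }

theorem tensorHom_tm {M' N' : DGMod A} (f : M ⟶ M') (g : N ⟶ N') (x : M) (y : N) :
    (tensorHom f g).toLin (tm M N x y) = tm M' N' (f.toLin x) (g.toLin y) :=
  BiHom.lift_tm _ x y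

/-! ### The associator -/

/-- The trilinear map `(x, y, z) ↦ x ⊗ (y ⊗ z)`. -/
def assocLin₀ (M N P : DGMod A) : M →ₗ[ℚ] N →ₗ[ℚ] P →ₗ[ℚ] tensor M (tensor N P) :=
  LinearMap.mk₂ ℚ (fun x y => tm M (tensor N P) x ∘ₗ tm N P y)
    (fun x x' y => by rw [map_add, LinearMap.add_comp])
    (fun c x y => by rw [map_smul, LinearMap.smul_comp])
    (fun x y y' => by rw [map_add, LinearMap.comp_add])
    (fun c x y => by rw [map_smul, LinearMap.comp_smul])

theorem assocLin₀_balanced : Balanced (assocLin₀ M N P) := by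
  intro p q a x y ha hx
  refine LinearMap.ext fun z => ?_
  change tm M (tensor N P) x (tm N P (a • y) z) =
    (-1 : ℚ) ^ (p * q) • tm M (tensor N P) (a • x) (tm N P y z)
  rw [← smul_tm]
  exact tm_balanced _ ha hx

/-- The linear map `(x ⊗ y) ⊗ z ↦ x ⊗ (y ⊗ z)`, before passing to the last quotient. -/
def assocLin (M N P : DGMod A) : tensor M N →ₗ[ℚ] P →ₗ[ℚ] tensor M (tensor N P) :=
  mlift (assocLin₀ M N P) assocLin₀_balanced

theorem assocLin_tm (x : M) (y : N) (z : P) :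
    assocLin M N P (tm M N x y) z = tm M (tensor N P) x (tm N P y z) := by
  rw [assocLin, mlift_tm]
  rfl

/-- The associator. -/
def assocHom (M N P : DGMod A) : tensor (tensor M N) P ⟶ tensor M (tensor N P) :=
  BiHom.lift
    { toLin := assocLin M N P
      balanced := fun {p n a t} z ha ht => by
        refine tm_gr_induction (P := fun t => assocLin M N P t (a • z) =
          (-1 : ℚ) ^ (p * n) • assocLin M N P (a • t) z) ?_ (by simp) ?_ ?_ ht
        · intro i j x y hx hy h
          rw [smul_tm, assocLin_tm, assocLin_tm, tm_balanced z ha hy, map_smul, ← smul_tm,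
            tm_balanced _ ha hx, smul_smul, ← h, mul_add, negOne_add, mul_comm]
        · intro s t hs ht
          rw [smul_add, map_add, map_add, LinearMap.add_apply, LinearMap.add_apply, hs, ht,
            smul_add]
        · intro c s hs
          rw [smul_comm a c s, (assocLin M N P).map_smul, (assocLin M N P).map_smul,
            LinearMap.smul_apply, LinearMap.smul_apply, hs, smul_comm]
      smul := fun a t z => by
        refine tm_induction (p := fun t => assocLin M N P (a • t) z =
          a • assocLin M N P t z) ?_ (by simp) ?_ t
        · intro x y
          rw [smul_tm, assocLin_tm, assocLin_tm, smul_tm]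
        · intro s t hs ht
          rw [smul_add, map_add, map_add, LinearMap.add_apply, LinearMap.add_apply, hs, ht,
            smul_add]
      mem := fun {n r t z} ht hz => by
        refine tm_gr_induction (P := fun t => assocLin M N P t z ∈
          (tensor M (tensor N P)).str.gr (n + r)) ?_ (by simp) ?_ ?_ ht
        · intro i j x y hx hy h
          rw [assocLin_tm]
          exact tm_mem hx (tm_mem hy hz rfl) (by rw [← h]; ring)
        · intro s t hs ht
          rw [map_add]
          exact add_mem hs ht
        · intro c s hs
          rw [map_smul]
          exact Submodule.smul_mem _ c hs
      d := fun {n t} z ht => by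
        refine tm_gr_induction (P := fun t => (tensor M (tensor N P)).str.d (assocLin M N P t z) =
          assocLin M N P ((tensor M N).str.d t) z + (-1 : ℚ) ^ n • assocLin M N P t (P.str.d z))
          ?_ (by simp) ?_ ?_ ht
        · intro i j x y hx hy h
          rw [assocLin_tm, assocLin_tm, d_tm hx, d_tm hx, d_tm hy]
          simp only [map_add, map_smul, LinearMap.add_apply, LinearMap.smul_apply, assocLin_tm,
            ← h, negOne_add, smul_add, mul_smul]
          abel
        · intro s t hs ht
          simp only [map_add, LinearMap.add_apply, hs, ht, smul_add]
          abel
        · intro c s hs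
          simp only [map_smul, LinearMap.smul_apply, hs, smul_add]
          rw [smul_comm c]
      ρ := fun t z => by
        refine tm_induction (p := fun t => (tensor M (tensor N P)).str.ρ (assocLin M N P t z) =
          pairH H (assocLin M N P) ((tensor M N).str.ρ t) (P.str.ρ z)) ?_ (by simp) ?_ t
        · intro x y
          rw [assocLin_tm, ρ_tm, ρ_tm, ρ_tm, pairH_assoc assocLin_tm]
        · intro s t hs ht
          simp only [map_add, LinearMap.add_apply, hs, ht] }

theorem assocHom_tm (x : M) (y : N) (z : P) :
    (assocHom M N P).toLin (tm (tensor M N) P (tm M N x y) z) =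
      tm M (tensor N P) x (tm N P y z) :=
  (BiHom.lift_tm _ _ _).trans (assocLin_tm x y z)

/-- The trilinear map `(y, z, x) ↦ (x ⊗ y) ⊗ z`. -/
def assocInvLin₀ (M N P : DGMod A) : N →ₗ[ℚ] P →ₗ[ℚ] M →ₗ[ℚ] tensor (tensor M N) P :=
  LinearMap.mk₂ ℚ (fun y z => (tm (tensor M N) P).flip z ∘ₗ (tm M N).flip y)
    (fun y y' z => by rw [map_add, LinearMap.comp_add])
    (fun c y z => by rw [map_smul, LinearMap.comp_smul])
    (fun y z z' => by rw [map_add, LinearMap.add_comp])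
    (fun c y z => by rw [map_smul, LinearMap.smul_comp])

theorem assocInvLin₀_balanced : Balanced (assocInvLin₀ M N P) := by
  intro p q a y z ha hy
  refine M.str.hom_ext fun r x hx => ?_
  change tm (tensor M N) P (tm M N x y) (a • z) =
    (-1 : ℚ) ^ (p * q) • tm (tensor M N) P (tm M N x (a • y)) z
  rw [tm_balanced z ha (tm_mem hx hy rfl), tm_balanced y ha hx, smul_tm,
    (tm (tensor M N) P).map_smul, LinearMap.smul_apply, smul_smul, mul_add, negOne_add, mul_comm]

/-- The linear map `x ⊗ (y ⊗ z) ↦ (x ⊗ y) ⊗ z`, before passing to the last quotient. -/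
def assocInvLin (M N P : DGMod A) : M →ₗ[ℚ] tensor N P →ₗ[ℚ] tensor (tensor M N) P :=
  (mlift (assocInvLin₀ M N P) assocInvLin₀_balanced).flip

theorem assocInvLin_tm (x : M) (y : N) (z : P) :
    assocInvLin M N P x (tm N P y z) = tm (tensor M N) P (tm M N x y) z := by
  rw [assocInvLin, LinearMap.flip_apply, mlift_tm]
  rfl

/-- The inverse of the associator. -/
def assocInv (M N P : DGMod A) : tensor M (tensor N P) ⟶ tensor (tensor M N) P :=
  BiHom.lift
    { toLin := assocInvLin M N P
      balanced := fun {p q a x} t ha hx => by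
        refine tm_induction (p := fun t => assocInvLin M N P x (a • t) =
          (-1 : ℚ) ^ (p * q) • assocInvLin M N P (a • x) t) ?_ (by simp) ?_ t
        · intro y z
          rw [smul_tm, assocInvLin_tm, assocInvLin_tm, tm_balanced y ha hx, map_smul,
            LinearMap.smul_apply]
        · intro s t hs ht
          simp only [smul_add, map_add, hs, ht]
      smul := fun a x t => by
        refine tm_induction (p := fun t => assocInvLin M N P (a • x) t =
          a • assocInvLin M N P x t) ?_ (by simp) ?_ t
        · intro y z
          rw [assocInvLin_tm, assocInvLin_tm, smul_tm, smul_tm]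
        · intro s t hs ht
          simp only [smul_add, map_add, hs, ht]
      mem := fun {n r x t} hx ht => by
        refine tm_gr_induction (P := fun t => assocInvLin M N P x t ∈
          (tensor (tensor M N) P).str.gr (n + r)) ?_ (by simp) ?_ ?_ ht
        · intro i j y z hy hz h
          rw [assocInvLin_tm]
          exact tm_mem (tm_mem hx hy rfl) hz (by rw [← h]; ring)
        · intro s t hs ht
          rw [map_add]
          exact add_mem hs ht
        · intro c s hs
          rw [map_smul]
          exact Submodule.smul_mem _ c hs
      d := fun {n x} t hx => by
        refine tm_induction_hom (p := fun t => (tensor (tensor M N) P).str.d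
          (assocInvLin M N P x t) = assocInvLin M N P (M.str.d x) t +
            (-1 : ℚ) ^ n • assocInvLin M N P x ((tensor N P).str.d t)) ?_ (by simp) ?_ t
        · intro i j y z hy hz
          rw [assocInvLin_tm, assocInvLin_tm, d_tm (tm_mem hx hy rfl), d_tm hx, d_tm hy]
          simp only [map_add, map_smul, LinearMap.add_apply, LinearMap.smul_apply, assocInvLin_tm,
            negOne_add, smul_add, mul_smul]
          abel
        · intro s t hs ht
          simp only [map_add, hs, ht, smul_add]
          abel
      ρ := fun x t => by
        refine tm_induction (p := fun t => (tensor (tensor M N) P).str.ρ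
          (assocInvLin M N P x t) =
          pairH H (assocInvLin M N P) (M.str.ρ x) ((tensor N P).str.ρ t)) ?_ (by simp) ?_ t
        · intro y z
          rw [assocInvLin_tm, ρ_tm, ρ_tm, ρ_tm,
            pairH_assoc (fun x y z => (assocInvLin_tm x y z).symm)]
        · intro s t hs ht
          simp only [map_add, hs, ht] }

theorem assocInv_tm (x : M) (y : N) (z : P) :
    (assocInv M N P).toLin (tm M (tensor N P) x (tm N P y z)) =
      tm (tensor M N) P (tm M N x y) z :=
  (BiHom.lift_tm _ _ _).trans (assocInvLin_tm x y z)

theorem tensor_hom_ext₃ {X : DGMod A} {f g : tensor (tensor M N) P ⟶ X}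
    (h : ∀ x y z, f.toLin (tm (tensor M N) P (tm M N x y) z) =
      g.toLin (tm (tensor M N) P (tm M N x y) z)) : f = g := by
  refine tensor_hom_ext fun t z => ?_
  refine tm_induction (p := fun t => f.toLin (tm (tensor M N) P t z) =
    g.toLin (tm (tensor M N) P t z)) (fun x y => h x y z) (by simp) ?_ t
  intro s t hs ht
  simp only [map_add, LinearMap.add_apply, hs, ht]

theorem tensor_hom_ext₃' {X : DGMod A} {f g : tensor M (tensor N P) ⟶ X}
    (h : ∀ x y z, f.toLin (tm M (tensor N P) x (tm N P y z)) =
      g.toLin (tm M (tensor N P) x (tm N P y z))) : f = g := by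
  refine tensor_hom_ext fun x t => ?_
  refine tm_induction (p := fun t => f.toLin (tm M (tensor N P) x t) =
    g.toLin (tm M (tensor N P) x t)) (fun y z => h x y z) (by simp) ?_ t
  intro s t hs ht
  simp only [map_add, hs, ht]

/-- The associativity isomorphism. -/
@[simps]
def assocIso (M N P : DGMod A) : tensor (tensor M N) P ≅ tensor M (tensor N P) where
  hom := assocHom M N P
  inv := assocInv M N P
  hom_inv_id := tensor_hom_ext₃ fun x y z => by
    rw [comp_apply, assocHom_tm, assocInv_tm, id_apply]
  inv_hom_id := tensor_hom_ext₃' fun x y z => by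
    rw [comp_apply, assocInv_tm, assocHom_tm, id_apply]

/-! ### The unit -/

/-- `A` as a dg module over itself. -/
def unit (A : CDGA H) : DGMod A where
  carrier := A
  str := A.str
  smul_mem := A.mul_mem
  leibniz := fun b ha => A.leibniz b ha
  ρ_smul := fun a b => by
    change A.str.ρ (a * b) = _
    rw [A.ρ_mul]
    generalize A.str.ρ a = α
    generalize A.str.ρ b = β
    induction α using TensorProduct.induction_on with
    | zero => simp
    | add s t hs ht => simp only [add_mul, map_add, LinearMap.add_apply, hs, ht]
    | tmul a h =>
      induction β using TensorProduct.induction_on with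
      | zero => simp
      | add s t hs ht => simp only [mul_add, map_add, hs, ht]
      | tmul b k => simp

theorem d_one : A.str.d (1 : A) = 0 := by
  have h := A.leibniz 1 A.one_mem
  simpa using h

end Monoidal

end DGMod


namespace DGMod

section Unitors

variable {M N P : DGMod A}

/-- The identity of `A`, as a map to the dg module `A`. -/
def ofA : A →ₗ[A] unit A := LinearMap.id

theorem ofA_surjective (b : unit A) : ∃ a : A, ofA a = b := ⟨b, rfl⟩

theorem ofA_mem {p : ℤ} {a : A} (ha : a ∈ A.str.gr p) : ofA a ∈ (unit A).str.gr p := ha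

theorem smul_ofA (a b : A) : a • ofA b = ofA (a * b) := rfl

theorem d_ofA (a : A) : (unit A).str.d (ofA a) = ofA (A.str.d a) := rfl

theorem ρ_ofA_one : (unit A).str.ρ (ofA 1) = ofA 1 ⊗ₜ 1 := A.ρ_one

theorem ofA_induction {p : unit A → Prop} (hom : ∀ n, ∀ a ∈ A.str.gr n, p (ofA a))
    (zero : p 0) (add : ∀ x y, p x → p y → p (x + y)) (a : unit A) : p a :=
  (unit A).str.induction hom zero add a

/-- The action of `A` on `M`. -/
def act (M : DGMod A) : unit A →ₗ[ℚ] M →ₗ[ℚ] M :=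
  ((Algebra.lsmul ℚ ℚ M).toLinearMap : A →ₗ[ℚ] M →ₗ[ℚ] M)

theorem act_ofA (a : A) (x : M) : act M (ofA a) x = a • x := rfl

/-- The left unit `a ⊗ x ↦ a x`. -/
def leftUnitorHom (M : DGMod A) : tensor (unit A) M ⟶ M :=
  BiHom.lift
    { toLin := act M
      balanced := fun {p q a b} x ha hb => by
        obtain ⟨b, rfl⟩ := ofA_surjective b
        rw [smul_ofA, act_ofA, act_ofA, A.comm (b := b) ha hb, smul_assoc, smul_smul, smul_smul, negOne_sq,
          one_smul]
      smul := fun a b x => mul_smul (α := A) a b x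
      mem := fun ha hx => M.smul_mem ha hx
      d := fun x ha => M.leibniz x ha
      ρ := fun a x => M.ρ_smul a x }

theorem leftUnitorHom_tm (a : A) (x : M) :
    (leftUnitorHom M).toLin (tm (unit A) M (ofA a) x) = a • x :=
  BiHom.lift_tm _ _ _

theorem tm_one_smul (a : A) (x : M) :
    tm (unit A) M (ofA 1) (a • x) = tm (unit A) M (ofA a) x := by
  refine A.str.induction (p := fun a => tm (unit A) M (ofA 1) (a • x) =
    tm (unit A) M (ofA a) x) ?_ (by simp) ?_ a
  · intro p a ha
    rw [tm_balanced x ha (ofA_mem A.one_mem), smul_ofA, mul_one, mul_zero, zpow_zero, one_smul]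
  · intro a b h h'
    rw [add_smul, map_add, h, h', map_add, map_add, LinearMap.add_apply]

theorem pairH_one_left {X Y Z : Type u} [AddCommGroup X] [Module ℚ X] [AddCommGroup Y] [Module ℚ Y]
    [AddCommGroup Z] [Module ℚ Z] (b : X →ₗ[ℚ] Y →ₗ[ℚ] Z) (x : X) (η : Y ⊗[ℚ] H) :
    pairH H b (x ⊗ₜ 1) η = (b x).rTensor H η := by
  induction η using TensorProduct.induction_on with
  | zero => simp
  | add s t hs ht => simp only [map_add, hs, ht]
  | tmul y k => simp

theorem pairH_one_right {X Y Z : Type u} [AddCommGroup X] [Module ℚ X] [AddCommGroup Y]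
    [Module ℚ Y] [AddCommGroup Z] [Module ℚ Z] (b : X →ₗ[ℚ] Y →ₗ[ℚ] Z) (ξ : X ⊗[ℚ] H) (y : Y) :
    pairH H b ξ (y ⊗ₜ 1) = (b.flip y).rTensor H ξ := by
  induction ξ using TensorProduct.induction_on with
  | zero => simp
  | add s t hs ht => simp only [map_add, LinearMap.add_apply, hs, ht]
  | tmul x k => simp

/-- The inverse `x ↦ 1 ⊗ x` of the left unit. -/
def leftUnitorInv (M : DGMod A) : M ⟶ tensor (unit A) M where
  toLin :=
    { tm (unit A) M (ofA 1) with
      map_smul' := fun a x => by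
        change tm (unit A) M (ofA 1) (a • x) = a • tm (unit A) M (ofA 1) x
        rw [tm_one_smul, smul_tm, smul_ofA, mul_one] }
  mem hx := tm_mem (ofA_mem A.one_mem) hx (zero_add _)
  d x := by
    change tm (unit A) M (ofA 1) (M.str.d x) = (tensor (unit A) M).str.d (tm (unit A) M (ofA 1) x)
    rw [d_tm (ofA_mem A.one_mem), d_ofA, d_one]
    simp
  ρ x := by
    change (tensor (unit A) M).str.ρ (tm (unit A) M (ofA 1) x) =
      (tm (unit A) M (ofA 1)).rTensor H (M.str.ρ x)
    rw [ρ_tm, ρ_ofA_one, pairH_one_left]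

theorem leftUnitorInv_apply (x : M) :
    (leftUnitorInv M).toLin x = tm (unit A) M (ofA 1) x := rfl

/-- The left unit isomorphism. -/
@[simps]
def leftUnitorIso (M : DGMod A) : tensor (unit A) M ≅ M where
  hom := leftUnitorHom M
  inv := leftUnitorInv M
  hom_inv_id := tensor_hom_ext fun a x => by
    obtain ⟨a, rfl⟩ := ofA_surjective a
    rw [comp_apply, leftUnitorHom_tm, leftUnitorInv_apply, tm_one_smul, id_apply]
  inv_hom_id := hom_ext fun x => by
    rw [comp_apply, leftUnitorInv_apply, leftUnitorHom_tm, one_smul, id_apply]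

/-- The operator `a ↦ (-1) ^ (|a| q) a`. -/
def sgnPow (A : CDGA H) (q : ℤ) : unit A →ₗ[ℚ] unit A :=
  (unit A).str.glue fun p => (-1 : ℚ) ^ (p * q) • ((unit A).str.gr p).subtype

theorem sgnPow_apply {p : ℤ} {a : A} (ha : a ∈ A.str.gr p) (q : ℤ) :
    sgnPow A q (ofA a) = (-1 : ℚ) ^ (p * q) • ofA a := by
  rw [sgnPow, (unit A).str.glue_apply _ (ofA_mem ha)]
  rfl

/-- The right action `x a = (-1) ^ (|a| |x|) a x`. -/
def ract (M : DGMod A) : M →ₗ[ℚ] unit A →ₗ[ℚ] M :=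
  M.str.glue fun q => LinearMap.lcomp ℚ M (sgnPow A q) ∘ₗ (act M).flip ∘ₗ (M.str.gr q).subtype

theorem ract_apply {p q : ℤ} {a : A} {x : M} (ha : a ∈ A.str.gr p) (hx : x ∈ M.str.gr q) :
    ract M x (ofA a) = (-1 : ℚ) ^ (p * q) • a • x := by
  rw [ract, M.str.glue_apply _ hx]
  change act M (sgnPow A q (ofA a)) x = _
  rw [sgnPow_apply ha, map_smul, LinearMap.smul_apply, act_ofA]

theorem ract_smul (b : A) (x : M) (a : unit A) : ract M (b • x) a = b • ract M x a := by
  refine A.str.induction (p := fun b => ract M (b • x) a = b • ract M x a) ?_ (by simp) ?_ b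
  · intro p b hb
    refine M.str.induction (p := fun x => ract M (b • x) a = b • ract M x a) ?_ (by simp) ?_ x
    · intro q x hx
      refine ofA_induction (p := fun a => ract M (b • x) a = b • ract M x a) ?_ (by simp) ?_ a
      · intro r a ha
        rw [ract_apply ha (M.smul_mem hb hx), ract_apply ha hx, smul_comm b, smul_smul a b,
          A.comm ha hb, smul_assoc, smul_smul, mul_smul b a x, mul_add, negOne_add]
        congr 1
        linear_combination (-1 : ℚ) ^ (r * q) * negOne_sq (r * p)
      · intro a a' h h'
        rw [map_add, map_add, h, h', smul_add]
    · intro x x' h h'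
      rw [smul_add, map_add, map_add, LinearMap.add_apply, LinearMap.add_apply, h, h', smul_add]
  · intro b b' h h'
    rw [add_smul, map_add, LinearMap.add_apply, h, h', add_smul]

theorem ract_balanced : Balanced (ract M) := by
  intro p q b x a hb hx
  refine ofA_induction (p := fun a => ract M x (b • a) =
    (-1 : ℚ) ^ (p * q) • ract M (b • x) a) ?_ (by simp) ?_ a
  · intro r a ha
    rw [ract_smul, smul_ofA, ract_apply (A.mul_mem hb ha) hx, ract_apply ha hx, smul_comm b,
      smul_smul ((-1 : ℚ) ^ (p * q)), ← negOne_add, ← add_mul, mul_smul]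
  · intro a a' h h'
    rw [smul_add, map_add, map_add, h, h', smul_add]

theorem pairH_ract {p q : ℤ} {ξ : M ⊗[ℚ] H} {η : unit A ⊗[ℚ] H}
    (hξ : ξ ∈ LinearMap.range ((M.str.gr q).subtype.rTensor H))
    (hη : η ∈ LinearMap.range (((unit A).str.gr p).subtype.rTensor H)) :
    pairH H (ract M) ξ η = (-1 : ℚ) ^ (p * q) • pairH H (act M) η ξ := by
  obtain ⟨ξ, rfl⟩ := hξ
  obtain ⟨η, rfl⟩ := hη
  induction ξ using TensorProduct.induction_on with
  | zero => simp
  | add s t hs ht => simp only [map_add, LinearMap.add_apply, smul_add, hs, ht]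
  | tmul x h =>
    induction η using TensorProduct.induction_on with
    | zero => simp
    | add s t hs ht => simp only [map_add, LinearMap.add_apply, smul_add, hs, ht]
    | tmul a k =>
      have := ract_apply (a := a.1) a.2 x.2
      simp only [LinearMap.rTensor_tmul, Submodule.subtype_apply, pairH_tmul]
      change ract M x.1 (ofA a.1) ⊗ₜ _ = _ • act M (ofA a.1) x.1 ⊗ₜ _
      rw [this, mul_comm h k, TensorProduct.smul_tmul']
      rfl

/-- The right unit `x ⊗ a ↦ x a`. -/
def rightUnitorHom (M : DGMod A) : tensor M (unit A) ⟶ M :=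
  BiHom.lift
    { toLin := ract M
      balanced := ract_balanced
      smul := ract_smul
      mem := fun {q p x a} hx ha => by
        obtain ⟨a, rfl⟩ := ofA_surjective a
        rw [ract_apply (a := a) ha hx, add_comm]
        exact Submodule.smul_mem _ _ (M.smul_mem ha hx)
      d := fun {q x} a hx => by
        refine ofA_induction (p := fun a => M.str.d (ract M x a) =
          ract M (M.str.d x) a + (-1 : ℚ) ^ q • ract M x ((unit A).str.d a)) ?_ (by simp) ?_ a
        · intro p a ha
          rw [ract_apply ha hx, ract_apply ha (M.str.d_mem hx), d_ofA,
            ract_apply (A.str.d_mem ha) hx, map_smul, M.leibniz x ha, smul_add, smul_smul,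
            smul_smul, add_comm]
          congr 1
          · rw [mul_add, mul_one, negOne_add]
          · congr 1
            rw [add_mul, one_mul, negOne_add]
            linear_combination (-(-1 : ℚ) ^ (p * q)) * negOne_sq q
        · intro a a' h h'
          simp only [map_add, h, h', smul_add]
          abel
      ρ := fun x a => by
        refine M.str.induction (p := fun x => M.str.ρ (ract M x a) =
          pairH H (ract M) (M.str.ρ x) ((unit A).str.ρ a)) ?_ (by simp) ?_ x
        · intro q x hx
          refine ofA_induction (p := fun a => M.str.ρ (ract M x a) =
            pairH H (ract M) (M.str.ρ x) ((unit A).str.ρ a)) ?_ (by simp) ?_ a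
          · intro p a ha
            rw [ract_apply ha hx, map_smul, M.ρ_smul,
              pairH_ract (M.str.isSubrep q x hx) ((unit A).str.isSubrep p _ (ofA_mem ha))]
            rfl
          · intro a a' h h'
            simp only [map_add, h, h']
        · intro x x' h h'
          simp only [map_add, LinearMap.add_apply, h, h'] }

theorem rightUnitorHom_tm (x : M) (a : unit A) :
    (rightUnitorHom M).toLin (tm M (unit A) x a) = ract M x a :=
  BiHom.lift_tm _ _ _

theorem ract_one (x : M) : ract M x (ofA 1) = x := by
  refine M.str.induction (p := fun x => ract M x (ofA 1) = x) ?_ (by simp) ?_ x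
  · intro q x hx
    rw [ract_apply A.one_mem hx, zero_mul, zpow_zero, one_smul, one_smul]
  · intro x x' h h'
    rw [map_add, LinearMap.add_apply, h, h']

/-- The relation `x a ⊗ y = x ⊗ a y`. -/
theorem tm_ract (x : M) (a : unit A) (y : N) :
    tm M N (ract M x a) y = tm M N x (act N a y) := by
  refine M.str.induction (p := fun x => tm M N (ract M x a) y = tm M N x (act N a y))
    ?_ (by simp) ?_ x
  · intro q x hx
    refine ofA_induction (p := fun a => tm M N (ract M x a) y = tm M N x (act N a y))
      ?_ (by simp) ?_ a
    · intro p a ha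
      rw [ract_apply ha hx, act_ofA, tm_balanced y ha hx, map_smul, LinearMap.smul_apply]
    · intro a a' h h'
      simp only [map_add, LinearMap.add_apply, h, h']
  · intro x x' h h'
    simp only [map_add, LinearMap.add_apply, h, h']

/-- The inverse `x ↦ x ⊗ 1` of the right unit. -/
def rightUnitorInv (M : DGMod A) : M ⟶ tensor M (unit A) where
  toLin :=
    { (tm M (unit A)).flip (ofA 1) with
      map_smul' := fun a x => (smul_tm a x (ofA 1)).symm }
  mem hx := tm_mem hx (ofA_mem A.one_mem) (add_zero _)
  d x := by
    change tm M (unit A) (M.str.d x) (ofA 1) = (tensor M (unit A)).str.d (tm M (unit A) x (ofA 1))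
    refine M.str.induction (p := fun x => tm M (unit A) (M.str.d x) (ofA 1) =
      (tensor M (unit A)).str.d (tm M (unit A) x (ofA 1))) ?_ (by simp) ?_ x
    · intro q x hx
      rw [d_tm hx, d_ofA, d_one]
      simp
    · intro x x' h h'
      simp only [map_add, LinearMap.add_apply, h, h']
  ρ x := by
    change (tensor M (unit A)).str.ρ (tm M (unit A) x (ofA 1)) =
      ((tm M (unit A)).flip (ofA 1)).rTensor H (M.str.ρ x)
    rw [ρ_tm, ρ_ofA_one, pairH_one_right]

theorem rightUnitorInv_apply (x : M) :
    (rightUnitorInv M).toLin x = tm M (unit A) x (ofA 1) := rfl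

/-- The right unit isomorphism. -/
@[simps]
def rightUnitorIso (M : DGMod A) : tensor M (unit A) ≅ M where
  hom := rightUnitorHom M
  inv := rightUnitorInv M
  hom_inv_id := tensor_hom_ext fun x a => by
    rw [comp_apply, rightUnitorHom_tm, rightUnitorInv_apply, tm_ract, id_apply]
    congr 1
    exact mul_one (M := A) a
  inv_hom_id := hom_ext fun x => by
    rw [comp_apply, rightUnitorInv_apply, rightUnitorHom_tm, ract_one, id_apply]

theorem tensorHom_id_id (M N : DGMod A) : tensorHom (𝟙 M) (𝟙 N) = 𝟙 (tensor M N) :=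
  tensor_hom_ext fun x y => tensorHom_tm _ _ x y

theorem tensorHom_comp {M₁ M₂ M₃ N₁ N₂ N₃ : DGMod A} (f₁ : M₁ ⟶ M₂) (f₂ : N₁ ⟶ N₂)
    (g₁ : M₂ ⟶ M₃) (g₂ : N₂ ⟶ N₃) :
    tensorHom f₁ f₂ ≫ tensorHom g₁ g₂ = tensorHom (f₁ ≫ g₁) (f₂ ≫ g₂) :=
  tensor_hom_ext fun x y => by simp only [comp_apply, tensorHom_tm]

theorem assocHom_naturality {M' N' P' : DGMod A} (f₁ : M ⟶ M') (f₂ : N ⟶ N') (f₃ : P ⟶ P') :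
    tensorHom (tensorHom f₁ f₂) f₃ ≫ assocHom M' N' P' =
      assocHom M N P ≫ tensorHom f₁ (tensorHom f₂ f₃) :=
  tensor_hom_ext₃ fun x y z => by simp only [comp_apply, tensorHom_tm, assocHom_tm]

theorem leftUnitorHom_naturality (f : M ⟶ N) :
    tensorHom (𝟙 (unit A)) f ≫ leftUnitorHom N = leftUnitorHom M ≫ f :=
  tensor_hom_ext fun a x => by
    obtain ⟨a, rfl⟩ := ofA_surjective a
    simp only [comp_apply, tensorHom_tm, leftUnitorHom_tm, id_apply, map_smul]

theorem rightUnitorInv_naturality (f : M ⟶ N) :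
    f ≫ rightUnitorInv N = rightUnitorInv M ≫ tensorHom f (𝟙 (unit A)) :=
  hom_ext fun x => by
    simp only [comp_apply, tensorHom_tm, rightUnitorInv_apply, id_apply]

theorem rightUnitorHom_naturality (f : M ⟶ N) :
    tensorHom f (𝟙 (unit A)) ≫ rightUnitorHom N = rightUnitorHom M ≫ f := by
  have h := rightUnitorInv_naturality f
  have h₁ : rightUnitorHom M ≫ rightUnitorInv M = 𝟙 _ := (rightUnitorIso M).hom_inv_id
  have h₂ : rightUnitorInv N ≫ rightUnitorHom N = 𝟙 _ := (rightUnitorIso N).inv_hom_id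
  calc tensorHom f (𝟙 (unit A)) ≫ rightUnitorHom N
      = (rightUnitorHom M ≫ rightUnitorInv M) ≫ tensorHom f (𝟙 (unit A)) ≫ rightUnitorHom N := by
        rw [h₁, Category.id_comp]
    _ = rightUnitorHom M ≫ (rightUnitorInv M ≫ tensorHom f (𝟙 (unit A))) ≫ rightUnitorHom N := by
        simp only [Category.assoc]
    _ = rightUnitorHom M ≫ f := by
        rw [← h, Category.assoc, h₂, Category.comp_id]

theorem assocHom_pentagon (W X Y Z : DGMod A) :
    tensorHom (assocHom W X Y) (𝟙 Z) ≫ assocHom W (tensor X Y) Z ≫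
      tensorHom (𝟙 W) (assocHom X Y Z) =
      assocHom (tensor W X) Y Z ≫ assocHom W X (tensor Y Z) := by
  refine tensor_hom_ext₃ fun t y z => ?_
  refine tm_induction (p := fun t =>
    (tensorHom (assocHom W X Y) (𝟙 Z) ≫ assocHom W (tensor X Y) Z ≫
      tensorHom (𝟙 W) (assocHom X Y Z)).toLin (tm _ Z (tm _ Y t y) z) =
    (assocHom (tensor W X) Y Z ≫ assocHom W X (tensor Y Z)).toLin (tm _ Z (tm _ Y t y) z))
    ?_ (by simp only [map_zero, LinearMap.zero_apply]) ?_ t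
  · intro w x
    simp only [comp_apply, tensorHom_tm, assocHom_tm, id_apply]
  · intro s t hs ht
    simp only [map_add, LinearMap.add_apply, hs, ht]

theorem assocHom_triangle (M N : DGMod A) :
    assocHom M (unit A) N ≫ tensorHom (𝟙 M) (leftUnitorHom N) =
      tensorHom (rightUnitorHom M) (𝟙 N) :=
  tensor_hom_ext₃ fun x a y => by
    obtain ⟨a, rfl⟩ := ofA_surjective a
    simp only [comp_apply, tensorHom_tm, rightUnitorHom_tm, assocHom_tm, leftUnitorHom_tm,
      id_apply, tm_ract, act_ofA]

end Unitors

instance : MonoidalCategoryStruct (DGMod A) where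
  tensorObj := tensor
  whiskerLeft M _ _ f := tensorHom (𝟙 M) f
  whiskerRight f N := tensorHom f (𝟙 N)
  tensorHom := tensorHom
  tensorUnit := unit A
  associator := assocIso
  leftUnitor := leftUnitorIso
  rightUnitor := rightUnitorIso

/-- The tensor category of dg modules over `A`, with tensor product `⊗_A` and unit `A`. -/
instance : MonoidalCategory (DGMod A) :=
  MonoidalCategory.ofTensorHom
    (id_tensorHom_id := tensorHom_id_id)
    (id_tensorHom := fun _ _ _ _ => rfl)
    (tensorHom_id := fun _ _ => rfl)
    (tensorHom_comp_tensorHom := tensorHom_comp)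
    (associator_naturality := assocHom_naturality)
    (leftUnitor_naturality := leftUnitorHom_naturality)
    (rightUnitor_naturality := rightUnitorHom_naturality)
    (pentagon := assocHom_pentagon)
    (triangle := assocHom_triangle)

end DGMod


namespace DGMod

variable {M N P : DGMod A}

/-- A morphism is a quasi-isomorphism if it induces an isomorphism on cohomology. (Morphisms
respect the grading, so it does not matter that the total cohomology is used here.) -/
structure IsQuasiIso (f : M ⟶ N) : Prop where
  injective : ∀ x, M.str.d x = 0 → ∀ y, f.toLin x = N.str.d y → ∃ x', x = M.str.d x'
  surjective : ∀ y, N.str.d y = 0 → ∃ x y', M.str.d x = 0 ∧ y = f.toLin x + N.str.d y'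

variable (A) in
/-- The class of quasi-isomorphisms of dg modules. -/
def quasiIso : MorphismProperty (DGMod A) := fun _ _ f => IsQuasiIso f

theorem IsQuasiIso.comp {f : M ⟶ N} {g : N ⟶ P} (hf : IsQuasiIso f) (hg : IsQuasiIso g) :
    IsQuasiIso (f ≫ g) where
  injective x hx z hz := by
    obtain ⟨y, hy⟩ := hg.injective (f.toLin x) (by rw [← f.d, hx, map_zero]) z hz
    exact hf.injective x hx y hy
  surjective z hz := by
    obtain ⟨y, z', hy, rfl⟩ := hg.surjective z hz
    obtain ⟨x, y', hx, rfl⟩ := hf.surjective y hy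
    exact ⟨x, g.toLin y' + z', hx, by rw [comp_apply, map_add, map_add, g.d, add_assoc]⟩

theorem isQuasiIso_of_iso (e : M ≅ N) : IsQuasiIso e.hom := by
  have h₁ : ∀ x, e.inv.toLin (e.hom.toLin x) = x := fun x => by
    rw [← comp_apply, e.hom_inv_id, id_apply]
  have h₂ : ∀ y, e.hom.toLin (e.inv.toLin y) = y := fun y => by
    rw [← comp_apply, e.inv_hom_id, id_apply]
  exact
    { injective := fun x _ y h => ⟨e.inv.toLin y, by rw [← e.inv.d, ← h, h₁]⟩
      surjective := fun y hy => ⟨e.inv.toLin y, 0, by rw [← e.inv.d, hy, map_zero], by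
        rw [h₂, map_zero, add_zero]⟩ }

instance : (quasiIso A).IsMultiplicative where
  id_mem M := isQuasiIso_of_iso (Iso.refl M)
  comp_mem _ _ hf hg := IsQuasiIso.comp hf hg

/-- Two morphisms are homotopic: `f - g = d h + h d` for a `G`-equivariant map `h` of degree `-1`
which is linear over `A` in the graded sense. -/
def Homotopic (f g : M ⟶ N) : Prop :=
  ∃ h : M →ₗ[ℚ] N, (∀ n x, x ∈ M.str.gr n → h x ∈ N.str.gr (n - 1)) ∧
    (∀ (p : ℤ) (a : A) (x : M), a ∈ A.str.gr p → h (a • x) = (-1 : ℚ) ^ p • a • h x) ∧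
    (∀ x, N.str.ρ (h x) = h.rTensor H (M.str.ρ x)) ∧
    ∀ x, f.toLin x - g.toLin x = N.str.d (h x) + h (M.str.d x)

variable (A) in
/-- The homotopy relation on morphisms of dg modules. -/
def homotopyRel : HomRel (DGMod A) := fun _ _ f g => Homotopic f g

end DGMod

variable (A) in
/-- The homotopy category `𝒦_A^G` of dg modules over `A`. -/
abbrev KCat := Quotient (DGMod.homotopyRel A)

variable (A) in
/-- The quasi-isomorphisms in the homotopy category. -/
def quasiIsoK : MorphismProperty (KCat A) := fun X Y f =>
  ∃ g : X.as ⟶ Y.as, DGMod.IsQuasiIso g ∧ f = (Quotient.functor (DGMod.homotopyRel A)).map g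

variable (A) in
/-- The derived category `𝒟_A^G` of dg modules over `A`. -/
abbrev DCat := (quasiIsoK A).Localization

variable (A) in
/-- The functor from dg modules to the derived category. -/
def toDCat : DGMod A ⥤ DCat A := Quotient.functor (DGMod.homotopyRel A) ⋙ (quasiIsoK A).Q

namespace DGMod

variable (A) in
/-- Flat (or `K`-flat) dg modules: those for which `P ⊗_A -` and `- ⊗_A P` preserve
quasi-isomorphisms. All cell modules are flat. -/
def flat : ObjectProperty (DGMod A) := fun P =>
  (∀ ⦃M N : DGMod A⦄ (f : M ⟶ N), IsQuasiIso f →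
    IsQuasiIso (MonoidalCategoryStruct.whiskerLeft P f)) ∧
  ∀ ⦃M N : DGMod A⦄ (f : M ⟶ N), IsQuasiIso f →
    IsQuasiIso (MonoidalCategoryStruct.whiskerRight f P)

open MonoidalCategory

instance : (flat A).IsMonoidal where
  prop_unit := ⟨fun M N f hf => by
      rw [id_whiskerLeft]
      exact (isQuasiIso_of_iso (λ_ M)).comp (hf.comp (isQuasiIso_of_iso (λ_ N).symm)),
    fun M N f hf => by
      rw [whiskerRight_id]
      exact (isQuasiIso_of_iso (ρ_ M)).comp (hf.comp (isQuasiIso_of_iso (ρ_ N).symm))⟩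
  prop_tensor P Q hP hQ := ⟨fun M N f hf => by
      rw [tensor_whiskerLeft]
      exact (isQuasiIso_of_iso (α_ P Q M)).comp
        ((hP.1 _ (hQ.1 _ hf)).comp (isQuasiIso_of_iso (α_ P Q N).symm)),
    fun M N f hf => by
      rw [whiskerRight_tensor]
      exact (isQuasiIso_of_iso (α_ M P Q).symm).comp
        ((hQ.2 _ (hP.2 _ hf)).comp (isQuasiIso_of_iso (α_ N P Q)))⟩

variable (A) in
/-- The quasi-isomorphisms between flat dg modules. -/
def quasiIsoFlat : MorphismProperty (flat A).FullSubcategory :=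
  (quasiIso A).inverseImage (flat A).ι

instance : (quasiIsoFlat A).IsMonoidal where
  id_mem M := (quasiIso A).id_mem M.obj
  comp_mem f g hf hg := (quasiIso A).comp_mem f.hom g.hom hf hg
  whiskerLeft P _ _ f hf := P.property.1 f.hom hf
  whiskerRight f hf P := P.property.2 f.hom hf

end DGMod

variable (A) in
/-- The derived category of flat dg modules, with its tensor product, which is the derived tensor
product `⊗_A^𝕃`. -/
abbrev DFlat := LocalizedMonoidal (DGMod.quasiIsoFlat A).Q (DGMod.quasiIsoFlat A)
  (Iso.refl ((DGMod.quasiIsoFlat A).Q.obj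
    (MonoidalCategory.tensorUnit (DGMod.flat A).FullSubcategory)))

theorem quasiIsoFlat_isInvertedBy :
    (DGMod.quasiIsoFlat A).IsInvertedBy ((DGMod.flat A).ι ⋙ toDCat A) := fun _ _ f hf =>
  Localization.inverts (quasiIsoK A).Q (quasiIsoK A) _ ⟨f.hom, hf, rfl⟩

variable (A) in
/-- The functor from the derived category of flat dg modules to the derived category. Every dg
module has a flat resolution, so this is an equivalence, by means of which `⊗_A^𝕃` is defined on
the derived category. -/
def flatToD : DFlat A ⥤ DCat A :=
  Localization.lift _ (quasiIsoFlat_isInvertedBy (A := A))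
    (Localization.Monoidal.toMonoidalCategory (DGMod.quasiIsoFlat A).Q (DGMod.quasiIsoFlat A)
      (Iso.refl _))

/-- The object `M` of the derived category is rigid: in terms of `P ≅ M` there are an object `P'`
and morphisms `A ⟶ P ⊗ P'` and `P' ⊗ P ⟶ A` satisfying the two triangle identities. -/
def IsRigid (M : DCat A) : Prop :=
  ∃ P P' : DFlat A, Nonempty (ExactPairing P P') ∧ Nonempty ((flatToD A).obj P ≅ M)

open Classical in
/-- The structure of a cell module on `M`. As a graded module over `A` in representations of `G`,
`M` is the direct sum of the modules `A[-n_j] ⊗ V_j` for `V_j` a finite-dimensional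
representation of `G` (here identified with its image `1 ⊗ V_j` in `M`), and the index set `J` is
the union of an increasing sequence of subsets, starting with the empty set, such that the
differential maps the generators in each step to the submodule generated by the previous step. -/
structure CellStructure (M : DGMod A) where
  J : Type u
  deg : J → ℤ
  V : J → Submodule ℚ M
  finite : ∀ j, FiniteDimensional ℚ (V j)
  isSubrep : ∀ j, IsSubrep M.str.ρ (V j)
  mem : ∀ j, V j ≤ M.str.gr (deg j)
  bijective : Function.Bijective (DirectSum.toModule ℚ J M fun j =>
    TensorProduct.lift ((Algebra.lsmul ℚ ℚ M).toLinearMap.compl₂ (V j).subtype) :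
      (DirectSum J fun j => A ⊗[ℚ] V j) →ₗ[ℚ] M)
  step : ℕ → Set J
  step_zero : step 0 = ∅
  step_mono : Monotone step
  step_union : ⋃ n, step n = Set.univ
  d_mem : ∀ n, ∀ j ∈ step (n + 1), ∀ v ∈ V j,
    M.str.d v ∈ Submodule.span A (⋃ i ∈ step n, (V i : Set M))

/-- `M` is a cell module. -/
def IsCell (M : DGMod A) : Prop := Nonempty (CellStructure M)

/-- `M` is a finite cell module. -/
def IsFiniteCell (M : DGMod A) : Prop := ∃ c : CellStructure M, Finite c.J

variable (A) in
/-- The objects of `𝒟_A^{G,f}`: those isomorphic to a finite cell module in the derived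
category. -/
def finiteD : ObjectProperty (DCat A) := fun X =>
  ∃ M : DGMod A, IsFiniteCell M ∧ Nonempty (X ≅ (toDCat A).obj M)

/-- The cell module `N` is a summand of `M` up to homotopy: `M` is homotopy equivalent to a direct
sum `S = N ⊕ N'` of dg modules, for a cell module `N'`. -/
def IsHomotopySummand (N M : DGMod A) : Prop :=
  ∃ (N' S : DGMod A) (i : N ⟶ S) (i' : N' ⟶ S), IsCell N' ∧
    Function.Bijective (fun z : N × N' => i.toLin z.1 + i'.toLin z.2) ∧
    Nonempty ((Quotient.functor (DGMod.homotopyRel A)).obj M ≅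
      (Quotient.functor (DGMod.homotopyRel A)).obj S)

variable (A) in
/-- The objects of `𝒦ℱ𝒞ℳ_A^G`, as a full subcategory of the homotopy category: the cell modules
which are summands up to homotopy of finite cell modules. -/
def cellSummandK : ObjectProperty (KCat A) := fun X =>
  IsCell X.as ∧ ∃ M : DGMod A, IsFiniteCell M ∧ IsHomotopySummand X.as M

end

/-! Two facts about finite cell modules carry the proof.

(a) Finite cell modules are projective with respect to quasi-isomorphisms. A cocycle with values in
the cone of a quasi-isomorphism is bounded step by step along the filtration of the generators.
Acyclicity of the cone bounds each value, and complete reducibility makes the choice equivariant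
(`DGMod.exists_bounding_step`, `DGMod.exists_bounding`). Hence morphisms out of a finite cell
module, or out of a retract of one in the homotopy category, are the same in the homotopy category
and in the derived category (`DGMod.Q_map_bijective`).

(b) Homotopy idempotents of finite cell modules split, and the image is again a finite cell module
(`DGMod.exists_split`). This is where Adams connectedness enters. The augmentation `A → ℚ` is
multiplicative, so a module free on `V` has a reduction `ℚ ⊗_A M = V`. In positive Adams degree the
coefficients push the generators to lower Adams degree, so a degree-zero endomorphism with zero
reduction is nilpotent (`DGMod.IsFreeOn.isNilpotent`). The identity is homotopic to a morphism `f`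
such that `d f` has zero reduction (`DGMod.IsFreeOn.exists_homotopic_id`). For a homotopy idempotent
`e`, the composite `f e f` is therefore idempotent up to a nilpotent error and can be corrected to a
strict idempotent. The image of a strict idempotent is free on a finite-dimensional graded
representation, and such a module is a finite cell module, its cells being ordered by Adams degree
and then by degree (`DGMod.IsFreeOn.isFiniteCell`).

From (a) and (b), a retract in the derived category of a finite cell module lies in `finiteD`
(`DGMod.finiteD_of_retract`). Idempotent completeness follows by the same argument, and the
comparison with the homotopy category by (a).

A finite cell module is rigid because it is flat and has a finite homogeneous basis: the matrices of
its coaction and differential can be dualized, and the dual basis gives an evaluation and a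
coevaluation already for dg modules (`DGMod.HBasis.exactPairing`). The monoidal localization functor
preserves this duality.

Conversely, let `M` be rigid with dual `N`. The bar resolution of `M` is a directed union of finite
cell modules, and the unit `A` is itself a finite cell module, so the coevaluation `A → M ⊗ N`
factors through `F ⊗ N` for some finite cell module `F → M` (`DGMod.exists_factor_tensor`). Then `F
→ M` has a section (`CategoryTheory.ExactPairing.exists_section`), so `M` is a retract of `F`. -/

noncomputable section

/-! ### Tensors over a field and their contractions -/

section Slices

variable {C : Type*} [AddCommGroup C] [Module ℚ C]
variable {M N : Type u} [AddCommGroup M] [Module ℚ M] [AddCommGroup N] [Module ℚ N]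

/-- Contraction of the second tensor factor with a functional. -/
def slice (φ : C →ₗ[ℚ] ℚ) : M ⊗[ℚ] C →ₗ[ℚ] M :=
  (TensorProduct.rid ℚ M).toLinearMap ∘ₗ φ.lTensor M

@[simp] theorem slice_tmul (φ : C →ₗ[ℚ] ℚ) (x : M) (c : C) : slice φ (x ⊗ₜ[ℚ] c) = φ c • x := by
  simp [slice]

theorem slice_rTensor (φ : C →ₗ[ℚ] ℚ) (f : M →ₗ[ℚ] N) (t : M ⊗[ℚ] C) :
    slice φ (f.rTensor C t) = f (slice φ t) := by
  induction t using TensorProduct.induction_on with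
  | zero => simp
  | tmul x c => simp
  | add s t hs ht => simp only [map_add, hs, ht]

theorem slice_lTensor {D : Type*} [AddCommGroup D] [Module ℚ D] (φ : D →ₗ[ℚ] ℚ) (g : C →ₗ[ℚ] D)
    (t : M ⊗[ℚ] C) : slice φ (g.lTensor M t) = slice (φ ∘ₗ g) t := by
  induction t using TensorProduct.induction_on with
  | zero => simp
  | tmul x c => simp
  | add s t hs ht => simp only [map_add, hs, ht]

/-- A basis of `C` identifies `M ⊗ C` with the finitely supported families in `M`, and the slices
along the coordinates are the entries of the family. -/
theorem eq_of_slice_coord {ι : Type*} (b : Module.Basis ι ℚ C) {s t : M ⊗[ℚ] C}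
    (h : ∀ i, slice (b.coord i) s = slice (b.coord i) t) : s = t := by
  classical
  have key : ∀ (u : M ⊗[ℚ] C) i, TensorProduct.equivFinsuppOfBasisRight b u i =
      slice (b.coord i) u := by
    intro u i
    induction u using TensorProduct.induction_on with
    | zero => simp
    | tmul x c => simp
    | add s t hs ht => simp only [map_add, Finsupp.add_apply, hs, ht]
  apply (TensorProduct.equivFinsuppOfBasisRight b).injective
  ext i
  rw [key, key, h]

theorem eq_of_slice {s t : M ⊗[ℚ] C}
    (h : ∀ φ : C →ₗ[ℚ] ℚ, slice φ s = slice φ t) : s = t :=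
  eq_of_slice_coord (Module.Basis.ofVectorSpace ℚ C) fun _ => h _

/-- By right exactness of the tensor product, lying in the image of `W ⊗ C` means vanishing in `(M ⧸
W) ⊗ C`, and vanishing is detected by slices. Subrepresentations thereby become subspaces stable
under operators. -/
theorem mem_range_rTensor_iff {W : Submodule ℚ M} {t : M ⊗[ℚ] C} :
    t ∈ LinearMap.range (W.subtype.rTensor C) ↔ ∀ φ : C →ₗ[ℚ] ℚ, slice φ t ∈ W := by
  constructor
  · rintro ⟨t, rfl⟩ φ
    rw [slice_rTensor]
    exact (slice φ t).2
  · intro h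
    have ex := rTensor_exact C (LinearMap.exact_subtype_mkQ W) W.mkQ_surjective
    refine (ex t).1 (eq_of_slice fun φ => ?_)
    rw [slice_rTensor, map_zero]
    exact (Submodule.Quotient.mk_eq_zero W).2 (h φ)

/-- Contraction as a function of the functional. -/
def sliceLeft (t : M ⊗[ℚ] C) : (C →ₗ[ℚ] ℚ) →ₗ[ℚ] M where
  toFun φ := slice φ t
  map_add' φ ψ := by
    induction t using TensorProduct.induction_on with
    | zero => simp
    | tmul x c => simp [add_smul]
    | add s t hs ht => simp only [map_add, hs, ht]; abel
  map_smul' a φ := by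
    induction t using TensorProduct.induction_on with
    | zero => simp
    | tmul x c => simp [mul_smul]
    | add s t hs ht => simp only [map_add, hs, ht, smul_add]

/-- A tensor is a finite sum of pure tensors. Applied to `ρ x`, this is the local finiteness of
representations. -/
instance (t : M ⊗[ℚ] C) : FiniteDimensional ℚ (LinearMap.range (sliceLeft t)) := by
  suffices h : ∃ W : Submodule ℚ M, FiniteDimensional ℚ W ∧ ∀ φ : C →ₗ[ℚ] ℚ, slice φ t ∈ W by
    obtain ⟨W, hW, h⟩ := h
    exact Submodule.finiteDimensional_of_le (S₂ := W) (by rintro _ ⟨φ, rfl⟩; exact h φ)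
  induction t using TensorProduct.induction_on with
  | zero => exact ⟨⊥, inferInstance, by simp⟩
  | tmul x c =>
    refine ⟨Submodule.span ℚ {x}, inferInstance, fun φ => ?_⟩
    rw [slice_tmul]
    exact Submodule.smul_mem _ _ (Submodule.mem_span_singleton_self x)
  | add s t hs ht =>
    obtain ⟨V, hV, hs⟩ := hs
    obtain ⟨W, hW, ht⟩ := ht
    refine ⟨V ⊔ W, inferInstance, fun φ => ?_⟩
    rw [map_add]
    exact Submodule.add_mem_sup (hs φ) (ht φ)

end Slices

/-! ### Representations as modules over the convolution algebra; complete reducibility -/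

section Coactions

variable {H : Type u} [CommRing H] [HopfAlgebra ℚ H]
variable {M N : Type u} [AddCommGroup M] [Module ℚ M] [AddCommGroup N] [Module ℚ N]
variable {ρ : M →ₗ[ℚ] M ⊗[ℚ] H} {ρ' : N →ₗ[ℚ] N ⊗[ℚ] H}

/-- The action of the functional `φ` on a comodule. -/
def coact (ρ : M →ₗ[ℚ] M ⊗[ℚ] H) (φ : H →ₗ[ℚ] ℚ) : M →ₗ[ℚ] M := slice φ ∘ₗ ρ

theorem coact_apply (φ : H →ₗ[ℚ] ℚ) (x : M) : coact ρ φ x = slice φ (ρ x) := rfl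

/-- The convolution of two functionals. -/
def convol (φ ψ : H →ₗ[ℚ] ℚ) : H →ₗ[ℚ] ℚ :=
  LinearMap.mul' ℚ ℚ ∘ₗ TensorProduct.map φ ψ ∘ₗ Coalgebra.comul

theorem slice_slice (φ ψ : H →ₗ[ℚ] ℚ) (t : (M ⊗[ℚ] H) ⊗[ℚ] H) :
    slice φ (slice ψ t) = slice (LinearMap.mul' ℚ ℚ ∘ₗ TensorProduct.map φ ψ)
      (TensorProduct.assoc ℚ M H H t) := by
  induction t using TensorProduct.induction_on with
  | zero => simp
  | add s t hs ht => simp only [map_add, hs, ht]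
  | tmul x k =>
    induction x using TensorProduct.induction_on with
    | zero => simp
    | add s t hs ht => simp only [map_add, TensorProduct.add_tmul, hs, ht]
    | tmul x h =>
      simp only [slice_tmul, map_smul, TensorProduct.assoc_tmul, LinearMap.comp_apply,
        TensorProduct.map_tmul, LinearMap.mul'_apply]
      rw [smul_smul, mul_comm]

/-- Slicing by all functionals loses no information, so the comodule axioms say that the operators
`coact ρ φ` represent the convolution algebra of functionals on `𝒪(G)`. Together with `isSubrep_iff`
and `equivariant_iff` this replaces tensor computations by computations with operators. -/
theorem isCoaction_iff : IsCoaction ρ ↔ (∀ x, coact ρ Coalgebra.counit x = x) ∧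
    ∀ φ ψ x, coact ρ φ (coact ρ ψ x) = coact ρ (convol φ ψ) x := by
  have h₁ : ∀ φ ψ x, coact ρ φ (coact ρ ψ x) = slice (LinearMap.mul' ℚ ℚ ∘ₗ TensorProduct.map φ ψ)
      (TensorProduct.assoc ℚ M H H (ρ.rTensor H (ρ x))) := by
    intro φ ψ x
    rw [← slice_slice, slice_rTensor]
    rfl
  have h₂ : ∀ φ ψ x, coact ρ (convol φ ψ) x = slice (LinearMap.mul' ℚ ℚ ∘ₗ TensorProduct.map φ ψ)
      ((Coalgebra.comul (R := ℚ) (A := H)).lTensor M (ρ x)) := by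
    intro φ ψ x
    rw [slice_lTensor]
    rfl
  constructor
  · intro h
    refine ⟨h.counit, fun φ ψ x => ?_⟩
    rw [h₁, h₂, h.coassoc]
  · rintro ⟨h, h'⟩
    refine ⟨h, fun x => ?_⟩
    rw [← LinearEquiv.eq_symm_apply]
    refine eq_of_slice fun ψ => eq_of_slice fun φ => ?_
    rw [slice_slice, slice_slice, LinearEquiv.apply_symm_apply, ← h₁, ← h₂, h']

theorem IsCoaction.coact_counit (h : IsCoaction ρ) (x : M) : coact ρ Coalgebra.counit x = x :=
  (isCoaction_iff.1 h).1 x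

theorem IsCoaction.coact_coact (h : IsCoaction ρ) (φ ψ : H →ₗ[ℚ] ℚ) (x : M) :
    coact ρ φ (coact ρ ψ x) = coact ρ (convol φ ψ) x :=
  (isCoaction_iff.1 h).2 φ ψ x

theorem isSubrep_iff {W : Submodule ℚ M} :
    IsSubrep ρ W ↔ ∀ φ, ∀ x ∈ W, coact ρ φ x ∈ W :=
  ⟨fun h φ x hx => mem_range_rTensor_iff.1 (h x hx) φ,
    fun h x hx => mem_range_rTensor_iff.2 fun φ => h φ x hx⟩

theorem equivariant_iff {f : M →ₗ[ℚ] N} : (∀ x, ρ' (f x) = f.rTensor H (ρ x)) ↔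
    ∀ φ x, coact ρ' φ (f x) = f (coact ρ φ x) := by
  constructor
  · intro h φ x
    rw [coact_apply, h, slice_rTensor]
    rfl
  · intro h x
    refine eq_of_slice fun φ => ?_
    rw [slice_rTensor]
    exact h φ x

theorem IsSubrep.sup {V W : Submodule ℚ M} (hV : IsSubrep ρ V) (hW : IsSubrep ρ W) :
    IsSubrep ρ (V ⊔ W) := by
  rw [isSubrep_iff] at *
  intro φ x hx
  obtain ⟨y, hy, z, hz, rfl⟩ := Submodule.mem_sup.1 hx
  rw [map_add]
  exact Submodule.add_mem_sup (hV φ y hy) (hW φ z hz)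

theorem IsSubrep.inf {V W : Submodule ℚ M} (hV : IsSubrep ρ V) (hW : IsSubrep ρ W) :
    IsSubrep ρ (V ⊓ W) := by
  rw [isSubrep_iff] at *
  exact fun φ x hx => ⟨hV φ x hx.1, hW φ x hx.2⟩

theorem IsSubrep.iSup {ι : Sort*} {V : ι → Submodule ℚ M} (hV : ∀ i, IsSubrep ρ (V i)) :
    IsSubrep ρ (⨆ i, V i) := by
  simp only [isSubrep_iff] at *
  intro φ x hx
  refine Submodule.iSup_induction V (motive := fun x => coact ρ φ x ∈ ⨆ i, V i) hx ?_ (by simp) ?_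
  · exact fun i x hx => Submodule.mem_iSup_of_mem i (hV i φ x hx)
  · intro x y hx hy
    rw [map_add]
    exact add_mem hx hy

theorem isSubrep_bot : IsSubrep ρ ⊥ := by
  rw [isSubrep_iff]
  rintro φ x rfl
  simp

theorem IsSubrep.map {f : M →ₗ[ℚ] N} (hf : ∀ φ x, coact ρ' φ (f x) = f (coact ρ φ x))
    {V : Submodule ℚ M} (hV : IsSubrep ρ V) : IsSubrep ρ' (V.map f) := by
  rw [isSubrep_iff] at *
  rintro φ _ ⟨x, hx, rfl⟩
  exact ⟨_, hV φ x hx, (hf φ x).symm⟩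

theorem IsSubrep.comap {f : M →ₗ[ℚ] N} (hf : ∀ φ x, coact ρ' φ (f x) = f (coact ρ φ x))
    {V : Submodule ℚ N} (hV : IsSubrep ρ' V) : IsSubrep ρ (V.comap f) := by
  rw [isSubrep_iff] at *
  intro φ x hx
  rw [Submodule.mem_comap, ← hf]
  exact hV φ _ hx

/-- The subrepresentation generated by an element. -/
def orbit (ρ : M →ₗ[ℚ] M ⊗[ℚ] H) (x : M) : Submodule ℚ M := LinearMap.range (sliceLeft (ρ x))

instance (x : M) : FiniteDimensional ℚ (orbit ρ x) :=
  inferInstanceAs (FiniteDimensional ℚ (LinearMap.range (sliceLeft (ρ x))))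

theorem IsCoaction.isSubrep_orbit (h : IsCoaction ρ) (x : M) : IsSubrep ρ (orbit ρ x) := by
  rw [isSubrep_iff]
  rintro φ _ ⟨ψ, rfl⟩
  exact ⟨convol φ ψ, (h.coact_coact φ ψ x).symm⟩

theorem IsCoaction.mem_orbit (h : IsCoaction ρ) (x : M) : x ∈ orbit ρ x :=
  ⟨Coalgebra.counit, h.coact_counit x⟩

theorem IsSubrep.orbit_le {W : Submodule ℚ M} (h : IsSubrep ρ W) {x : M} (hx : x ∈ W) :
    orbit ρ x ≤ W := by
  rintro _ ⟨φ, rfl⟩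
  exact isSubrep_iff.1 h φ x hx

/-- The restriction of a coaction to a subrepresentation. -/
def IsSubrep.restrict {W : Submodule ℚ M} (h : IsSubrep ρ W) : W →ₗ[ℚ] W ⊗[ℚ] H :=
  (LinearEquiv.ofInjective (W.subtype.rTensor H)
    (Module.Flat.rTensor_preserves_injective_linearMap _ W.injective_subtype)).symm.toLinearMap ∘ₗ
    (ρ ∘ₗ W.subtype).codRestrict _ fun x => h x x.2

theorem IsSubrep.rTensor_restrict {W : Submodule ℚ M} (h : IsSubrep ρ W) (x : W) :
    W.subtype.rTensor H (h.restrict x) = ρ x := by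
  have := LinearEquiv.apply_symm_apply (LinearEquiv.ofInjective (W.subtype.rTensor H)
    (Module.Flat.rTensor_preserves_injective_linearMap _ W.injective_subtype))
    ((ρ ∘ₗ W.subtype).codRestrict _ (fun x => h x x.2) x)
  exact congrArg Subtype.val this

theorem IsSubrep.coact_restrict {W : Submodule ℚ M} (h : IsSubrep ρ W) (φ : H →ₗ[ℚ] ℚ) (x : W) :
    (coact h.restrict φ x : M) = coact ρ φ x := by
  rw [coact_apply, coact_apply, ← h.rTensor_restrict, slice_rTensor]
  rfl

theorem IsSubrep.isCoaction_restrict {W : Submodule ℚ M} (h : IsSubrep ρ W) (hρ : IsCoaction ρ) :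
    IsCoaction h.restrict := by
  refine isCoaction_iff.2 ⟨fun x => Subtype.ext ?_, fun φ ψ x => Subtype.ext ?_⟩
  · rw [h.coact_restrict, hρ.coact_counit]
  · rw [h.coact_restrict, h.coact_restrict, h.coact_restrict, hρ.coact_coact]

/-- The coaction on a direct sum. -/
def prodCoaction (ρ : M →ₗ[ℚ] M ⊗[ℚ] H) (ρ' : N →ₗ[ℚ] N ⊗[ℚ] H) :
    M × N →ₗ[ℚ] (M × N) ⊗[ℚ] H :=
  (LinearMap.inl ℚ M N).rTensor H ∘ₗ ρ ∘ₗ LinearMap.fst ℚ M N +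
    (LinearMap.inr ℚ M N).rTensor H ∘ₗ ρ' ∘ₗ LinearMap.snd ℚ M N

theorem coact_prodCoaction (φ : H →ₗ[ℚ] ℚ) (z : M × N) :
    coact (prodCoaction ρ ρ') φ z = (coact ρ φ z.1, coact ρ' φ z.2) := by
  rw [coact_apply, prodCoaction]
  simp only [LinearMap.add_apply, LinearMap.comp_apply, map_add, slice_rTensor]
  simp [coact_apply]

theorem isCoaction_prodCoaction (h : IsCoaction ρ) (h' : IsCoaction ρ') :
    IsCoaction (prodCoaction ρ ρ') := by
  refine isCoaction_iff.2 ⟨fun x => ?_, fun φ ψ x => ?_⟩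
  · rw [coact_prodCoaction, h.coact_counit, h'.coact_counit]
  · simp only [coact_prodCoaction, h.coact_coact, h'.coact_coact]

/-- A subrepresentation of a finite-dimensional representation has an equivariant projector. -/
theorem IsReductive.exists_projector [FiniteDimensional ℚ M] (hH : IsReductive H)
    (hρ : IsCoaction ρ) {W : Submodule ℚ M} (hW : IsSubrep ρ W) :
    ∃ p : M →ₗ[ℚ] M, (∀ φ x, coact ρ φ (p x) = p (coact ρ φ x)) ∧ (∀ x, p x ∈ W) ∧
      ∀ x ∈ W, p x = x := by
  obtain ⟨W', hW', hc⟩ := hH M ρ hρ W hW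
  refine ⟨W.subtype ∘ₗ W.projectionOnto W' hc, fun φ x => ?_, fun x => Subtype.property _, fun x hx => ?_⟩
  · obtain ⟨y, hy, z, hz, rfl⟩ : ∃ y ∈ W, ∃ z ∈ W', y + z = x := by
      rw [← Submodule.mem_sup, hc.sup_eq_top]; trivial
    have h₁ := isSubrep_iff.1 hW φ y hy
    have h₂ := isSubrep_iff.1 hW' φ z hz
    have e₁ : W.projectionOnto W' hc y = ⟨y, hy⟩ := Submodule.projectionOnto_apply_left hc ⟨y, hy⟩
    have e₂ := Submodule.projectionOnto_apply_left hc ⟨_, h₁⟩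
    simp only at e₂
    simp only [map_add, LinearMap.comp_apply, (Submodule.projectionOnto_apply_eq_zero_iff hc).2 hz,
      (Submodule.projectionOnto_apply_eq_zero_iff hc).2 h₂, e₁, e₂, Submodule.subtype_apply,
      map_zero, add_zero]
  · have e₁ : W.projectionOnto W' hc x = ⟨x, hx⟩ := Submodule.projectionOnto_apply_left hc ⟨x, hx⟩
    rw [LinearMap.comp_apply, e₁]; rfl

/-- Equivariant maps from a finite-dimensional representation lift along equivariant maps. -/
theorem IsReductive.exists_lift {V B : Type u} [AddCommGroup V] [Module ℚ V]
    [FiniteDimensional ℚ V] [AddCommGroup B] [Module ℚ B] (hH : IsReductive H)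
    {ρV : V →ₗ[ℚ] V ⊗[ℚ] H} {ρB : B →ₗ[ℚ] B ⊗[ℚ] H} (hV : IsCoaction ρV) (hρ : IsCoaction ρ)
    {π : M →ₗ[ℚ] B} (hπ : ∀ φ x, coact ρB φ (π x) = π (coact ρ φ x))
    {f : V →ₗ[ℚ] B} (hf : ∀ φ x, coact ρB φ (f x) = f (coact ρV φ x))
    (h : ∀ v, ∃ x, π x = f v) :
    ∃ g : V →ₗ[ℚ] M, (∀ φ x, coact ρ φ (g x) = g (coact ρV φ x)) ∧ ∀ v, π (g v) = f v := by
  choose s hs using h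
  have hc := isCoaction_prodCoaction hV hρ
  let b := Module.finBasis ℚ V
  -- `M` may be infinite-dimensional, so complete reducibility is applied inside the fibre product
  -- of `V` and `M` over `B`: arbitrary lifts of a basis of `V` generate there a finite-dimensional
  -- subrepresentation `W`, which maps onto `V`.
  let W : Submodule ℚ (V × M) := ⨆ i, orbit (prodCoaction ρV ρ) (b i, s (b i))
  have hW : IsSubrep (prodCoaction ρV ρ) W := IsSubrep.iSup fun i => hc.isSubrep_orbit _
  have hWP : ∀ z ∈ W, π z.2 = f z.1 := by
    intro z hz
    refine Submodule.iSup_induction _ (motive := fun z : V × M => π z.2 = f z.1) hz ?_ (by simp) ?_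
    · rintro i _ ⟨φ, rfl⟩
      change π (coact (prodCoaction ρV ρ) φ _).2 = f (coact (prodCoaction ρV ρ) φ _).1
      rw [coact_prodCoaction, ← hπ, ← hf, hs]
    · intro x y hx hy
      simp only [Prod.snd_add, Prod.fst_add, map_add, hx, hy]
  let q : W →ₗ[ℚ] V := LinearMap.fst ℚ V M ∘ₗ W.subtype
  have hqe : ∀ φ x, coact ρV φ (q x) = q (coact hW.restrict φ x) := by
    intro φ x
    change _ = (coact hW.restrict φ x : V × M).1
    rw [hW.coact_restrict, coact_prodCoaction]
    rfl
  have hq : LinearMap.range q = ⊤ := by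
    rw [eq_top_iff, ← b.span_eq, Submodule.span_le]
    rintro _ ⟨i, rfl⟩
    exact ⟨⟨_, Submodule.mem_iSup_of_mem i (hc.mem_orbit (b i, s (b i)))⟩, rfl⟩
  have hK : IsSubrep hW.restrict (LinearMap.ker q) := by
    rw [isSubrep_iff]
    intro φ x hx
    rw [LinearMap.mem_ker, ← hqe, LinearMap.mem_ker.1 hx, map_zero]
  obtain ⟨K', hK', hcompl⟩ := hH W hW.restrict (hW.isCoaction_restrict hc) _ hK
  -- An invariant complement of the kernel of `W → V` is a copy of `V` inside the fibre product; its
  -- second coordinate is the equivariant lift.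
  let e : K' ≃ₗ[ℚ] V := LinearEquiv.ofBijective (q ∘ₗ K'.subtype) (by
    constructor
    · refine (injective_iff_map_eq_zero _).2 fun x hx => Subtype.ext ?_
      exact Submodule.disjoint_def.1 hcompl.disjoint x hx x.2
    · rw [← LinearMap.range_eq_top, LinearMap.range_comp, Submodule.range_subtype, ← hq,
        LinearMap.range_eq_map, ← hcompl.sup_eq_top, Submodule.map_sup]
      have : Submodule.map q (LinearMap.ker q) = ⊥ := by
        rw [eq_bot_iff, Submodule.map_le_iff_le_comap]
        exact fun x hx => hx
      rw [this, bot_sup_eq])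
  have he : ∀ φ x, e.symm (coact ρV φ x) =
      (⟨coact hW.restrict φ (e.symm x), isSubrep_iff.1 hK' φ _ (e.symm x).2⟩ : K') := by
    intro φ x
    rw [LinearEquiv.symm_apply_eq]
    change _ = q (coact hW.restrict φ (e.symm x))
    rw [← hqe]
    congr 1
    exact (e.apply_symm_apply x).symm
  refine ⟨LinearMap.snd ℚ V M ∘ₗ W.subtype ∘ₗ K'.subtype ∘ₗ e.symm.toLinearMap, ?_, ?_⟩
  · intro φ x
    simp only [LinearMap.comp_apply, LinearEquiv.coe_coe, he, Submodule.subtype_apply,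
      LinearMap.snd_apply]
    rw [hW.coact_restrict, coact_prodCoaction]
  · intro v
    simp only [LinearMap.comp_apply, LinearEquiv.coe_coe, Submodule.subtype_apply,
      LinearMap.snd_apply]
    rw [hWP _ (e.symm v : W).2]
    congr 1
    exact e.apply_symm_apply v

end Coactions

/-! ### The grading by Adams degree -/

section Weights

variable {H : Type u} [CommRing H] [HopfAlgebra ℚ H]
variable {M N : Type u} [AddCommGroup M] [Module ℚ M] [AddCommGroup N] [Module ℚ N]
variable {ρ : M →ₗ[ℚ] M ⊗[ℚ] H} {ρ' : N →ₗ[ℚ] N ⊗[ℚ] H}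

/-- The basis of monomials. -/
def laurentBasis : Module.Basis ℤ ℚ ℚ[T;T⁻¹] := .ofRepr (AddMonoidAlgebra.coeffLinearEquiv ℚ)

theorem laurentBasis_apply (n : ℤ) : laurentBasis n = LaurentPolynomial.T n := rfl

theorem laurentBasis_coord_T (r n : ℤ) :
    laurentBasis.coord r (LaurentPolynomial.T n) = if n = r then 1 else 0 :=
  LaurentPolynomial.T_apply r n

/-- The monomials are group-like, so the coordinate functionals are orthogonal idempotents for
convolution. Pulled back along `w` they give the projectors to the weight parts. -/
theorem laurent_convol (r s : ℤ) :
    LinearMap.mul' ℚ ℚ ∘ₗ TensorProduct.map (laurentBasis.coord r) (laurentBasis.coord s) ∘ₗ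
      Coalgebra.comul = if r = s then laurentBasis.coord s else 0 := by
  refine laurentBasis.ext fun n => ?_
  have hc : Coalgebra.comul (R := ℚ) (LaurentPolynomial.T n : ℚ[T;T⁻¹]) =
      LaurentPolynomial.T n ⊗ₜ LaurentPolynomial.T n := by
    simp
  rw [laurentBasis_apply, LinearMap.comp_apply, LinearMap.comp_apply, hc, TensorProduct.map_tmul,
    LinearMap.mul'_apply]
  by_cases h : r = s
  · subst h
    rw [if_pos rfl, laurentBasis_coord_T]
    split_ifs <;> simp
  · rw [if_neg h, laurentBasis_coord_T, laurentBasis_coord_T]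
    split_ifs with h₁ h₂
    · exact absurd (h₁.symm.trans h₂) h
    all_goals simp

variable (w : H →ₐc[ℚ] ℚ[T;T⁻¹])

/-- The functional on `𝒪(G)` which cuts out the part of Adams degree `r`. -/
def adamsFun (r : ℤ) : H →ₗ[ℚ] ℚ := laurentBasis.coord (-r) ∘ₗ (w : H →ₗ[ℚ] ℚ[T;T⁻¹])

theorem convol_adamsFun (r s : ℤ) :
    convol (adamsFun w r) (adamsFun w s) = if r = s then adamsFun w s else 0 := by
  have h : TensorProduct.map (w : H →ₗ[ℚ] ℚ[T;T⁻¹]) (w : H →ₗ[ℚ] ℚ[T;T⁻¹]) ∘ₗ Coalgebra.comul =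
      Coalgebra.comul ∘ₗ (w : H →ₗ[ℚ] ℚ[T;T⁻¹]) := CoalgHomClass.map_comp_comul w
  have h' := laurent_convol (-r) (-s)
  rw [convol, adamsFun, adamsFun, TensorProduct.map_comp, LinearMap.comp_assoc, h,
    ← LinearMap.comp_assoc, ← LinearMap.comp_assoc, LinearMap.comp_assoc Coalgebra.comul, h']
  simp only [neg_inj]
  split_ifs <;> rfl

/-- Centrality is the equality of two contractions of the comultiplication along `w`; contracting
the remaining factor with `φ` gives commutation. Consequently the Adams projectors commute with the
whole representation. -/
theorem IsCentralCochar.convol_comm {w : H →ₐc[ℚ] ℚ[T;T⁻¹]} (hc : IsCentralCochar w) (r : ℤ)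
    (φ : H →ₗ[ℚ] ℚ) : convol (adamsFun w r) φ = convol φ (adamsFun w r) := by
  refine LinearMap.ext fun x => ?_
  have h := congrArg (LinearMap.mul' ℚ ℚ ∘ₗ TensorProduct.map (laurentBasis.coord (-r)) φ) (hc x)
  have e₁ : ∀ t : H ⊗[ℚ] H, (LinearMap.mul' ℚ ℚ ∘ₗ TensorProduct.map (laurentBasis.coord (-r)) φ)
      ((w : H →ₗ[ℚ] ℚ[T;T⁻¹]).rTensor H t) =
      (LinearMap.mul' ℚ ℚ ∘ₗ TensorProduct.map (adamsFun w r) φ) t := by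
    intro t
    induction t using TensorProduct.induction_on with
    | zero => simp
    | tmul x y => simp [adamsFun]
    | add s t hs ht => simp only [map_add, hs, ht]
  have e₂ : ∀ t : H ⊗[ℚ] H, (LinearMap.mul' ℚ ℚ ∘ₗ TensorProduct.map (laurentBasis.coord (-r)) φ)
      (TensorProduct.comm ℚ H ℚ[T;T⁻¹] ((w : H →ₗ[ℚ] ℚ[T;T⁻¹]).lTensor H t)) =
      (LinearMap.mul' ℚ ℚ ∘ₗ TensorProduct.map φ (adamsFun w r)) t := by
    intro t
    induction t using TensorProduct.induction_on with
    | zero => simp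
    | tmul x y => simp [adamsFun, mul_comm]
    | add s t hs ht => simp only [map_add, hs, ht]
  rw [e₁, e₂] at h
  exact h

/-- The projection to the part of Adams degree `r`. -/
def adams (ρ : M →ₗ[ℚ] M ⊗[ℚ] H) (r : ℤ) : M →ₗ[ℚ] M := coact ρ (adamsFun w r)

theorem adams_eq_slice (r : ℤ) (x : M) : adams w ρ r x =
    slice (laurentBasis.coord (-r)) ((w : H →ₗ[ℚ] ℚ[T;T⁻¹]).lTensor M (ρ x)) := by
  rw [slice_lTensor]; rfl

variable {w}

theorem IsCoaction.adams_adams (h : IsCoaction ρ) (r s : ℤ) (x : M) :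
    adams w ρ r (adams w ρ s x) = if r = s then adams w ρ s x else 0 := by
  rw [adams, adams, h.coact_coact, convol_adamsFun]
  split_ifs
  · rfl
  · simp [coact, slice]

/-- If the projector fixes `x`, orthogonality makes every other slice of `ρ x` along `w` vanish,
which leaves `x ⊗ T ^ (-r)`. The sign reflects that the Adams degree is the negative of the weight.
-/
theorem IsCoaction.mem_adamsPart_iff (h : IsCoaction ρ) {r : ℤ} {x : M} :
    x ∈ adamsPart ρ w r ↔ adams w ρ r x = x := by
  rw [adamsPart, weightPart, LinearMap.mem_ker, LinearMap.sub_apply, sub_eq_zero]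
  change (w : H →ₗ[ℚ] ℚ[T;T⁻¹]).lTensor M (ρ x) = x ⊗ₜ LaurentPolynomial.T (-r) ↔ _
  constructor
  · intro hx
    rw [adams_eq_slice, hx, slice_tmul, laurentBasis_coord_T, if_pos rfl, one_smul]
  · intro hx
    refine eq_of_slice_coord laurentBasis fun s => ?_
    have := adams_eq_slice (ρ := ρ) w (-s) x
    rw [neg_neg] at this
    rw [← this, slice_tmul, laurentBasis_coord_T, ← hx, h.adams_adams, hx]
    by_cases hs : -s = r
    · rw [if_pos hs, if_pos (by omega), one_smul]
    · rw [if_neg hs, if_neg (by omega), zero_smul]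

theorem IsCoaction.adams_mem (h : IsCoaction ρ) (r : ℤ) (x : M) :
    adams w ρ r x ∈ adamsPart ρ w r := by
  rw [h.mem_adamsPart_iff, h.adams_adams, if_pos rfl]

theorem IsCoaction.adams_eq_zero (h : IsCoaction ρ) {r s : ℤ} (hrs : r ≠ s) {x : M}
    (hx : x ∈ adamsPart ρ w s) : adams w ρ r x = 0 := by
  rw [← h.mem_adamsPart_iff.1 hx, h.adams_adams, if_neg hrs]

/-- Every vector is the sum of its components of the various Adams degrees. -/
theorem IsCoaction.exists_sum_adams (h : IsCoaction ρ) (x : M) :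
    ∃ S : Finset ℤ, (∀ r ∉ S, adams w ρ r x = 0) ∧ ∑ r ∈ S, adams w ρ r x = x := by
  -- The counit takes the value `1` on every monomial, so it is the sum of all coordinate
  -- functionals, and the sum is finite on each tensor. Allowing every larger index set `S'` makes
  -- the additive step a union.
  have key : ∀ t : M ⊗[ℚ] ℚ[T;T⁻¹], ∃ S : Finset ℤ, ∀ S', S ⊆ S' →
      (∀ r ∉ S, slice (laurentBasis.coord (-r)) t = 0) ∧
      ∑ r ∈ S', slice (laurentBasis.coord (-r)) t = slice Coalgebra.counit t := by
    intro t
    induction t using TensorProduct.induction_on with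
    | zero => exact ⟨∅, by simp⟩
    | add s t hs ht =>
      obtain ⟨S, hS⟩ := hs
      obtain ⟨S', hS'⟩ := ht
      refine ⟨S ∪ S', fun U hU => ⟨fun r hr => ?_, ?_⟩⟩
      · rw [Finset.notMem_union] at hr
        rw [map_add, (hS S subset_rfl).1 r hr.1, (hS' S' subset_rfl).1 r hr.2, add_zero]
      · simp only [map_add, Finset.sum_add_distrib,
          (hS U (Finset.union_subset_left hU)).2, (hS' U (Finset.union_subset_right hU)).2]
    | tmul x p =>
      refine p.induction_on' (motive := fun p => ∃ S : Finset ℤ, ∀ S', S ⊆ S' →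
        (∀ r ∉ S, slice (laurentBasis.coord (-r)) (x ⊗ₜ[ℚ] p) = 0) ∧
        ∑ r ∈ S', slice (laurentBasis.coord (-r)) (x ⊗ₜ[ℚ] p) =
          slice Coalgebra.counit (x ⊗ₜ[ℚ] p)) ?_ ?_
      · rintro p q ⟨S, hS⟩ ⟨S', hS'⟩
        refine ⟨S ∪ S', fun U hU => ⟨fun r hr => ?_, ?_⟩⟩
        · rw [Finset.notMem_union] at hr
          rw [TensorProduct.tmul_add, map_add, (hS S subset_rfl).1 r hr.1,
            (hS' S' subset_rfl).1 r hr.2, add_zero]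
        · simp only [TensorProduct.tmul_add, map_add, Finset.sum_add_distrib,
            (hS U (Finset.union_subset_left hU)).2, (hS' U (Finset.union_subset_right hU)).2]
      · intro n a
        have hc : ∀ r, laurentBasis.coord (-r) (LaurentPolynomial.C a * LaurentPolynomial.T n) =
            if n = -r then a else 0 := by
          intro r
          rw [← LaurentPolynomial.smul_eq_C_mul, map_smul, laurentBasis_coord_T, smul_eq_mul]
          split_ifs <;> simp
        refine ⟨{-n}, fun U hU => ⟨fun r hr => ?_, ?_⟩⟩
        · rw [Finset.mem_singleton] at hr
          rw [slice_tmul, hc, if_neg (by omega), zero_smul]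
        · rw [Finset.sum_eq_single_of_mem (-n) (hU (Finset.mem_singleton_self _))]
          · rw [slice_tmul, slice_tmul, hc, neg_neg, if_pos rfl, LaurentPolynomial.counit_C_mul_T]
            rfl
          · intro r _ hr
            rw [slice_tmul, hc, if_neg (by omega), zero_smul]
  obtain ⟨S, hS⟩ := key ((w : H →ₗ[ℚ] ℚ[T;T⁻¹]).lTensor M (ρ x))
  refine ⟨S, fun r hr => ?_, ?_⟩
  · rw [adams_eq_slice, (hS S subset_rfl).1 r hr]
  · simp only [adams_eq_slice]
    rw [(hS S subset_rfl).2, slice_lTensor]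
    have : Coalgebra.counit ∘ₗ (w : H →ₗ[ℚ] ℚ[T;T⁻¹]) = Coalgebra.counit :=
      CoalgHomClass.counit_comp w
    rw [this]
    exact h.coact_counit x

theorem coact_adams {φ : H →ₗ[ℚ] ℚ} (hc : IsCentralCochar w) (h : IsCoaction ρ) (r : ℤ) (x : M) :
    coact ρ φ (adams w ρ r x) = adams w ρ r (coact ρ φ x) := by
  rw [adams, h.coact_coact, h.coact_coact, hc.convol_comm]

theorem isSubrep_adamsPart (hc : IsCentralCochar w) (h : IsCoaction ρ) (r : ℤ) :
    IsSubrep ρ (adamsPart ρ w r) := by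
  rw [isSubrep_iff]
  intro φ x hx
  rw [h.mem_adamsPart_iff] at *
  rw [← coact_adams hc h, hx]

/-- Equivariant maps preserve the Adams degree. -/
theorem map_mem_adamsPart (h : IsCoaction ρ) (h' : IsCoaction ρ') {f : M →ₗ[ℚ] N}
    (hf : ∀ φ x, coact ρ' φ (f x) = f (coact ρ φ x)) {r : ℤ} {x : M} (hx : x ∈ adamsPart ρ w r) :
    f x ∈ adamsPart ρ' w r := by
  rw [h'.mem_adamsPart_iff]
  rw [h.mem_adamsPart_iff] at hx
  rw [adams, hf]
  exact congrArg f hx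

theorem adams_mem_of_isSubrep {W : Submodule ℚ M} (hW : IsSubrep ρ W) {x : M} (hx : x ∈ W) (r : ℤ) :
    adams w ρ r x ∈ W := isSubrep_iff.1 hW _ x hx

/-- Adams degrees add up under pairings. -/
theorem pairing_mem_adamsPart {P : Type u} [AddCommGroup P] [Module ℚ P]
    {ρ'' : P →ₗ[ℚ] P ⊗[ℚ] H} {b : M →ₗ[ℚ] N →ₗ[ℚ] P} {x : M} {y : N}
    (hb : ρ'' (b x y) = pairH H b (ρ x) (ρ' y)) {r s : ℤ} (hx : x ∈ adamsPart ρ w r)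
    (hy : y ∈ adamsPart ρ' w s) : b x y ∈ adamsPart ρ'' w (r + s) := by
  have key : ∀ (ξ : M ⊗[ℚ] H) (η : N ⊗[ℚ] H),
      (w : H →ₗ[ℚ] ℚ[T;T⁻¹]).lTensor P (pairH H b ξ η) =
      TensorProduct.map₂ b (LinearMap.mul ℚ ℚ[T;T⁻¹])
        ((w : H →ₗ[ℚ] ℚ[T;T⁻¹]).lTensor M ξ) ((w : H →ₗ[ℚ] ℚ[T;T⁻¹]).lTensor N η) := by
    intro ξ η
    induction ξ using TensorProduct.induction_on with
    | zero => simp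
    | add s t hs ht => simp only [map_add, LinearMap.add_apply, hs, ht]
    | tmul x h =>
      induction η using TensorProduct.induction_on with
      | zero => simp
      | add s t hs ht => simp only [map_add, hs, ht]
      | tmul y k =>
        simp only [pairH_tmul, LinearMap.lTensor_tmul, TensorProduct.map₂_apply_tmul]
        congr 1
        exact map_mul w h k
  rw [adamsPart, weightPart, LinearMap.mem_ker, LinearMap.sub_apply, sub_eq_zero] at *
  have hx' : (w : H →ₗ[ℚ] ℚ[T;T⁻¹]).lTensor M (ρ x) = x ⊗ₜ LaurentPolynomial.T (-r) := hx
  have hy' : (w : H →ₗ[ℚ] ℚ[T;T⁻¹]).lTensor N (ρ' y) = y ⊗ₜ LaurentPolynomial.T (-s) := hy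
  change (w : H →ₗ[ℚ] ℚ[T;T⁻¹]).lTensor P (ρ'' (b x y)) =
    b x y ⊗ₜ LaurentPolynomial.T (-(r + s))
  rw [hb, key, hx', hy', TensorProduct.map₂_apply_tmul, neg_add,
    LaurentPolynomial.T_add]
  rfl

end Weights

end

noncomputable section

/-! ### Projections to the graded parts and homogeneous components of maps -/

section Projections

variable {H : Type u} [CommRing H] [HopfAlgebra ℚ H]
variable {M N : Type u} [AddCommGroup M] [Module ℚ M] [AddCommGroup N] [Module ℚ N]
variable (S : GComplex H M) (S' : GComplex H N)

/-- The projection to the part of degree `n`. -/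
def GComplex.proj (n : ℤ) : M →ₗ[ℚ] M := S.glue fun m => if m = n then (S.gr m).subtype else 0

theorem GComplex.proj_same {n : ℤ} {x : M} (hx : x ∈ S.gr n) : S.proj n x = x := by
  rw [GComplex.proj, S.glue_apply _ hx, if_pos rfl]; rfl

theorem GComplex.proj_of_ne {m n : ℤ} (h : m ≠ n) {x : M} (hx : x ∈ S.gr m) : S.proj n x = 0 := by
  rw [GComplex.proj, S.glue_apply _ hx, if_neg h]; rfl

theorem GComplex.proj_mem (n : ℤ) (x : M) : S.proj n x ∈ S.gr n := by
  refine S.induction (p := fun x => S.proj n x ∈ S.gr n) ?_ (by simp) ?_ x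
  · intro m x hx
    by_cases h : m = n
    · subst h
      rwa [S.proj_same hx]
    · rw [S.proj_of_ne h hx]; exact zero_mem _
  · intro x y hx hy
    rw [map_add]; exact add_mem hx hy

variable {S S'} in
theorem GComplex.proj_comm {f : M →ₗ[ℚ] N} {k : ℤ} (hf : ∀ n, ∀ x ∈ S.gr n, f x ∈ S'.gr (n + k))
    (n : ℤ) (x : M) : S'.proj (n + k) (f x) = f (S.proj n x) := by
  refine S.induction (p := fun x => S'.proj (n + k) (f x) = f (S.proj n x)) ?_ (by simp) ?_ x
  · intro m x hx
    by_cases h : m = n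
    · subst h
      rw [S.proj_same hx, S'.proj_same (hf m x hx)]
    · rw [S.proj_of_ne h hx, S'.proj_of_ne (by omega) (hf m x hx), map_zero]
  · intro x y hx hy
    rw [map_add, map_add, map_add, hx, hy, map_add]

theorem GComplex.d_proj (n : ℤ) (x : M) : S.d (S.proj n x) = S.proj (n + 1) (S.d x) :=
  (GComplex.proj_comm (fun _ _ hx => S.d_mem hx) n x).symm

theorem GComplex.coact_mem (φ : H →ₗ[ℚ] ℚ) {n : ℤ} {x : M} (hx : x ∈ S.gr n) :
    coact S.ρ φ x ∈ S.gr n := isSubrep_iff.1 (S.isSubrep n) φ x hx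

theorem GComplex.coact_proj (φ : H →ₗ[ℚ] ℚ) (n : ℤ) (x : M) :
    coact S.ρ φ (S.proj n x) = S.proj n (coact S.ρ φ x) := by
  have := GComplex.proj_comm (S := S) (S' := S) (f := coact S.ρ φ) (k := 0)
    (fun n x hx => by rw [add_zero]; exact S.coact_mem φ hx) n x
  rw [add_zero] at this
  exact this.symm

theorem GComplex.coact_d (φ : H →ₗ[ℚ] ℚ) (x : M) : coact S.ρ φ (S.d x) = S.d (coact S.ρ φ x) :=
  equivariant_iff.1 S.ρ_d φ x

theorem GComplex.exists_sum_proj (x : M) :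
    ∃ U : Finset ℤ, ∀ U', U ⊆ U' → ∑ n ∈ U', S.proj n x = x := by
  refine S.induction (p := fun x => ∃ U : Finset ℤ, ∀ U', U ⊆ U' → ∑ n ∈ U', S.proj n x = x)
    ?_ ⟨∅, by simp⟩ ?_ x
  · intro m x hx
    refine ⟨{m}, fun U hU => ?_⟩
    rw [Finset.sum_eq_single_of_mem m (hU (Finset.mem_singleton_self m)), S.proj_same hx]
    exact fun n _ hn => S.proj_of_ne (Ne.symm hn) hx
  · rintro x y ⟨U, hU⟩ ⟨V, hV⟩
    refine ⟨U ∪ V, fun W hW => ?_⟩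
    simp only [map_add, Finset.sum_add_distrib, hU W (Finset.union_subset_left hW),
      hV W (Finset.union_subset_right hW)]

theorem GComplex.ext_proj {x y : M} (h : ∀ n, S.proj n x = S.proj n y) : x = y := by
  obtain ⟨U, hU⟩ := S.exists_sum_proj x
  obtain ⟨V, hV⟩ := S.exists_sum_proj y
  rw [← hU (U ∪ V) Finset.subset_union_left, ← hV (U ∪ V) Finset.subset_union_right]
  exact Finset.sum_congr rfl fun n _ => h n

/-- The component of degree `k` of a linear map. -/
def GComplex.homPart (k : ℤ) (f : M →ₗ[ℚ] N) : M →ₗ[ℚ] N :=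
  S.glue fun n => S'.proj (n + k) ∘ₗ f ∘ₗ (S.gr n).subtype

theorem GComplex.homPart_apply (k : ℤ) (f : M →ₗ[ℚ] N) {n : ℤ} {x : M} (hx : x ∈ S.gr n) :
    S.homPart S' k f x = S'.proj (n + k) (f x) := by
  rw [GComplex.homPart, S.glue_apply _ hx]; rfl

theorem GComplex.homPart_mem (k : ℤ) (f : M →ₗ[ℚ] N) {n : ℤ} {x : M} (hx : x ∈ S.gr n) :
    S.homPart S' k f x ∈ S'.gr (n + k) := by
  rw [S.homPart_apply S' k f hx]
  exact S'.proj_mem _ _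

theorem GComplex.coact_homPart {k : ℤ} {f : M →ₗ[ℚ] N} (φ : H →ₗ[ℚ] ℚ)
    (hf : ∀ x, coact S'.ρ φ (f x) = f (coact S.ρ φ x)) (x : M) :
    coact S'.ρ φ (S.homPart S' k f x) = S.homPart S' k f (coact S.ρ φ x) := by
  refine S.induction (p := fun x => coact S'.ρ φ (S.homPart S' k f x) =
    S.homPart S' k f (coact S.ρ φ x)) ?_ (by simp) ?_ x
  · intro n x hx
    rw [S.homPart_apply S' k f hx, S.homPart_apply S' k f (S.coact_mem φ hx), S'.coact_proj, hf]
  · intro x y hx hy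
    simp only [map_add, hx, hy]

theorem isInternal_of_proj {gr : ℤ → Submodule ℚ M} (p : ℤ → M →ₗ[ℚ] M)
    (h₁ : ∀ x, x ∈ iSup gr) (h₂ : ∀ n, ∀ x ∈ gr n, ∀ m, p m x = if n = m then x else 0) :
    DirectSum.IsInternal gr := by
  have key : ∀ (z : DirectSum ℤ fun n => gr n) (n : ℤ),
      p n (DirectSum.coeLinearMap gr z) = (z n : M) := by
    intro z n
    induction z using DirectSum.induction_on with
    | zero => simp
    | of i x =>
      have e : DirectSum.coeLinearMap gr (DirectSum.of (fun n => gr n) i x) = x :=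
        DirectSum.coeLinearMap_of gr i x
      rw [e, h₂ i x x.2]
      by_cases h : i = n
      · subst h; simp
      · rw [if_neg h, DirectSum.of_eq_of_ne _ _ _ (Ne.symm h)]; rfl
    | add x y hx hy => simp [hx, hy]
  constructor
  · intro z z' h
    refine DFinsupp.ext fun n => Subtype.ext ?_
    have h' : DirectSum.coeLinearMap gr z = DirectSum.coeLinearMap gr z' := h
    exact (key z n).symm.trans (by rw [h', key])
  · intro x
    have hx : x ∈ LinearMap.range (DirectSum.coeLinearMap gr) := by
      rw [DirectSum.range_coeLinearMap]
      exact h₁ x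
    exact hx

end Projections

variable {H : Type u} [CommRing H] [HopfAlgebra ℚ H] {A : CDGA H}

/-! ### Graded linear maps, homotopies and dg submodules -/

namespace DGMod

variable {M N P : DGMod A}

theorem coact_smul_tmul_one {φ : H →ₗ[ℚ] ℚ} (a : A) (x : M) (hx : M.str.ρ x = x ⊗ₜ 1) :
    coact M.str.ρ φ (a • x) = coact A.str.ρ φ a • x := by
  rw [coact_apply, M.ρ_smul, hx, pairH_one_right, slice_rTensor]
  rfl

theorem Hom.coact (f : M ⟶ N) (φ : H →ₗ[ℚ] ℚ) (x : M) :
    coact N.str.ρ φ (f.toLin x) = f.toLin (_root_.coact M.str.ρ φ x) :=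
  equivariant_iff (f := f.toLin.restrictScalars ℚ).1 f.ρ φ x

/-- The constructor of morphisms in terms of the action of functionals on `𝒪(G)`. -/
def Hom.ofCoact (f : M →ₗ[A] N) (mem : ∀ n, ∀ x ∈ M.str.gr n, f x ∈ N.str.gr n)
    (d : ∀ x, f (M.str.d x) = N.str.d (f x))
    (hc : ∀ φ x, _root_.coact N.str.ρ φ (f x) = f (_root_.coact M.str.ρ φ x)) : M ⟶ N where
  toLin := f
  mem hx := mem _ _ hx
  d := d
  ρ := equivariant_iff (f := f.restrictScalars ℚ).2 hc

@[simp] theorem Hom.ofCoact_apply (f : M →ₗ[A] N) (mem : ∀ n, ∀ x ∈ M.str.gr n, f x ∈ N.str.gr n)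
    (d : ∀ x, f (M.str.d x) = N.str.d (f x))
    (hc : ∀ φ x, _root_.coact N.str.ρ φ (f x) = f (_root_.coact M.str.ρ φ x)) (x : M) :
    (Hom.ofCoact f mem d hc).toLin x = f x := rfl

/-- Equivariant maps of degree `k` which are linear over `A` in the graded sense. -/
structure IsGLin (k : ℤ) (h : M →ₗ[ℚ] N) : Prop where
  mem : ∀ n, ∀ x ∈ M.str.gr n, h x ∈ N.str.gr (n + k)
  smul : ∀ (p : ℤ) (a : A) (x : M), a ∈ A.str.gr p → h (a • x) = (-1 : ℚ) ^ (p * k) • a • h x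
  coact : ∀ φ x, coact N.str.ρ φ (h x) = h (_root_.coact M.str.ρ φ x)

namespace IsGLin

variable {k l : ℤ} {h h' : M →ₗ[ℚ] N}

theorem zero : IsGLin k (0 : M →ₗ[ℚ] N) :=
  ⟨fun _ _ _ => zero_mem _, fun p a x _ => by simp, fun φ x => by simp⟩

theorem add (hh : IsGLin k h) (hh' : IsGLin k h') : IsGLin k (h + h') :=
  ⟨fun n x hx => add_mem (hh.mem n x hx) (hh'.mem n x hx),
    fun p a x ha => by simp [hh.smul p a x ha, hh'.smul p a x ha],
    fun φ x => by simp [hh.coact, hh'.coact]⟩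

theorem const_smul (hh : IsGLin k h) (c : ℚ) : IsGLin k (c • h) :=
  ⟨fun n x hx => Submodule.smul_mem _ c (hh.mem n x hx),
    fun p a x ha => by
      simp only [LinearMap.smul_apply, hh.smul p a x ha]
      rw [smul_comm c, smul_comm c],
    fun φ x => by simp [hh.coact]⟩

theorem neg (hh : IsGLin k h) : IsGLin k (-h) := by
  have := hh.const_smul (-1)
  rwa [neg_one_smul] at this

theorem sub (hh : IsGLin k h) (hh' : IsGLin k h') : IsGLin k (h - h') := by
  rw [sub_eq_add_neg]; exact hh.add hh'.neg

theorem comp {g : N →ₗ[ℚ] P} (hg : IsGLin l g) (hh : IsGLin k h) : IsGLin (k + l) (g ∘ₗ h) :=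
  ⟨fun n x hx => by rw [← add_assoc]; exact hg.mem _ _ (hh.mem n x hx),
    fun p a x ha => by
      simp only [LinearMap.comp_apply, hh.smul p a x ha, map_smul, hg.smul p a _ ha, smul_smul,
        mul_add, negOne_add],
    fun φ x => by simp only [LinearMap.comp_apply, hg.coact, hh.coact]⟩

theorem smul' (hh : IsGLin 0 h) (a : A) (x : M) : h (a • x) = a • h x := by
  refine A.str.induction (p := fun a => h (a • x) = a • h x) ?_ (by simp) ?_ a
  · intro p a ha
    rw [hh.smul p a x ha, mul_zero, zpow_zero, one_smul]
  · intro a b ha hb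
    rw [add_smul, map_add, ha, hb, add_smul]

/-- The differential in the complex of graded linear maps. -/
theorem d_comm (hh : IsGLin k h) :
    IsGLin (k + 1) (N.str.d ∘ₗ h - (-1 : ℚ) ^ k • (h ∘ₗ M.str.d)) :=
  ⟨fun n x hx => sub_mem (by rw [← add_assoc]; exact N.str.d_mem (hh.mem n x hx))
      (Submodule.smul_mem _ _ (by
        have := hh.mem _ _ (M.str.d_mem hx)
        rwa [add_assoc, add_comm 1 k] at this)),
    fun p a x ha => by
      simp only [LinearMap.sub_apply, LinearMap.comp_apply, LinearMap.smul_apply, hh.smul p a x ha,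
        map_smul, N.leibniz _ ha, M.leibniz _ ha, map_add, hh.smul _ _ _ (A.str.d_mem ha),
        hh.smul _ _ _ ha, smul_add, smul_sub, smul_smul, add_mul, one_mul, mul_add, mul_one,
        negOne_add, smul_comm a]
      rw [show (-1 : ℚ) ^ k * ((-1 : ℚ) ^ (p * k) * (-1 : ℚ) ^ k) = (-1 : ℚ) ^ (p * k) by
        linear_combination (-1 : ℚ) ^ (p * k) * negOne_sq k]
      rw [show (-1 : ℚ) ^ k * ((-1 : ℚ) ^ p * (-1 : ℚ) ^ (p * k)) =
        (-1 : ℚ) ^ (p * k) * (-1 : ℚ) ^ p * (-1 : ℚ) ^ k by ring]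
      abel,
    fun φ x => by
      simp only [LinearMap.sub_apply, LinearMap.comp_apply, LinearMap.smul_apply, map_sub,
        map_smul, N.str.coact_d, M.str.coact_d, hh.coact]⟩

end IsGLin

theorem Hom.isGLin (f : M ⟶ N) : IsGLin 0 (f.toLin.restrictScalars ℚ) :=
  ⟨fun n x hx => by rw [add_zero]; exact f.mem hx,
    fun p a x _ => by simp, fun φ x => Hom.coact f φ x⟩

/-- The morphism given by a graded linear map of degree zero which commutes with `d`. -/
def IsGLin.hom {h : M →ₗ[ℚ] N} (hh : IsGLin 0 h) (hd : ∀ x, h (M.str.d x) = N.str.d (h x)) :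
    M ⟶ N where
  toLin := { h with map_smul' := hh.smul' }
  mem hx := by
    have := hh.mem _ _ hx
    rwa [add_zero] at this
  d := hd
  ρ := equivariant_iff.2 hh.coact

@[simp] theorem IsGLin.hom_apply {h : M →ₗ[ℚ] N} (hh : IsGLin 0 h)
    (hd : ∀ x, h (M.str.d x) = N.str.d (h x)) (x : M) : (hh.hom hd).toLin x = h x := rfl

instance : Add (M ⟶ N) where
  add f g := (f.isGLin.add g.isGLin).hom fun x => by simp [f.d, g.d]

instance : Zero (M ⟶ N) where
  zero := IsGLin.zero.hom fun x => by simp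

instance : Neg (M ⟶ N) where
  neg f := f.isGLin.neg.hom fun x => by simp [f.d]

instance : AddCommGroup (M ⟶ N) where
  nsmul := nsmulRec
  zsmul := zsmulRec
  add_assoc f g h := hom_ext fun x => add_assoc (f.toLin x) (g.toLin x) (h.toLin x)
  zero_add f := hom_ext fun x => zero_add (f.toLin x)
  add_zero f := hom_ext fun x => add_zero (f.toLin x)
  neg_add_cancel f := hom_ext fun x => neg_add_cancel (f.toLin x)
  add_comm f g := hom_ext fun x => add_comm (f.toLin x) (g.toLin x)

@[simp] theorem add_apply (f g : M ⟶ N) (x : M) : (f + g).toLin x = f.toLin x + g.toLin x := rfl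

@[simp] theorem zero_apply (x : M) : Hom.toLin (0 : M ⟶ N) x = 0 := rfl

@[simp] theorem neg_apply (f : M ⟶ N) (x : M) : Hom.toLin (-f) x = -f.toLin x := rfl

instance : Preadditive (DGMod A) where
  homGroup _ _ := inferInstance
  add_comp _ _ _ f g h := hom_ext fun x => by simp
  comp_add _ _ _ f g h := hom_ext fun x => by simp

/-- A homotopy is a graded linear map of degree `-1`, since `(-1) ^ (p * -1) = (-1) ^ p`. In this
form homotopies can be added, composed, and built by the same extension from generators as
morphisms. -/
theorem homotopic_iff {f g : M ⟶ N} : Homotopic f g ↔ ∃ h : M →ₗ[ℚ] N, IsGLin (-1) h ∧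
    ∀ x, f.toLin x - g.toLin x = N.str.d (h x) + h (M.str.d x) := by
  have e : ∀ p : ℤ, (-1 : ℚ) ^ (p * -1) = (-1 : ℚ) ^ p := fun p => by
    rw [mul_neg_one, zpow_neg, ← inv_zpow]; norm_num
  constructor
  · rintro ⟨h, h₁, h₂, h₃, h₄⟩
    exact ⟨h, ⟨fun n x hx => h₁ n x hx, fun p a x ha => by rw [e]; exact h₂ p a x ha,
      equivariant_iff.1 h₃⟩, h₄⟩
  · rintro ⟨h, hh, h₄⟩
    exact ⟨h, fun n x hx => hh.mem n x hx, fun p a x ha => by rw [← e]; exact hh.smul p a x ha,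
      equivariant_iff.2 hh.coact, h₄⟩

theorem Homotopic.refl (f : M ⟶ N) : Homotopic f f :=
  homotopic_iff.2 ⟨0, IsGLin.zero, fun x => by simp⟩

theorem Homotopic.symm {f g : M ⟶ N} (h : Homotopic f g) : Homotopic g f := by
  obtain ⟨h, hh, e⟩ := homotopic_iff.1 h
  refine homotopic_iff.2 ⟨-h, hh.neg, fun x => ?_⟩
  rw [← neg_sub, e]
  simp [add_comm]

theorem Homotopic.add {f g f' g' : M ⟶ N} (h : Homotopic f g) (h' : Homotopic f' g') :
    Homotopic (f + f') (g + g') := by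
  obtain ⟨h, hh, e⟩ := homotopic_iff.1 h
  obtain ⟨h', hh', e'⟩ := homotopic_iff.1 h'
  refine homotopic_iff.2 ⟨h + h', hh.add hh', fun x => ?_⟩
  rw [add_apply, add_apply, add_sub_add_comm, e, e']
  simp only [LinearMap.add_apply, map_add]
  abel

theorem Homotopic.neg {f g : M ⟶ N} (h : Homotopic f g) : Homotopic (-f) (-g) := by
  obtain ⟨h, hh, e⟩ := homotopic_iff.1 h.symm
  refine homotopic_iff.2 ⟨h, hh, fun x => ?_⟩
  rw [← e, neg_apply, neg_apply]
  abel

theorem Homotopic.sub {f g f' g' : M ⟶ N} (h : Homotopic f g) (h' : Homotopic f' g') :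
    Homotopic (f - f') (g - g') := by
  rw [sub_eq_add_neg, sub_eq_add_neg]
  exact h.add h'.neg

theorem Homotopic.trans {f g k : M ⟶ N} (h : Homotopic f g) (h' : Homotopic g k) :
    Homotopic f k := by
  have := (h.add h').sub (Homotopic.refl g)
  rwa [add_sub_cancel_right, add_sub_cancel_left] at this

theorem Homotopic.comp_left (f : M ⟶ N) {g g' : N ⟶ P} (h : Homotopic g g') :
    Homotopic (f ≫ g) (f ≫ g') := by
  obtain ⟨h, hh, e⟩ := homotopic_iff.1 h
  refine homotopic_iff.2 ⟨h ∘ₗ f.toLin.restrictScalars ℚ, ?_, fun x => ?_⟩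
  · have := hh.comp f.isGLin
    rwa [zero_add] at this
  · simp [e, f.d]

theorem Homotopic.comp_right {f f' : M ⟶ N} (h : Homotopic f f') (g : N ⟶ P) :
    Homotopic (f ≫ g) (f' ≫ g) := by
  obtain ⟨h, hh, e⟩ := homotopic_iff.1 h
  refine homotopic_iff.2 ⟨g.toLin.restrictScalars ℚ ∘ₗ h, ?_, fun x => ?_⟩
  · exact g.isGLin.comp hh
  · rw [comp_apply, comp_apply, ← map_sub, e]
    simp [g.d]

/-- Homotopy is already an equivalence relation stable under composition, so equality in the
quotient category is homotopy itself and not the relation that it generates. -/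
instance : Congruence (homotopyRel A) where
  equivalence := ⟨Homotopic.refl, Homotopic.symm, Homotopic.trans⟩
  comp_left f _ _ h := Homotopic.comp_left f h
  comp_right g h := Homotopic.comp_right h g

/-- Morphisms out of the unit are invariant cocycles of degree zero. -/
def ofCycle (z : M) (hz : z ∈ M.str.gr 0) (hd : M.str.d z = 0) (hρ : M.str.ρ z = z ⊗ₜ 1) :
    unit A ⟶ M :=
  Hom.ofCoact (LinearMap.toSpanSingleton A M z : A →ₗ[A] M)
    (fun n a ha => by
      have := M.smul_mem (a := a) (p := n) ha hz
      rwa [add_zero] at this)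
    (fun a => by
      refine A.str.induction (p := fun a => A.str.d a • z = M.str.d (a • z)) ?_ (by simp) ?_ a
      · intro p a ha
        rw [M.leibniz z ha, hd, smul_zero, smul_zero, add_zero]
      · intro a b ha hb
        rw [map_add, add_smul, add_smul, map_add, ha, hb])
    fun _ a => coact_smul_tmul_one (M := M) a z hρ

theorem ofCycle_ofA (z : M) (hz : z ∈ M.str.gr 0) (hd : M.str.d z = 0)
    (hρ : M.str.ρ z = z ⊗ₜ 1) (a : A) : (ofCycle z hz hd hρ).toLin (ofA a) = a • z := rfl

theorem unit_hom_ext {f g : unit A ⟶ M} (h : f.toLin (ofA 1) = g.toLin (ofA 1)) : f = g :=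
  hom_ext fun a => by
    obtain ⟨a, rfl⟩ := ofA_surjective a
    rw [show ofA a = a • ofA (1 : A) by rw [smul_ofA, mul_one], map_smul, map_smul, h]

variable (A) in
/-- The zero dg module. -/
def zeroMod : DGMod A where
  carrier := PUnit
  str :=
    { gr := fun _ => ⊤
      isInternal := isInternal_of_proj 0 (fun x => Submodule.mem_iSup_of_mem 0 trivial)
        fun _ _ _ _ => Subsingleton.elim _ _
      d := 0
      d_mem := fun _ => trivial
      d_d := fun _ => rfl
      ρ := 0
      isCoaction := isCoaction_iff.2
        ⟨fun _ => Subsingleton.elim _ _, fun _ _ _ => Subsingleton.elim _ _⟩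
      isSubrep := fun _ => isSubrep_iff.2 fun _ _ _ => trivial
      ρ_d := fun _ => by simp }
  smul_mem _ _ := trivial
  leibniz _ _ := Subsingleton.elim _ _
  ρ_smul _ _ := by simp

/-- A dg submodule. -/
structure IsDGSub (M : DGMod A) (W : Submodule A M) : Prop where
  proj : ∀ n, ∀ x ∈ W, M.str.proj n x ∈ W
  d : ∀ x ∈ W, M.str.d x ∈ W
  isSubrep : IsSubrep M.str.ρ (W.restrictScalars ℚ)

/-- The dg module underlying a dg submodule. -/
def subMod (M : DGMod A) (W : Submodule A M) (hW : IsDGSub M W) : DGMod A where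
  carrier := W.restrictScalars ℚ
  str :=
    { gr := fun n => (M.str.gr n).comap (W.restrictScalars ℚ).subtype
      isInternal := isInternal_of_proj
        (fun n => (M.str.proj n).restrict (p := W.restrictScalars ℚ) (q := W.restrictScalars ℚ)
          fun x hx => hW.proj n x hx)
        (fun x => by
          obtain ⟨U, hU⟩ := M.str.exists_sum_proj x
          have : x = ∑ n ∈ U, (⟨M.str.proj n x, hW.proj n x x.2⟩ : W.restrictScalars ℚ) :=
            Subtype.ext (by rw [AddSubmonoidClass.coe_finsetSum, hU U subset_rfl])
          rw [this]
          exact Submodule.sum_mem _ fun n _ => Submodule.mem_iSup_of_mem n (M.str.proj_mem n x))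
        (fun n x hx m => Subtype.ext (by
          split_ifs with h
          · subst h; exact M.str.proj_same hx
          · exact M.str.proj_of_ne h hx))
      d := M.str.d.restrict (p := W.restrictScalars ℚ) (q := W.restrictScalars ℚ)
        fun x hx => hW.d x hx
      d_mem := fun hx => M.str.d_mem hx
      d_d := fun x => Subtype.ext (M.str.d_d x)
      ρ := hW.isSubrep.restrict
      isCoaction := hW.isSubrep.isCoaction_restrict M.str.isCoaction
      isSubrep := fun n => isSubrep_iff.2 fun φ x hx => by
        rw [Submodule.mem_comap, Submodule.subtype_apply, hW.isSubrep.coact_restrict]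
        exact M.str.coact_mem φ hx
      ρ_d := equivariant_iff.2 fun φ x => Subtype.ext (by
        rw [hW.isSubrep.coact_restrict]
        change coact M.str.ρ φ (M.str.d x) = M.str.d (coact hW.isSubrep.restrict φ x)
        rw [hW.isSubrep.coact_restrict, M.str.coact_d]) }
  smul_mem ha hx := M.smul_mem ha hx
  leibniz x ha := Subtype.ext (M.leibniz (x : M) ha)
  ρ_smul a x := by
    apply Module.Flat.rTensor_preserves_injective_linearMap (M := H) _
      (W.restrictScalars ℚ).injective_subtype
    rw [hW.isSubrep.rTensor_restrict, pairH_map (b' := (Algebra.lsmul ℚ ℚ M).toLinearMap)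
      (f := LinearMap.id) (g := (W.restrictScalars ℚ).subtype) (fun a x => rfl),
      hW.isSubrep.rTensor_restrict]
    rw [LinearMap.rTensor_id, LinearMap.id_apply]
    exact M.ρ_smul a x

/-- The inclusion of a dg submodule. -/
def subι (M : DGMod A) (W : Submodule A M) (hW : IsDGSub M W) : subMod M W hW ⟶ M where
  toLin := W.subtype
  mem hx := hx
  d _ := rfl
  ρ x := (hW.isSubrep.rTensor_restrict x).symm

theorem subι_mem {W : Submodule A M} (hW : IsDGSub M W) (x : subMod M W hW) :
    (subι M W hW).toLin x ∈ W := x.2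

theorem subι_injective {W : Submodule A M} (hW : IsDGSub M W) :
    Function.Injective (subι M W hW).toLin := Subtype.val_injective

/-- A morphism with values in a dg submodule. -/
def subLift {W : Submodule A M} (hW : IsDGSub M W) (f : N ⟶ M) (hf : ∀ x, f.toLin x ∈ W) :
    N ⟶ subMod M W hW :=
  Hom.ofCoact (f.toLin.codRestrict W hf) (fun _ _ hx => f.mem hx) (fun x => Subtype.ext (f.d x))
    fun φ x => Subtype.ext (by
      refine (hW.isSubrep.coact_restrict φ _).trans ?_
      exact Hom.coact f φ x)

end DGMod

end

noncomputable section

/-! ### Graded subrepresentations and modules free on them -/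

section GradedSub

variable {H : Type u} [CommRing H] [HopfAlgebra ℚ H]
variable {M N : Type u} [AddCommGroup M] [Module ℚ M] [AddCommGroup N] [Module ℚ N]
variable (S : GComplex H M) (S' : GComplex H N)

/-- A graded subrepresentation. -/
structure GComplex.IsGraded (W : Submodule ℚ M) : Prop where
  isSubrep : IsSubrep S.ρ W
  proj : ∀ n, ∀ x ∈ W, S.proj n x ∈ W

variable {S}

theorem GComplex.IsGraded.induction {W : Submodule ℚ M} (hW : S.IsGraded W) {p : M → Prop}
    (hom : ∀ n, ∀ x ∈ W, x ∈ S.gr n → p x) (zero : p 0) (add : ∀ x y, p x → p y → p (x + y))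
    {x : M} (hx : x ∈ W) : p x := by
  classical
  obtain ⟨U, hU⟩ := S.exists_sum_proj x
  rw [← hU U subset_rfl]
  exact Finset.sum_induction _ p add zero fun n _ => hom n _ (hW.proj n x hx) (S.proj_mem n x)

theorem GComplex.IsGraded.sup {V W : Submodule ℚ M} (hV : S.IsGraded V) (hW : S.IsGraded W) :
    S.IsGraded (V ⊔ W) :=
  ⟨hV.isSubrep.sup hW.isSubrep, fun n x hx => by
    obtain ⟨y, hy, z, hz, rfl⟩ := Submodule.mem_sup.1 hx
    rw [map_add]
    exact Submodule.add_mem_sup (hV.proj n y hy) (hW.proj n z hz)⟩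

theorem GComplex.IsGraded.iSup {ι : Sort*} {V : ι → Submodule ℚ M} (hV : ∀ i, S.IsGraded (V i)) :
    S.IsGraded (⨆ i, V i) :=
  ⟨.iSup fun i => (hV i).isSubrep, fun n x hx => by
    refine Submodule.iSup_induction V (motive := fun x => S.proj n x ∈ ⨆ i, V i) hx ?_ (by simp) ?_
    · exact fun i x hx => Submodule.mem_iSup_of_mem i ((hV i).proj n x hx)
    · intro x y hx hy
      rw [map_add]
      exact add_mem hx hy⟩

theorem GComplex.isGraded_bot : S.IsGraded ⊥ :=
  ⟨isSubrep_bot, fun n x hx => by rw [(Submodule.mem_bot ℚ).1 hx, map_zero]; exact zero_mem _⟩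

theorem GComplex.isGraded_of_le {W : Submodule ℚ M} (h : IsSubrep S.ρ W) {m : ℤ}
    (hm : W ≤ S.gr m) : S.IsGraded W :=
  ⟨h, fun n x hx => by
    by_cases e : m = n
    · subst e; rwa [S.proj_same (hm hx)]
    · rw [S.proj_of_ne e (hm hx)]; exact zero_mem _⟩

/-- The graded representation given by a graded subrepresentation, with zero differential. -/
def GComplex.IsGraded.str {W : Submodule ℚ M} (hW : S.IsGraded W) : GComplex H W where
  gr n := (S.gr n).comap W.subtype
  isInternal := isInternal_of_proj
    (fun n => (S.proj n).restrict (p := W) (q := W) fun x hx => hW.proj n x hx)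
    (fun x => by
      obtain ⟨U, hU⟩ := S.exists_sum_proj x
      have : x = ∑ n ∈ U, (⟨S.proj n x, hW.proj n x x.2⟩ : W) :=
        Subtype.ext (by rw [AddSubmonoidClass.coe_finsetSum, hU U subset_rfl])
      rw [this]
      exact Submodule.sum_mem _ fun n _ => Submodule.mem_iSup_of_mem n (S.proj_mem n x))
    (fun n x hx m => Subtype.ext (by
      split_ifs with h
      · subst h; exact S.proj_same hx
      · exact S.proj_of_ne h hx))
  d := 0
  d_mem _ := zero_mem _
  d_d _ := rfl
  ρ := hW.isSubrep.restrict
  isCoaction := hW.isSubrep.isCoaction_restrict S.isCoaction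
  isSubrep n := isSubrep_iff.2 fun φ x hx => by
    rw [Submodule.mem_comap, Submodule.subtype_apply, hW.isSubrep.coact_restrict]
    exact S.coact_mem φ hx
  ρ_d x := by simp

end GradedSub

variable {H : Type u} [CommRing H] [HopfAlgebra ℚ H] {A : CDGA H}

/-- The operator `a ↦ (-1) ^ (k |a|) a`. -/
def CDGA.twist (A : CDGA H) (k : ℤ) : A →ₗ[ℚ] A :=
  A.str.glue fun p => (-1 : ℚ) ^ (p * k) • (A.str.gr p).subtype

theorem CDGA.twist_apply {p : ℤ} {a : A} (ha : a ∈ A.str.gr p) (k : ℤ) :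
    A.twist k a = (-1 : ℚ) ^ (p * k) • a := by
  rw [CDGA.twist, A.str.glue_apply _ ha]; rfl

theorem CDGA.twist_mul (k : ℤ) (a b : A) : A.twist k (a * b) = A.twist k a * A.twist k b := by
  refine A.str.induction (p := fun a => A.twist k (a * b) = A.twist k a * A.twist k b) ?_
    (by simp) ?_ a
  · intro p a ha
    refine A.str.induction (p := fun b => A.twist k (a * b) = A.twist k a * A.twist k b) ?_
      (by simp) ?_ b
    · intro q b hb
      rw [A.twist_apply ha, A.twist_apply hb, A.twist_apply (A.mul_mem ha hb), smul_mul_smul_comm,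
        add_mul, negOne_add]
    · intro b b' h h'
      rw [mul_add, map_add, map_add, h, h', mul_add]
  · intro a a' h h'
    rw [add_mul, map_add, map_add, h, h', add_mul]

theorem CDGA.twist_one (k : ℤ) : A.twist k 1 = 1 := by
  rw [A.twist_apply A.one_mem, zero_mul, zpow_zero, one_smul]

theorem CDGA.twist_mem {p : ℤ} {a : A} (ha : a ∈ A.str.gr p) (k : ℤ) :
    A.twist k a ∈ A.str.gr p := by
  rw [A.twist_apply ha]
  exact Submodule.smul_mem _ _ ha

theorem CDGA.twist_zero (a : A) : A.twist 0 a = a := by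
  refine A.str.induction (p := fun a => A.twist 0 a = a) ?_ (by simp) ?_ a
  · intro p a ha
    rw [A.twist_apply ha, mul_zero, zpow_zero, one_smul]
  · intro a b h h'
    rw [map_add, h, h']

theorem CDGA.coact_twist (φ : H →ₗ[ℚ] ℚ) (k : ℤ) (a : A) :
    coact A.str.ρ φ (A.twist k a) = A.twist k (coact A.str.ρ φ a) := by
  refine A.str.induction (p := fun a => coact A.str.ρ φ (A.twist k a) =
    A.twist k (coact A.str.ρ φ a)) ?_ (by simp) ?_ a
  · intro p a ha
    rw [A.twist_apply ha, A.twist_apply (A.str.coact_mem φ ha), map_smul]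
  · intro a b h h'
    simp only [map_add, h, h']

namespace DGMod

variable {M N N' : DGMod A}

section LiftA

variable {X Y : Type u} [AddCommGroup X] [Module ℚ X] [AddCommGroup Y] [Module ℚ Y]

/-- The map `a ⊗ x ↦ a g (x)`. -/
def liftA (g : X →ₗ[ℚ] M) : A ⊗[ℚ] X →ₗ[ℚ] M :=
  TensorProduct.lift ((Algebra.lsmul ℚ ℚ M).toLinearMap.compl₂ g)

@[simp] theorem liftA_tmul (g : X →ₗ[ℚ] M) (a : A) (x : X) : liftA g (a ⊗ₜ x) = a • g x := rfl

theorem liftA_smul (g : X →ₗ[ℚ] M) (a : A) (t : A ⊗[ℚ] X) : liftA g (a • t) = a • liftA g t := by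
  induction t using TensorProduct.induction_on with
  | zero => simp
  | tmul b x => simp [TensorProduct.smul_tmul', mul_smul]
  | add s t hs ht => simp only [smul_add, map_add, hs, ht]

theorem liftA_comp (g : X →ₗ[ℚ] M) (f : Y →ₗ[ℚ] X) (t : A ⊗[ℚ] Y) :
    liftA (g ∘ₗ f) t = liftA g (f.lTensor A t) := by
  induction t using TensorProduct.induction_on with
  | zero => simp
  | tmul b x => simp
  | add s t hs ht => simp only [map_add, hs, ht]

end LiftA

/-- As a graded module over `A` in representations of `G`, the dg module `M` is free on the
finite-dimensional graded subrepresentation `V`. -/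
structure IsFreeOn (M : DGMod A) (V : Submodule ℚ M) : Prop where
  finite : FiniteDimensional ℚ V
  graded : M.str.IsGraded V
  bijective : Function.Bijective (liftA (A := A) V.subtype)

namespace IsFreeOn

variable {V : Submodule ℚ M} (hV : IsFreeOn M V)
include hV

theorem induction {p : M → Prop} (hom : ∀ i j, ∀ a ∈ A.str.gr i, ∀ v ∈ V, v ∈ M.str.gr j →
    p (a • v)) (zero : p 0) (add : ∀ x y, p x → p y → p (x + y)) (x : M) : p x := by
  obtain ⟨t, rfl⟩ := hV.bijective.2 x
  induction t using TensorProduct.induction_on with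
  | zero => rwa [map_zero]
  | add s t hs ht => rw [map_add]; exact add _ _ hs ht
  | tmul a v =>
    rw [liftA_tmul]
    refine A.str.induction (p := fun a => p (a • (v : M))) ?_ (by simpa using zero) ?_ a
    · intro i a ha
      refine hV.graded.induction (p := fun v => p (a • v)) ?_ (by simpa using zero) ?_ v.2
      · exact fun j v hv hj => hom i j a ha v hv hj
      · intro x y hx hy
        rw [smul_add]; exact add _ _ hx hy
    · intro a b ha hb
      rw [add_smul]; exact add _ _ ha hb

/-- The extension of a map on the generators to a map of degree `k`, linear in the graded sense. -/
def extend (k : ℤ) (g : V →ₗ[ℚ] N) : M →ₗ[ℚ] N :=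
  liftA g ∘ₗ (A.twist k).rTensor V ∘ₗ (LinearEquiv.ofBijective _ hV.bijective).symm.toLinearMap

theorem extend_smul (k : ℤ) (g : V →ₗ[ℚ] N) (a : A) (v : V) :
    hV.extend k g (a • (v : M)) = A.twist k a • g v := by
  have : (LinearEquiv.ofBijective _ hV.bijective).symm (a • (v : M)) = a ⊗ₜ v := by
    rw [LinearEquiv.symm_apply_eq]; rfl
  simp only [extend, LinearMap.comp_apply, LinearEquiv.coe_coe, this, LinearMap.rTensor_tmul,
    liftA_tmul]

theorem extend_apply (k : ℤ) (g : V →ₗ[ℚ] N) (v : V) : hV.extend k g v = g v := by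
  have := hV.extend_smul k g 1 v
  rwa [one_smul, CDGA.twist_one, one_smul] at this

/-- Since `M` is `A ⊗ V` as a graded module, all three conditions can be tested on products `a v`,
where the extension is `(-1) ^ (k |a|) a g(v)`. Homotopies and morphisms on `M` are thus produced
from equivariant homogeneous maps on the finite-dimensional space `V`. -/
theorem isGLin_extend {k : ℤ} {g : V →ₗ[ℚ] N}
    (hg : ∀ n, ∀ v : V, (v : M) ∈ M.str.gr n → g v ∈ N.str.gr (n + k))
    (hc : ∀ φ v, coact N.str.ρ φ (g v) = g (coact hV.graded.isSubrep.restrict φ v)) :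
    IsGLin k (hV.extend k g) := by
  have hs : ∀ (b : A) (x : M), hV.extend k g (b • x) = A.twist k b • hV.extend k g x := by
    intro b x
    refine hV.induction (p := fun x => hV.extend k g (b • x) = A.twist k b • hV.extend k g x)
      ?_ (by simp) ?_ x
    · intro i j a _ v hv _
      have := hV.extend_smul k g a ⟨v, hv⟩
      simp only at this
      rw [smul_smul, this, hV.extend_smul k g (b * a) ⟨v, hv⟩, CDGA.twist_mul, mul_smul]
    · intro x y hx hy
      simp only [smul_add, map_add, hx, hy]
  refine ⟨fun n x hx => ?_, fun p a x ha => ?_, ?_⟩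
  · rw [← M.str.proj_same hx]
    refine hV.induction (p := fun x => hV.extend k g (M.str.proj n x) ∈ N.str.gr (n + k))
      ?_ (by simp) ?_ x
    · intro i j a ha v hv hj
      have hav := M.smul_mem ha hj
      by_cases h : i + j = n
      · subst h
        rw [M.str.proj_same hav, hV.extend_smul k g a ⟨v, hv⟩, add_assoc]
        exact N.smul_mem (CDGA.twist_mem ha k) (hg j ⟨v, hv⟩ hj)
      · rw [M.str.proj_of_ne h hav, map_zero]
        exact zero_mem _
    · intro x y hx hy
      rw [map_add, map_add]
      exact add_mem hx hy
  · rw [hs, CDGA.twist_apply ha, smul_assoc]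
  · refine equivariant_iff.1 fun x => ?_
    refine hV.induction (p := fun x => N.str.ρ (hV.extend k g x) =
      (hV.extend k g).rTensor H (M.str.ρ x)) ?_ (by simp) ?_ x
    · intro i j a _ v hv _
      have h₁ : A.str.ρ (A.twist k a) = (A.twist k).rTensor H (A.str.ρ a) :=
        equivariant_iff.2 (fun φ a => CDGA.coact_twist φ k a) a
      have h₂ : N.str.ρ (g ⟨v, hv⟩) = g.rTensor H (hV.graded.isSubrep.restrict ⟨v, hv⟩) :=
        equivariant_iff.2 hc _
      have h₃ := hV.graded.isSubrep.rTensor_restrict ⟨v, hv⟩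
      rw [hV.extend_smul k g a ⟨v, hv⟩, N.ρ_smul, h₁, h₂, M.ρ_smul, ← h₃]
      generalize hV.graded.isSubrep.restrict ⟨v, hv⟩ = η
      generalize A.str.ρ a = ξ
      induction ξ using TensorProduct.induction_on with
      | zero => simp
      | add s t hs ht => simp only [map_add, LinearMap.add_apply, hs, ht]
      | tmul a h =>
        induction η using TensorProduct.induction_on with
        | zero => simp
        | add s t hs ht => simp only [map_add, hs, ht]
        | tmul v k' =>
          simp only [LinearMap.rTensor_tmul, pairH_tmul]
          congr 1
          exact (hV.extend_smul k g a v).symm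
    · intro x y hx hy
      simp only [map_add, hx, hy]

omit hV in
-- A graded linear map is `A`-linear up to sign, so its kernel is an `A`-submodule. The lemma is
-- used for `d v`, which lies in the span of the previous stage of the filtration.
theorem _root_.DGMod.IsGLin.eq_zero_of_span {k : ℤ} {h : M →ₗ[ℚ] N} (hh : IsGLin k h)
    {W : Set M} (hW : ∀ v ∈ W, h v = 0) {x : M} (hx : x ∈ Submodule.span A W) : h x = 0 := by
  have hs : ∀ (a : A) (x : M), h x = 0 → h (a • x) = 0 := by
    intro a x hx
    refine A.str.induction (p := fun a => h (a • x) = 0) ?_ (by simp) ?_ a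
    · intro p a ha
      rw [hh.smul p a x ha, hx, smul_zero, smul_zero]
    · intro a b ha hb
      rw [add_smul, map_add, ha, hb, add_zero]
  refine Submodule.span_induction (p := fun x _ => h x = 0) hW (map_zero h) ?_ ?_ hx
  · intro x y _ _ hx hy
    rw [map_add, hx, hy, add_zero]
  · exact fun a x _ hx => hs a x hx

theorem span_eq_top : Submodule.span A (V : Set M) = ⊤ := by
  rw [eq_top_iff]
  rintro x -
  refine hV.induction (p := fun x => x ∈ Submodule.span A (V : Set M)) ?_ (zero_mem _)
    (fun _ _ => add_mem) x
  exact fun i j a _ v hv _ => Submodule.smul_mem _ a (Submodule.subset_span hv)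

theorem eq_of_isGLin {k : ℤ} {h h' : M →ₗ[ℚ] N} (hh : IsGLin k h) (hh' : IsGLin k h')
    (e : ∀ v ∈ V, h v = h' v) : h = h' := by
  refine LinearMap.ext fun x => sub_eq_zero.1 ?_
  exact (hh.sub hh').eq_zero_of_span (W := V) (fun v hv => sub_eq_zero.2 (e v hv))
    (by rw [hV.span_eq_top]; trivial)

end IsFreeOn

/-- A filtration of the generators which is lowered by the differential. -/
structure GenFiltration (M : DGMod A) (V : Submodule ℚ M) where
  F : ℕ → Submodule ℚ M
  zero : F 0 = ⊥
  mono : ∀ n, F n ≤ F (n + 1)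
  le : ∀ n, F n ≤ V
  graded : ∀ n, M.str.IsGraded (F n)
  d_mem : ∀ n, ∀ v ∈ F (n + 1), M.str.d v ∈ Submodule.span A (F n : Set M)
  length : ℕ
  top : F length = V

section Cells

open Classical in
-- When the `V j` are independent, their direct sum is `⨆ j, V j`, and tensoring with `A` commutes
-- with direct sums; the two maps then differ by an isomorphism. This passes between a decomposition
-- into cells and freeness on a single space.
theorem directSum_bijective_iff {J : Type u} (V : J → Submodule ℚ M)
    (hi : Function.Injective (DirectSum.coeLinearMap V)) :
    Function.Bijective (DirectSum.toModule ℚ J M fun j =>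
      TensorProduct.lift ((Algebra.lsmul ℚ ℚ M).toLinearMap.compl₂ (V j).subtype) :
        (DirectSum J fun j => A ⊗[ℚ] V j) →ₗ[ℚ] M) ↔
    Function.Bijective (liftA (A := A) (⨆ j, V j).subtype) := by
  let c : (DirectSum J fun j => V j) →ₗ[ℚ] ↥(⨆ j, V j) :=
    (DirectSum.coeLinearMap V).codRestrict _ fun z => by
      rw [← DirectSum.range_coeLinearMap]; exact ⟨z, rfl⟩
  have hc : Function.Bijective c := by
    constructor
    · exact fun x y h => hi (congrArg Subtype.val h)
    · rintro ⟨x, hx⟩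
      obtain ⟨z, rfl⟩ : x ∈ LinearMap.range (DirectSum.coeLinearMap V) := by
        rwa [DirectSum.range_coeLinearMap]
      exact ⟨z, rfl⟩
  let e := LinearEquiv.ofBijective c hc
  let e' := (TensorProduct.directSumRight ℚ ℚ A (fun j => V j)).symm ≪≫ₗ
    LinearEquiv.lTensor A e
  have he : (DirectSum.toModule ℚ J M fun j =>
      TensorProduct.lift ((Algebra.lsmul ℚ ℚ M).toLinearMap.compl₂ (V j).subtype) :
        (DirectSum J fun j => A ⊗[ℚ] V j) →ₗ[ℚ] M) =
      liftA (A := A) (⨆ j, V j).subtype ∘ₗ e'.toLinearMap := by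
    refine DirectSum.linearMap_ext _ fun j => TensorProduct.ext' fun a v => ?_
    simp only [LinearMap.comp_apply, DirectSum.toModule_lof, LinearEquiv.coe_coe, e',
      LinearEquiv.trans_apply, TensorProduct.directSumRight_symm_lof_tmul]
    change a • (v : M) = liftA _ (a ⊗ₜ c _)
    rw [liftA_tmul]
    congr 1
    exact (DirectSum.coeLinearMap_lof V j v).symm
  rw [he, LinearMap.coe_comp, LinearEquiv.coe_coe]
  exact Function.Bijective.of_comp_iff _ e'.bijective

open Classical in
-- `ℚ · 1` is a direct summand of `A`, so `V j → A ⊗ V j` has a left inverse. Independence over `A`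
-- therefore implies independence over `ℚ`.
theorem directSum_injective {J : Type u} (V : J → Submodule ℚ M)
    (hb : Function.Injective (DirectSum.toModule ℚ J M fun j =>
      TensorProduct.lift ((Algebra.lsmul ℚ ℚ M).toLinearMap.compl₂ (V j).subtype) :
        (DirectSum J fun j => A ⊗[ℚ] V j) →ₗ[ℚ] M)) :
    Function.Injective (DirectSum.coeLinearMap V) := by
  obtain ⟨π, hπ, -⟩ := A.unit_summand
  let i : (DirectSum J fun j => V j) →ₗ[ℚ] DirectSum J fun j => A ⊗[ℚ] V j :=
    DirectSum.lmap fun j => TensorProduct.mk ℚ A (V j) 1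
  let r : (DirectSum J fun j => A ⊗[ℚ] V j) →ₗ[ℚ] DirectSum J fun j => V j :=
    DirectSum.lmap fun j => (TensorProduct.lid ℚ (V j)).toLinearMap ∘ₗ π.rTensor (V j)
  have hri : r ∘ₗ i = LinearMap.id := by
    refine DirectSum.linearMap_ext _ fun j => LinearMap.ext fun v => ?_
    simp [r, i, hπ]
  have hi : Function.Injective i := fun x y h => by
    rw [← LinearMap.id_apply (R := ℚ) x, ← LinearMap.id_apply (R := ℚ) y, ← hri,
      LinearMap.comp_apply, h, LinearMap.comp_apply]
  have he : DirectSum.coeLinearMap V = (DirectSum.toModule ℚ J M fun j =>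
      TensorProduct.lift ((Algebra.lsmul ℚ ℚ M).toLinearMap.compl₂ (V j).subtype)) ∘ₗ i := by
    refine DirectSum.linearMap_ext _ fun j => LinearMap.ext fun v => ?_
    simp [i]
  rw [he, LinearMap.coe_comp]
  exact hb.comp hi

variable (c : CellStructure M)

theorem _root_.CellStructure.isGraded (j : c.J) : M.str.IsGraded (c.V j) :=
  GComplex.isGraded_of_le (c.isSubrep j) (c.mem j)

theorem _root_.CellStructure.isFreeOn [Finite c.J] : IsFreeOn M (⨆ j, c.V j) := by
  have := c.finite
  exact ⟨inferInstance, .iSup c.isGraded,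
    (directSum_bijective_iff c.V (directSum_injective c.V c.bijective.1)).1 c.bijective⟩

theorem _root_.CellStructure.exists_step_eq_univ [Finite c.J] : ∃ n, c.step n = Set.univ := by
  have : ∀ j, ∃ n, j ∈ c.step n := fun j => by
    have : j ∈ ⋃ n, c.step n := by rw [c.step_union]; trivial
    exact Set.mem_iUnion.1 this
  choose r hr using this
  obtain ⟨n, hn⟩ := (Set.finite_range r).bddAbove
  exact ⟨n, Set.eq_univ_of_forall fun j => c.step_mono (hn ⟨j, rfl⟩) (hr j)⟩

/-- The filtration of the generators of a cell module. -/
def _root_.CellStructure.genFiltration [Finite c.J] : GenFiltration M (⨆ j, c.V j) where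
  F n := ⨆ j : c.step n, c.V j
  zero := by
    have : IsEmpty (c.step 0) := by rw [c.step_zero]; infer_instance
    exact iSup_of_empty _
  mono n := iSup_le fun j => le_iSup (fun j : c.step (n + 1) => c.V j)
    ⟨j, c.step_mono (Nat.le_succ n) j.2⟩
  le n := iSup_le fun j => le_iSup c.V j
  graded n := .iSup fun j => c.isGraded j
  d_mem n v hv := by
    refine Submodule.iSup_induction (fun j : c.step (n + 1) => c.V j)
      (motive := fun v => M.str.d v ∈ Submodule.span A _) hv ?_ (by simp) ?_
    · intro j v hv
      refine Submodule.span_mono ?_ (c.d_mem n j j.2 v hv)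
      exact Set.iUnion₂_subset fun i hi => le_iSup (fun j : c.step n => c.V j) ⟨i, hi⟩
    · intro x y hx hy
      rw [map_add]; exact add_mem hx hy
  length := c.exists_step_eq_univ.choose
  top := by
    refine le_antisymm (iSup_le fun j => le_iSup c.V j) (iSup_le fun j => ?_)
    exact le_iSup (fun j : c.step _ => c.V j)
      ⟨j, by rw [c.exists_step_eq_univ.choose_spec]; trivial⟩

end Cells

end DGMod

end

/-! ### Lifting morphisms of finite cell modules along quasi-isomorphisms -/

noncomputable section

variable {H : Type u} [CommRing H] [HopfAlgebra ℚ H] {A : CDGA H}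

namespace DGMod

variable {M N N' : DGMod A}

/-- The cone of a quasi-isomorphism is acyclic. -/
theorem IsQuasiIso.exists_bounding {w : N ⟶ N'} (hw : IsQuasiIso w) {x : N} {y : N'}
    (hx : N.str.d x = 0) (hy : N'.str.d y = w.toLin x) :
    ∃ x' y', N.str.d x' = x ∧ w.toLin x' + N'.str.d y' = y := by
  obtain ⟨x', rfl⟩ := hw.injective x hx y hy.symm
  have : N'.str.d (y - w.toLin x') = 0 := by rw [map_sub, hy, w.d, sub_self]
  obtain ⟨x'', y', hx'', e⟩ := hw.surjective _ this
  refine ⟨x' + x'', y', by rw [map_add, hx'', add_zero], ?_⟩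
  rw [map_add, add_assoc, ← e, add_sub_cancel]

/-- Injectivity on cohomology is the bounding property of the cone with `y` forgotten, and
surjectivity is the case `x = 0`. A single statement about pairs is what an induction over a
filtration can handle. -/
theorem IsQuasiIso.of_bounding {w : N ⟶ N'} (hw : ∀ x y, N.str.d x = 0 →
    N'.str.d y = w.toLin x → ∃ x' y', N.str.d x' = x ∧ w.toLin x' + N'.str.d y' = y) :
    IsQuasiIso w where
  injective x hx y hy := by
    obtain ⟨x', _, h, _⟩ := hw x y hx hy.symm
    exact ⟨x', h.symm⟩
  surjective y hy := by
    obtain ⟨x', y', h, h'⟩ := hw 0 y (map_zero _) (by rw [hy, map_zero])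
    exact ⟨x', y', h, h'.symm⟩

/-- The differential in the complex of graded linear maps of degree `k`. -/
def bdry (k : ℤ) (h : M →ₗ[ℚ] N) : M →ₗ[ℚ] N :=
  N.str.d ∘ₗ h - (-1 : ℚ) ^ k • (h ∘ₗ M.str.d)

theorem bdry_apply (k : ℤ) (h : M →ₗ[ℚ] N) (x : M) :
    bdry k h x = N.str.d (h x) - (-1 : ℚ) ^ k • h (M.str.d x) := rfl

theorem bdry_add (k : ℤ) (h h' : M →ₗ[ℚ] N) : bdry k (h + h') = bdry k h + bdry k h' :=
  LinearMap.ext fun x => by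
    simp only [bdry_apply, LinearMap.add_apply, map_add, smul_add]
    abel

theorem bdry_sub (k : ℤ) (h h' : M →ₗ[ℚ] N) : bdry k (h - h') = bdry k h - bdry k h' :=
  LinearMap.ext fun x => by
    simp only [bdry_apply, LinearMap.sub_apply, map_sub, smul_sub]
    abel

theorem bdry_bdry (k : ℤ) (h : M →ₗ[ℚ] N) : bdry (k + 1) (bdry k h) = 0 :=
  LinearMap.ext fun x => by
    simp only [bdry_apply, map_sub, map_smul, N.str.d_d, M.str.d_d, map_zero, smul_zero, sub_zero,
      zero_sub, negOne_succ, neg_smul, LinearMap.zero_apply]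
    abel

theorem bdry_comp (k : ℤ) (w : N ⟶ N') (h : M →ₗ[ℚ] N) :
    bdry k (w.toLin.restrictScalars ℚ ∘ₗ h) = w.toLin.restrictScalars ℚ ∘ₗ bdry k h :=
  LinearMap.ext fun x => by
    simp only [bdry_apply, LinearMap.comp_apply, LinearMap.restrictScalars_apply, map_sub, w.d,
      LinearMap.map_smul_of_tower]

theorem IsGLin.comp_hom {k : ℤ} {h : M →ₗ[ℚ] N} (hh : IsGLin k h) (w : N ⟶ N') :
    IsGLin k (w.toLin.restrictScalars ℚ ∘ₗ h) := by
  have := w.isGLin.comp hh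
  rwa [add_zero] at this

/-- One step of obstruction theory. The pair `(ψ, φ)` is a cocycle with values in the cone of `w`.
If it vanishes on `F n`, it also vanishes on `d v` for `v` in `F (n + 1)`, so each `(ψ v, φ v)` is a
cycle of the acyclic cone. The bounding elements are chosen equivariantly, made homogeneous,
arranged to vanish on `F n`, and extended `A`-linearly. -/
theorem exists_bounding_step (hH : IsReductive H) {w : N ⟶ N'} (hw : IsQuasiIso w)
    {V : Submodule ℚ M} (hV : IsFreeOn M V) (c : GenFiltration M V) {k : ℤ}
    {φ : M →ₗ[ℚ] N'} {ψ : M →ₗ[ℚ] N} (hφ : IsGLin k φ) (hψ : IsGLin (k + 1) ψ)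
    (hdψ : bdry (k + 1) ψ = 0) (hdφ : bdry k φ = w.toLin.restrictScalars ℚ ∘ₗ ψ) (n : ℕ)
    (hφn : ∀ v ∈ c.F n, φ v = 0) (hψn : ∀ v ∈ c.F n, ψ v = 0) :
    ∃ (θ : M →ₗ[ℚ] N) (h : M →ₗ[ℚ] N'), IsGLin k θ ∧ IsGLin (k - 1) h ∧
      (∀ v ∈ c.F (n + 1), bdry k θ v = ψ v) ∧
      ∀ v ∈ c.F (n + 1), w.toLin (θ v) + bdry (k - 1) h v = φ v := by
  have := hV.finite
  let ρV := hV.graded.isSubrep.restrict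
  have hρV : IsCoaction ρV := hV.graded.isSubrep.isCoaction_restrict M.str.isCoaction
  let Fn : ℕ → Submodule ℚ V := fun n => (c.F n).comap V.subtype
  have hFn : ∀ n, IsSubrep ρV (Fn n) := fun n => IsSubrep.comap
    (fun φ x => (hV.graded.isSubrep.coact_restrict φ x).symm) (c.graded n).isSubrep
  -- The projector `q` to the new stage lets the lifting problem be posed on all of `V`; the
  -- projector `p` to the old stage serves to make the solution vanish there.
  obtain ⟨p, hp, hpm, hpe⟩ := hH.exists_projector hρV (hFn n)
  obtain ⟨q, hq, hqm, hqe⟩ := hH.exists_projector hρV (hFn (n + 1))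
  let ρB := prodCoaction N.str.ρ N'.str.ρ
  have hρB : IsCoaction ρB := isCoaction_prodCoaction N.str.isCoaction N'.str.isCoaction
  -- This is the differential of the cone up to signs; its image contains every cycle that occurs
  -- here.
  let π : N × N' →ₗ[ℚ] N × N' := LinearMap.prod (N.str.d ∘ₗ LinearMap.fst ℚ N N')
    (w.toLin.restrictScalars ℚ ∘ₗ LinearMap.fst ℚ N N' + N'.str.d ∘ₗ LinearMap.snd ℚ N N')
  have hπ : ∀ χ x, coact ρB χ (π x) = π (coact ρB χ x) := by
    intro χ x
    simp only [ρB, coact_prodCoaction]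
    simp [π, N.str.coact_d, N'.str.coact_d, Hom.coact]
  let f : V →ₗ[ℚ] N × N' := LinearMap.prod ψ φ ∘ₗ V.subtype ∘ₗ q
  have hf : ∀ χ x, coact ρB χ (f x) = f (coact ρV χ x) := by
    intro χ x
    simp only [ρB, coact_prodCoaction]
    simp only [f, LinearMap.comp_apply, LinearMap.prod_apply, Function.prod_apply, ← hq,
      Submodule.subtype_apply,
      hψ.coact, hφ.coact]
    rw [hV.graded.isSubrep.coact_restrict]
  have hd : ∀ v ∈ c.F (n + 1), ψ (M.str.d v) = 0 ∧ φ (M.str.d v) = 0 := fun v hv =>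
    ⟨hψ.eq_zero_of_span hψn (c.d_mem n v hv), hφ.eq_zero_of_span hφn (c.d_mem n v hv)⟩
  have hsurj : ∀ v, ∃ x, π x = f v := by
    intro v
    have h₁ := LinearMap.congr_fun hdψ (q v : M)
    have h₂ := LinearMap.congr_fun hdφ (q v : M)
    have hq' : (q v : M) ∈ c.F (n + 1) := hqm v
    rw [bdry_apply, (hd _ hq').1, smul_zero, sub_zero, LinearMap.zero_apply] at h₁
    rw [bdry_apply, (hd _ hq').2, smul_zero, sub_zero] at h₂
    obtain ⟨x', y', e, e'⟩ := hw.exists_bounding h₁ h₂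
    exact ⟨(x', y'), Prod.ext e e'⟩
  obtain ⟨g, hg, hgf⟩ := hH.exists_lift hρV hρB hπ hf hsurj
  let S := hV.graded.str
  -- Precomposition with `1 - p` forces vanishing on `F n`. The equation on `F (n + 1)` survives
  -- because `ψ` and `φ` already vanish on `F n`.
  let g₁ : V →ₗ[ℚ] N := LinearMap.fst ℚ N N' ∘ₗ g ∘ₗ (LinearMap.id - p)
  let g₂ : V →ₗ[ℚ] N' := LinearMap.snd ℚ N N' ∘ₗ g ∘ₗ (LinearMap.id - p)
  have hgc : ∀ χ v, coact ρB χ (g (v - p v)) = g (coact ρV χ v - p (coact ρV χ v)) := by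
    intro χ v
    rw [hg, map_sub, hp]
  have hg₁ : ∀ χ v, coact N.str.ρ χ (g₁ v) = g₁ (coact ρV χ v) := fun χ v => by
    have := congrArg Prod.fst (hgc χ v)
    simp only [ρB, coact_prodCoaction] at this
    exact this
  have hg₂ : ∀ χ v, coact N'.str.ρ χ (g₂ v) = g₂ (coact ρV χ v) := fun χ v => by
    have := congrArg Prod.snd (hgc χ v)
    simp only [ρB, coact_prodCoaction] at this
    exact this
  have hg0 : ∀ v : V, (v : M) ∈ c.F n → g₁ v = 0 ∧ g₂ v = 0 := by
    intro v hv
    have : g (v - p v) = 0 := by rw [hpe v hv, sub_self, map_zero]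
    exact ⟨congrArg Prod.fst this, congrArg Prod.snd this⟩
  have hge : ∀ v : V, (v : M) ∈ c.F (n + 1) → N.str.d (g₁ v) = ψ v ∧
      w.toLin (g₁ v) + N'.str.d (g₂ v) = φ v := by
    intro v hv
    have h₁ := hgf (v - p v)
    have h₂ : q (v - p v) = v - p v := hqe _ (sub_mem hv (c.mono n (hpm v)))
    have h₃ : f (v - p v) = (ψ v, φ v) := by
      change (ψ (q (v - p v) : M), φ (q (v - p v) : M)) = _
      have hp' : (p v : M) ∈ c.F n := hpm v
      rw [h₂, AddSubgroupClass.coe_sub, map_sub, map_sub, hψn _ hp', hφn _ hp', sub_zero,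
        sub_zero]
    rw [h₃] at h₁
    exact ⟨congrArg Prod.fst h₁, congrArg Prod.snd h₁⟩
  -- Reducibility gives an equivariant lift without regard to degrees. Only its homogeneous
  -- component of the right degree is kept, and the equations survive because `d`, `w`, `ψ` and `φ`
  -- are homogeneous.
  have hθ : IsGLin k (hV.extend k (S.homPart N.str k g₁)) := hV.isGLin_extend
    (fun m v hv => S.homPart_mem N.str k g₁ hv) fun χ v => S.coact_homPart N.str χ (hg₁ χ) v
  have hh : IsGLin (k - 1) (hV.extend (k - 1) (S.homPart N'.str (k - 1) g₂)) := hV.isGLin_extend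
    (fun m v hv => S.homPart_mem N'.str (k - 1) g₂ hv)
    fun χ v => S.coact_homPart N'.str χ (hg₂ χ) v
  have hθv : ∀ m, ∀ v : V, (v : M) ∈ M.str.gr m →
      hV.extend k (S.homPart N.str k g₁) v = N.str.proj (m + k) (g₁ v) := fun m v hv => by
    rw [hV.extend_apply, S.homPart_apply N.str k g₁ hv]
  have hhv : ∀ m, ∀ v : V, (v : M) ∈ M.str.gr m →
      hV.extend (k - 1) (S.homPart N'.str (k - 1) g₂) v = N'.str.proj (m + (k - 1)) (g₂ v) :=
    fun m v hv => by
      rw [hV.extend_apply, S.homPart_apply N'.str (k - 1) g₂ hv]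
  have hθ0 : ∀ v ∈ c.F n, hV.extend k (S.homPart N.str k g₁) v = 0 := fun v hv => by
    refine (c.graded n).induction (p := fun v => hV.extend k (S.homPart N.str k g₁) v = 0)
      ?_ (map_zero _) ?_ hv
    · intro m v hv hm
      rw [hθv m ⟨v, c.le n hv⟩ hm, (hg0 ⟨v, c.le n hv⟩ hv).1, map_zero]
    · intro x y hx hy
      rw [map_add, hx, hy, add_zero]
  have hh0 : ∀ v ∈ c.F n, hV.extend (k - 1) (S.homPart N'.str (k - 1) g₂) v = 0 := fun v hv => by
    refine (c.graded n).induction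
      (p := fun v => hV.extend (k - 1) (S.homPart N'.str (k - 1) g₂) v = 0) ?_ (map_zero _) ?_ hv
    · intro m v hv hm
      rw [hhv m ⟨v, c.le n hv⟩ hm, (hg0 ⟨v, c.le n hv⟩ hv).2, map_zero]
    · intro x y hx hy
      rw [map_add, hx, hy, add_zero]
  refine ⟨_, _, hθ, hh, fun v hv => ?_, fun v hv => ?_⟩
  -- The term of the boundary involving `d v` drops out because `d v` lies in the span of `F n`,
  -- where the solution is zero; only `d (θ v)` remains.
  · rw [bdry_apply, hθ.eq_zero_of_span hθ0 (c.d_mem n v hv), smul_zero, sub_zero]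
    refine (c.graded (n + 1)).induction (p := fun v => N.str.d (hV.extend k _ v) = ψ v)
      ?_ (by simp) ?_ hv
    · intro m v hv hm
      rw [hθv m ⟨v, c.le _ hv⟩ hm, N.str.d_proj, (hge ⟨v, c.le _ hv⟩ hv).1, add_assoc,
        N.str.proj_same (hψ.mem m v hm)]
    · intro x y hx hy
      rw [map_add, map_add, map_add, hx, hy]
  · rw [bdry_apply, hh.eq_zero_of_span hh0 (c.d_mem n v hv), smul_zero, sub_zero]
    refine (c.graded (n + 1)).induction (p := fun v => w.toLin (hV.extend k _ v) +
      N'.str.d (hV.extend (k - 1) _ v) = φ v) ?_ (by simp) ?_ hv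
    · intro m v hv hm
      have hwp : N'.str.proj (m + k) (w.toLin (g₁ ⟨v, c.le _ hv⟩)) =
          w.toLin (N.str.proj (m + k) (g₁ ⟨v, c.le _ hv⟩)) := by
        have := GComplex.proj_comm (f := w.toLin.restrictScalars ℚ) (w.isGLin.mem) (m + k)
          (g₁ ⟨v, c.le _ hv⟩)
        rwa [add_zero] at this
      rw [hθv m ⟨v, c.le _ hv⟩ hm, hhv m ⟨v, c.le _ hv⟩ hm, N'.str.d_proj, ← hwp,
        show m + (k - 1) + 1 = m + k by ring, ← map_add, (hge ⟨v, c.le _ hv⟩ hv).2,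
        N'.str.proj_same (hφ.mem m v hm)]
    · intro x y hx hy
      rw [map_add, map_add, map_add, map_add, map_add, ← hx, ← hy]
      abel

/-- Maps from a finite cell module to the cone of a quasi-isomorphism are null-homotopic. -/
theorem exists_bounding (hH : IsReductive H) {w : N ⟶ N'} (hw : IsQuasiIso w)
    (hM : IsFiniteCell M) {k : ℤ}
    {φ : M →ₗ[ℚ] N'} {ψ : M →ₗ[ℚ] N} (hφ : IsGLin k φ) (hψ : IsGLin (k + 1) ψ)
    (hdψ : bdry (k + 1) ψ = 0) (hdφ : bdry k φ = w.toLin.restrictScalars ℚ ∘ₗ ψ) :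
    ∃ (θ : M →ₗ[ℚ] N) (h : M →ₗ[ℚ] N'), IsGLin k θ ∧ IsGLin (k - 1) h ∧
      bdry k θ = ψ ∧ w.toLin.restrictScalars ℚ ∘ₗ θ + bdry (k - 1) h = φ := by
  obtain ⟨c, hc⟩ := hM
  have hV := c.isFreeOn
  let F := c.genFiltration
  have key : ∀ n, ∃ (θ : M →ₗ[ℚ] N) (h : M →ₗ[ℚ] N'), IsGLin k θ ∧ IsGLin (k - 1) h ∧
      (∀ v ∈ F.F n, bdry k θ v = ψ v) ∧
      ∀ v ∈ F.F n, w.toLin (θ v) + bdry (k - 1) h v = φ v := by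
    intro n
    induction n with
    | zero =>
      refine ⟨0, 0, .zero, .zero, fun v hv => ?_, fun v hv => ?_⟩
      all_goals
        rw [F.zero, Submodule.mem_bot] at hv
        subst hv
        simp
    | succ n ih =>
      obtain ⟨θ, h, hθ, hh, e, e'⟩ := ih
      have hh' : IsGLin k (bdry (k - 1) h) := by
        have := hh.d_comm
        rwa [sub_add_cancel] at this
      have hbb : bdry k (bdry (k - 1) h) = 0 := by
        have := bdry_bdry (k - 1) h
        rwa [sub_add_cancel] at this
      -- What the partial solution fails to bound is again a cocycle in the cone and vanishes on `F
      -- n`, as the step requires.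
      have hψ' : IsGLin (k + 1) (ψ - bdry k θ) := hψ.sub hθ.d_comm
      have hφ' : IsGLin k (φ - (w.toLin.restrictScalars ℚ ∘ₗ θ + bdry (k - 1) h)) :=
        hφ.sub ((hθ.comp_hom w).add hh')
      obtain ⟨θ', h', hθ', hh', e₁, e₂⟩ := exists_bounding_step hH hw hV F hφ' hψ'
        (by rw [bdry_sub, hdψ, bdry_bdry, sub_zero])
        (by rw [bdry_sub, bdry_add, hdφ, bdry_comp, hbb, add_zero, LinearMap.comp_sub]) n
        (fun v hv => by
          rw [LinearMap.sub_apply, ← e' v hv]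
          exact sub_self _)
        (fun v hv => by rw [LinearMap.sub_apply, e v hv, sub_self])
      refine ⟨θ + θ', h + h', hθ.add hθ', hh.add hh', fun v hv => ?_, fun v hv => ?_⟩
      · rw [bdry_add, LinearMap.add_apply, e₁ v hv, LinearMap.sub_apply, add_sub_cancel]
      · rw [bdry_add, LinearMap.add_apply, LinearMap.add_apply, map_add, add_add_add_comm, e₂ v hv,
          LinearMap.sub_apply]
        exact add_sub_cancel _ _
  obtain ⟨θ, h, hθ, hh, e, e'⟩ := key F.length
  rw [F.top] at e e'
  refine ⟨θ, h, hθ, hh, hV.eq_of_isGLin hθ.d_comm hψ e, ?_⟩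
  refine hV.eq_of_isGLin ((hθ.comp_hom w).add ?_) hφ e'
  have := hh.d_comm
  rwa [sub_add_cancel] at this

theorem bdry_zero_hom (f : M ⟶ N) : bdry 0 (f.toLin.restrictScalars ℚ) = 0 :=
  LinearMap.ext fun x => by simp [bdry_apply, f.d]

theorem homotopic_iff_bdry {f g : M ⟶ N} : Homotopic f g ↔ ∃ h : M →ₗ[ℚ] N, IsGLin (-1) h ∧
    bdry (-1) h = f.toLin.restrictScalars ℚ - g.toLin.restrictScalars ℚ := by
  rw [homotopic_iff]
  refine exists_congr fun h => and_congr_right fun _ => ?_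
  rw [LinearMap.ext_iff]
  refine forall_congr' fun x => ?_
  rw [bdry_apply]
  simp [eq_comm]

/-- Morphisms from a finite cell module lift along quasi-isomorphisms, up to homotopy. -/
theorem exists_lift_homotopic (hH : IsReductive H) {w : N ⟶ N'} (hw : IsQuasiIso w)
    (hM : IsFiniteCell M) (f : M ⟶ N') : ∃ g : M ⟶ N, Homotopic (g ≫ w) f := by
  -- With `ψ = 0`, the first component of a bounding pair is a cocycle, that is, the lift, and the
  -- second is the homotopy.
  obtain ⟨θ, h, hθ, hh, e, e'⟩ := exists_bounding hH hw hM f.isGLin (ψ := 0) .zero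
    (by ext; simp [bdry_apply]) (by rw [bdry_zero_hom, LinearMap.comp_zero])
  have hd : ∀ x, θ (M.str.d x) = N.str.d (θ x) := fun x => by
    have := LinearMap.congr_fun e x
    rw [bdry_apply, zpow_zero, one_smul, LinearMap.zero_apply, sub_eq_zero] at this
    exact this.symm
  refine ⟨hθ.hom hd, (homotopic_iff_bdry.2 ⟨h, hh, ?_⟩).symm⟩
  rw [eq_sub_iff_add_eq, add_comm]
  exact e'

theorem homotopic_of_comp (hH : IsReductive H) {w : N ⟶ N'} (hw : IsQuasiIso w)
    (hM : IsFiniteCell M) {f g : M ⟶ N} (hfg : Homotopic (f ≫ w) (g ≫ w)) : Homotopic f g := by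
  obtain ⟨h, hh, e⟩ := homotopic_iff_bdry.1 hfg
  -- Here `k = -1`: the given homotopy between the composites is `φ` and `f - g` is `ψ`. The first
  -- component of a bounding pair is a homotopy from `f` to `g`.
  obtain ⟨θ, -, hθ, -, e', -⟩ := exists_bounding hH hw hM hh
    (ψ := f.toLin.restrictScalars ℚ - g.toLin.restrictScalars ℚ)
    (by
      have := f.isGLin.sub g.isGLin
      simpa using this)
    (by
      rw [neg_add_cancel, bdry_sub, bdry_zero_hom, bdry_zero_hom, sub_zero])
    (by rw [e, LinearMap.comp_sub]; rfl)
  exact homotopic_iff_bdry.2 ⟨θ, hθ, e'⟩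

end DGMod

end

/-! ### Morphisms out of finite cell modules in the derived category -/

noncomputable section

section Localization

open Localization.Construction

variable {C : Type*} [Category* C] (W : MorphismProperty C) {F : C}

/-- Consider the morphisms of the localization along which the property of coming from a morphism
out of `F` is preserved. They are closed under composition and contain the images of morphisms; by
`h` they contain the formal inverses of morphisms in `W`. These generate the localization, so no
calculus of fractions is needed. -/
theorem exists_map_Q (h : ∀ ⦃N N' : C⦄ (w : N ⟶ N'), W w → ∀ f : F ⟶ N', ∃ g : F ⟶ N,
    W.Q.map (g ≫ w) = W.Q.map f) {N : C} (f : W.Q.obj F ⟶ W.Q.obj N) :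
    ∃ g : F ⟶ N, W.Q.map g = f := by
  -- The predicate must make sense at every object of the localization, hence the equality of
  -- objects and the `eqToHom`; injectivity of `objEquiv` removes it again.
  let R : ∀ X : W.Localization, (W.Q.obj F ⟶ X) → Prop := fun X k =>
    ∃ (Y : C) (e : W.Q.obj Y = X) (g : F ⟶ Y), k = W.Q.map g ≫ eqToHom e
  have hR : ∀ {N : C} {k : W.Q.obj F ⟶ W.Q.obj N}, R _ k ↔ ∃ g : F ⟶ N, W.Q.map g = k := by
    intro N k
    constructor
    · rintro ⟨Y, e, g, rfl⟩
      obtain rfl : Y = N := (objEquiv W).injective e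
      exact ⟨g, by rw [eqToHom_refl, Category.comp_id]⟩
    · rintro ⟨g, rfl⟩
      exact ⟨N, rfl, g, by rw [eqToHom_refl, Category.comp_id]⟩
  let P : MorphismProperty W.Localization := fun X Y f => ∀ k : W.Q.obj F ⟶ X, R X k → R Y (k ≫ f)
  have hP : P.IsStableUnderComposition := ⟨fun f f' hf hf' k hk => by
    rw [← Category.assoc]
    exact hf' _ (hf k hk)⟩
  have : P = ⊤ := by
    refine morphismProperty_eq_top P (fun X Y f k hk => ?_) (fun X Y w hw k hk => ?_)
    · obtain ⟨g, rfl⟩ := hR.1 hk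
      exact hR.2 ⟨g ≫ f, W.Q.map_comp g f⟩
    · obtain ⟨g, rfl⟩ := hR.1 hk
      obtain ⟨g', e⟩ := h w hw g
      refine hR.2 ⟨g', ?_⟩
      have e' : W.Q.map w ≫ wInv w hw = 𝟙 _ := (wIso w hw).hom_inv_id
      rw [← e, W.Q.map_comp, Category.assoc, e', Category.comp_id]
  have hf : P f := by rw [this]; trivial
  have := hf (𝟙 _) (hR.2 ⟨𝟙 F, W.Q.map_id F⟩)
  rw [Category.id_comp] at this
  exact hR.1 this

/-- By hypothesis the functor represented by `F` inverts `W`, so it factors through the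
localization. Morphisms with the same image there act equally on `𝟙 F`. -/
theorem Q_map_injective (h : ∀ ⦃N N' : C⦄ (w : N ⟶ N'), W w →
    Function.Bijective fun g : F ⟶ N => g ≫ w) {N : C} {f g : F ⟶ N}
    (hfg : W.Q.map f = W.Q.map g) : f = g := by
  have hW : W.IsInvertedBy (coyoneda.obj (Opposite.op F)) := fun N N' w hw =>
    (isIso_iff_bijective _).2 (h w hw)
  let G := lift _ hW
  have e : W.Q ⋙ G = coyoneda.obj (Opposite.op F) := fac _ hW
  have h₁ : (W.Q ⋙ G).map f = (W.Q ⋙ G).map g := congrArg G.map hfg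
  have h₂ : (coyoneda.obj (Opposite.op F)).map f = (coyoneda.obj (Opposite.op F)).map g := by
    revert h₁
    rw [e]
    exact id
  have h₃ := congrArg (fun k => (ConcreteCategory.hom k) (𝟙 F)) h₂
  have h₄ : 𝟙 F ≫ f = 𝟙 F ≫ g := h₃
  rwa [Category.id_comp, Category.id_comp] at h₄

end Localization

variable {H : Type u} [CommRing H] [HopfAlgebra ℚ H] {A : CDGA H}

namespace DGMod

variable {M N N' : DGMod A}

variable (A) in
/-- The functor to the homotopy category. -/
abbrev toK : DGMod A ⥤ KCat A := Quotient.functor (homotopyRel A)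

theorem toK_map_eq_iff {f g : M ⟶ N} : (toK A).map f = (toK A).map g ↔ Homotopic f g :=
  Quotient.functor_map_eq_iff _ f g

/-- Surjectivity is lifting up to homotopy, and injectivity is the uniqueness of lifts up to
homotopy: finite cell modules are orthogonal to quasi-isomorphisms in the homotopy category. -/
theorem toK_bijective (hH : IsReductive H) (hM : IsFiniteCell M) {X Y : KCat A} (w : X ⟶ Y)
    (hw : quasiIsoK A w) : Function.Bijective fun g : (toK A).obj M ⟶ X => g ≫ w := by
  obtain ⟨w, hw, rfl⟩ := hw
  constructor
  · intro f g hfg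
    obtain ⟨f, rfl⟩ := (toK A).map_surjective (X := M) (Y := X.as) f
    obtain ⟨g, rfl⟩ := (toK A).map_surjective (X := M) (Y := X.as) g
    have h : (toK A).map (f ≫ w) = (toK A).map (g ≫ w) := by
      rw [Functor.map_comp, Functor.map_comp]; exact hfg
    exact toK_map_eq_iff.2 (homotopic_of_comp hH hw hM (toK_map_eq_iff.1 h))
  · intro f
    obtain ⟨f, rfl⟩ := (toK A).map_surjective (X := M) (Y := Y.as) f
    obtain ⟨g, hg⟩ := exists_lift_homotopic hH hw hM f
    exact ⟨(toK A).map g, ((toK A).map_comp g w).symm.trans (toK_map_eq_iff.2 hg)⟩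

/-- Retracts in the homotopy category of finite cell modules see no difference between the
homotopy category and the derived category. -/
theorem Q_map_bijective (hH : IsReductive H) (hM : IsFiniteCell M) {X : KCat A}
    (r : Retract X ((toK A).obj M)) (Y : KCat A) :
    Function.Bijective fun f : X ⟶ Y => (quasiIsoK A).Q.map f := by
  constructor
  · intro f g hfg
    have : r.r ≫ f = r.r ≫ g := by
      refine Q_map_injective (quasiIsoK A) (fun _ _ w hw => toK_bijective hH hM w hw) ?_
      rw [Functor.map_comp, Functor.map_comp]
      exact congrArg (_ ≫ ·) hfg
    rw [← Category.id_comp f, ← Category.id_comp g, ← r.retract, Category.assoc, this,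
      Category.assoc]
  · intro f
    obtain ⟨g, hg⟩ := exists_map_Q (quasiIsoK A) (F := (toK A).obj M) (fun N N' w hw f => by
      obtain ⟨g, rfl⟩ := (toK_bijective hH hM w hw).2 f
      exact ⟨g, rfl⟩) ((quasiIsoK A).Q.map r.r ≫ f)
    refine ⟨r.i ≫ g, ?_⟩
    change (quasiIsoK A).Q.map (r.i ≫ g) = f
    rw [Functor.map_comp, hg, ← Category.assoc, ← Functor.map_comp, r.retract,
      CategoryTheory.Functor.map_id, Category.id_comp]

theorem exists_map_toD (hH : IsReductive H) (hM : IsFiniteCell M)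
    (f : (toDCat A).obj M ⟶ (toDCat A).obj N) : ∃ g : M ⟶ N, (toDCat A).map g = f := by
  obtain ⟨g, hg⟩ := (Q_map_bijective hH hM (.refl _) ((toK A).obj N)).2 f
  obtain ⟨g, rfl⟩ := (toK A).map_surjective (X := M) (Y := N) g
  exact ⟨g, hg⟩

theorem toD_map_eq_iff (hH : IsReductive H) (hM : IsFiniteCell M) {f g : M ⟶ N} :
    (toDCat A).map f = (toDCat A).map g ↔ Homotopic f g :=
  ⟨fun h => toK_map_eq_iff.1 ((Q_map_bijective hH hM (.refl _) ((toK A).obj N)).1 h),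
    fun h => congrArg (quasiIsoK A).Q.map (toK_map_eq_iff.2 h)⟩

end DGMod

end

/-! ### The augmentation of `A` and the reduction of free modules -/

noncomputable section

variable {H : Type u} [CommRing H] [HopfAlgebra ℚ H]

section AdamsInduction

variable {M : Type u} [AddCommGroup M] [Module ℚ M] {ρ : M →ₗ[ℚ] M ⊗[ℚ] H}
variable {w : H →ₐc[ℚ] ℚ[T;T⁻¹]}

theorem IsCoaction.adams_induction (h : IsCoaction ρ) {W : Submodule ℚ M} (hW : IsSubrep ρ W)
    {p : M → Prop} (hom : ∀ r, ∀ x ∈ W, x ∈ adamsPart ρ w r → p x) (zero : p 0)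
    (add : ∀ x y, p x → p y → p (x + y)) {x : M} (hx : x ∈ W) : p x := by
  obtain ⟨S, -, hS⟩ := h.exists_sum_adams (w := w) x
  rw [← hS]
  exact Finset.sum_induction _ p add zero fun r _ =>
    hom r _ (adams_mem_of_isSubrep hW hx r) (h.adams_mem r x)

theorem GComplex.IsGraded.adams_induction {S : GComplex H M} {W : Submodule ℚ M}
    (hW : S.IsGraded W) {p : M → Prop}
    (hom : ∀ n r, ∀ x ∈ W, x ∈ S.gr n → x ∈ adamsPart S.ρ w r → p x) (zero : p 0)
    (add : ∀ x y, p x → p y → p (x + y)) {x : M} (hx : x ∈ W) : p x :=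
  hW.induction (fun n _ hx hn => S.isCoaction.adams_induction (hW.isSubrep.inf (S.isSubrep n))
    (fun r y hy hr => hom n r y hy.1 hy.2 hr) zero add ⟨hx, hn⟩) zero add hx

theorem GComplex.adams_proj (S : GComplex H M) (r n : ℤ) (x : M) :
    adams w S.ρ r (S.proj n x) = S.proj n (adams w S.ρ r x) := S.coact_proj _ n x

theorem GComplex.isGraded_top (S : GComplex H M) : S.IsGraded ⊤ :=
  ⟨isSubrep_iff.2 fun _ _ _ => trivial, fun _ _ _ => trivial⟩

theorem GComplex.isGraded_adamsPart (S : GComplex H M) (hc : IsCentralCochar w) (r : ℤ) :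
    S.IsGraded (adamsPart S.ρ w r) :=
  ⟨isSubrep_adamsPart hc S.isCoaction r, fun n x hx => by
    rw [S.isCoaction.mem_adamsPart_iff] at *
    rw [S.adams_proj, hx]⟩

end AdamsInduction

variable {A : CDGA H} {w : H →ₐc[ℚ] ℚ[T;T⁻¹]}

namespace CDGA

theorem adams_mul_mem {r s : ℤ} {a b : A} (ha : a ∈ adamsPart A.str.ρ w r)
    (hb : b ∈ adamsPart A.str.ρ w s) : a * b ∈ adamsPart A.str.ρ w (r + s) :=
  pairing_mem_adamsPart (b := LinearMap.mul ℚ A) (by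
    refine (A.ρ_mul a b).trans ?_
    generalize A.str.ρ a = ξ
    generalize A.str.ρ b = η
    induction ξ using TensorProduct.induction_on with
    | zero => simp
    | add s t hs ht => simp only [map_add, LinearMap.add_apply, add_mul, hs, ht]
    | tmul x h =>
      induction η using TensorProduct.induction_on with
      | zero => simp
      | add s t hs ht => simp only [map_add, mul_add, hs, ht]
      | tmul y k => simp) ha hb

variable (A w) in
/-- The augmentation of an Adams connected algebra. -/
def aug : A →ₗ[ℚ] ℚ := A.unit_summand.choose ∘ₗ adams w A.str.ρ 0

variable (hA : A.IsAdamsConnected w)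
include hA

theorem IsAdamsConnected.eq_zero {r : ℤ} (hr : r < 0) {a : A} (ha : a ∈ adamsPart A.str.ρ w r) :
    a = 0 := by
  rw [← A.str.isCoaction.mem_adamsPart_iff.1 ha]
  have : a ∈ ⨆ r : ℕ, adamsPart A.str.ρ w r := by rw [hA.nonneg]; trivial
  refine Submodule.iSup_induction _ (motive := fun a => adams w A.str.ρ r a = 0) this ?_
    (map_zero _) ?_
  · exact fun n a ha => A.str.isCoaction.adams_eq_zero (by omega) ha
  · intro a b ha hb
    rw [map_add, ha, hb, add_zero]

theorem IsAdamsConnected.adams_zero (a : A) : adams w A.str.ρ 0 a = A.aug w a • 1 := by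
  have : adams w A.str.ρ 0 a ∈ Submodule.span ℚ {1} := by
    rw [← hA.zero]; exact A.str.isCoaction.adams_mem 0 a
  obtain ⟨c, hc⟩ := Submodule.mem_span_singleton.1 this
  rw [aug, LinearMap.comp_apply, ← hc, map_smul, A.unit_summand.choose_spec.1, smul_eq_mul, mul_one]

theorem IsAdamsConnected.one_mem : (1 : A) ∈ adamsPart A.str.ρ w 0 := by
  rw [hA.zero]; exact Submodule.mem_span_singleton_self 1

theorem IsAdamsConnected.aug_eq {a : A} (ha : a ∈ adamsPart A.str.ρ w 0) : A.aug w a • 1 = a := by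
  rw [← hA.adams_zero, A.str.isCoaction.mem_adamsPart_iff.1 ha]

omit hA in
theorem aug_of_ne {r : ℤ} (hr : r ≠ 0) {a : A} (ha : a ∈ adamsPart A.str.ρ w r) :
    A.aug w a = 0 := by
  rw [aug, LinearMap.comp_apply, A.str.isCoaction.adams_eq_zero hr.symm ha, map_zero]

omit hA in
theorem aug_of_gr_ne {n : ℤ} (hn : n ≠ 0) {a : A} (ha : a ∈ A.str.gr n) : A.aug w a = 0 :=
  A.unit_summand.choose_spec.2.1 n hn _ (A.str.coact_mem _ ha)

omit hA in
theorem aug_d (a : A) : A.aug w (A.str.d a) = 0 := by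
  rw [aug, LinearMap.comp_apply, adams, A.str.coact_d]
  exact A.unit_summand.choose_spec.2.2.1 _

/-- Without negative Adams degrees, a product has a component in Adams degree `0` only if both
factors have, and there the algebra is `ℚ`. The part of positive Adams degree is thus an ideal. -/
theorem IsAdamsConnected.aug_mul (a b : A) : A.aug w (a * b) = A.aug w a * A.aug w b := by
  refine A.str.isGraded_top.adams_induction (w := w)
    (p := fun a => A.aug w (a * b) = A.aug w a * A.aug w b) ?_ (by simp) ?_ (x := a) trivial
  · intro _ r a _ _ ha
    refine A.str.isGraded_top.adams_induction (w := w)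
      (p := fun b => A.aug w (a * b) = A.aug w a * A.aug w b) ?_ (by simp) ?_ (x := b) trivial
    · intro _ s b _ _ hb
      rcases lt_trichotomy r 0 with hr | rfl | hr
      · rw [hA.eq_zero hr ha, zero_mul, map_zero, zero_mul]
      · nth_rw 1 [← hA.aug_eq ha]
        rw [smul_one_mul, map_smul, smul_eq_mul]
      · rw [aug_of_ne hr.ne' ha, zero_mul]
        rcases lt_or_ge s 0 with hs | hs
        · rw [hA.eq_zero hs hb, mul_zero, map_zero]
        · exact aug_of_ne (by omega) (adams_mul_mem ha hb)
    · intro b b' h h'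
      rw [mul_add, map_add, map_add, h, h', mul_add]
  · intro a a' h h'
    rw [add_mul, map_add, map_add, h, h', add_mul]

end CDGA

namespace DGMod

variable {M N : DGMod A}

theorem smul_mem_adamsPart {r s : ℤ} {a : A} {x : M} (ha : a ∈ adamsPart A.str.ρ w r)
    (hx : x ∈ adamsPart M.str.ρ w s) : a • x ∈ adamsPart M.str.ρ w (r + s) := by
  have h := M.ρ_smul a x
  generalize hb : (Algebra.lsmul (A := A) ℚ ℚ M).toLinearMap = b at h
  have e : b a x = a • x := by rw [← hb]; rfl
  rw [← e] at h ⊢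
  exact pairing_mem_adamsPart h ha hx

/-- The submodule generated by the generators of Adams degree less than `r`. -/
def lowSpan (M : DGMod A) (w : H →ₐc[ℚ] ℚ[T;T⁻¹]) (V : Submodule ℚ M) (r : ℤ) : Submodule A M :=
  Submodule.span A {v | v ∈ V ∧ ∃ s < r, v ∈ adamsPart M.str.ρ w s}

theorem lowSpan_mono {V : Submodule ℚ M} {r s : ℤ} (h : r ≤ s) :
    lowSpan M w V r ≤ lowSpan M w V s :=
  Submodule.span_mono fun _ ⟨hv, t, ht, hvt⟩ => ⟨hv, t, ht.trans_le h, hvt⟩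

namespace IsFreeOn

variable {V : Submodule ℚ M} (hV : IsFreeOn M V)

/-- The projection to the generators which is induced by the augmentation. -/
def red (w : H →ₐc[ℚ] ℚ[T;T⁻¹]) : M →ₗ[ℚ] M :=
  liftA V.subtype ∘ₗ (adams w A.str.ρ 0).rTensor V ∘ₗ
    (LinearEquiv.ofBijective _ hV.bijective).symm.toLinearMap

theorem red_smul_aux (a : A) {v : M} (hv : v ∈ V) : hV.red w (a • v) = adams w A.str.ρ 0 a • v := by
  have : (LinearEquiv.ofBijective _ hV.bijective).symm (a • v) = a ⊗ₜ ⟨v, hv⟩ := by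
    rw [LinearEquiv.symm_apply_eq]; rfl
  simp only [red, LinearMap.comp_apply, LinearEquiv.coe_coe, this, LinearMap.rTensor_tmul,
    liftA_tmul]
  rfl

theorem coact_red (hc : IsCentralCochar w) (φ : H →ₗ[ℚ] ℚ) (x : M) :
    coact M.str.ρ φ (hV.red w x) = hV.red w (coact M.str.ρ φ x) := by
  refine equivariant_iff.1 (fun x => ?_) φ x
  refine hV.induction (p := fun x => M.str.ρ (hV.red w x) = (hV.red w).rTensor H (M.str.ρ x))
    ?_ (by simp) (fun x y hx hy => by simp only [map_add, hx, hy]) x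
  intro i j a _ v hv _
  have h₁ : A.str.ρ (adams w A.str.ρ 0 a) = (adams w A.str.ρ 0).rTensor H (A.str.ρ a) :=
    equivariant_iff.2 (fun φ a => coact_adams hc A.str.isCoaction 0 a) a
  have h₂ := hV.graded.isSubrep.rTensor_restrict ⟨v, hv⟩
  rw [hV.red_smul_aux a hv, M.ρ_smul, h₁, M.ρ_smul, ← h₂]
  generalize hV.graded.isSubrep.restrict ⟨v, hv⟩ = η
  generalize A.str.ρ a = ξ
  induction ξ using TensorProduct.induction_on with
  | zero => simp
  | add s t hs ht => simp only [map_add, LinearMap.add_apply, hs, ht]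
  | tmul a h =>
    induction η using TensorProduct.induction_on with
    | zero => simp
    | add s t hs ht => simp only [map_add, hs, ht]
    | tmul v k =>
      simp only [LinearMap.rTensor_tmul, pairH_tmul]
      congr 1
      exact (hV.red_smul_aux a v.2).symm

variable (hA : A.IsAdamsConnected w)
include hA

theorem red_smul_mem (a : A) {v : M} (hv : v ∈ V) : hV.red w (a • v) = A.aug w a • v := by
  rw [hV.red_smul_aux a hv, hA.adams_zero, smul_assoc, one_smul]

theorem red_of_mem {v : M} (hv : v ∈ V) : hV.red w v = v := by
  have := hV.red_smul_aux (w := w) 1 hv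
  rwa [one_smul, A.str.isCoaction.mem_adamsPart_iff.1 hA.one_mem, one_smul] at this

theorem red_mem (x : M) : hV.red w x ∈ V := by
  refine hV.induction (p := fun x => hV.red w x ∈ V) ?_ (by simp)
    (fun x y hx hy => by rw [map_add]; exact add_mem hx hy) x
  intro i j a _ v hv _
  rw [hV.red_smul_mem hA a hv]
  exact V.smul_mem _ hv

/-- By multiplicativity of the augmentation, `red` is the map `M → ℚ ⊗_A M` followed by the
identification of the target with `V`. -/
theorem red_smul (a : A) (x : M) : hV.red w (a • x) = A.aug w a • hV.red w x := by
  refine hV.induction (p := fun x => hV.red w (a • x) = A.aug w a • hV.red w x) ?_ (by simp)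
    (fun x y hx hy => by rw [smul_add, map_add, map_add, hx, hy, smul_add]) x
  intro i j b _ v hv _
  rw [smul_smul, hV.red_smul_mem hA _ hv, hV.red_smul_mem hA _ hv, hA.aug_mul, mul_smul]

theorem red_gr {n : ℤ} {x : M} (hx : x ∈ M.str.gr n) : hV.red w x ∈ M.str.gr n := by
  rw [← M.str.proj_same hx]
  refine hV.induction (p := fun x => hV.red w (M.str.proj n x) ∈ M.str.gr n) ?_ (by simp)
    (fun x y hx hy => by rw [map_add, map_add]; exact add_mem hx hy) x
  intro i j a ha v hv hj
  have hav := M.smul_mem ha hj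
  by_cases h : i + j = n
  · subst h
    rw [M.str.proj_same hav, hV.red_smul_mem hA a hv]
    by_cases hi : i = 0
    · subst hi
      rw [zero_add]
      exact Submodule.smul_mem _ _ hj
    · rw [CDGA.aug_of_gr_ne hi ha, zero_smul]
      exact zero_mem _
  · rw [M.str.proj_of_ne h hav, map_zero]
    exact zero_mem _

/-- The augmentation kills `d a` and every `a` of nonzero degree, so in the Leibniz rule only the
scalar part of `a` contributes. The differential therefore descends to `V`. -/
theorem red_d (x : M) : hV.red w (M.str.d x) = hV.red w (M.str.d (hV.red w x)) := by
  refine hV.induction (p := fun x => hV.red w (M.str.d x) = hV.red w (M.str.d (hV.red w x))) ?_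
    (by simp) (fun x y hx hy => by simp only [map_add, hx, hy]) x
  intro i j a ha v hv _
  rw [M.leibniz v ha, map_add, hV.red_smul hA, CDGA.aug_d, zero_smul, zero_add,
    hV.red_smul_mem hA a hv, (hV.red w).map_smul, hV.red_smul hA, M.str.d.map_smul,
    (hV.red w).map_smul]
  by_cases hi : i = 0
  · subst hi
    rw [zpow_zero, one_smul]
  · rw [CDGA.aug_of_gr_ne hi ha, zero_smul, smul_zero]

theorem red_isGLin {k : ℤ} {h : M →ₗ[ℚ] M} (hh : IsGLin k h) (x : M) :
    hV.red w (h x) = hV.red w (h (hV.red w x)) := by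
  refine hV.induction (p := fun x => hV.red w (h x) = hV.red w (h (hV.red w x))) ?_
    (by simp) (fun x y hx hy => by simp only [map_add, hx, hy]) x
  intro i j a ha v hv _
  rw [hh.smul _ _ _ ha, map_smul, hV.red_smul hA, hV.red_smul_mem hA a hv, map_smul, map_smul]
  by_cases hi : i = 0
  · subst hi
    rw [zero_mul, zpow_zero, one_smul]
  · rw [CDGA.aug_of_gr_ne hi ha, zero_smul, smul_zero]

/-- Modulo its reduction, an element is a combination of terms `a v` with `a` of positive Adams
degree. If the total Adams degree is `r`, then `v` has Adams degree less than `r`. This gain drives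
both the cell filtration and the nilpotence argument. -/
theorem sub_red_mem (hc : IsCentralCochar w) {r : ℤ} {x : M} (hx : x ∈ adamsPart M.str.ρ w r) :
    x - hV.red w x ∈ lowSpan M w V r := by
  have key : ∀ x, adams w M.str.ρ r (x - hV.red w x) ∈ lowSpan M w V r := by
    intro x
    refine hV.induction (p := fun x => adams w M.str.ρ r (x - hV.red w x) ∈ lowSpan M w V r) ?_
      (by simp) (fun x y hx hy => by rw [map_add, add_sub_add_comm, map_add]; exact add_mem hx hy) x
    intro _ _ a _ v hv _
    refine A.str.isCoaction.adams_induction (w := w) A.str.isGraded_top.isSubrep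
      (p := fun a => adams w M.str.ρ r (a • v - hV.red w (a • v)) ∈ lowSpan M w V r) ?_ (by simp)
      (fun x y hx hy => by
        rw [add_smul, map_add, add_sub_add_comm, map_add]; exact add_mem hx hy)
      (x := a) trivial
    intro s a _ ha
    refine M.str.isCoaction.adams_induction (w := w) hV.graded.isSubrep
      (p := fun v => adams w M.str.ρ r (a • v - hV.red w (a • v)) ∈ lowSpan M w V r) ?_ (by simp)
      (fun x y hx hy => by
        rw [smul_add, map_add, add_sub_add_comm, map_add]; exact add_mem hx hy) hv
    intro t v hv ht
    rcases lt_trichotomy s 0 with hs | rfl | hs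
    · rw [hA.eq_zero hs ha, zero_smul, map_zero, sub_zero, map_zero]
      exact zero_mem _
    · rw [← hA.aug_eq ha, smul_assoc, one_smul, map_smul, hV.red_of_mem hA hv, sub_self, map_zero]
      exact zero_mem _
    · rw [hV.red_smul_mem hA a hv, CDGA.aug_of_ne hs.ne' ha, zero_smul, sub_zero]
      have hav := smul_mem_adamsPart ha ht
      by_cases h : s + t = r
      · subst h
        rw [M.str.isCoaction.mem_adamsPart_iff.1 hav]
        exact Submodule.smul_mem _ _ (Submodule.subset_span ⟨hv, t, by omega, ht⟩)
      · rw [M.str.isCoaction.adams_eq_zero (Ne.symm h) hav]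
        exact zero_mem _
  have := key x
  rwa [map_sub, M.str.isCoaction.mem_adamsPart_iff.1 hx, adams, hV.coact_red hc,
    show coact M.str.ρ (adamsFun w r) x = x from M.str.isCoaction.mem_adamsPart_iff.1 hx] at this

omit hA in
include hV in
-- Each vector has finitely many bihomogeneous components, and a finite generating set of `V` gives
-- a uniform bound. Using one `B` for both gradings simplifies the numbering of the cells.
theorem exists_bound (w : H →ₐc[ℚ] ℚ[T;T⁻¹]) : ∃ B : ℤ, 0 ≤ B ∧ ∀ v ∈ V, ∀ n r : ℤ,
    (n < -B ∨ B < n ∨ r < -B ∨ B < r) → adams w M.str.ρ r (M.str.proj n v) = 0 := by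
  have h1 : ∀ v : M, ∃ B : ℕ, ∀ B' : ℕ, B ≤ B' → ∀ n r : ℤ,
      (n < -B' ∨ B' < n ∨ r < -B' ∨ B' < r) → adams w M.str.ρ r (M.str.proj n v) = 0 := by
    intro v
    refine M.str.isGraded_top.adams_induction (w := w) (p := fun v => ∃ B : ℕ, ∀ B' : ℕ, B ≤ B' →
      ∀ n r : ℤ, (n < -B' ∨ B' < n ∨ r < -B' ∨ B' < r) → adams w M.str.ρ r (M.str.proj n v) = 0)
      ?_ ⟨0, by simp⟩ ?_ (x := v) trivial
    · intro m s x _ hm hs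
      refine ⟨m.natAbs + s.natAbs, fun B' hB n r h => ?_⟩
      by_cases hn : m = n
      · subst hn
        rw [M.str.proj_same hm, M.str.isCoaction.adams_eq_zero (by omega) hs]
      · rw [M.str.proj_of_ne hn hm, map_zero]
    · rintro x y ⟨B, hB⟩ ⟨C, hC⟩
      refine ⟨B + C, fun B' hB' n r h => ?_⟩
      rw [map_add, map_add, hB B' (by omega) n r h, hC B' (by omega) n r h, add_zero]
  choose f hf using h1
  have := hV.finite
  obtain ⟨S, hS⟩ := Module.Finite.iff_fg.1 this
  refine ⟨(S.sup f : ℕ), by omega, fun v hv n r h => ?_⟩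
  rw [← hS] at hv
  refine Submodule.span_induction (p := fun v _ => adams w M.str.ρ r (M.str.proj n v) = 0)
    ?_ (by simp) ?_ ?_ hv
  · exact fun v hv => hf v _ (Finset.le_sup hv) n r h
  · intro x y _ _ hx hy
    rw [map_add, map_add, hx, hy, add_zero]
  · intro c x _ hx
    rw [map_smul, map_smul, hx, smul_zero]

omit hA in
include hV in
theorem mem_of_homogeneous {B : ℤ} (hB : ∀ v ∈ V, ∀ n r : ℤ,
    (n < -B ∨ B < n ∨ r < -B ∨ B < r) → adams w M.str.ρ r (M.str.proj n v) = 0)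
    (P : Submodule ℚ M)
    (hP : ∀ n r : ℤ, -B ≤ n → n ≤ B → -B ≤ r → r ≤ B → ∀ v ∈ V, v ∈ M.str.gr n →
      v ∈ adamsPart M.str.ρ w r → v ∈ P) : V ≤ P := by
  intro v hv
  refine hV.graded.adams_induction (w := w) (p := fun v => v ∈ P) ?_ (zero_mem _)
    (fun _ _ => add_mem) hv
  intro n r v hv hn hr
  by_cases h : n < -B ∨ B < n ∨ r < -B ∨ B < r
  · have := hB v hv n r h
    rw [M.str.proj_same hn, M.str.isCoaction.mem_adamsPart_iff.1 hr] at this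
    rw [this]
    exact zero_mem _
  · push Not at h
    exact hP n r h.1 h.2.1 h.2.2.1 h.2.2.2 v hv hn hr

end IsFreeOn

end DGMod

end

/-! ### Cell structures from freeness; nilpotence of maps with zero reduction -/

noncomputable section

theorem coeLinearMap_injective_of_proj {M : Type*} [AddCommGroup M] [Module ℚ M] {J : Type*}
    [DecidableEq J] {V : J → Submodule ℚ M} (p : J → M →ₗ[ℚ] M)
    (h : ∀ i, ∀ x ∈ V i, ∀ j, p j x = if i = j then x else 0) :
    Function.Injective (DirectSum.coeLinearMap V) := by
  have key : ∀ (z : DirectSum J fun n => V n) (n : J),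
      p n (DirectSum.coeLinearMap V z) = (z n : M) := by
    intro z n
    induction z using DirectSum.induction_on with
    | zero => simp
    | of i x =>
      have e : DirectSum.coeLinearMap V (DirectSum.of (fun n => V n) i x) = x :=
        DirectSum.coeLinearMap_of V i x
      rw [e, h i x x.2]
      by_cases h : i = n
      · subst h; simp
      · rw [if_neg h, DirectSum.of_eq_of_ne _ _ _ (Ne.symm h)]; rfl
    | add x y hx hy => simp [hx, hy]
  intro z z' e
  refine DFinsupp.ext fun n => Subtype.ext ?_
  rw [← key z n, e, key]

variable {H : Type u} [CommRing H] [HopfAlgebra ℚ H]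
variable {A : CDGA H} {w : H →ₐc[ℚ] ℚ[T;T⁻¹]}

namespace DGMod

variable {M N : DGMod A}

namespace IsFreeOn

variable {V : Submodule ℚ M} (hV : IsFreeOn M V) (hA : A.IsAdamsConnected w)
include hV hA

/-- The differential of a generator splits into its reduction, which keeps the Adams degree and
raises the degree by one, and a remainder generated in lower Adams degrees, since `d` is
equivariant. -/
theorem span_bihomogeneous (hc : IsCentralCochar w) {n r : ℤ} {v : M}
    (hn : v ∈ M.str.gr n) (hr : v ∈ adamsPart M.str.ρ w r) :
    ∃ v' ∈ V, v' ∈ M.str.gr (n + 1) ∧ v' ∈ adamsPart M.str.ρ w r ∧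
      M.str.d v - v' ∈ lowSpan M w V r := by
  have hd : M.str.d v ∈ adamsPart M.str.ρ w r :=
    map_mem_adamsPart M.str.isCoaction M.str.isCoaction M.str.coact_d hr
  exact ⟨hV.red w (M.str.d v), hV.red_mem hA _, hV.red_gr hA (M.str.d_mem hn),
    map_mem_adamsPart M.str.isCoaction M.str.isCoaction (hV.coact_red hc) hd,
    hV.sub_red_mem hA hc hd⟩

/-- A module which is free on a finite-dimensional graded representation is a finite cell module:
the cells are ordered by their Adams degrees, and by their degrees. -/
theorem isFiniteCell (hc : IsCentralCochar w) : IsFiniteCell M := by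
  classical
  obtain ⟨B, hB0, hB⟩ := hV.exists_bound w
  let T : Set (ℤ × ℤ) := Set.Icc (-B) B ×ˢ Set.Icc (-B) B
  let J : Type u := ULift.{u} T
  have hJ : Finite J := by
    have : Finite T := ((Set.finite_Icc _ _).prod (Set.finite_Icc _ _)).to_subtype
    exact inferInstanceAs (Finite (ULift T))
  let _ : DecidableEq J := fun i j => Classical.propDecidable (i = j)
  let n : J → ℤ := fun j => j.down.1.1
  let r : J → ℤ := fun j => j.down.1.2
  have hn : ∀ j, -B ≤ n j ∧ n j ≤ B := fun j => j.down.2.1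
  have hr : ∀ j, -B ≤ r j ∧ r j ≤ B := fun j => j.down.2.2
  have hmk : ∀ m s : ℤ, -B ≤ m → m ≤ B → -B ≤ s → s ≤ B → ∃ j, n j = m ∧ r j = s :=
    fun m s h₁ h₂ h₃ h₄ => ⟨⟨⟨(m, s), ⟨⟨h₁, h₂⟩, h₃, h₄⟩⟩⟩, rfl, rfl⟩
  have hext : ∀ i j, n i = n j → r i = r j → i = j := fun i j h h' =>
    ULift.down_injective (Subtype.ext (Prod.ext h h'))
  let W : J → Submodule ℚ M := fun j => V ⊓ M.str.gr (n j) ⊓ adamsPart M.str.ρ w (r j)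
  have hWV : ⨆ j, W j = V := by
    refine le_antisymm (iSup_le fun j => inf_le_left.trans inf_le_left)
      (hV.mem_of_homogeneous hB _ ?_)
    intro m s h₁ h₂ h₃ h₄ v hv hm hs
    obtain ⟨j, rfl, rfl⟩ := hmk m s h₁ h₂ h₃ h₄
    exact Submodule.mem_iSup_of_mem j ⟨⟨hv, hm⟩, hs⟩
  have hinj : Function.Injective (DirectSum.coeLinearMap W) := by
    refine coeLinearMap_injective_of_proj
      (fun j => adams w M.str.ρ (r j) ∘ₗ M.str.proj (n j)) ?_
    rintro i x ⟨⟨-, hx⟩, hx'⟩ j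
    rw [LinearMap.comp_apply]
    by_cases e : n i = n j
    · rw [← e, M.str.proj_same hx]
      by_cases e' : r i = r j
      · rw [if_pos (hext i j e e'), ← e', M.str.isCoaction.mem_adamsPart_iff.1 hx']
      · rw [if_neg (by rintro rfl; exact e' rfl),
          M.str.isCoaction.adams_eq_zero (Ne.symm e') hx']
    · rw [if_neg (by rintro rfl; exact e rfl), M.str.proj_of_ne e hx, map_zero]
  -- The rank orders cells lexicographically: first by Adams degree, then by decreasing degree.
  -- Since `B - n` ranges over `0, …, 2B`, the factor `2B + 1` makes one unit of Adams degree
  -- outweigh every change of degree. The linear part of `d` lowers the rank by exactly one. Ranks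
  -- are nonnegative, so the stages `rank < k` start with the empty set.
  let rank : J → ℤ := fun j => (r j + B) * (2 * B + 1) + (B - n j)
  have hrank0 : ∀ j, 0 ≤ rank j := fun j => by
    have h₁ := hn j
    have h₂ := hr j
    have : 0 ≤ (r j + B) * (2 * B + 1) := mul_nonneg (by omega) (by omega)
    simp only [rank]
    omega
  -- A generator of smaller Adams degree decomposes into cells of strictly smaller rank, because the
  -- term `(r + B) * (2B + 1)` drops by at least `2B + 1`.
  have hlow : ∀ (j : J) (k : ℕ), rank j < k + 1 → lowSpan M w V (r j) ≤
      Submodule.span A (⋃ i ∈ {i | rank i < k}, (W i : Set M)) := by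
    intro j k hj
    refine Submodule.span_le.2 ?_
    rintro v ⟨hv, s, hs, hvs⟩
    have hvs' : v ∈ V ⊓ adamsPart M.str.ρ w s := ⟨hv, hvs⟩
    refine GComplex.IsGraded.induction (S := M.str) (W := V ⊓ adamsPart M.str.ρ w s)
      (p := fun v => v ∈ Submodule.span A (⋃ i ∈ {i | rank i < k}, (W i : Set M)))
      ⟨hV.graded.isSubrep.inf (isSubrep_adamsPart hc M.str.isCoaction s), fun m x hx =>
        ⟨hV.graded.proj m x hx.1, (M.str.isGraded_adamsPart hc s).proj m x hx.2⟩⟩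
      ?_ (zero_mem _) (fun _ _ => add_mem) hvs'
    rintro m x ⟨hx, hxs⟩ hm
    by_cases h : m < -B ∨ B < m ∨ s < -B ∨ B < s
    · have := hB x hx m s h
      rw [M.str.proj_same hm, M.str.isCoaction.mem_adamsPart_iff.1 hxs] at this
      rw [this]
      exact zero_mem _
    · push Not at h
      obtain ⟨i, rfl, rfl⟩ := hmk m s h.1 h.2.1 h.2.2.1 h.2.2.2
      refine Submodule.subset_span (Set.mem_iUnion₂.2 ⟨i, ?_, ⟨⟨hx, hm⟩, hxs⟩⟩)
      have h₁ := hn i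
      have h₂ := hn j
      have : (r i + B) * (2 * B + 1) + (2 * B + 1) ≤ (r j + B) * (2 * B + 1) := by
        nlinarith
      simp only [rank, Set.mem_ofPred_eq] at hj ⊢
      omega
  refine ⟨{
    J := J
    deg := n
    V := W
    finite := fun j => by
      have := hV.finite
      exact Submodule.finiteDimensional_of_le (S₂ := V) (inf_le_left.trans inf_le_left)
    isSubrep := fun j => (hV.graded.isSubrep.inf (M.str.isSubrep _)).inf
      (isSubrep_adamsPart hc M.str.isCoaction _)
    mem := fun j => inf_le_left.trans inf_le_right
    bijective := ?_
    step := fun k => {j | rank j < k}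
    step_zero := Set.eq_empty_of_forall_notMem fun j hj => by
      have := hrank0 j
      rw [Set.mem_ofPred_eq, Nat.cast_zero] at hj
      omega
    step_mono := fun k l hkl j hj => by
      have h₁ : rank j < k := hj
      have h₂ : k ≤ l := hkl
      change rank j < l
      omega
    step_union := Set.eq_univ_of_forall fun j =>
      Set.mem_iUnion.2 ⟨(rank j).toNat + 1, by
        have := hrank0 j
        simp only [Set.mem_ofPred_eq]
        omega⟩
    d_mem := ?_ }, hJ⟩
  · have h₁ := directSum_bijective_iff (A := A) W hinj
    have h₂ : Function.Bijective (liftA (A := A) (⨆ j, W j).subtype) := by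
      rw [hWV]; exact hV.bijective
    exact h₁.2 h₂
  · rintro k j hj v ⟨⟨hv, hvn⟩, hvr⟩
    have hj' : rank j < k + 1 := by
      have : rank j < ((k + 1 : ℕ) : ℤ) := hj
      push_cast at this
      exact this
    obtain ⟨v', hv', hn', hr', hd⟩ := hV.span_bihomogeneous hA hc hvn hvr
    rw [← sub_add_cancel (M.str.d v) v']
    refine add_mem (hlow j k hj' hd) ?_
    by_cases h : n j + 1 < -B ∨ B < n j + 1 ∨ r j < -B ∨ B < r j
    · have := hB v' hv' _ _ h
      rw [M.str.proj_same hn', M.str.isCoaction.mem_adamsPart_iff.1 hr'] at this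
      rw [this]
      exact zero_mem _
    · push Not at h
      obtain ⟨i, hi, hi'⟩ := hmk (n j + 1) (r j) h.1 h.2.1 h.2.2.1 h.2.2.2
      refine Submodule.subset_span (Set.mem_iUnion₂.2 ⟨i, ?_, ⟨⟨hv', ?_⟩, ?_⟩⟩)
      · simp only [rank, Set.mem_ofPred_eq, hi, hi'] at hj' ⊢
        omega
      · rwa [SetLike.mem_coe, hi]
      · rwa [SetLike.mem_coe, hi']

/-- Equivariant endomorphisms of degree zero with zero reduction are nilpotent. -/
theorem isNilpotent (hc : IsCentralCochar w) {h : Module.End ℚ M} (hh : IsGLin 0 h)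
    (h0 : ∀ v ∈ V, hV.red w (h v) = 0) : IsNilpotent h := by
  obtain ⟨B, hB0, hB⟩ := hV.exists_bound w
  -- As the reduction of `h v` vanishes, `h v` is generated in Adams degrees below that of `v`: each
  -- application of `h` lowers the filtration by one.
  have hlow : ∀ r, ∀ x ∈ lowSpan M w V (r + 1), h x ∈ lowSpan M w V r := by
    intro r x hx
    refine Submodule.span_induction (p := fun x _ => h x ∈ lowSpan M w V r) ?_ (by simp) ?_ ?_ hx
    · rintro v ⟨hv, s, hs, hvs⟩
      have h₁ := map_mem_adamsPart M.str.isCoaction M.str.isCoaction hh.coact hvs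
      have h₂ := hV.sub_red_mem hA hc h₁
      rw [h0 v hv, sub_zero] at h₂
      exact lowSpan_mono (by omega) h₂
    · intro x y _ _ hx hy
      rw [map_add]; exact add_mem hx hy
    · intro a x _ hx
      rw [hh.smul']
      exact Submodule.smul_mem _ a hx
  have hbot : lowSpan M w V (-B) = ⊥ := by
    refine (Submodule.span_eq_bot).2 ?_
    rintro v ⟨hv, s, hs, hvs⟩
    rw [← M.str.isCoaction.mem_adamsPart_iff.1 hvs]
    refine M.str.ext_proj fun n => ?_
    rw [map_zero, ← M.str.adams_proj]
    exact hB v hv n s (by omega)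
  have htop : ∀ x, x ∈ lowSpan M w V (B + 1) := by
    intro x
    have : Submodule.span A (V : Set M) ≤ lowSpan M w V (B + 1) := by
      refine Submodule.span_le.2 ?_
      have := hV.mem_of_homogeneous (w := w) hB
        ((lowSpan M w V (B + 1)).restrictScalars ℚ) fun n r _ _ _ hr v hv _ hvr =>
          Submodule.subset_span ⟨hv, r, by omega, hvr⟩
      exact this
    rw [hV.span_eq_top] at this
    exact this trivial
  have key : ∀ (k : ℕ) (r : ℤ), ∀ x ∈ lowSpan M w V (r + k), (h ^ k) x ∈ lowSpan M w V r := by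
    intro k
    induction k with
    | zero => intro r x hx; simpa using hx
    | succ k ih =>
      intro r x hx
      rw [pow_succ', Module.End.mul_apply]
      refine hlow r _ (ih (r + 1) x ?_)
      rw [show r + 1 + k = r + ((k + 1 : ℕ) : ℤ) by push_cast; ring]
      exact hx
  -- The generators have Adams degrees between `-B` and `B`, so the filtration is everything at `B +
  -- 1` and zero at `-B`; the difference of these indices is the exponent.
  refine ⟨(2 * B + 1).toNat, LinearMap.ext fun x => ?_⟩
  have := key (2 * B + 1).toNat (-B) x (by
    rw [show -B + ((2 * B + 1).toNat : ℤ) = B + 1 by omega]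
    exact htop x)
  rw [hbot] at this
  exact (Submodule.mem_bot A).1 this

end IsFreeOn

end DGMod

end

/-! ### Splitting homotopy idempotents -/

noncomputable section

variable {H : Type u} [CommRing H] [HopfAlgebra ℚ H]
variable {A : CDGA H} {w : H →ₐc[ℚ] ℚ[T;T⁻¹]}

namespace DGMod

variable {M N : DGMod A}

theorem map_liftA {X : Type u} [AddCommGroup X] [Module ℚ X] {h : M →ₗ[ℚ] N}
    (hs : ∀ (a : A) x, h (a • x) = a • h x) (g : X →ₗ[ℚ] M) (t : A ⊗[ℚ] X) :
    h (liftA g t) = liftA (h ∘ₗ g) t := by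
  induction t using TensorProduct.induction_on with
  | zero => simp
  | tmul a x => simp [hs]
  | add s t hs ht => simp only [map_add, hs, ht]

namespace IsFreeOn

variable {V : Submodule ℚ M} (hV : IsFreeOn M V) (hA : A.IsAdamsConnected w)
include hV hA

/-- The reduced differential `D` on the finite-dimensional `V` admits an equivariant `g` with `D g D
= D`, by reducibility. Extending `g` to a homotopy `k`, the morphism `f = 1 - (d k + k d)` satisfies
on reductions `D f = D - D g D = 0`. This takes the place of passing to a minimal model. -/
theorem exists_homotopic_id (hH : IsReductive H) (hc : IsCentralCochar w) :
    ∃ f : M ⟶ M, Homotopic f (𝟙 M) ∧ ∀ x, hV.red w (M.str.d (f.toLin x)) = 0 := by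
  have := hV.finite
  let S := hV.graded.str
  let ρV := hV.graded.isSubrep.restrict
  have hρV : IsCoaction ρV := hV.graded.isSubrep.isCoaction_restrict M.str.isCoaction
  let D : V →ₗ[ℚ] V := (hV.red w ∘ₗ M.str.d ∘ₗ V.subtype).codRestrict V fun v => hV.red_mem hA _
  have hDv : ∀ v : V, (D v : M) = hV.red w (M.str.d v) := fun v => rfl
  have hD : ∀ φ v, coact ρV φ (D v) = D (coact ρV φ v) := fun φ v => Subtype.ext (by
    rw [hV.graded.isSubrep.coact_restrict, hDv, hDv, hV.coact_red hc, M.str.coact_d,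
      hV.graded.isSubrep.coact_restrict])
  -- `q` is an equivariant projector to the image of `D` and `g` is a lift of it along `D`, so `D g
  -- = q` is the identity on that image.
  obtain ⟨q, hq, hqm, hqe⟩ := hH.exists_projector hρV (W := LinearMap.range D) (by
    rw [LinearMap.range_eq_map]
    exact IsSubrep.map hD (isSubrep_iff.2 fun _ _ _ => trivial))
  obtain ⟨g, hg, hgq⟩ := hH.exists_lift hρV hρV hD hq fun v => hqm v
  let k : M →ₗ[ℚ] M := hV.extend (-1) (S.homPart M.str (-1) (V.subtype ∘ₗ g))
  have hk : IsGLin (-1) k := hV.isGLin_extend (fun n v hv => S.homPart_mem M.str _ _ hv)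
    fun φ v => S.coact_homPart M.str φ (fun v => by
      refine (hV.graded.isSubrep.coact_restrict φ _).symm.trans ?_
      exact congrArg Subtype.val (hg φ v)) v
  have hkv : ∀ n, ∀ v : V, (v : M) ∈ M.str.gr n → k v = M.str.proj (n + -1) (g v) := fun n v hv => by
    rw [hV.extend_apply, S.homPart_apply M.str _ _ hv]
    rfl
  have hred : ∀ n x, M.str.proj n (hV.red w x) = hV.red w (M.str.proj n x) := fun n x => by
    have := GComplex.proj_comm (S := M.str) (S' := M.str) (f := hV.red w) (k := 0)
      (fun n x hx => by rw [add_zero]; exact hV.red_gr hA hx) n x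
    rwa [add_zero] at this
  -- Here `k` is given by a homogeneous component of `g`; as `D` raises degree by one, the identity
  -- `D g D = D` persists in each degree.
  have hdkd : ∀ v ∈ V, hV.red w (M.str.d (k (hV.red w (M.str.d v)))) = hV.red w (M.str.d v) := by
    intro v hv
    refine hV.graded.induction (p := fun v => hV.red w (M.str.d (k (hV.red w (M.str.d v)))) =
      hV.red w (M.str.d v)) ?_ (by simp) (fun x y hx hy => by simp only [map_add, hx, hy]) hv
    intro n v hv hn
    have hb := hV.red_gr hA (M.str.d_mem hn)
    have h₁ := hkv (n + 1) (D ⟨v, hv⟩) hb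
    rw [hDv, add_neg_cancel_right] at h₁
    rw [h₁, M.str.d_proj, ← hred, ← hDv, hgq, hqe _ ⟨_, rfl⟩]
    exact M.str.proj_same hb
  have hp : IsGLin 0 (LinearMap.id - (M.str.d ∘ₗ k + k ∘ₗ M.str.d) : M →ₗ[ℚ] M) := by
    have := (Hom.isGLin (𝟙 M)).sub hk.d_comm
    simpa using this
  let f : M ⟶ M := hp.hom fun x => by
    simp [M.str.d_d]
  have hfx : ∀ x, f.toLin x = x - (M.str.d (k x) + k (M.str.d x)) := fun x => rfl
  have hf : ∀ v ∈ V, hV.red w (M.str.d (f.toLin v)) = 0 := fun v hv => by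
    rw [hfx, map_sub, map_add, M.str.d_d, zero_add, map_sub, hV.red_d hA (k _),
      hV.red_isGLin hA hk, ← hV.red_d hA, hdkd v hv, sub_self]
  refine ⟨f, (homotopic_iff.2 ⟨k, hk, fun x => ?_⟩ : Homotopic (𝟙 M) f).symm, fun x => ?_⟩
  · rw [hfx, id_apply, sub_sub_cancel]
  · have := hV.red_isGLin hA f.isGLin x
    rw [LinearMap.restrictScalars_apply, LinearMap.restrictScalars_apply] at this
    rw [hV.red_d hA, this, ← hV.red_d hA]
    exact hf _ (hV.red_mem hA x)

omit hV hA in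
theorem _root_.DGMod.Homotopic.mul {a a' b b' : End M} (h : Homotopic a a') (h' : Homotopic b b') :
    Homotopic (a * b) (a' * b') :=
  (Homotopic.comp_left b h).trans (Homotopic.comp_right h' a')

omit hV hA in
theorem _root_.DGMod.Homotopic.pow_succ {a : End M} (h : Homotopic (a * a) a) (n : ℕ) :
    Homotopic (a ^ (n + 1)) a := by
  induction n with
  | zero => rw [zero_add, pow_one]; exact Homotopic.refl a
  | succ n ih =>
    rw [_root_.pow_succ]
    exact (Homotopic.mul ih (Homotopic.refl a)).trans h

omit hV hA in
theorem _root_.DGMod.Homotopic.pow {a b : End M} (h : Homotopic a b) (n : ℕ) :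
    Homotopic (a ^ n) (b ^ n) := by
  induction n with
  | zero => exact Homotopic.refl _
  | succ n ih =>
    rw [_root_.pow_succ, _root_.pow_succ]
    exact Homotopic.mul ih h

omit hV hA in
theorem _root_.DGMod.Homotopic.one_sub {a : End M} (h : Homotopic (a * a) a) :
    Homotopic ((1 - a) * (1 - a)) (1 - a) := by
  have : (1 - a) * (1 - a) = (1 - a) - (a - a * a) := by noncomm_ring
  rw [this]
  have h' := (Homotopic.refl (1 - a)).sub ((Homotopic.refl a).sub h)
  rwa [sub_self, sub_zero] at h'

/-- Endomorphisms which are idempotent up to homotopy are homotopic to idempotents. -/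
theorem exists_idempotent (hH : IsReductive H) (hc : IsCentralCochar w) (e : M ⟶ M)
    (he : Homotopic (e ≫ e) e) : ∃ e' : M ⟶ M, e' ≫ e' = e' ∧ Homotopic e' e := by
  obtain ⟨f, hf, hfd⟩ := hV.exists_homotopic_id hA hH hc
  -- Since `f` is homotopic to the identity, `a` is homotopic to `e`; flanking by `f` on both sides
  -- makes the reduced differential invisible.
  let a : End M := f ≫ e ≫ f
  have hfe : Homotopic (f ≫ e) e := by
    have := hf.comp_right e
    rwa [Category.id_comp] at this
  have hef : Homotopic (e ≫ f) e := by
    have := hf.comp_left e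
    rwa [Category.comp_id] at this
  have ha : Homotopic a e := by
    have := hef.comp_left f
    exact this.trans hfe
  have haa : Homotopic (a * a) a := (ha.mul ha).trans (he.trans ha.symm)
  -- `u` is null-homotopic because `e` is idempotent up to homotopy, and `a - a ^ 2` is exactly `f u
  -- f`.
  let u : M ⟶ M := e - e ≫ f ≫ f ≫ e
  have hu : Homotopic u 0 := by
    have h₁ : Homotopic (e ≫ f ≫ f ≫ e) e := by
      have := hef.comp_right (f ≫ e)
      rw [Category.assoc] at this
      exact this.trans ((hfe.comp_left e).trans he)
    have := (Homotopic.refl e).sub h₁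
    rwa [sub_self] at this
  obtain ⟨h, hh, hhe⟩ := homotopic_iff.1 hu
  have hau : a - a ^ 2 = f ≫ u ≫ f := by
    have : a ^ 2 = f ≫ e ≫ f ≫ f ≫ e ≫ f := by
      rw [pow_two, End.mul_def]
      simp only [a, Category.assoc]
    rw [this]
    simp only [u, Preadditive.sub_comp, Preadditive.comp_sub, Category.assoc, a]
  -- With `u = d h + h d`, one term of `f u f` begins, and the other ends, with a composite of `d`
  -- and `f`. The composite `d f` has zero reduction, and graded linear maps are compatible with
  -- reduction, so both terms reduce to zero.
  obtain ⟨n, hn⟩ := hV.isNilpotent hA hc (Hom.isGLin (f ≫ u ≫ f)) fun v _ => by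
    have h₁ := hh.comp_hom f
    rw [LinearMap.restrictScalars_apply, comp_apply, comp_apply]
    have h₂ := hhe (f.toLin v)
    rw [zero_apply, sub_zero] at h₂
    rw [h₂, map_add, map_add, f.d, hfd, zero_add]
    have h₃ := hV.red_isGLin hA h₁ (M.str.d (f.toLin v))
    rw [hfd, map_zero, map_zero] at h₃
    exact h₃
  have hpow : ∀ (b : End M) (n : ℕ), (Hom.toLin (b ^ n)).restrictScalars ℚ =
      ((Hom.toLin b).restrictScalars ℚ : Module.End ℚ M) ^ n := by
    intro b n
    induction n with
    | zero => rfl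
    | succ n ih => rw [pow_succ, pow_succ, ← ih]; rfl
  have hn' : (a - a ^ 2) ^ n = 0 := by
    rw [hau]
    refine hom_ext fun x => ?_
    exact LinearMap.congr_fun ((hpow (f ≫ u ≫ f) n).trans hn) x
  -- The exponent is raised to be positive, because only positive powers of a homotopy idempotent
  -- are homotopic to it.
  have hn'' : (a - a ^ 2) ^ (n + 1) = 0 := by rw [pow_succ, hn', zero_mul]
  -- The lifted idempotent is `1 - (1 - a ^ m) ^ m` with `m = n + 1`. Up to homotopy, `a` and `1 -
  -- a` are idempotent, so this expression is homotopic to `1 - (1 - a) = a`.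
  refine ⟨_, isIdempotentElem_one_sub_one_sub_pow_pow a (n + 1) hn'', Homotopic.trans ?_ ha⟩
  have h₁ : Homotopic (1 - a ^ (n + 1)) (1 - a) := (Homotopic.refl _).sub (haa.pow_succ n)
  have h₂ : Homotopic ((1 - a ^ (n + 1)) ^ (n + 1)) (1 - a) :=
    (h₁.pow (n + 1)).trans (haa.one_sub.pow_succ n)
  have h₃ := (Homotopic.refl (1 : End M)).sub h₂
  rwa [sub_sub_cancel] at h₃

omit hV hA in
theorem _root_.DGMod.isDGSub_range (e : M ⟶ N) : IsDGSub N (LinearMap.range e.toLin) where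
  proj n := by
    rintro _ ⟨x, rfl⟩
    have := GComplex.proj_comm (f := e.toLin.restrictScalars ℚ) e.isGLin.mem n x
    rw [add_zero] at this
    exact ⟨M.str.proj n x, this.symm⟩
  d := by
    rintro _ ⟨x, rfl⟩
    exact ⟨M.str.d x, e.d x⟩
  isSubrep := isSubrep_iff.2 fun φ => by
    rintro _ ⟨x, rfl⟩
    exact ⟨coact M.str.ρ φ x, (Hom.coact e φ x).symm⟩

/-- The image of an idempotent endomorphism is free. -/
theorem exists_isFreeOn_range (hc : IsCentralCochar w) (e : M ⟶ M) (he : e ≫ e = e) :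
    ∃ V', IsFreeOn (subMod M _ (isDGSub_range e)) V' := by
  have := hV.finite
  have hee : ∀ x, e.toLin (e.toLin x) = e.toLin x := fun x => by rw [← comp_apply, he]
  let e₀ : Module.End ℚ M := e.toLin.restrictScalars ℚ
  have he₀ : IsGLin 0 e₀ := e.isGLin
  -- `E` is the `A`-linear extension of the reduction of `e`. It need not commute with `d`; only the
  -- graded module structure is at stake here.
  let E : Module.End ℚ M := hV.extend 0 (hV.red w ∘ₗ e₀ ∘ₗ V.subtype)
  have hE : IsGLin 0 E := hV.isGLin_extend
    (fun n v hv => by rw [add_zero]; exact hV.red_gr hA (e.mem hv)) fun φ v => by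
      simp only [LinearMap.comp_apply, hV.coact_red hc, he₀.coact, Submodule.subtype_apply,
        hV.graded.isSubrep.coact_restrict]
  have hEv : ∀ v ∈ V, E v = hV.red w (e.toLin v) := fun v hv => hV.extend_apply 0 _ ⟨v, hv⟩
  have hEV : ∀ v ∈ V, E v ∈ V := fun v hv => by rw [hEv v hv]; exact hV.red_mem hA _
  have hre : ∀ x, hV.red w (e.toLin (hV.red w x)) = hV.red w (e.toLin x) := fun x =>
    (hV.red_isGLin hA he₀ x).symm
  have hEE : ∀ x, E (E x) = E x := by
    have hEE' : IsGLin 0 (E ∘ₗ E) := by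
      have := hE.comp hE
      rwa [add_zero] at this
    refine LinearMap.congr_fun (hV.eq_of_isGLin hEE' hE fun v hv => ?_)
    rw [LinearMap.comp_apply, hEv _ (hEV v hv), hEv v hv, hre, hee]
  -- The usual intertwiner of two idempotents: `e U = e E = U E`. Its reduction is the identity, so
  -- `1 - U` is nilpotent and `U` is invertible, carrying the image of `E`, which is free on `E(V)`,
  -- to the image of `e`.
  let U : Module.End ℚ M := e₀ * E + (1 - e₀) * (1 - E)
  have hone : IsGLin 0 (1 : Module.End ℚ M) := Hom.isGLin (𝟙 M)
  have hmul : ∀ {a b : Module.End ℚ M}, IsGLin 0 a → IsGLin 0 b → IsGLin 0 (a * b) :=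
    fun ha hb => by
      have := ha.comp hb
      rwa [add_zero] at this
  have hU : IsGLin 0 U := (hmul he₀ hE).add (hmul (hone.sub he₀) (hone.sub hE))
  have hUx : ∀ x, U x = e.toLin (E x) + ((x - E x) - e.toLin (x - E x)) := fun x => rfl
  have hUE : ∀ x, U (E x) = e.toLin (E x) := fun x => by
    rw [hUx, hEE, sub_self, map_zero, sub_zero, add_zero]
  have heU : ∀ x, e.toLin (U x) = e.toLin (E x) := fun x => by
    rw [hUx, map_add, map_sub, hee, hee, sub_self, add_zero]
  have hUunit : IsUnit U := by
    have : IsNilpotent (1 - U) := hV.isNilpotent hA hc (hone.sub hU) fun v hv => by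
      rw [LinearMap.sub_apply, Module.End.one_apply, hUx, map_sub (hV.red w), map_add, map_sub,
        map_sub e.toLin, map_sub, map_sub, hV.red_of_mem hA hv, hV.red_of_mem hA (hEV v hv),
        hEv v hv, hre, hee]
      abel
    have := this.isUnit_one_sub
    rwa [sub_sub_cancel] at this
  let U' : M ≃ₗ[ℚ] M := LinearEquiv.ofBijective U ((Module.End.isUnit_iff U).1 hUunit)
  have hU' : ∀ x, U' x = U x := fun _ => rfl
  let V'' : Submodule ℚ M := V.map (e₀ * E)
  have hgr : M.str.IsGraded V'' := by
    refine ⟨IsSubrep.map (hmul he₀ hE).coact hV.graded.isSubrep, fun n => ?_⟩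
    rintro _ ⟨v, hv, rfl⟩
    have := GComplex.proj_comm (hmul he₀ hE).mem n v
    rw [add_zero] at this
    exact ⟨_, hV.graded.proj n v hv, this.symm⟩
  let i := subι M _ (isDGSub_range e)
  let i₀ : subMod M _ (isDGSub_range e) →ₗ[ℚ] M := i.toLin.restrictScalars ℚ
  let V' : Submodule ℚ (subMod M _ (isDGSub_range e)) := V''.comap i₀
  have hi : Function.Injective i₀ := subι_injective _
  -- From `U (E v) = e (E v)`, the inverse of `U` carries the new generators back into `V`, so
  -- freeness of `M` on `V` yields injectivity.
  have hs : ∀ x : V', U'.symm (i₀ x) ∈ V := by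
    rintro ⟨x, v, hv, hx⟩
    have : U'.symm (i₀ x) = E v := by
      rw [LinearEquiv.symm_apply_eq, hU', hUE, ← hx]
      rfl
    rw [this]
    exact hEV v hv
  let σ : V' →ₗ[ℚ] V := (U'.symm.toLinearMap ∘ₗ i₀ ∘ₗ V'.subtype).codRestrict V hs
  have hσ : Function.Injective σ := fun x y hxy =>
    Subtype.ext (hi (U'.symm.injective (congrArg Subtype.val hxy)))
  have hUσ : U ∘ₗ V.subtype ∘ₗ σ = i₀ ∘ₗ V'.subtype :=
    LinearMap.ext fun x => U'.apply_symm_apply _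
  refine ⟨V', FiniteDimensional.of_injective σ hσ, ⟨IsSubrep.comap
    (fun φ x => Hom.coact i φ x) hgr.isSubrep, fun n x hx => ?_⟩, fun s t hst => ?_, fun x => ?_⟩
  · have := GComplex.proj_comm i.isGLin.mem n x
    rw [add_zero] at this
    change i₀ _ ∈ V''
    rw [← this]
    exact hgr.proj n _ hx
  · have h₁ := congrArg i₀ hst
    rw [map_liftA (h := i₀) i.isGLin.smul', map_liftA (h := i₀) i.isGLin.smul', ← hUσ,
      ← map_liftA hU.smul', ← map_liftA hU.smul'] at h₁
    have h₂ := U'.injective h₁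
    rw [liftA_comp, liftA_comp] at h₂
    exact Module.Flat.lTensor_preserves_injective_linearMap _ hσ (hV.bijective.1 h₂)
  · obtain ⟨m, hm⟩ : i₀ x ∈ LinearMap.range e.toLin := subι_mem _ x
    obtain ⟨t, ht⟩ := hV.bijective.2 (U'.symm (i₀ x))
    -- For `x` in the image of `e` one has `x = e x = e U (U⁻¹ x) = e E (U⁻¹ x)`; expanding `U⁻¹ x`
    -- over `V` expresses `x` through `e E (V)`.
    have hx : i₀ x = (e₀ * E) (U'.symm (i₀ x)) := by
      change _ = e.toLin (E _)
      rw [← heU, ← hU', LinearEquiv.apply_symm_apply, ← hm, hee]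
    let τ : V →ₗ[ℚ] V' :=
      LinearMap.codRestrict V' ((subLift (isDGSub_range e) e fun x => ⟨x, rfl⟩).toLin.restrictScalars
        ℚ ∘ₗ E ∘ₗ V.subtype) fun v => ⟨v, v.2, rfl⟩
    refine ⟨τ.lTensor A t, hi ?_⟩
    rw [← liftA_comp, map_liftA (h := i₀) i.isGLin.smul', hx, ← ht,
      map_liftA (hmul he₀ hE).smul']
    rfl

end IsFreeOn

/-- Homotopy idempotents of finite cell modules split. -/
theorem exists_split (hH : IsReductive H) (hc : IsCentralCochar w) (hA : A.IsAdamsConnected w)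
    (hM : IsFiniteCell M) (e : M ⟶ M) (he : Homotopic (e ≫ e) e) :
    ∃ (N : DGMod A) (i : N ⟶ M) (r : M ⟶ N), IsFiniteCell N ∧ i ≫ r = 𝟙 N ∧
      Homotopic (r ≫ i) e := by
  obtain ⟨c, hcf⟩ := hM
  obtain ⟨e', he', hee'⟩ := c.isFreeOn.exists_idempotent hA hH hc e he
  obtain ⟨V', hV'⟩ := c.isFreeOn.exists_isFreeOn_range hA hc e' he'
  refine ⟨_, subι M _ (isDGSub_range e'), subLift (isDGSub_range e') e' fun x => ⟨x, rfl⟩,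
    hV'.isFiniteCell hA hc, hom_ext fun x => subι_injective _ ?_, hee'⟩
  obtain ⟨m, hm⟩ := subι_mem _ x
  change e'.toLin ((subι M _ (isDGSub_range e')).toLin x) = (subι M _ (isDGSub_range e')).toLin x
  rw [← hm, ← comp_apply, he']

end DGMod

end

/-! ### Retracts of finite cell modules; assertions 2 and 3 -/

noncomputable section

variable {H : Type u} [CommRing H] [HopfAlgebra ℚ H]
variable {A : CDGA H} {w : H →ₐc[ℚ] ℚ[T;T⁻¹]}

namespace DGMod

variable {M N : DGMod A}

/-- A retract determines an idempotent on a finite cell module in the derived category. It is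
represented by a homotopy idempotent, which splits through a finite cell module, and two splittings
of one idempotent are isomorphic. -/
theorem finiteD_of_retract (hH : IsReductive H) (hc : IsCentralCochar w)
    (hA : A.IsAdamsConnected w) (hM : IsFiniteCell M) {X : DCat A}
    (r : Retract X ((toDCat A).obj M)) : finiteD A X := by
  obtain ⟨e, he⟩ := exists_map_toD hH hM (r.r ≫ r.i)
  have hee : Homotopic (e ≫ e) e := by
    rw [← toD_map_eq_iff hH hM, Functor.map_comp, he, Category.assoc, r.retract_assoc]
  obtain ⟨N, i, q, hN, hiq, hqi⟩ := exists_split hH hc hA hM e hee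
  rw [← toD_map_eq_iff hH hM, he, Functor.map_comp] at hqi
  refine ⟨N, hN, ⟨⟨r.i ≫ (toDCat A).map q, (toDCat A).map i ≫ r.r, ?_, ?_⟩⟩⟩
  · rw [Category.assoc, ← Category.assoc ((toDCat A).map q), hqi, Category.assoc, r.retract_assoc,
      r.retract]
  · rw [Category.assoc, ← Category.assoc r.r, ← hqi, Category.assoc, ← Functor.map_comp, hiq,
      CategoryTheory.Functor.map_id, Category.comp_id, ← Functor.map_comp, hiq,
      CategoryTheory.Functor.map_id]

/-- An idempotent is transported to a finite cell module, represented by a homotopy idempotent and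
split there; the splitting is then transported back. -/
theorem isIdempotentComplete_finiteD (hH : IsReductive H) (hc : IsCentralCochar w)
    (hA : A.IsAdamsConnected w) : IsIdempotentComplete (finiteD A).FullSubcategory := by
  refine ⟨fun ⟨X, M, hM, ⟨φ⟩⟩ p hp => ?_⟩
  have hp' : p.hom ≫ p.hom = p.hom := congrArg InducedCategory.Hom.hom hp
  obtain ⟨e, he⟩ := exists_map_toD hH hM (φ.inv ≫ p.hom ≫ φ.hom)
  have hee : Homotopic (e ≫ e) e := by
    rw [← toD_map_eq_iff hH hM, Functor.map_comp, he]
    simp only [Category.assoc, Iso.hom_inv_id_assoc]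
    rw [reassoc_of% hp']
  obtain ⟨N, i, q, hN, hiq, hqi⟩ := exists_split hH hc hA hM e hee
  rw [← toD_map_eq_iff hH hM, he, Functor.map_comp] at hqi
  refine ⟨⟨(toDCat A).obj N, N, hN, ⟨Iso.refl _⟩⟩, ⟨(toDCat A).map i ≫ φ.inv⟩,
    ⟨φ.hom ≫ (toDCat A).map q⟩, InducedCategory.hom_ext ?_, InducedCategory.hom_ext ?_⟩
  · change ((toDCat A).map i ≫ φ.inv) ≫ φ.hom ≫ (toDCat A).map q = 𝟙 _
    rw [Category.assoc, Iso.inv_hom_id_assoc, ← Functor.map_comp, hiq,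
      CategoryTheory.Functor.map_id]
  · change (φ.hom ≫ (toDCat A).map q) ≫ (toDCat A).map i ≫ φ.inv = p.hom
    rw [Category.assoc, reassoc_of% hqi]
    simp

/-- The projection from a direct sum to the first summand. -/
theorem exists_retraction {S N' : DGMod A} (i : N ⟶ S) (i' : N' ⟶ S)
    (h : Function.Bijective fun z : N × N' => i.toLin z.1 + i'.toLin z.2) :
    ∃ r : S ⟶ N, i ≫ r = 𝟙 N := by
  let e : (N × N') ≃ₗ[A] S := LinearEquiv.ofBijective (i.toLin.coprod i'.toLin) h
  let r : S →ₗ[A] N := LinearMap.fst A N N' ∘ₗ e.symm.toLinearMap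
  have hr : ∀ x y, r (i.toLin x + i'.toLin y) = x := fun x y => by
    have : e.symm (i.toLin x + i'.toLin y) = (x, y) := by
      rw [LinearEquiv.symm_apply_eq]; rfl
    change (e.symm _).1 = x
    rw [this]
  have hs : ∀ s, ∃ x y, i.toLin x + i'.toLin y = s := fun s => by
    obtain ⟨⟨x, y⟩, hxy⟩ := h.2 s
    exact ⟨x, y, hxy⟩
  refine ⟨Hom.ofCoact r (fun n s hsn => ?_) (fun s => ?_) (fun φ s => ?_), hom_ext fun x => ?_⟩
  · obtain ⟨x, y, rfl⟩ := hs s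
    have h₁ := GComplex.proj_comm (f := i.toLin.restrictScalars ℚ) i.isGLin.mem n x
    have h₂ := GComplex.proj_comm (f := i'.toLin.restrictScalars ℚ) i'.isGLin.mem n y
    rw [add_zero, LinearMap.restrictScalars_apply, LinearMap.restrictScalars_apply] at h₁ h₂
    have h₃ := S.str.proj_same hsn
    rw [map_add, h₁, h₂] at h₃
    rw [← h₃, hr]
    exact N.str.proj_mem n x
  · obtain ⟨x, y, rfl⟩ := hs s
    rw [map_add, ← i.d, ← i'.d, hr, hr]
  · obtain ⟨x, y, rfl⟩ := hs s
    rw [hr, map_add (coact S.str.ρ φ), Hom.coact, Hom.coact, hr]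
  · rw [comp_apply, Hom.ofCoact_apply, id_apply]
    simpa using hr x 0

/-- Needed as the complement when a finite cell module is regarded as a summand of itself. -/
theorem isCell_zeroMod (hc : IsCentralCochar w) (hA : A.IsAdamsConnected w) :
    IsCell (zeroMod A) := by
  have : IsFreeOn (zeroMod A) ⊥ := by
    refine ⟨inferInstance, GComplex.isGraded_bot, fun s t _ => ?_, fun x => ⟨0, rfl⟩⟩
    have : Subsingleton (A ⊗[ℚ] (⊥ : Submodule ℚ (zeroMod A))) :=
      inferInstance
    exact Subsingleton.elim s t
  obtain ⟨c, -⟩ := this.isFiniteCell hA hc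
  exact ⟨c⟩

theorem cellSummandK_of_isFiniteCell (hc : IsCentralCochar w) (hA : A.IsAdamsConnected w)
    (hM : IsFiniteCell M) : cellSummandK A ((toK A).obj M) := by
  obtain ⟨c, hc'⟩ := hM
  refine ⟨⟨c⟩, M, ⟨c, hc'⟩, zeroMod A, M, 𝟙 M, 0, isCell_zeroMod hc hA, ⟨?_, fun x => ?_⟩,
    ⟨Iso.refl _⟩⟩
  · intro z z' h
    have h' : z.1 + 0 = z'.1 + 0 := h
    rw [add_zero, add_zero] at h'
    exact Prod.ext h' (Subsingleton.elim (α := PUnit) _ _)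
  · exact ⟨(x, 0), add_zero x⟩

theorem exists_retract_of_cellSummandK {X : KCat A} (hX : cellSummandK A X) :
    ∃ M : DGMod A, IsFiniteCell M ∧ Nonempty (Retract X ((toK A).obj M)) := by
  obtain ⟨-, M, hM, N', S, i, i', -, hb, ⟨e⟩⟩ := hX
  obtain ⟨r, hr⟩ := exists_retraction i i' hb
  refine ⟨M, hM, ⟨⟨(toK A).map i ≫ e.inv, e.hom ≫ (toK A).map r, ?_⟩⟩⟩
  rw [Category.assoc, Iso.inv_hom_id_assoc, ← Functor.map_comp, hr]
  exact (toK A).map_id _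

theorem finiteD_of_cellSummandK (hH : IsReductive H) (hc : IsCentralCochar w)
    (hA : A.IsAdamsConnected w) {X : KCat A} (hX : cellSummandK A X) :
    finiteD A ((quasiIsoK A).Q.obj X) := by
  obtain ⟨M, hM, ⟨r⟩⟩ := exists_retract_of_cellSummandK hX
  exact finiteD_of_retract hH hc hA hM (r.map (quasiIsoK A).Q)

/-- Objects of the source are retracts of finite cell modules in the homotopy category, so
localization is bijective on their morphisms. Essential surjectivity holds because finite cell
modules themselves belong to the source. -/
theorem isEquivalence_cellSummandK (hH : IsReductive H) (hc : IsCentralCochar w)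
    (hA : A.IsAdamsConnected w)
    (h : ∀ X : (cellSummandK A).FullSubcategory,
      finiteD A (((cellSummandK A).ι ⋙ (quasiIsoK A).Q).obj X)) :
    ((finiteD A).lift ((cellSummandK A).ι ⋙ (quasiIsoK A).Q) h).IsEquivalence := by
  have key : ∀ X Y : (cellSummandK A).FullSubcategory,
      Function.Bijective fun f : X.obj ⟶ Y.obj => (quasiIsoK A).Q.map f := fun X Y => by
    obtain ⟨M, hM, ⟨r⟩⟩ := exists_retract_of_cellSummandK X.property
    exact Q_map_bijective hH hM r Y.obj
  have h₁ : ((finiteD A).lift ((cellSummandK A).ι ⋙ (quasiIsoK A).Q) h).Full := ⟨fun {X Y} f => by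
    obtain ⟨g, hg⟩ := (key X Y).2 f.hom
    exact ⟨⟨g⟩, InducedCategory.hom_ext hg⟩⟩
  have h₂ : ((finiteD A).lift ((cellSummandK A).ι ⋙ (quasiIsoK A).Q) h).Faithful :=
    ⟨fun {X Y} f g hfg => InducedCategory.hom_ext
      ((key X Y).1 (congrArg (fun k => k.hom) hfg))⟩
  have h₃ : ((finiteD A).lift ((cellSummandK A).ι ⋙ (quasiIsoK A).Q) h).EssSurj := by
    refine ⟨fun ⟨Y, M, hM, ⟨e⟩⟩ => ⟨⟨(toK A).obj M, cellSummandK_of_isFiniteCell hc hA hM⟩, ⟨?_⟩⟩⟩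
    exact (finiteD A).isoMk e.symm
  exact {}

end DGMod

end

/-! ### Free graded modules `A ⊗ Y` with a prescribed differential -/

noncomputable section

variable {H : Type u} [CommRing H] [HopfAlgebra ℚ H]

namespace GComplex

variable {X Y : Type u} [AddCommGroup X] [Module ℚ X] [AddCommGroup Y] [Module ℚ Y]
variable (S : GComplex H X) (S' : GComplex H Y)

/-- The grading of the tensor product of two graded representations. -/
def tensGr (n : ℤ) : Submodule ℚ (X ⊗[ℚ] Y) :=
  Submodule.span ℚ {z | ∃ (p q : ℤ) (x : X) (y : Y), x ∈ S.gr p ∧ y ∈ S'.gr q ∧ p + q = n ∧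
    z = x ⊗ₜ y}

variable {S S'}

theorem tmul_mem_tensGr {p q n : ℤ} {x : X} {y : Y} (hx : x ∈ S.gr p) (hy : y ∈ S'.gr q)
    (h : p + q = n) : x ⊗ₜ y ∈ tensGr S S' n :=
  Submodule.subset_span ⟨p, q, x, y, hx, hy, h, rfl⟩

theorem tensGr_le {n : ℤ} {W : Submodule ℚ (X ⊗[ℚ] Y)}
    (h : ∀ p q x y, x ∈ S.gr p → y ∈ S'.gr q → p + q = n → x ⊗ₜ y ∈ W) : tensGr S S' n ≤ W := by
  refine Submodule.span_le.2 ?_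
  rintro _ ⟨p, q, x, y, hx, hy, e, rfl⟩
  exact h p q x y hx hy e

variable (S S')

theorem tens_induction {p : X ⊗[ℚ] Y → Prop}
    (hom : ∀ i j, ∀ x ∈ S.gr i, ∀ y ∈ S'.gr j, p (x ⊗ₜ y)) (zero : p 0)
    (add : ∀ s t, p s → p t → p (s + t)) (t : X ⊗[ℚ] Y) : p t := by
  induction t using TensorProduct.induction_on with
  | zero => exact zero
  | add s t hs ht => exact add _ _ hs ht
  | tmul x y =>
    refine S.induction (p := fun x => p (x ⊗ₜ y)) ?_ (by simpa using zero) ?_ x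
    · intro i x hx
      refine S'.induction (p := fun y => p (x ⊗ₜ y)) ?_ (by simpa using zero) ?_ y
      · exact fun j y hy => hom i j x hx y hy
      · intro y y' h h'
        rw [TensorProduct.tmul_add]; exact add _ _ h h'
    · intro x x' h h'
      rw [TensorProduct.add_tmul]; exact add _ _ h h'

theorem tensGr_isInternal : DirectSum.IsInternal (tensGr S S') := by
  let g : ∀ p, S.gr p →ₗ[ℚ] Y →ₗ[ℚ] ℤ →₀ X ⊗[ℚ] Y := fun p =>
    { toFun := fun x => S'.glue fun q => Finsupp.lsingle (p + q) ∘ₗ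
        TensorProduct.mk ℚ X Y x ∘ₗ (S'.gr q).subtype
      map_add' := fun x x' => S'.hom_ext fun q y hy => by
        rw [LinearMap.add_apply]
        simp only [S'.glue_apply _ hy]
        simp
      map_smul' := fun c x => S'.hom_ext fun q y hy => by
        rw [LinearMap.smul_apply]
        simp only [S'.glue_apply _ hy]
        simp [TensorProduct.smul_tmul'] }
  have hg : ∀ p q x y, x ∈ S.gr p → y ∈ S'.gr q →
      TensorProduct.lift (S.glue g) (x ⊗ₜ y) = Finsupp.single (p + q) (x ⊗ₜ y) := by
    intro p q x y hx hy
    rw [TensorProduct.lift.tmul, S.glue_apply _ hx]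
    change S'.glue _ y = _
    rw [S'.glue_apply _ hy]
    rfl
  refine isInternal_of (TensorProduct.lift (S.glue g)) ?_ ?_
  · refine tens_induction S S' (fun i j x hx y hy => ?_) (zero_mem _) fun _ _ => add_mem
    exact Submodule.mem_iSup_of_mem (i + j) (tmul_mem_tensGr hx hy rfl)
  · intro n t ht
    have : tensGr S S' n ≤ LinearMap.ker (TensorProduct.lift (S.glue g) - Finsupp.lsingle n) := by
      refine tensGr_le fun p q x y hx hy e => ?_
      rw [LinearMap.mem_ker, LinearMap.sub_apply, hg p q x y hx hy, e, Finsupp.lsingle_apply,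
        sub_self]
    exact sub_eq_zero.1 (this ht)

/-- The coaction on the tensor product of two representations. -/
def tensCoaction : X ⊗[ℚ] Y →ₗ[ℚ] (X ⊗[ℚ] Y) ⊗[ℚ] H :=
  TensorProduct.lift ((pairH H (TensorProduct.mk ℚ X Y)).compl₁₂ S.ρ S'.ρ)

theorem tensCoaction_tmul (x : X) (y : Y) : tensCoaction S S' (x ⊗ₜ y) =
    pairH H (TensorProduct.mk ℚ X Y) (S.ρ x) (S'.ρ y) := rfl

theorem isCoaction_tensCoaction : IsCoaction (tensCoaction S S') where
  counit t := by
    induction t using TensorProduct.induction_on with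
    | zero => simp
    | add s t hs ht => simp only [map_add, hs, ht]
    | tmul x y =>
      rw [tensCoaction_tmul, DGMod.pairH_counit, S.isCoaction.counit, S'.isCoaction.counit]
      rfl
  coassoc t := by
    induction t using TensorProduct.induction_on with
    | zero => simp
    | add s t hs ht => simp only [map_add, hs, ht]
    | tmul x y =>
      rw [tensCoaction_tmul, DGMod.pairH_rTensor (tensCoaction_tmul S S'), S.isCoaction.coassoc,
        S'.isCoaction.coassoc, DGMod.pairH_comul]

theorem isSubrep_tensGr (n : ℤ) : IsSubrep (tensCoaction S S') (tensGr S S' n) := by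
  intro t ht
  have : tensGr S S' n ≤ (LinearMap.range ((tensGr S S' n).subtype.rTensor H)).comap
      (tensCoaction S S') := by
    refine tensGr_le fun p q x y hx hy e => ?_
    rw [Submodule.mem_comap, tensCoaction_tmul]
    exact DGMod.pairH_mem (fun x hx y hy => tmul_mem_tensGr hx hy e) (S.isSubrep p x hx)
      (S'.isSubrep q y hy)
  exact this ht

end GComplex

variable {A : CDGA H}

/-- The map `a ⊗ y ↦ a τ (y)`. -/
def smulLift {Y : Type u} [AddCommGroup Y] [Module ℚ Y] (τ : Y →ₗ[ℚ] A ⊗[ℚ] Y) :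
    A ⊗[ℚ] Y →ₗ[ℚ] A ⊗[ℚ] Y :=
  TensorProduct.lift ((Algebra.lsmul (A := A) ℚ ℚ (A ⊗[ℚ] Y)).toLinearMap.compl₂ τ)

variable (A) in
/-- The data for a differential on the free graded module `A ⊗ Y`. -/
structure Twist (Y : Type u) [AddCommGroup Y] [Module ℚ Y] where
  S : GComplex H Y
  τ : Y →ₗ[ℚ] A ⊗[ℚ] Y
  τ_mem : ∀ n, ∀ y ∈ S.gr n, τ y ∈ GComplex.tensGr A.str S (n + 1)
  τ_ρ : ∀ y, GComplex.tensCoaction A.str S (τ y) = τ.rTensor H (S.ρ y)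
  d_τ : ∀ y, (A.str.d.rTensor Y + smulLift τ ∘ₗ A.str.sgn.rTensor Y) (τ y) = 0

namespace Twist

variable {Y : Type u} [AddCommGroup Y] [Module ℚ Y] (T : Twist A Y)

/-- The differential. -/
def d : A ⊗[ℚ] Y →ₗ[ℚ] A ⊗[ℚ] Y :=
  A.str.d.rTensor Y + smulLift T.τ ∘ₗ A.str.sgn.rTensor Y

theorem d_tmul {p : ℤ} {a : A} (ha : a ∈ A.str.gr p) (y : Y) :
    T.d (a ⊗ₜ y) = A.str.d a ⊗ₜ y + (-1 : ℚ) ^ p • a • T.τ y := by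
  rw [d, LinearMap.add_apply, LinearMap.comp_apply, LinearMap.rTensor_tmul, LinearMap.rTensor_tmul,
    A.str.sgn_apply ha, smulLift, TensorProduct.lift.tmul]
  congr 1
  exact smul_assoc ((-1 : ℚ) ^ p) a (T.τ y)

theorem d_smul {p : ℤ} {a : A} (ha : a ∈ A.str.gr p) (t : A ⊗[ℚ] Y) :
    T.d (a • t) = A.str.d a • t + (-1 : ℚ) ^ p • a • T.d t := by
  refine GComplex.tens_induction A.str T.S (p := fun t => T.d (a • t) =
    A.str.d a • t + (-1 : ℚ) ^ p • a • T.d t) ?_ (by simp) ?_ t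
  · intro i j b hb y _
    rw [TensorProduct.smul_tmul', T.d_tmul hb, smul_eq_mul, T.d_tmul (A.mul_mem ha hb),
      A.leibniz b ha, TensorProduct.add_tmul, smul_add, smul_add, TensorProduct.smul_tmul',
      TensorProduct.smul_tmul', smul_eq_mul, smul_eq_mul, negOne_add, mul_smul, mul_smul, add_assoc,
      smul_comm a ((-1 : ℚ) ^ i), TensorProduct.smul_tmul']
  · intro s t hs ht
    simp only [smul_add, map_add, hs, ht]
    abel

/-- On `a ⊗ y` the two cross terms `d a · τ y` have opposite signs, and the remaining term is `a · d
(τ y)`, which vanishes by the axiom on `τ`. -/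
theorem d_d (t : A ⊗[ℚ] Y) : T.d (T.d t) = 0 := by
  refine GComplex.tens_induction A.str T.S (p := fun t => T.d (T.d t) = 0) ?_ (by simp)
    (fun s t hs ht => by rw [map_add, map_add, hs, ht, add_zero]) t
  intro i j a ha y _
  have := T.d_τ y
  change T.d (T.τ y) = 0 at this
  rw [T.d_tmul ha, map_add, map_smul, T.d_smul ha, T.d_tmul (A.str.d_mem ha), this, A.str.d_d,
    negOne_succ]
  rw [TensorProduct.zero_tmul, zero_add, smul_zero, smul_zero, add_zero]
  generalize A.str.d a • T.τ y = z
  rw [← add_smul, neg_add_cancel, zero_smul]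

theorem d_mem {n : ℤ} {t : A ⊗[ℚ] Y} (ht : t ∈ GComplex.tensGr A.str T.S n) :
    T.d t ∈ GComplex.tensGr A.str T.S (n + 1) := by
  have hs : ∀ p q (a : A), a ∈ A.str.gr p → ∀ t ∈ GComplex.tensGr A.str T.S q,
      a • t ∈ GComplex.tensGr A.str T.S (p + q) := by
    intro p q a ha t ht
    have : GComplex.tensGr A.str T.S q ≤ (GComplex.tensGr A.str T.S (p + q)).comap
        (Algebra.lsmul ℚ ℚ (A ⊗[ℚ] Y) a) := GComplex.tensGr_le fun i j b y hb hy e => by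
      change a • (b ⊗ₜ[ℚ] y) ∈ GComplex.tensGr A.str T.S (p + q)
      rw [TensorProduct.smul_tmul']
      exact GComplex.tmul_mem_tensGr (A.mul_mem ha hb) hy (by omega)
    exact this ht
  have : GComplex.tensGr A.str T.S n ≤ (GComplex.tensGr A.str T.S (n + 1)).comap T.d :=
    GComplex.tensGr_le fun p q a y ha hy e => by
      rw [Submodule.mem_comap, T.d_tmul ha]
      refine add_mem (GComplex.tmul_mem_tensGr (A.str.d_mem ha) hy (by omega))
        (Submodule.smul_mem _ _ ?_)
      have := hs p _ a ha _ (T.τ_mem q y hy)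
      rwa [← add_assoc, e] at this
  exact this ht

theorem ρ_smul (a : A) (t : A ⊗[ℚ] Y) : GComplex.tensCoaction A.str T.S (a • t) =
    pairH H (Algebra.lsmul ℚ ℚ (A ⊗[ℚ] Y)).toLinearMap (A.str.ρ a)
      (GComplex.tensCoaction A.str T.S t) := by
  induction t using TensorProduct.induction_on with
  | zero => simp
  | add s t hs ht => simp only [smul_add, map_add, hs, ht]
  | tmul b y =>
    rw [TensorProduct.smul_tmul', GComplex.tensCoaction_tmul, GComplex.tensCoaction_tmul,
      smul_eq_mul, A.ρ_mul]
    have : A.str.ρ a * A.str.ρ b = pairH H (LinearMap.mul ℚ A) (A.str.ρ a) (A.str.ρ b) := by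
      generalize A.str.ρ a = ξ
      generalize A.str.ρ b = η
      induction ξ using TensorProduct.induction_on with
      | zero => simp
      | add s t hs ht => simp only [map_add, LinearMap.add_apply, add_mul, hs, ht]
      | tmul x h =>
        induction η using TensorProduct.induction_on with
        | zero => simp
        | add s t hs ht => simp only [map_add, mul_add, hs, ht]
        | tmul y k => simp
    rw [this]
    exact DGMod.pairH_assoc (fun x y z => rfl) _ _ _

theorem ρ_d (t : A ⊗[ℚ] Y) : GComplex.tensCoaction A.str T.S (T.d t) =
    T.d.rTensor H (GComplex.tensCoaction A.str T.S t) := by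
  refine GComplex.tens_induction A.str T.S (p := fun t => GComplex.tensCoaction A.str T.S (T.d t) =
    T.d.rTensor H (GComplex.tensCoaction A.str T.S t)) ?_ (by simp)
    (fun s t hs ht => by simp only [map_add, hs, ht]) t
  intro p q a ha y _
  rw [T.d_tmul ha, map_add, map_smul, T.ρ_smul, T.τ_ρ, GComplex.tensCoaction_tmul,
    GComplex.tensCoaction_tmul, A.str.ρ_d]
  obtain ⟨ξ, hξ⟩ := A.str.isSubrep p a ha
  rw [← hξ]
  clear hξ
  generalize T.S.ρ y = η
  induction ξ using TensorProduct.induction_on with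
  | zero => simp
  | add s t hs ht =>
    simp only [map_add, LinearMap.add_apply, smul_add, ← hs, ← ht]
    exact add_add_add_comm _ _ _ _
  | tmul b h =>
    induction η using TensorProduct.induction_on with
    | zero => simp
    | add s t hs ht =>
      simp only [map_add, smul_add, ← hs, ← ht]
      exact add_add_add_comm _ _ _ _
    | tmul y k =>
      simp only [LinearMap.rTensor_tmul, pairH_tmul, Submodule.subtype_apply,
        TensorProduct.mk_apply, T.d_tmul b.2, TensorProduct.add_tmul]
      rfl

/-- The dg module `A ⊗ Y` with the differential given by `τ`. -/
def toMod : DGMod A where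
  carrier := A ⊗[ℚ] Y
  str :=
    { gr := GComplex.tensGr A.str T.S
      isInternal := GComplex.tensGr_isInternal A.str T.S
      d := T.d
      d_mem := T.d_mem
      d_d := T.d_d
      ρ := GComplex.tensCoaction A.str T.S
      isCoaction := GComplex.isCoaction_tensCoaction A.str T.S
      isSubrep := GComplex.isSubrep_tensGr A.str T.S
      ρ_d := T.ρ_d }
  smul_mem {p q a t} ha ht := by
    have : GComplex.tensGr A.str T.S q ≤ (GComplex.tensGr A.str T.S (p + q)).comap
        (Algebra.lsmul ℚ ℚ (A ⊗[ℚ] Y) a) := GComplex.tensGr_le fun i j b y hb hy e => by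
      change a • (b ⊗ₜ[ℚ] y) ∈ GComplex.tensGr A.str T.S (p + q)
      rw [TensorProduct.smul_tmul']
      exact GComplex.tmul_mem_tensGr (A.mul_mem ha hb) hy (by omega)
    exact this ht
  leibniz t ha := T.d_smul ha t
  ρ_smul := T.ρ_smul

/-- The element `a ⊗ y`. -/
def gen (a : A) : Y →ₗ[ℚ] T.toMod := TensorProduct.mk ℚ A Y a

theorem smul_gen (a b : A) (y : Y) : a • T.gen b y = T.gen (a * b) y :=
  TensorProduct.smul_tmul' a b y

theorem gen_eq_smul (a : A) (y : Y) : T.gen a y = a • T.gen 1 y := by rw [smul_gen, mul_one]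

theorem gen_mem {p q n : ℤ} {a : A} {y : Y} (ha : a ∈ A.str.gr p) (hy : y ∈ T.S.gr q)
    (h : p + q = n) : T.gen a y ∈ T.toMod.str.gr n := GComplex.tmul_mem_tensGr ha hy h

theorem gen_one_mem {n : ℤ} {y : Y} (hy : y ∈ T.S.gr n) : T.gen 1 y ∈ T.toMod.str.gr n :=
  T.gen_mem A.one_mem hy (zero_add n)

/-- The differential of `1 ⊗ y`. -/
def tau : Y →ₗ[ℚ] T.toMod := T.τ

theorem d_gen {p : ℤ} {a : A} (ha : a ∈ A.str.gr p) (y : Y) :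
    T.toMod.str.d (T.gen a y) = T.gen (A.str.d a) y + (-1 : ℚ) ^ p • a • T.tau y := T.d_tmul ha y

theorem d_gen_one (y : Y) : T.toMod.str.d (T.gen 1 y) = T.tau y := by
  rw [T.d_gen A.one_mem, DGMod.d_one, zpow_zero, one_smul, one_smul]
  change TensorProduct.mk ℚ A Y 0 y + _ = _
  rw [map_zero, LinearMap.zero_apply]
  exact zero_add (T.tau y)

theorem coact_gen_one (φ : H →ₗ[ℚ] ℚ) (y : Y) :
    coact T.toMod.str.ρ φ (T.gen 1 y) = T.gen 1 (coact T.S.ρ φ y) := by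
  refine equivariant_iff (f := T.gen 1).1 (fun y => ?_) φ y
  change pairH H (TensorProduct.mk ℚ A Y) (A.str.ρ 1) (T.S.ρ y) = _
  rw [A.ρ_one]
  generalize T.S.ρ y = η
  induction η using TensorProduct.induction_on with
  | zero => rw [map_zero, map_zero]; rfl
  | add s t hs ht => rw [map_add, map_add, hs, ht]; rfl
  | tmul y k =>
    rw [pairH_tmul, one_mul]
    rfl

theorem induction {p : T.toMod → Prop} (hom : ∀ i j, ∀ a ∈ A.str.gr i, ∀ y ∈ T.S.gr j,
    p (T.gen a y)) (zero : p 0) (add : ∀ s t, p s → p t → p (s + t)) (t : T.toMod) : p t :=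
  GComplex.tens_induction A.str T.S hom zero add t

/-- The retraction of `A` to `ℚ · 1` recovers `y` from `1 ⊗ y`. -/
theorem gen_one_injective : Function.Injective (T.gen 1) := by
  obtain ⟨π, hπ, -⟩ := A.unit_summand
  intro y y' h
  have h' := congrArg ((TensorProduct.lid ℚ Y).toLinearMap ∘ₗ π.rTensor Y) h
  have e : ∀ y, ((TensorProduct.lid ℚ Y).toLinearMap ∘ₗ π.rTensor Y) (T.gen 1 y) = y := fun y => by
    change (TensorProduct.lid ℚ Y) (π.rTensor Y (1 ⊗ₜ y)) = y
    rw [LinearMap.rTensor_tmul, hπ, TensorProduct.lid_tmul, one_smul]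
  rwa [e, e] at h'

variable {N : DGMod A}

/-- The map of degree `k` with prescribed values on the generators. -/
def ext (k : ℤ) (g : Y →ₗ[ℚ] N) : T.toMod →ₗ[ℚ] N :=
  DGMod.liftA g ∘ₗ (A.twist k).rTensor Y

theorem ext_gen (k : ℤ) (g : Y →ₗ[ℚ] N) (a : A) (y : Y) :
    T.ext k g (T.gen a y) = A.twist k a • g y := rfl

theorem ext_gen_one (k : ℤ) (g : Y →ₗ[ℚ] N) (y : Y) : T.ext k g (T.gen 1 y) = g y := by
  rw [ext_gen, CDGA.twist_one, one_smul]

theorem isGLin_ext {k : ℤ} {g : Y →ₗ[ℚ] N} (hg : ∀ n, ∀ y ∈ T.S.gr n, g y ∈ N.str.gr (n + k))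
    (hc : ∀ φ y, coact N.str.ρ φ (g y) = g (coact T.S.ρ φ y)) : DGMod.IsGLin k (T.ext k g) := by
  refine ⟨fun n t ht => ?_, fun p a t ha => ?_, equivariant_iff.1 fun t => ?_⟩
  · have : GComplex.tensGr A.str T.S n ≤ (N.str.gr (n + k)).comap (T.ext k g) :=
      GComplex.tensGr_le fun p q a y ha hy e => by
        have h := N.smul_mem (CDGA.twist_mem ha k) (hg q y hy)
        rw [← add_assoc, e] at h
        exact h
    exact this ht
  · refine T.induction (p := fun t => T.ext k g (a • t) = (-1 : ℚ) ^ (p * k) • a • T.ext k g t) ?_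
      (by simp) (fun s t hs ht => by simp only [smul_add, map_add, hs, ht]) t
    intro i j b hb y _
    rw [smul_gen, ext_gen, ext_gen, CDGA.twist_mul, CDGA.twist_apply ha, mul_smul, smul_assoc]
  · refine T.induction (p := fun t => N.str.ρ (T.ext k g t) =
      (T.ext k g).rTensor H (T.toMod.str.ρ t)) ?_ (by simp)
      (fun s t hs ht => by simp only [map_add, hs, ht]) t
    intro i j a _ y _
    have h₁ : A.str.ρ (A.twist k a) = (A.twist k).rTensor H (A.str.ρ a) :=
      (equivariant_iff (f := A.twist k) (ρ := A.str.ρ) (ρ' := A.str.ρ)).2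
        (fun φ a => CDGA.coact_twist φ k a) a
    rw [ext_gen, N.ρ_smul, h₁, equivariant_iff.2 hc]
    let e : A ⊗[ℚ] Y →ₗ[ℚ] N := DGMod.liftA g ∘ₗ (A.twist k).rTensor Y
    have h₂ : ∀ ξ η, e.rTensor H (pairH H (TensorProduct.mk ℚ A Y) ξ η) =
        pairH H (Algebra.lsmul (A := A) ℚ ℚ N).toLinearMap ((A.twist k).rTensor H ξ)
          (g.rTensor H η) := fun ξ η => DGMod.pairH_map (e := e) (fun a y => rfl) ξ η
    exact (h₂ _ _).symm

theorem ext_eq {k : ℤ} {f f' : T.toMod →ₗ[ℚ] N} (hf : DGMod.IsGLin k f) (hf' : DGMod.IsGLin k f')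
    (h : ∀ n, ∀ y ∈ T.S.gr n, f (T.gen 1 y) = f' (T.gen 1 y)) : f = f' := by
  refine LinearMap.ext fun t => ?_
  refine T.induction (p := fun t => f t = f' t) ?_ (by simp)
    (fun s t hs ht => by rw [map_add, map_add, hs, ht]) t
  intro i j a ha y hy
  rw [gen_eq_smul, hf.smul _ _ _ ha, hf'.smul _ _ _ ha, h j y hy]

/-- Morphisms out of `A ⊗ Y`. -/
theorem exists_hom {g : Y →ₗ[ℚ] N} (hg : ∀ n, ∀ y ∈ T.S.gr n, g y ∈ N.str.gr n)
    (hc : ∀ φ y, coact N.str.ρ φ (g y) = g (coact T.S.ρ φ y))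
    (hd : ∀ n, ∀ y ∈ T.S.gr n, T.ext 0 g (T.tau y) = N.str.d (g y)) :
    ∃ f : T.toMod ⟶ N, ∀ a y, f.toLin (T.gen a y) = a • g y := by
  have h := T.isGLin_ext (k := 0) (g := g) (fun n y hy => by rw [add_zero]; exact hg n y hy) hc
  refine ⟨h.hom fun t => ?_, fun a y => by rw [DGMod.IsGLin.hom_apply, ext_gen, CDGA.twist_zero]⟩
  have e := T.ext_eq (f := DGMod.bdry 0 (T.ext 0 g)) (f' := 0) h.d_comm .zero fun n y hy => by
    rw [DGMod.bdry_apply, ext_gen_one, zpow_zero, one_smul, T.d_gen_one, hd n y hy, sub_self]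
    rfl
  have := LinearMap.congr_fun e t
  rw [DGMod.bdry_apply, zpow_zero, one_smul, LinearMap.zero_apply, sub_eq_zero] at this
  exact this.symm

theorem isFreeOn [FiniteDimensional ℚ Y] : DGMod.IsFreeOn T.toMod (LinearMap.range (T.gen 1)) := by
  refine ⟨inferInstance, ⟨isSubrep_iff.2 fun φ => ?_, fun n => ?_⟩, ?_⟩
  · rintro _ ⟨y, rfl⟩
    exact ⟨_, (T.coact_gen_one φ y).symm⟩
  · rintro _ ⟨y, rfl⟩
    have := GComplex.proj_comm (S := T.S) (S' := T.toMod.str) (f := T.gen 1) (k := 0)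
      (fun n y hy => by rw [add_zero]; exact T.gen_one_mem hy) n y
    rw [add_zero] at this
    exact ⟨_, this.symm⟩
  · let e := LinearEquiv.ofInjective (T.gen 1) T.gen_one_injective
    have h : ∀ t, DGMod.liftA (A := A) (LinearMap.range (T.gen 1)).subtype (e.toLinearMap.lTensor A t)
        = t := by
      intro t
      rw [← DGMod.liftA_comp]
      induction t using TensorProduct.induction_on with
      | zero => rw [map_zero]; rfl
      | add s t hs ht => rw [map_add, hs, ht]; rfl
      | tmul a y =>
        rw [DGMod.liftA_tmul]
        exact (T.gen_eq_smul a y).symm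
    have hb : Function.Bijective (e.toLinearMap.lTensor A) :=
      (LinearEquiv.lTensor A e).bijective
    have hc : (DGMod.liftA (A := A) (LinearMap.range (T.gen 1)).subtype) ∘
        (e.toLinearMap.lTensor A) = id := funext h
    exact (Function.Bijective.of_comp_iff _ hb).1 (by rw [hc]; exact Function.bijective_id)

end Twist

end

/-! ### Homogeneous bases and flatness of finite cell modules -/

noncomputable section

variable {H : Type u} [CommRing H] [HopfAlgebra ℚ H] {A : CDGA H}

theorem negOne_congr {m n : ℤ} (c : ℤ) (h : m = n + 2 * c) : (-1 : ℚ) ^ m = (-1 : ℚ) ^ n := by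
  rw [h, negOne_add, zpow_mul]
  simp

namespace DGMod

variable {M N N' T T' : DGMod A}

/-- The tensor product with a quasi-isomorphism, in coordinates. -/
theorem isQuasiIso_of_coord {ι : Type*} [Fintype ι] [DecidableEq ι] (rank : ι → ℕ) (s : ι → ℚ)
    (hs : ∀ i, s i * s i = 1) {w : N ⟶ N'} (hw : IsQuasiIso w) (f : T ⟶ T')
    (e : ι → N →ₗ[ℚ] T) (κ : ι → T →ₗ[ℚ] N) (e' : ι → N' →ₗ[ℚ] T') (κ' : ι → T' →ₗ[ℚ] N')
    (h : ∀ t, ∑ i, e i (κ i t) = t) (h' : ∀ t, ∑ i, e' i (κ' i t) = t)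
    (hκ : ∀ i j n, κ j (e i n) = if i = j then n else 0)
    (hκ' : ∀ i j n, κ' j (e' i n) = if i = j then n else 0)
    (hd : ∀ i j n, rank i ≤ rank j →
      κ j (T.str.d (e i n)) = if i = j then s j • N.str.d n else 0)
    (hd' : ∀ i j n, rank i ≤ rank j →
      κ' j (T'.str.d (e' i n)) = if i = j then s j • N'.str.d n else 0)
    (hf : ∀ i n, f.toLin (e i n) = e' i (w.toLin n)) : IsQuasiIso f := by
  have hfκ : ∀ i t, κ' i (f.toLin t) = w.toLin (κ i t) := by
    intro i t
    conv_lhs => rw [← h t]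
    rw [map_sum, map_sum]
    simp only [hf, hκ', Finset.sum_ite_eq', Finset.mem_univ, if_true]
  -- Cross terms of the differential strictly lower the rank. For an element supported in ranks at
  -- most `k`, the coordinates of rank `k` therefore see only the diagonal term `± d`.
  have hdκ : ∀ k, ∀ t, (∀ i, k + 1 ≤ rank i → κ i t = 0) → ∀ j, k ≤ rank j →
      κ j (T.str.d t) = s j • N.str.d (κ j t) := by
    intro k t ht j hj
    conv_lhs => rw [← h t]
    rw [map_sum, map_sum, Finset.sum_eq_single j]
    · rw [hd j j _ le_rfl, if_pos rfl]
    · intro i _ hij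
      by_cases hi : rank i ≤ rank j
      · rw [hd i j _ hi, if_neg hij]
      · rw [ht i (by omega), map_zero, map_zero, map_zero]
    · simp
  have hdκ' : ∀ k, ∀ t, (∀ i, k + 1 ≤ rank i → κ' i t = 0) → ∀ j, k ≤ rank j →
      κ' j (T'.str.d t) = s j • N'.str.d (κ' j t) := by
    intro k t ht j hj
    conv_lhs => rw [← h' t]
    rw [map_sum, map_sum, Finset.sum_eq_single j]
    · rw [hd' j j _ le_rfl, if_pos rfl]
    · intro i _ hij
      by_cases hi : rank i ≤ rank j
      · rw [hd' i j _ hi, if_neg hij]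
      · rw [ht i (by omega), map_zero, map_zero, map_zero]
    · simp
  -- Descent on the highest rank present: bounding the top coordinates through `w` and subtracting
  -- the result leaves a cycle of the cone supported in lower ranks.
  have key : ∀ k, ∀ x y, (∀ i, k ≤ rank i → κ i x = 0) → (∀ i, k ≤ rank i → κ' i y = 0) →
      T.str.d x = 0 → T'.str.d y = f.toLin x →
      ∃ x' y', T.str.d x' = x ∧ f.toLin x' + T'.str.d y' = y := by
    intro k
    induction k with
    | zero =>
      intro x y hx hy _ _
      have hx0 : x = 0 := by
        rw [← h x]; exact Finset.sum_eq_zero fun i _ => by rw [hx i (Nat.zero_le _), map_zero]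
      have hy0 : y = 0 := by
        rw [← h' y]; exact Finset.sum_eq_zero fun i _ => by rw [hy i (Nat.zero_le _), map_zero]
      exact ⟨0, 0, by rw [map_zero, hx0], by rw [map_zero, map_zero, add_zero, hy0]⟩
    | succ k ih =>
      intro x y hx hy hdx hdy
      have hex : ∀ i, ∃ (x' : N) (y' : N'), (rank i = k → N.str.d x' = κ i x ∧
          w.toLin x' + N'.str.d y' = s i • κ' i y) ∧ (rank i ≠ k → x' = 0 ∧ y' = 0) := by
        intro i
        by_cases hi : rank i = k
        · have e₁ : N.str.d (κ i x) = 0 := by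
            have := hdκ k x hx i hi.ge
            rw [hdx, map_zero] at this
            have := congrArg (s i • ·) this
            simpa [smul_smul, hs] using this.symm
          have e₂ : N'.str.d (s i • κ' i y) = w.toLin (κ i x) := by
            rw [map_smul, ← hdκ' k y hy i hi.ge, hdy, hfκ]
          obtain ⟨x', y', h₁, h₂⟩ := hw.exists_bounding e₁ e₂
          exact ⟨x', y', fun _ => ⟨h₁, h₂⟩, fun h => absurd hi h⟩
        · exact ⟨0, 0, fun h => absurd h hi, fun _ => ⟨rfl, rfl⟩⟩
      choose x' y' h₁ h₂ using hex
      -- The sign `s i` compensates the one in the diagonal term of the differential, so that `d X`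
      -- has exactly the coordinates of `x` in rank `k`.
      let X := ∑ i, e i (s i • x' i)
      let Y := ∑ i, e' i (y' i)
      have hX : ∀ i, κ i X = s i • x' i := fun i => by
        simp only [X, map_sum, hκ, Finset.sum_ite_eq', Finset.mem_univ, if_true]
      have hY : ∀ i, κ' i Y = y' i := fun i => by
        simp only [Y, map_sum, hκ', Finset.sum_ite_eq', Finset.mem_univ, if_true]
      have hX0 : ∀ i, k + 1 ≤ rank i → κ i X = 0 := fun i hi => by
        rw [hX, (h₂ i (by omega)).1, smul_zero]
      have hY0 : ∀ i, k + 1 ≤ rank i → κ' i Y = 0 := fun i hi => by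
        rw [hY, (h₂ i (by omega)).2]
      have c₁ : ∀ i, k ≤ rank i → κ i (x - T.str.d X) = 0 := by
        intro i hi
        rw [map_sub, hdκ k X hX0 i hi, hX, map_smul, smul_smul, hs, one_smul]
        by_cases hik : rank i = k
        · rw [(h₁ i hik).1, sub_self]
        · rw [(h₂ i hik).1, map_zero, sub_zero, hx i (by omega)]
      have c₂ : ∀ i, k ≤ rank i → κ' i (y - f.toLin X - T'.str.d Y) = 0 := by
        intro i hi
        rw [map_sub, map_sub, hdκ' k Y hY0 i hi, hY, hfκ, hX]
        by_cases hik : rank i = k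
        · have := congrArg (s i • ·) (h₁ i hik).2
          simp only [smul_smul, hs, one_smul, smul_add] at this
          rw [← this, LinearMap.map_smul_of_tower]
          abel
        · rw [(h₂ i hik).1, (h₂ i hik).2, smul_zero, map_zero, map_zero, smul_zero, sub_zero,
            sub_zero, hy i (by omega)]
      obtain ⟨x'', y'', e₁, e₂⟩ := ih _ _ c₁ c₂ (by rw [map_sub, hdx, T.str.d_d, sub_zero])
        (by rw [map_sub, map_sub, T'.str.d_d, sub_zero, hdy, map_sub, f.d])
      refine ⟨X + x'', Y + y'', by rw [map_add, e₁]; abel, ?_⟩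
      rw [map_add, map_add]
      have : f.toLin X + f.toLin x'' + (T'.str.d Y + T'.str.d y'') =
        f.toLin X + T'.str.d Y + (f.toLin x'' + T'.str.d y'') := by abel
      rw [this, e₂]
      abel
  refine .of_bounding fun x y hx hy => key (Finset.univ.sup rank + 1) x y ?_ ?_ hx hy
  all_goals
    intro i hi
    have := Finset.le_sup (f := rank) (Finset.mem_univ i)
    omega

end DGMod

/-- A retraction of `A` onto `ℚ · 1`. -/
def CDGA.unitPart (A : CDGA H) : A →ₗ[ℚ] ℚ := A.unit_summand.choose

theorem CDGA.unitPart_one : A.unitPart 1 = 1 := A.unit_summand.choose_spec.1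

theorem CDGA.unitPart_of_ne {n : ℤ} (h : n ≠ 0) {a : A} (ha : a ∈ A.str.gr n) :
    A.unitPart a = 0 := A.unit_summand.choose_spec.2.1 n h a ha

namespace DGMod

/-- A homogeneous basis of a dg module whose span over `ℚ` is a subrepresentation, and on which
the differential is triangular. -/
structure HBasis (ι : Type u) [Fintype ι] [DecidableEq ι] (M : DGMod A) where
  b : Module.Basis ι A M
  deg : ι → ℤ
  mem : ∀ i, b i ∈ M.str.gr (deg i)
  rank : ι → ℕ
  d_mem : ∀ j, M.str.d (b j) ∈ Submodule.span A (b '' {i | rank i < rank j})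
  mat : Matrix ι ι H
  ρ_b : ∀ j, M.str.ρ (b j) = ∑ i, b i ⊗ₜ mat i j

namespace HBasis

variable {ι : Type u} [Fintype ι] [DecidableEq ι] {M N P : DGMod A} (B : HBasis ι M)

theorem induction {p : M → Prop} (hom : ∀ n i, ∀ a ∈ A.str.gr n, p (a • B.b i)) (zero : p 0)
    (add : ∀ x y, p x → p y → p (x + y)) (x : M) : p x := by
  rw [← B.b.sum_repr x]
  refine Finset.sum_induction _ p add zero fun i _ => ?_
  exact A.str.induction (p := fun a => p (a • B.b i)) (fun n a ha => hom n i a ha)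
    (by simpa using zero) (fun a a' h h' => by rw [add_smul]; exact add _ _ h h') _

/-- The coordinates. -/
def coord (i : ι) : M →ₗ[ℚ] A := (B.b.coord i).restrictScalars ℚ

theorem coord_smul (i : ι) (a : A) (x : M) : B.coord i (a • x) = a * B.coord i x :=
  (B.b.coord i).map_smul a x

theorem coord_b (i j : ι) : B.coord i (B.b j) = if j = i then 1 else 0 := by
  change B.b.repr (B.b j) i = _
  rw [B.b.repr_self, Finsupp.single_apply]

theorem coord_smul_b (i j : ι) (a : A) : B.coord i (a • B.b j) = if j = i then a else 0 := by
  rw [coord_smul, coord_b, mul_ite, mul_one, mul_zero]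

theorem sum_coord (x : M) : ∑ i, B.coord i x • B.b i = x := B.b.sum_repr x

theorem coord_mem (i : ι) {q : ℤ} {x : M} (hx : x ∈ M.str.gr q) :
    B.coord i x ∈ A.str.gr (q - B.deg i) := by
  have h : ∀ i (a : A), M.str.proj q (a • B.b i) = A.str.proj (q - B.deg i) a • B.b i := by
    intro i a
    have := GComplex.proj_comm (S := A.str) (S' := M.str) (k := B.deg i)
      (f := (LinearMap.toSpanSingleton A M (B.b i)).restrictScalars ℚ)
      (fun n a ha => M.smul_mem ha (B.mem i)) (q - B.deg i) a
    rwa [sub_add_cancel] at this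
  have e : ∑ i, A.str.proj (q - B.deg i) (B.coord i x) • B.b i = x := by
    conv_rhs => rw [← M.str.proj_same hx, ← B.sum_coord x, map_sum]
    exact Finset.sum_congr rfl fun i _ => (h i _).symm
  have := congrArg (B.coord i) e
  simp only [map_sum, coord_smul_b, Finset.sum_ite_eq', Finset.mem_univ, if_true] at this
  rw [← this]
  exact A.str.proj_mem _ _

/-- The coordinates modulo the complement of `ℚ · 1`. -/
def rcoord (i : ι) : M →ₗ[ℚ] ℚ := A.unitPart ∘ₗ B.coord i

theorem rcoord_b (i j : ι) : B.rcoord i (B.b j) = if j = i then 1 else 0 := by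
  rw [rcoord, LinearMap.comp_apply, coord_b]
  split_ifs
  · exact A.unitPart_one
  · exact map_zero _

/-- The coordinates of an element of `M ⊗ C`. -/
def tcoord (C : Type*) [AddCommGroup C] [Module ℚ C] (i : ι) : M ⊗[ℚ] C →ₗ[ℚ] C :=
  (TensorProduct.lid ℚ C).toLinearMap ∘ₗ (B.rcoord i).rTensor C

theorem tcoord_tmul {C : Type*} [AddCommGroup C] [Module ℚ C] (i : ι) (x : M) (c : C) :
    B.tcoord C i (x ⊗ₜ c) = B.rcoord i x • c := by simp [tcoord]

theorem tcoord_sum {C : Type*} [AddCommGroup C] [Module ℚ C] (i : ι) (c : ι → C) :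
    B.tcoord C i (∑ j, B.b j ⊗ₜ c j) = c i := by
  simp only [map_sum, tcoord_tmul, rcoord_b, ite_smul, one_smul, zero_smul, Finset.sum_ite_eq',
    Finset.mem_univ, if_true]

theorem mat_eq (i j : ι) : B.mat i j = B.tcoord H i (M.str.ρ (B.b j)) := by
  rw [B.ρ_b, tcoord_sum]

/-- A homogeneous basis whose span is a subrepresentation. -/
def ofSpan (b : Module.Basis ι A M) (deg : ι → ℤ) (mem : ∀ i, b i ∈ M.str.gr (deg i))
    (rank : ι → ℕ)
    (d_mem : ∀ j, M.str.d (b j) ∈ Submodule.span A (b '' {i | rank i < rank j}))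
    (h : ∀ j, M.str.ρ (b j) ∈
      LinearMap.range ((Submodule.span ℚ (Set.range b)).subtype.rTensor H)) : HBasis ι M where
  b := b
  deg := deg
  mem := mem
  rank := rank
  d_mem := d_mem
  mat i j := (TensorProduct.lid ℚ H)
    ((A.unitPart ∘ₗ (b.coord i).restrictScalars ℚ).rTensor H (M.str.ρ (b j)))
  ρ_b j := by
    obtain ⟨ξ, hξ⟩ := h j
    rw [← hξ]
    clear hξ
    have hx : ∀ x ∈ Submodule.span ℚ (Set.range b),
        ∑ i, A.unitPart (b.coord i x) • b i = x := by
      intro x hx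
      refine Submodule.span_induction (p := fun x _ => ∑ i, A.unitPart (b.coord i x) • b i = x)
        ?_ (by simp) (fun x y _ _ h h' => ?_) (fun c x _ h => ?_) hx
      · rintro _ ⟨l, rfl⟩
        rw [Finset.sum_eq_single l]
        · simp [A.unitPart_one]
        · intro i _ hi
          simp [Finsupp.single_eq_of_ne hi]
        · simp
      · simp only [map_add, add_smul, Finset.sum_add_distrib, h, h']
      · simp only [LinearMap.map_smul_of_tower, map_smul, smul_assoc, ← Finset.smul_sum, h]
    induction ξ using TensorProduct.induction_on with
    | zero => simp
    | add s t hs ht => simp only [map_add, TensorProduct.tmul_add, Finset.sum_add_distrib, ← hs, ← ht]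
    | tmul x k =>
      conv_lhs => rw [LinearMap.rTensor_tmul, Submodule.subtype_apply, ← hx x x.2,
        TensorProduct.sum_tmul]
      refine Finset.sum_congr rfl fun i _ => ?_
      rw [TensorProduct.smul_tmul]
      rfl

/-- The coordinates of `M` lie in `A`. Following them by the retraction to `ℚ · 1` isolates the
matrix entries, and the comodule axioms become matrix identities. -/
theorem counit_mat (i j : ι) : Coalgebra.counit (R := ℚ) (B.mat i j) = if j = i then 1 else 0 := by
  have h := congrArg (B.rcoord i) (M.str.isCoaction.counit (B.b j))
  rw [B.ρ_b, rcoord_b] at h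
  simpa [rcoord_b] using h

theorem comul_mat (i j : ι) : Coalgebra.comul (R := ℚ) (B.mat i j) =
    ∑ l, B.mat i l ⊗ₜ[ℚ] B.mat l j := by
  have h := congrArg (B.tcoord (H ⊗[ℚ] H) i) (M.str.isCoaction.coassoc (B.b j))
  rw [B.ρ_b] at h
  simp only [map_sum, LinearMap.lTensor_tmul, LinearMap.rTensor_tmul, B.ρ_b,
    TensorProduct.sum_tmul, TensorProduct.assoc_tmul, tcoord_tmul, rcoord_b, ite_smul,
    one_smul, zero_smul, Finset.sum_ite_eq', Finset.mem_univ, if_true] at h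
  exact h.symm

/-- The coaction preserves degree, so a coordinate along a basis vector of another degree lies in a
part of `A` of nonzero degree, which the retraction to `ℚ · 1` kills. -/
theorem mat_of_ne {i j : ι} (h : B.deg i ≠ B.deg j) : B.mat i j = 0 := by
  obtain ⟨ξ, hξ⟩ := M.str.isSubrep _ _ (B.mem j)
  rw [mat_eq, ← hξ]
  clear hξ
  induction ξ using TensorProduct.induction_on with
  | zero => simp
  | add s t hs ht => rw [map_add, map_add, hs, ht, add_zero]
  | tmul x k =>
    rw [LinearMap.rTensor_tmul, tcoord_tmul, Submodule.subtype_apply, rcoord,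
      LinearMap.comp_apply, A.unitPart_of_ne (sub_ne_zero.2 h.symm) (B.coord_mem i x.2), zero_smul]

theorem coord_d {i j : ι} (h : B.rank j ≤ B.rank i) : B.coord i (M.str.d (B.b j)) = 0 := by
  have : Submodule.span A (B.b '' {i | B.rank i < B.rank j}) ≤ LinearMap.ker (B.b.coord i) := by
    refine Submodule.span_le.2 ?_
    rintro _ ⟨l, hl, rfl⟩
    have hl : B.rank l < B.rank j := hl
    refine (B.coord_b i l).trans (if_neg ?_)
    rintro rfl
    omega
  exact this (B.d_mem j)

theorem coordR_balanced (N : DGMod A) (i : ι) :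
    Balanced ((ract N).compl₂ (ofA.restrictScalars ℚ ∘ₗ B.coord i)) := by
  intro p q a x y ha hx
  change ract N x (ofA (B.coord i (a • y))) = _ • ract N (a • x) (ofA (B.coord i y))
  rw [coord_smul]
  refine A.str.induction (p := fun c => ract N x (ofA (a * c)) =
    (-1 : ℚ) ^ (p * q) • ract N (a • x) (ofA c)) ?_ (by simp) ?_ _
  · intro r c hc
    rw [ract_apply (A.mul_mem ha hc) hx, ract_apply hc (N.smul_mem ha hx), A.comm ha hc,
      smul_assoc, ← mul_smul c a, smul_smul, smul_smul, ← negOne_add, ← negOne_add]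
    rw [show (p + r) * q + p * r = p * q + r * (p + q) by ring]
  · intro c c' h h'
    simp only [mul_add, map_add, h, h', smul_add]

/-- The coordinate maps on `N ⊗ M`. -/
def coordR (N : DGMod A) (i : ι) : tensor N M →ₗ[ℚ] N := mlift _ (B.coordR_balanced N i)

theorem coordR_tm (i : ι) (x : N) (y : M) :
    B.coordR N i (tm N M x y) = ract N x (ofA (B.coord i y)) :=
  mlift_tm _ (B.coordR_balanced N i) x y

/-- The twist by `deg i` is the sign for moving the coefficient of `b i` to the right of `b i`,
where it can act on the second tensor factor. -/
theorem coordL_balanced (N : DGMod A) (i : ι) : Balanced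
    ((Algebra.lsmul (A := A) ℚ ℚ N).toLinearMap ∘ₗ A.twist (B.deg i) ∘ₗ B.coord i) := by
  intro p q a x y ha hx
  change A.twist (B.deg i) (B.coord i x) • a • y =
    (-1 : ℚ) ^ (p * q) • A.twist (B.deg i) (B.coord i (a • x)) • y
  have hc := B.coord_mem i hx
  rw [coord_smul, CDGA.twist_mul, CDGA.twist_apply ha, CDGA.twist_apply hc, smul_mul_smul_comm,
    A.comm ha hc]
  simp only [smul_assoc, smul_smul, ← negOne_add]
  rw [negOne_congr (m := p * q + (p * B.deg i + (q - B.deg i) * B.deg i + p * (q - B.deg i)))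
    (n := (q - B.deg i) * B.deg i) (p * q) (by ring)]
  rw [smul_mul_assoc, smul_assoc]

/-- The coordinate maps on `M ⊗ N`. -/
def coordL (N : DGMod A) (i : ι) : tensor M N →ₗ[ℚ] N := mlift _ (B.coordL_balanced N i)

theorem coordL_tm (i : ι) (x : M) (y : N) :
    B.coordL N i (tm M N x y) = A.twist (B.deg i) (B.coord i x) • y :=
  mlift_tm _ (B.coordL_balanced N i) x y

theorem coordL_b (i j : ι) (y : N) : B.coordL N j (tm M N (B.b i) y) = if i = j then y else 0 := by
  rw [coordL_tm, coord_b]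
  split_ifs
  · rw [CDGA.twist_one, one_smul]
  · rw [map_zero, zero_smul]

theorem coordR_b (i j : ι) (x : N) : B.coordR N j (tm N M x (B.b i)) = if i = j then x else 0 := by
  rw [coordR_tm, coord_b]
  split_ifs
  · exact ract_one x
  · rw [map_zero, map_zero]

theorem sum_coordR (t : tensor N M) : ∑ i, tm N M (B.coordR N i t) (B.b i) = t := by
  refine tm_induction (p := fun t => ∑ i, tm N M (B.coordR N i t) (B.b i) = t) ?_ (by simp) ?_ t
  · intro x y
    conv_rhs => rw [← B.sum_coord y, map_sum]
    exact Finset.sum_congr rfl fun i _ => by rw [coordR_tm, tm_ract, act_ofA]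
  · intro s t hs ht
    simp only [map_add, LinearMap.add_apply, Finset.sum_add_distrib, hs, ht]

theorem sum_coordL (t : tensor M N) : ∑ i, tm M N (B.b i) (B.coordL N i t) = t := by
  refine tm_induction (p := fun t => ∑ i, tm M N (B.b i) (B.coordL N i t) = t) ?_ (by simp) ?_ t
  · intro x y
    refine B.induction (p := fun x => ∑ i, tm M N (B.b i) (B.coordL N i (tm M N x y)) =
      tm M N x y) ?_ (by simp) ?_ x
    · intro p j a ha
      rw [Finset.sum_eq_single j]
      · rw [coordL_tm, coord_smul_b, if_pos rfl, CDGA.twist_apply ha, smul_assoc, map_smul,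
          tm_balanced y ha (B.mem j), smul_smul, negOne_sq, one_smul]
      · intro i _ hi
        rw [coordL_tm, coord_smul_b, if_neg hi.symm, map_zero, zero_smul, map_zero]
      · simp
    · intro x x' h h'
      simp only [map_add, LinearMap.add_apply, Finset.sum_add_distrib, h, h']
  · intro s t hs ht
    simp only [map_add, Finset.sum_add_distrib, hs, ht]

include B in
-- As a graded vector space `M ⊗ N` is the direct sum of the `b i ⊗ N`. Its differential is
-- triangular, with diagonal `(-1) ^ (deg i) d`, so a finite filtration reduces the claim to `f`.
theorem isQuasiIso_tensorHom_left {f : N ⟶ P} (hf : IsQuasiIso f) :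
    IsQuasiIso (tensorHom (𝟙 M) f) := by
  have hd : ∀ (N : DGMod A) i j (n : N), B.rank i ≤ B.rank j →
      B.coordL N j ((tensor M N).str.d (tm M N (B.b i) n)) =
        if i = j then (-1 : ℚ) ^ B.deg j • N.str.d n else 0 := by
    intro N i j n h
    rw [d_tm (B.mem i), map_add, map_smul, coordL_tm, coordL_b, B.coord_d h, map_zero, zero_smul,
      zero_add]
    split_ifs with e
    · rw [e]
    · exact smul_zero _
  exact isQuasiIso_of_coord B.rank (fun i => (-1 : ℚ) ^ B.deg i) (fun i => negOne_sq _) hf _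
    (fun i => tm M N (B.b i)) (B.coordL N) (fun i => tm M P (B.b i)) (B.coordL P) B.sum_coordL
    B.sum_coordL (fun i j n => B.coordL_b i j n) (fun i j n => B.coordL_b i j n) (hd N) (hd P)
    fun i n => tensorHom_tm _ _ _ _

include B in
theorem isQuasiIso_tensorHom_right {f : N ⟶ P} (hf : IsQuasiIso f) :
    IsQuasiIso (tensorHom f (𝟙 M)) := by
  have hd : ∀ (N : DGMod A) i j (n : N), B.rank i ≤ B.rank j →
      B.coordR N j ((tensor N M).str.d (tm N M n (B.b i))) =
        if i = j then (1 : ℚ) • N.str.d n else 0 := by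
    intro N i j n h
    refine N.str.induction (p := fun n => B.coordR N j ((tensor N M).str.d (tm N M n (B.b i))) =
      if i = j then (1 : ℚ) • N.str.d n else 0) ?_ (by simp) ?_ n
    · intro p n hn
      rw [d_tm hn, map_add, map_smul, coordR_b, coordR_tm, B.coord_d h, map_zero, map_zero,
        smul_zero, add_zero, one_smul]
    · intro n n' h h'
      simp only [map_add, LinearMap.add_apply, h, h', smul_add]
      split_ifs
      · rfl
      · rw [add_zero]
  exact isQuasiIso_of_coord B.rank (fun i => 1) (fun i => mul_one _) hf _
    (fun i => (tm N M).flip (B.b i)) (B.coordR N) (fun i => (tm P M).flip (B.b i)) (B.coordR P)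
    B.sum_coordR B.sum_coordR (fun i j n => B.coordR_b i j n) (fun i j n => B.coordR_b i j n)
    (hd N) (hd P) fun i n => tensorHom_tm _ _ _ _

include B in
theorem flat : DGMod.flat A M :=
  ⟨fun _ _ _ hf => B.isQuasiIso_tensorHom_left hf, fun _ _ _ hf => B.isQuasiIso_tensorHom_right hf⟩

end HBasis

/-- Bases of the spaces `V j` together form a basis over `A`. The first filtration stage containing
a cell is its rank, so the differential strictly lowers rank. -/
theorem CellStructure.exists_hBasis {M : DGMod A} (c : CellStructure M) [Finite c.J] :
    ∃ (ι : Type u) (_ : Fintype ι) (_ : DecidableEq ι), Nonempty (HBasis ι M) := by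
  classical
  have := Fintype.ofFinite c.J
  have := c.finite
  let v (j : c.J) := Module.finBasis ℚ (c.V j)
  let φ : (DirectSum c.J fun j => A ⊗[ℚ] c.V j) →ₗ[A] M := DirectSum.toModule A c.J M fun j =>
    { liftA (c.V j).subtype with map_smul' := liftA_smul _ }
  have hφ : Function.Bijective φ := by
    have : (φ : _ → M) = DirectSum.toModule ℚ c.J M fun j => liftA (c.V j).subtype := by
      funext t
      induction t using DirectSum.induction_on with
      | zero => rw [map_zero, map_zero]
      | add s t hs ht => rw [map_add, map_add, hs, ht]
      | of j t =>
        exact (DirectSum.toModule_lof A (φ := fun j => ({ liftA (c.V j).subtype with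
          map_smul' := liftA_smul _ } : A ⊗[ℚ] c.V j →ₗ[A] M)) j t).trans
          (DirectSum.toModule_lof ℚ (φ := fun j => liftA (A := A) (c.V j).subtype) j t).symm
    rw [this]
    exact c.bijective
  let b : Module.Basis (Σ j, Fin (Module.finrank ℚ (c.V j))) A M :=
    (DFinsupp.basis fun j => (v j).baseChange A).map (LinearEquiv.ofBijective φ hφ)
  have hb : ∀ x, b x = (v x.1 x.2 : M) := by
    rintro ⟨j, k⟩
    have e : (DFinsupp.basis fun j => (v j).baseChange A) ⟨j, k⟩ =
        DirectSum.lof A c.J (fun j => A ⊗[ℚ] c.V j) j (1 ⊗ₜ v j k) := by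
      rw [← Module.Basis.baseChange_apply]
      refine Module.Basis.apply_eq_iff.2 (Finsupp.ext fun x => ?_)
      obtain ⟨j', k'⟩ := x
      by_cases h : j = j'
      · subst h
        simp [DFinsupp.basis, Finsupp.single_apply]
      · have e : (DirectSum.lof A c.J (fun j => A ⊗[ℚ] c.V j) j ((v j).baseChange A k) :
            DirectSum c.J fun j => A ⊗[ℚ] c.V j) j' = 0 := by
          rw [DirectSum.lof_eq_of, DirectSum.of_eq_of_ne _ _ _ (Ne.symm h)]
        refine (congrArg (fun z => ((v j').baseChange A).repr z k') e).trans ?_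
        rw [map_zero, Finsupp.single_eq_of_ne (fun e => h (congrArg Sigma.fst e).symm)]
        rfl
    rw [Module.Basis.map_apply, e]
    refine (DirectSum.toModule_lof A (φ := fun j => ({ liftA (c.V j).subtype with
          map_smul' := liftA_smul _ } : A ⊗[ℚ] c.V j →ₗ[A] M)) j _).trans ?_
    exact one_smul A _
  obtain ⟨n, hn⟩ := c.exists_step_eq_univ
  have hstep : ∀ j, ∃ n, j ∈ c.step n := fun j => ⟨n, by rw [hn]; trivial⟩
  let rank : c.J → ℕ := fun j => Nat.find (hstep j)
  have hspan : ∀ j, ∀ x ∈ c.V j, x ∈ Submodule.span ℚ (Set.range b) := by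
    intro j x hx
    have := (v j).sum_repr ⟨x, hx⟩
    rw [← show ((⟨x, hx⟩ : c.V j) : M) = x from rfl, ← this, Submodule.coe_sum]
    refine Submodule.sum_mem _ fun k _ => ?_
    rw [Submodule.coe_smul]
    exact Submodule.smul_mem _ _ (Submodule.subset_span ⟨⟨j, k⟩, hb _⟩)
  refine ⟨_, inferInstance, inferInstance, ⟨.ofSpan b (fun x => c.deg x.1)
    (fun x => by rw [hb]; exact c.mem _ (v x.1 x.2).2) (fun x => rank x.1) ?_ ?_⟩⟩
  · rintro ⟨j, k⟩
    rw [hb]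
    -- The rank is positive because stage zero is empty; the cell condition is then applied to the
    -- stage just before.
    obtain ⟨m, hm⟩ : ∃ m, rank j = m + 1 := by
      refine Nat.exists_eq_succ_of_ne_zero fun h => ?_
      have := Nat.find_spec (hstep j)
      rw [show Nat.find (hstep j) = 0 from h, c.step_zero] at this
      exact this
    have hj : j ∈ c.step (m + 1) := hm ▸ Nat.find_spec (hstep j)
    refine Submodule.span_le.2 ?_ (c.d_mem m j hj _ (v j k).2)
    refine Set.iUnion₂_subset fun i hi x hx => ?_
    have := (v i).sum_repr ⟨x, hx⟩
    rw [← show ((⟨x, hx⟩ : c.V i) : M) = x from rfl, ← this, Submodule.coe_sum]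
    refine Submodule.sum_mem _ fun l _ => ?_
    rw [Submodule.coe_smul, ← algebraMap_smul A]
    refine Submodule.smul_mem _ _ (Submodule.subset_span ⟨⟨i, l⟩, ?_, hb _⟩)
    change rank i < rank j
    have : rank i ≤ m := Nat.find_min' (hstep i) hi
    omega
  · rintro ⟨j, k⟩
    rw [hb]
    exact mem_range_rTensor_iff.2 fun φ => hspan j _ (isSubrep_iff.1 (c.isSubrep j) φ _ (v j k).2)

end DGMod

end

/-! ### Coactions and differentials as matrices, and their duals -/

noncomputable section

variable {H : Type u} [CommRing H] [HopfAlgebra ℚ H]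

section Matrices

variable {ι : Type u} [Fintype ι] [DecidableEq ι]

/-- The matrix coefficients `h` define a representation. -/
structure IsMatCoaction (deg : ι → ℤ) (h : Matrix ι ι H) : Prop where
  counit : ∀ i j, Coalgebra.counit (R := ℚ) (h i j) = if j = i then 1 else 0
  comul : ∀ i j, Coalgebra.comul (R := ℚ) (h i j) = ∑ l, h i l ⊗ₜ[ℚ] h l j
  of_ne : ∀ i j, deg i ≠ deg j → h i j = 0

/-- The coaction on `ℚ ^ ι` with the matrix `h`. -/
def matCoaction (h : Matrix ι ι H) : (ι → ℚ) →ₗ[ℚ] (ι → ℚ) ⊗[ℚ] H :=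
  ∑ j, (LinearMap.proj j : (ι → ℚ) →ₗ[ℚ] ℚ).smulRight (∑ i, (Pi.single i 1 : ι → ℚ) ⊗ₜ[ℚ] h i j)

theorem matCoaction_single (h : Matrix ι ι H) (j : ι) :
    matCoaction h (Pi.single j 1) = ∑ i, (Pi.single i 1 : ι → ℚ) ⊗ₜ[ℚ] h i j := by
  rw [matCoaction, LinearMap.sum_apply, Finset.sum_eq_single j]
  · simp
  · intro l _ hl
    simp [Pi.single_eq_of_ne hl]
  · simp

theorem coact_matCoaction (h : Matrix ι ι H) (φ : H →ₗ[ℚ] ℚ) (y : ι → ℚ) :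
    coact (matCoaction h) φ y = (h.map φ).mulVec y := by
  rw [coact_apply, matCoaction, LinearMap.sum_apply]
  simp only [map_sum, LinearMap.smulRight_apply, LinearMap.proj_apply, map_smul, slice_tmul]
  funext l
  simp [Matrix.mulVec, dotProduct, Finset.sum_apply, Pi.single_apply, mul_comm]

theorem IsMatCoaction.isCoaction {deg : ι → ℤ} {h : Matrix ι ι H} (hh : IsMatCoaction deg h) :
    IsCoaction (matCoaction h) := by
  refine isCoaction_iff.2 ⟨fun y => ?_, fun φ ψ y => ?_⟩
  · rw [coact_matCoaction]
    have : h.map (Coalgebra.counit (R := ℚ)) = 1 := by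
      ext i j
      rw [Matrix.map_apply, hh.counit, Matrix.one_apply]
      simp only [eq_comm]
    rw [this, Matrix.one_mulVec]
  · rw [coact_matCoaction, coact_matCoaction, coact_matCoaction, Matrix.mulVec_mulVec]
    congr 1
    ext i j
    rw [Matrix.mul_apply, Matrix.map_apply, convol, LinearMap.comp_apply, LinearMap.comp_apply,
      hh.comul]
    simp

/-- The graded representation with basis indexed by `ι` and matrix coefficients `h`. -/
def GComplex.ofMat (deg : ι → ℤ) (h : Matrix ι ι H) (hh : IsMatCoaction deg h) :
    GComplex H (ι → ℚ) where
  gr n :=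
    { carrier := {y | ∀ i, deg i ≠ n → y i = 0}
      add_mem' := fun {y z} hy hz i hi => by rw [Pi.add_apply, hy i hi, hz i hi, add_zero]
      zero_mem' := fun _ _ => rfl
      smul_mem' := fun c y hy i hi => by rw [Pi.smul_apply, hy i hi, smul_zero] }
  isInternal := by
    refine isInternal_of_proj
      (fun n => LinearMap.pi fun i => if deg i = n then LinearMap.proj i else 0) (fun y => ?_) ?_
    · rw [show y = ∑ i, Pi.single i (y i) from (Finset.univ_sum_single y).symm]
      refine Submodule.sum_mem _ fun i _ => Submodule.mem_iSup_of_mem (deg i) fun j hj => ?_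
      exact Pi.single_eq_of_ne (fun e => hj (by rw [e])) _
    · intro n y hy m
      funext i
      rw [LinearMap.pi_apply]
      by_cases h : deg i = n
      · subst h
        split_ifs <;> rfl
      · have : y i = 0 := hy i h
        split_ifs <;> simp [this]
  d := 0
  d_mem _ := zero_mem _
  d_d _ := rfl
  ρ := matCoaction h
  isCoaction := hh.isCoaction
  isSubrep n := isSubrep_iff.2 fun φ y hy i hi => by
    rw [coact_matCoaction]
    refine Finset.sum_eq_zero fun j _ => ?_
    by_cases hj : deg j = n
    · change φ (h i j) * y j = 0
      rw [hh.of_ne i j (by rwa [hj]), map_zero, zero_mul]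
    · change φ (h i j) * y j = 0
      rw [hy j hj, mul_zero]
  ρ_d y := by simp

theorem GComplex.single_mem_ofMat {deg : ι → ℤ} {h : Matrix ι ι H} (hh : IsMatCoaction deg h)
    (i : ι) : (Pi.single i 1 : ι → ℚ) ∈ (GComplex.ofMat deg h hh).gr (deg i) :=
  fun j hj => Pi.single_eq_of_ne (fun e => hj (by rw [e])) _

variable {A : CDGA H}

/-- The map with matrix `θ`. -/
def matTau (θ : Matrix ι ι A) : (ι → ℚ) →ₗ[ℚ] A ⊗[ℚ] (ι → ℚ) :=
  ∑ j, (LinearMap.proj j : (ι → ℚ) →ₗ[ℚ] ℚ).smulRight (∑ i, θ i j ⊗ₜ[ℚ] (Pi.single i 1 : ι → ℚ))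

theorem matTau_single (θ : Matrix ι ι A) (j : ι) :
    matTau θ (Pi.single j 1) = ∑ i, θ i j ⊗ₜ[ℚ] (Pi.single i 1 : ι → ℚ) := by
  rw [matTau, LinearMap.sum_apply, Finset.sum_eq_single j]
  · simp
  · intro l _ hl
    simp [Pi.single_eq_of_ne hl]
  · simp

/-- The matrix `θ` is the matrix of an equivariant differential. -/
structure IsMatDiff (deg : ι → ℤ) (h : Matrix ι ι H) (θ : Matrix ι ι A) : Prop where
  mem : ∀ i j, θ i j ∈ A.str.gr (deg j + 1 - deg i)
  d : ∀ l j, A.str.d (θ l j) + ∑ i, (-1 : ℚ) ^ (deg j + 1 - deg i) • (θ i j * θ l i) = 0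
  ρ : ∀ l j, ∑ i, A.str.ρ (θ i j) * (1 ⊗ₜ h l i) = ∑ k, θ l k ⊗ₜ h k j

theorem hom_ext_single {X : Type*} [AddCommMonoid X] [Module ℚ X] {f g : (ι → ℚ) →ₗ[ℚ] X}
    (h : ∀ i, f (Pi.single i 1) = g (Pi.single i 1)) : f = g :=
  (Pi.basisFun ℚ ι).ext fun i => by simpa using h i

/-- The dg module with given matrices for the coaction and the differential. -/
def Twist.ofMat {deg : ι → ℤ} {h : Matrix ι ι H} (hh : IsMatCoaction deg h) {θ : Matrix ι ι A}
    (hθ : IsMatDiff deg h θ) : Twist A (ι → ℚ) where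
  S := GComplex.ofMat deg h hh
  τ := matTau θ
  τ_mem n y hy := by
    have : y = ∑ i, y i • Pi.single i 1 := by
      conv_lhs => rw [← Finset.univ_sum_single y]
      exact Finset.sum_congr rfl fun i _ => by rw [← Pi.single_smul, smul_eq_mul, mul_one]
    rw [this, map_sum]
    refine Submodule.sum_mem _ fun j _ => ?_
    rw [map_smul, matTau_single]
    by_cases hj : deg j = n
    · refine Submodule.smul_mem _ _ (Submodule.sum_mem _ fun i _ => ?_)
      exact GComplex.tmul_mem_tensGr (hθ.mem i j) (GComplex.single_mem_ofMat hh i) (by omega)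
    · rw [hy j hj, zero_smul]
      exact zero_mem _
  τ_ρ y := by
    refine LinearMap.congr_fun (f := GComplex.tensCoaction A.str (GComplex.ofMat deg h hh) ∘ₗ
      matTau θ) (g := (matTau θ).rTensor H ∘ₗ matCoaction h) (hom_ext_single fun j => ?_) y
    let T (l : ι) : A ⊗[ℚ] H →ₗ[ℚ] (A ⊗[ℚ] (ι → ℚ)) ⊗[ℚ] H :=
      ((TensorProduct.mk ℚ A (ι → ℚ)).flip (Pi.single l 1)).rTensor H
    have hT : ∀ ξ l k, pairH H (TensorProduct.mk ℚ A (ι → ℚ)) ξ (Pi.single l 1 ⊗ₜ k) =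
        T l (ξ * (1 ⊗ₜ k)) := by
      intro ξ l k
      induction ξ using TensorProduct.induction_on with
      | zero => simp
      | add s t hs ht => simp only [map_add, LinearMap.add_apply, add_mul, hs, ht]
      | tmul a m => simp [T]
    rw [LinearMap.comp_apply, LinearMap.comp_apply, matTau_single, matCoaction_single]
    simp only [map_sum, GComplex.tensCoaction_tmul, LinearMap.rTensor_tmul, matTau_single]
    have e : ∀ i, (GComplex.ofMat deg h hh).ρ (Pi.single i 1) = _ := matCoaction_single h
    simp only [e, map_sum, hT, TensorProduct.sum_tmul]
    rw [Finset.sum_comm]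
    conv_rhs => rw [Finset.sum_comm]
    refine Finset.sum_congr rfl fun l _ => ?_
    rw [← map_sum, hθ.ρ, map_sum]
    exact Finset.sum_congr rfl fun k _ => by simp [T]
  d_τ y := by
    refine LinearMap.congr_fun (f := (A.str.d.rTensor (ι → ℚ) + smulLift (matTau θ) ∘ₗ
      A.str.sgn.rTensor (ι → ℚ)) ∘ₗ matTau θ) (g := 0) (hom_ext_single fun j => ?_) y
    rw [LinearMap.comp_apply, matTau_single, map_sum]
    have e : ∀ i, (A.str.d.rTensor (ι → ℚ) + smulLift (matTau θ) ∘ₗ A.str.sgn.rTensor (ι → ℚ))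
        (θ i j ⊗ₜ[ℚ] (Pi.single i 1 : ι → ℚ)) = A.str.d (θ i j) ⊗ₜ (Pi.single i 1 : ι → ℚ) +
          ∑ l, ((-1 : ℚ) ^ (deg j + 1 - deg i) • (θ i j * θ l i)) ⊗ₜ (Pi.single l 1 : ι → ℚ) := by
      intro i
      rw [LinearMap.add_apply, LinearMap.comp_apply, LinearMap.rTensor_tmul,
        LinearMap.rTensor_tmul, A.str.sgn_apply (hθ.mem i j), smulLift, TensorProduct.lift.tmul]
      congr 1
      change ((-1 : ℚ) ^ (deg j + 1 - deg i) • θ i j) • matTau θ (Pi.single i 1) = _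
      rw [matTau_single, Finset.smul_sum]
      refine Finset.sum_congr rfl fun l _ => ?_
      rw [TensorProduct.smul_tmul', smul_eq_mul, smul_mul_assoc]
    simp only [e, Finset.sum_add_distrib]
    rw [Finset.sum_comm, ← Finset.sum_add_distrib]
    refine Finset.sum_eq_zero fun l _ => ?_
    rw [← TensorProduct.sum_tmul, ← TensorProduct.add_tmul, hθ.d, TensorProduct.zero_tmul]

/-- The basis of `A ⊗ ℚ ^ ι`. -/
def Twist.basis (T : Twist A (ι → ℚ)) : Module.Basis ι A T.toMod :=
  (Pi.basisFun ℚ ι).baseChange A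

theorem Twist.basis_apply (T : Twist A (ι → ℚ)) (i : ι) :
    T.basis i = T.gen 1 (Pi.single i 1) :=
  ((Pi.basisFun ℚ ι).baseChange_apply A i).trans (by rw [Pi.basisFun_apply]; rfl)

/-- The basis of the dg module with given matrices. -/
def Twist.hBasis {deg : ι → ℤ} {h : Matrix ι ι H} (hh : IsMatCoaction deg h) {θ : Matrix ι ι A}
    (hθ : IsMatDiff deg h θ) (rank : ι → ℕ) (hr : ∀ i j, rank j ≤ rank i → θ i j = 0) :
    DGMod.HBasis ι (Twist.ofMat hh hθ).toMod where
  b := (Twist.ofMat hh hθ).basis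
  deg := deg
  mem i := by
    rw [Twist.basis_apply]
    exact (Twist.ofMat hh hθ).gen_one_mem (GComplex.single_mem_ofMat hh i)
  rank := rank
  d_mem j := by
    rw [Twist.basis_apply, Twist.d_gen_one, show (Twist.ofMat hh hθ).tau (Pi.single j 1) =
      ∑ i, (Twist.ofMat hh hθ).gen (θ i j) (Pi.single i 1) from matTau_single θ j]
    refine Submodule.sum_mem _ fun i _ => ?_
    rw [Twist.gen_eq_smul, ← Twist.basis_apply]
    by_cases hij : rank j ≤ rank i
    · rw [hr i j hij, zero_smul]
      exact zero_mem _
    · exact Submodule.smul_mem _ _ (Submodule.subset_span ⟨i, not_le.1 hij, rfl⟩)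
  mat := h
  ρ_b j := by
    simp only [Twist.basis_apply]
    change pairH H (TensorProduct.mk ℚ A (ι → ℚ)) (A.str.ρ 1) (matCoaction h (Pi.single j 1)) = _
    rw [A.ρ_one, DGMod.pairH_one_left, matCoaction_single, map_sum]
    rfl

theorem Twist.d_hBasis {deg : ι → ℤ} {h : Matrix ι ι H} (hh : IsMatCoaction deg h)
    {θ : Matrix ι ι A} (hθ : IsMatDiff deg h θ) (rank : ι → ℕ)
    (hr : ∀ i j, rank j ≤ rank i → θ i j = 0) (j : ι) :
    (Twist.ofMat hh hθ).toMod.str.d ((Twist.hBasis hh hθ rank hr).b j) =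
      ∑ i, θ i j • (Twist.hBasis hh hθ rank hr).b i := by
  change (Twist.ofMat hh hθ).toMod.str.d ((Twist.ofMat hh hθ).basis j) =
    ∑ i, θ i j • (Twist.ofMat hh hθ).basis i
  simp only [Twist.basis_apply, ← Twist.gen_eq_smul]
  rw [Twist.d_gen_one]
  exact matTau_single θ j

end Matrices

namespace DGMod.HBasis

variable {ι : Type u} [Fintype ι] [DecidableEq ι] {A : CDGA H} {M : DGMod A} (B : HBasis ι M)

theorem isMatCoaction : IsMatCoaction B.deg B.mat :=
  ⟨B.counit_mat, B.comul_mat, fun _ _ h => B.mat_of_ne h⟩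

/-- The matrix of the differential. -/
def dmat : Matrix ι ι A := fun i j => B.coord i (M.str.d (B.b j))

theorem d_b (j : ι) : M.str.d (B.b j) = ∑ i, B.dmat i j • B.b i := (B.sum_coord _).symm

theorem isMatDiff : IsMatDiff B.deg B.mat B.dmat where
  mem i j := B.coord_mem i (M.str.d_mem (B.mem j))
  d l j := by
    have h := congrArg (B.coord l) (M.str.d_d (B.b j))
    rw [B.d_b, map_sum, map_sum, map_zero] at h
    have e : ∀ i, B.coord l (M.str.d (B.dmat i j • B.b i)) =
        (if i = l then A.str.d (B.dmat i j) else 0) +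
          (-1 : ℚ) ^ (B.deg j + 1 - B.deg i) • (B.dmat i j * B.dmat l i) := by
      intro i
      have hm : B.dmat i j ∈ A.str.gr _ := B.coord_mem i (M.str.d_mem (B.mem j))
      rw [M.leibniz _ hm, map_add, coord_smul_b, (B.coord l).map_smul, coord_smul]
      rfl
    simp only [e, Finset.sum_add_distrib, Finset.sum_ite_eq', Finset.mem_univ, if_true] at h
    exact h
  ρ l j := by
    have hC : ∀ (ξ : A ⊗[ℚ] H) i k, (B.coord l).rTensor H
        (pairH H (Algebra.lsmul (A := A) ℚ ℚ M).toLinearMap ξ (B.b i ⊗ₜ k)) =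
          if i = l then ξ * (1 ⊗ₜ k) else 0 := by
      intro ξ i k
      induction ξ using TensorProduct.induction_on with
      | zero => simp
      | add s t hs ht =>
        simp only [map_add, LinearMap.add_apply, hs, ht, add_mul]
        split_ifs
        · rfl
        · rw [add_zero]
      | tmul a m =>
        rw [pairH_tmul, LinearMap.rTensor_tmul]
        change B.coord l (a • B.b i) ⊗ₜ _ = _
        rw [coord_smul_b, Algebra.TensorProduct.tmul_mul_tmul, mul_one]
        split_ifs
        · rfl
        · exact TensorProduct.zero_tmul _ _
    have h := congrArg ((B.coord l).rTensor H) (M.str.ρ_d (B.b j))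
    conv_lhs at h => rw [B.d_b]
    rw [B.ρ_b] at h
    simp only [map_sum, M.ρ_smul, B.ρ_b, hC, Finset.sum_ite_eq', Finset.mem_univ, if_true,
      LinearMap.rTensor_tmul] at h
    exact h

end DGMod.HBasis

section Antipode

variable {ι : Type u} [Fintype ι] [DecidableEq ι] {deg : ι → ℤ} {h : Matrix ι ι H}

/-- The antipodes of the matrix coefficients, which form the inverse matrix. -/
def antipodeMat (h : Matrix ι ι H) : Matrix ι ι H := h.map (HopfAlgebra.antipode ℚ)

theorem IsMatCoaction.antipode_mul (hh : IsMatCoaction deg h) : antipodeMat h * h = 1 := by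
  ext i j
  have := HopfAlgebra.mul_antipode_rTensor_comul_apply (R := ℚ) (h i j)
  rw [hh.comul, hh.counit] at this
  simp only [map_sum, LinearMap.rTensor_tmul, LinearMap.mul'_apply] at this
  rw [Matrix.mul_apply, Matrix.one_apply]
  refine this.trans ?_
  simp only [eq_comm (a := j)]
  split_ifs <;> simp

/-- A one-sided inverse of a square matrix over a commutative ring is two-sided. -/
theorem IsMatCoaction.mul_antipode (hh : IsMatCoaction deg h) : h * antipodeMat h = 1 :=
  mul_eq_one_comm.1 hh.antipode_mul

theorem IsMatCoaction.antipode_of_ne (hh : IsMatCoaction deg h) {i j : ι} (e : deg i ≠ deg j) :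
    antipodeMat h i j = 0 := by
  rw [antipodeMat, Matrix.map_apply, hh.of_ne i j e, map_zero]

/-- The matrix of the dual representation. -/
theorem IsMatCoaction.dual (hh : IsMatCoaction deg h) :
    IsMatCoaction (fun i => -deg i) (antipodeMat h).transpose where
  counit i j := by
    rw [Matrix.transpose_apply, antipodeMat, Matrix.map_apply, HopfAlgebra.counit_antipode,
      hh.counit]
    simp only [eq_comm]
  comul i j := by
    let Δ : H →+* H ⊗[ℚ] H := (Bialgebra.comulAlgHom ℚ H : H →+* H ⊗[ℚ] H)
    let L : H →+* H ⊗[ℚ] H :=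
      ((Algebra.TensorProduct.includeLeft : H →ₐ[ℚ] H ⊗[ℚ] H) : H →+* H ⊗[ℚ] H)
    let R : H →+* H ⊗[ℚ] H :=
      ((Algebra.TensorProduct.includeRight : H →ₐ[ℚ] H ⊗[ℚ] H) : H →+* H ⊗[ℚ] H)
    have e₁ : h.map Δ = h.map L * h.map R := by
      ext i j
      rw [Matrix.map_apply, Matrix.mul_apply]
      refine (hh.comul i j).trans (Finset.sum_congr rfl fun l _ => ?_)
      simp [L, R]
    have e₂ : (antipodeMat h).map Δ * h.map Δ = 1 := by
      rw [← Matrix.map_mul, hh.antipode_mul, Matrix.map_one _ (map_zero Δ) (map_one Δ)]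
    have e₃ : h.map Δ * ((antipodeMat h).map R * (antipodeMat h).map L) = 1 := by
      rw [e₁, Matrix.mul_assoc, ← Matrix.mul_assoc (h.map R), ← Matrix.map_mul, hh.mul_antipode,
        Matrix.map_one _ (map_zero R) (map_one R), Matrix.one_mul, ← Matrix.map_mul,
        hh.mul_antipode, Matrix.map_one _ (map_zero L) (map_one L)]
    -- Uniqueness of inverses: the comultiplication turns `h` into `L(h) R(h)`, whose inverse is
    -- `R(S h) L(S h)`. The reversed order is the one that the transposed matrix requires.
    have e := congrArg (fun m : Matrix ι ι (H ⊗[ℚ] H) => m j i) (left_inv_eq_right_inv e₂ e₃)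
    rw [Matrix.map_apply, Matrix.mul_apply] at e
    refine Eq.trans e (Finset.sum_congr rfl fun l _ => ?_)
    simp [L, R]
  of_ne i j e := hh.antipode_of_ne fun e' => e (by rw [e'])

variable {A : CDGA H} {θ : Matrix ι ι A}

/-- The matrix of the differential of the dual module. -/
def dualDiff (deg : ι → ℤ) (θ : Matrix ι ι A) : Matrix ι ι A := fun i k =>
  -((-1 : ℚ) ^ (deg k * (deg i + 1)) • θ k i)

/-- The signs in `dualDiff` are the ones that make evaluation a chain map. The square of the dual
differential is the transpose of the original identity, by graded commutativity; equivariance is the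
original relation conjugated by the inverse of `h`. -/
theorem IsMatDiff.dual (hh : IsMatCoaction deg h) (hθ : IsMatDiff deg h θ) :
    IsMatDiff (fun i => -deg i) (antipodeMat h).transpose (dualDiff deg θ) where
  mem i j := by
    refine neg_mem (Submodule.smul_mem _ _ ?_)
    have := hθ.mem j i
    rwa [show -deg j + 1 - -deg i = deg i + 1 - deg j by ring]
  d l j := by
    have h₁ := hθ.d j l
    rw [add_eq_zero_iff_eq_neg] at h₁
    rw [dualDiff, map_neg, map_smul, h₁, smul_neg, neg_neg, Finset.smul_sum,
      ← Finset.sum_add_distrib]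
    refine Finset.sum_eq_zero fun i _ => ?_
    -- The exponents of `-1` agree only modulo `2`, and `n ^ 2 ≡ n` is needed to compare them.
    obtain ⟨c, hc⟩ := Int.even_mul_pred_self (deg i)
    rw [dualDiff, dualDiff, neg_mul_neg, smul_mul_smul_comm, A.comm (hθ.mem j i) (hθ.mem i l),
      smul_smul, smul_smul, smul_smul, ← negOne_add, ← negOne_add, ← negOne_add, ← negOne_add,
      negOne_congr (m := -deg j + 1 - -deg i + (deg j * (deg i + 1) + deg i * (deg l + 1)) +
          (deg i + 1 - deg j) * (deg l + 1 - deg i)) (n := deg j * (deg l + 1) + (deg l + 1 - deg i) + 1)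
        (deg i + deg i * deg j + deg i * deg l - deg j * deg l - deg j - c)
        (by linear_combination -hc), negOne_succ, neg_smul, add_neg_cancel]
  ρ l j := by
    let I : H →+* A ⊗[ℚ] H :=
      ((Algebra.TensorProduct.includeRight : H →ₐ[ℚ] A ⊗[ℚ] H) : H →+* A ⊗[ℚ] H)
    have hI : ∀ (k : H) (ξ : A ⊗[ℚ] H), I k * ξ = ξ * I k := by
      intro k ξ
      induction ξ using TensorProduct.induction_on with
      | zero => simp
      | add s t hs ht => rw [mul_add, add_mul, hs, ht]
      | tmul a m => simp [I, mul_comm]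
    -- In matrix form equivariance of the differential reads `h R = Θ h`, the entries of `h` being
    -- central. Multiplying by the inverse of `h` on both sides gives the relation for the dual.
    let R : Matrix ι ι (A ⊗[ℚ] H) := θ.map A.str.ρ
    let Θ : Matrix ι ι (A ⊗[ℚ] H) := θ.map fun a => a ⊗ₜ 1
    have e₁ : h.map I * R = Θ * h.map I := by
      ext l j
      rw [Matrix.mul_apply, Matrix.mul_apply]
      simp only [Matrix.map_apply, hI, R, Θ]
      refine (hθ.ρ l j).trans (Finset.sum_congr rfl fun k _ => ?_)
      simp [I]
    have e₂ : R * (antipodeMat h).map I = (antipodeMat h).map I * Θ := by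
      calc R * (antipodeMat h).map I
          = ((antipodeMat h).map I * h.map I) * R * (antipodeMat h).map I := by
            rw [← Matrix.map_mul, hh.antipode_mul, Matrix.map_one _ (map_zero I) (map_one I),
              Matrix.one_mul]
        _ = (antipodeMat h).map I * (Θ * (h.map I * (antipodeMat h).map I)) := by
            rw [Matrix.mul_assoc _ _ R, e₁, Matrix.mul_assoc, Matrix.mul_assoc]
        _ = _ := by
            rw [← Matrix.map_mul, hh.mul_antipode, Matrix.map_one _ (map_zero I) (map_one I),
              Matrix.mul_one]
    have e := congrArg (fun m : Matrix ι ι (A ⊗[ℚ] H) => m j l) e₂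
    simp only [Matrix.mul_apply, Matrix.map_apply, R, Θ] at e
    -- Matrix coefficients between different degrees vanish, so the sign, which depends on degrees,
    -- can be taken to be the same in all surviving terms.
    have h₁ : ∀ i, A.str.ρ (dualDiff deg θ i j) * (1 ⊗ₜ (antipodeMat h).transpose l i) =
        -((-1 : ℚ) ^ (deg j * (deg l + 1)) • (A.str.ρ (θ j i) * I (antipodeMat h i l))) := by
      intro i
      by_cases hi : deg i = deg l
      · rw [dualDiff, hi, map_neg, map_smul, neg_mul, smul_mul_assoc]
        rfl
      · rw [Matrix.transpose_apply, hh.antipode_of_ne hi, TensorProduct.tmul_zero, map_zero,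
          mul_zero, mul_zero, smul_zero, neg_zero]
    have h₂ : ∀ k, dualDiff deg θ l k ⊗ₜ (antipodeMat h).transpose k j =
        -((-1 : ℚ) ^ (deg j * (deg l + 1)) • (I (antipodeMat h j k) * (θ k l ⊗ₜ 1))) := by
      intro k
      by_cases hk : deg j = deg k
      · rw [dualDiff, ← hk, TensorProduct.neg_tmul, ← TensorProduct.smul_tmul',
          Matrix.transpose_apply]
        simp [I]
      · rw [Matrix.transpose_apply, hh.antipode_of_ne hk, TensorProduct.tmul_zero, map_zero,
          zero_mul, smul_zero, neg_zero]
    simp only [h₁, h₂, Finset.sum_neg_distrib, ← Finset.smul_sum]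
    rw [e]

end Antipode

end

/-! ### Dual bases, evaluation and coevaluation -/

noncomputable section

open MonoidalCategory

variable {H : Type u} [CommRing H] [HopfAlgebra ℚ H] {A : CDGA H}

namespace DGMod.HBasis

variable {ι : Type u} [Fintype ι] [DecidableEq ι] {M N P : DGMod A}

theorem hom_ext (B : HBasis ι M) {f g : M ⟶ P} (h : ∀ i, f.toLin (B.b i) = g.toLin (B.b i)) :
    f = g := Hom.ext (B.b.ext h)

/-- The data of a pair of dual bases. -/
structure IsDual (B : HBasis ι M) (B' : HBasis ι N) : Prop where
  deg : ∀ i, B'.deg i = -B.deg i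
  mat : ∀ i j, B'.mat i j = antipodeMat B.mat j i
  dmat : ∀ i j, B'.dmat i j = dualDiff B.deg B.dmat i j

theorem exists_isDual (B : HBasis ι M) : ∃ (N : DGMod A) (B' : HBasis ι N), IsDual B B' := by
  have hh := B.isMatCoaction.dual
  have hθ := B.isMatDiff.dual B.isMatCoaction
  -- Transposition reverses triangularity, so the dual basis is ranked by the maximal rank minus the
  -- original one.
  have hr : ∀ i j, Finset.univ.sup B.rank - B.rank j ≤ Finset.univ.sup B.rank - B.rank i →
      dualDiff B.deg B.dmat i j = 0 := by
    intro i j hij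
    have h₁ := Finset.le_sup (f := B.rank) (Finset.mem_univ i)
    have h₂ := Finset.le_sup (f := B.rank) (Finset.mem_univ j)
    have : B.dmat j i = 0 := B.coord_d (by omega)
    rw [dualDiff, this, smul_zero, neg_zero]
  refine ⟨_, Twist.hBasis hh hθ (fun i => Finset.univ.sup B.rank - B.rank i) hr, fun _ => rfl,
    fun _ _ => rfl, fun i j => ?_⟩
  rw [HBasis.dmat, Twist.d_hBasis, map_sum]
  simp only [coord_smul_b, Finset.sum_ite_eq', Finset.mem_univ, if_true]

variable {B : HBasis ι M} {B' : HBasis ι N} (D : IsDual B B')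

variable (B B') in
/-- The evaluation pairing. -/
def evLin : N →ₗ[ℚ] M →ₗ[ℚ] A :=
  ∑ i, (LinearMap.mul ℚ A).compl₁₂ (B'.coord i) (A.twist (B.deg i) ∘ₗ B.coord i)

theorem evLin_apply (y : N) (x : M) :
    evLin B B' y x = ∑ i, B'.coord i y * A.twist (B.deg i) (B.coord i x) := by
  simp only [evLin, LinearMap.sum_apply]
  rfl

theorem evLin_smul (a : A) (y : N) (x : M) : evLin B B' (a • y) x = a * evLin B B' y x := by
  simp only [evLin_apply, coord_smul, Finset.mul_sum, mul_assoc]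

theorem evLin_b (j : ι) (x : M) :
    evLin B B' (B'.b j) x = A.twist (B.deg j) (B.coord j x) := by
  simp only [evLin_apply, coord_b, ite_mul, one_mul, zero_mul, Finset.sum_ite_eq, Finset.mem_univ,
    if_true]

theorem evLin_b_smul_b (i j : ι) (a : A) :
    evLin B B' (B'.b j) (a • B.b i) = if i = j then A.twist (B.deg j) a else 0 := by
  rw [evLin_b, coord_smul_b]
  split_ifs
  · rfl
  · exact map_zero _

theorem evLin_b_b (i j : ι) : evLin B B' (B'.b j) (B.b i) = if i = j then 1 else 0 := by
  rw [evLin_b, coord_b]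
  split_ifs
  · exact CDGA.twist_one _
  · exact map_zero _

include D

theorem evLin_mem {p q : ℤ} {y : N} {x : M} (hy : y ∈ N.str.gr p) (hx : x ∈ M.str.gr q) :
    evLin B B' y x ∈ A.str.gr (p + q) := by
  rw [evLin_apply]
  refine Submodule.sum_mem _ fun i _ => ?_
  have := A.mul_mem (B'.coord_mem i hy) (CDGA.twist_mem (B.coord_mem i hx) (B.deg i))
  rwa [D.deg, show p - -B.deg i + (q - B.deg i) = p + q by ring] at this

theorem evLin_balanced {p q : ℤ} {a : A} {y : N} (x : M) (ha : a ∈ A.str.gr p)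
    (hy : y ∈ N.str.gr q) :
    evLin B B' y (a • x) = (-1 : ℚ) ^ (p * q) • evLin B B' (a • y) x := by
  simp only [evLin_apply, Finset.smul_sum, coord_smul]
  refine Finset.sum_congr rfl fun i _ => ?_
  have h := B'.coord_mem i hy
  rw [D.deg] at h
  rw [CDGA.twist_mul, CDGA.twist_apply ha, A.comm ha h, smul_mul_assoc, mul_smul_comm,
    smul_mul_assoc, mul_assoc, smul_smul, ← negOne_add]
  congr 1
  exact negOne_congr (-p * q) (by ring)

theorem d_evLin {p : ℤ} {y : N} (x : M) (hy : y ∈ N.str.gr p) : A.str.d (evLin B B' y x) =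
    evLin B B' (N.str.d y) x + (-1 : ℚ) ^ p • evLin B B' y (M.str.d x) := by
  -- Replacing the sign by the operator `sgn` makes both sides additive in `y`, so that `y` may be
  -- decomposed over the dual basis.
  rw [← LinearMap.smul_apply, ← map_smul, ← N.str.sgn_apply hy]
  clear hy
  refine B'.induction (p := fun y => A.str.d (evLin B B' y x) =
    evLin B B' (N.str.d y) x + evLin B B' (N.str.sgn y) (M.str.d x)) ?_ (by simp) ?_ y
  · intro q k c hc
    suffices h : A.str.d (evLin B B' (B'.b k) x) = evLin B B' (N.str.d (B'.b k)) x +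
        (-1 : ℚ) ^ (B'.deg k) • evLin B B' (B'.b k) (M.str.d x) by
      rw [N.str.sgn_apply (N.smul_mem hc (B'.mem k)), N.leibniz _ hc, evLin_smul, A.leibniz _ hc, h,
        map_add, (evLin B B').map_smul, (evLin B B').map_smul, LinearMap.add_apply,
        LinearMap.smul_apply, LinearMap.smul_apply, evLin_smul, evLin_smul, evLin_smul, negOne_add,
        mul_add, smul_add, mul_smul_comm, smul_smul, add_assoc]
    rw [D.deg]
    refine B.induction (p := fun x => A.str.d (evLin B B' (B'.b k) x) =
      evLin B B' (N.str.d (B'.b k)) x + (-1 : ℚ) ^ (-B.deg k) • evLin B B' (B'.b k) (M.str.d x))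
      ?_ (by simp) ?_ x
    · intro p j a ha
      have h₁ : evLin B B' (N.str.d (B'.b k)) (a • B.b j) =
          -((-1 : ℚ) ^ (B.deg k * (B.deg j + 1) + p * B.deg j) • (B.dmat k j * a)) := by
        rw [B'.d_b, map_sum, LinearMap.sum_apply, Finset.sum_eq_single j]
        · rw [evLin_smul, evLin_b_smul_b, if_pos rfl, D.dmat, dualDiff, CDGA.twist_apply ha,
            neg_mul, smul_mul_smul_comm, negOne_add]
        · intro i _ hi
          rw [evLin_smul, evLin_b_smul_b, if_neg hi.symm, mul_zero]
        · simp
      have hm : ∀ i, a * B.dmat i j ∈ A.str.gr (p + (B.deg j + 1 - B.deg i)) :=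
        fun i => A.mul_mem ha (B.isMatDiff.mem i j)
      have h₂ : evLin B B' (B'.b k) (M.str.d (a • B.b j)) =
          (if j = k then A.twist (B.deg k) (A.str.d a) else 0) +
          (-1 : ℚ) ^ (p + (p + (B.deg j + 1 - B.deg k)) * B.deg k) • (a * B.dmat k j) := by
        rw [M.leibniz _ ha, map_add, (evLin B B' (B'.b k)).map_smul, evLin_b_smul_b, B.d_b, Finset.smul_sum, map_sum,
          Finset.sum_eq_single k]
        · rw [smul_smul, evLin_b_smul_b, if_pos rfl, CDGA.twist_apply (hm k), smul_smul,
            negOne_add p]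
        · intro i _ hi
          rw [smul_smul, evLin_b_smul_b, if_neg hi]
        · simp
      obtain ⟨c, hc⟩ := Int.even_mul_pred_self (B.deg k)
      rw [h₁, h₂, evLin_b_smul_b, A.comm (B.isMatDiff.mem k j) ha, smul_smul, ← negOne_add,
        smul_add, smul_smul, ← negOne_add,
        negOne_congr (m := B.deg k * (B.deg j + 1) + p * B.deg j + (B.deg j + 1 - B.deg k) * p)
          (n := -B.deg k + (p + (p + (B.deg j + 1 - B.deg k)) * B.deg k))
          (p * B.deg j - p * B.deg k + B.deg k + c) (by linear_combination hc)]
      have h₃ : A.str.d (if j = k then A.twist (B.deg k) a else 0) =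
          (-1 : ℚ) ^ (-B.deg k) • (if j = k then A.twist (B.deg k) (A.str.d a) else 0) := by
        split_ifs
        · rw [CDGA.twist_apply ha, CDGA.twist_apply (A.str.d_mem ha), map_smul, smul_smul,
            ← negOne_add]
          congr 1
          exact negOne_congr 0 (by ring)
        · rw [map_zero, smul_zero]
      rw [h₃]
      abel
    · intro x x' h h'
      simp only [map_add, h, h', smul_add]
      abel
  · intro y y' h h'
    simp only [map_add, LinearMap.add_apply, h, h']
    abel

theorem ρ_evLin (y : N) (x : M) :
    A.str.ρ (evLin B B' y x) = pairH H (evLin B B') (N.str.ρ y) (M.str.ρ x) := by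
  refine B'.induction (p := fun y => A.str.ρ (evLin B B' y x) =
    pairH H (evLin B B') (N.str.ρ y) (M.str.ρ x)) ?_ (by simp) ?_ y
  · intro q k c _
    have hmul : ∀ ξ η : A ⊗[ℚ] H, ξ * η = pairH H (LinearMap.mul ℚ A) ξ η := by
      intro ξ η
      induction ξ using TensorProduct.induction_on with
      | zero => simp
      | add s t hs ht => simp only [map_add, LinearMap.add_apply, add_mul, hs, ht]
      | tmul x h =>
        induction η using TensorProduct.induction_on with
        | zero => simp
        | add s t hs ht => simp only [map_add, mul_add, hs, ht]
        | tmul y k => simp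
    suffices h : A.str.ρ (evLin B B' (B'.b k) x) =
        pairH H (evLin B B') (N.str.ρ (B'.b k)) (M.str.ρ x) by
      rw [evLin_smul, A.ρ_mul, h, N.ρ_smul, hmul]
      exact (pairH_assoc (fun a y x => evLin_smul a y x) _ _ _).symm
    refine B.induction (p := fun x => A.str.ρ (evLin B B' (B'.b k) x) =
      pairH H (evLin B B') (N.str.ρ (B'.b k)) (M.str.ρ x)) ?_ (by simp)
      (fun x x' h h' => by simp only [map_add, h, h']) x
    intro p j a ha
    have hρ : A.str.ρ (A.twist (B.deg k) a) = (A.twist (B.deg k)).rTensor H (A.str.ρ a) :=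
      (equivariant_iff (f := A.twist (B.deg k)) (ρ := A.str.ρ) (ρ' := A.str.ρ)).2
        (fun φ a => CDGA.coact_twist φ _ a) a
    have hP : ∀ (ξ : A ⊗[ℚ] H) i l s t, pairH H (evLin B B') (B'.b i ⊗ₜ s)
        (pairH H (Algebra.lsmul (A := A) ℚ ℚ M).toLinearMap ξ (B.b l ⊗ₜ t)) =
          if l = i then (A.twist (B.deg i)).rTensor H ξ * (1 ⊗ₜ (s * t)) else 0 := by
      intro ξ i l s t
      induction ξ using TensorProduct.induction_on with
      | zero => simp
      | add ξ η hξ hη =>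
        simp only [map_add, LinearMap.add_apply, hξ, hη, add_mul]
        split_ifs
        · rfl
        · rw [add_zero]
      | tmul a m =>
        rw [pairH_tmul, pairH_tmul]
        change evLin B B' (B'.b i) (a • B.b l) ⊗ₜ _ = _
        rw [evLin_b_smul_b]
        split_ifs
        · rw [LinearMap.rTensor_tmul, Algebra.TensorProduct.tmul_mul_tmul, mul_one,
            mul_left_comm]
        · exact TensorProduct.zero_tmul _ _
    rw [evLin_b_smul_b, M.ρ_smul, B.ρ_b, B'.ρ_b]
    simp only [map_sum, LinearMap.sum_apply, hP]
    -- The twist depends on `i` only through its degree, and the matrix coefficient vanishes unless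
    -- the degrees agree. With a constant twist the sum becomes an entry of `S(h) h = 1`.
    have e : ∀ i, (A.twist (B.deg i)).rTensor H (A.str.ρ a) * (1 ⊗ₜ[ℚ] (B'.mat i k * B.mat i j)) =
        (A.twist (B.deg k)).rTensor H (A.str.ρ a) *
          (1 ⊗ₜ[ℚ] (antipodeMat B.mat k i * B.mat i j)) := by
      intro i
      rw [D.mat]
      by_cases hi : B.deg k = B.deg i
      · rw [hi]
      · rw [B.isMatCoaction.antipode_of_ne hi, zero_mul, TensorProduct.tmul_zero, mul_zero,
          mul_zero]
    simp only [e, Finset.sum_ite_eq, Finset.mem_univ, if_true]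
    rw [← Finset.mul_sum, ← TensorProduct.tmul_sum, ← Matrix.mul_apply,
      B.isMatCoaction.antipode_mul, Matrix.one_apply]
    simp only [eq_comm (a := k)]
    split_ifs
    · rw [hρ, ← Algebra.TensorProduct.one_def, mul_one]
    · rw [TensorProduct.tmul_zero, mul_zero, map_zero]
  · intro y y' h h'
    simp only [map_add, LinearMap.add_apply, h, h']

/-- The evaluation. -/
def ev : tensor N M ⟶ unit A :=
  BiHom.lift
    { toLin := (evLin B B').compr₂ (ofA.restrictScalars ℚ)
      balanced := fun x ha hy => congrArg ofA (evLin_balanced D x ha hy)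
      smul := fun a y x => congrArg ofA (evLin_smul a y x)
      mem := fun hy hx => ofA_mem (evLin_mem D hy hx)
      d := fun x hy => congrArg ofA (d_evLin D x hy)
      ρ := fun y x => ρ_evLin D y x }

theorem ev_tm (y : N) (x : M) : (ev D).toLin (tm N M y x) = ofA (evLin B B' y x) :=
  BiHom.lift_tm _ _ _

/-- The coevaluation. -/
def coev : unit A ⟶ tensor M N :=
  ofCycle (∑ i, tm M N (B.b i) (B'.b i))
    (Submodule.sum_mem _ fun i _ => tm_mem (B.mem i) (B'.mem i) (by rw [D.deg, add_neg_cancel]))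
    (by
      rw [map_sum]
      have e : ∀ j, (tensor M N).str.d (tm M N (B.b j) (B'.b j)) =
          ∑ i, tm M N (B.dmat i j • B.b i) (B'.b j) +
            ∑ i, (-1 : ℚ) ^ B.deg j • tm M N (B.b j) (B'.dmat i j • B'.b i) := fun j => by
        rw [d_tm (B.mem j), B.d_b, B'.d_b, map_sum, map_sum, LinearMap.sum_apply, Finset.smul_sum]
      simp only [e, Finset.sum_add_distrib]
      rw [Finset.sum_comm, ← Finset.sum_add_distrib]
      refine Finset.sum_eq_zero fun i _ => ?_
      rw [← Finset.sum_add_distrib]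
      refine Finset.sum_eq_zero fun j _ => ?_
      -- The `(i, j)` term of `d b_j` in the first factor cancels the `(j, i)` term of `d b'_i` in
      -- the second: moving the coefficient across the tensor sign produces exactly the opposite
      -- sign.
      have hm : B'.dmat j i ∈ A.str.gr (B.deg j + 1 - B.deg i) := by
        have := B'.isMatDiff.mem j i
        rwa [D.deg, D.deg, show -B.deg i + 1 - -B.deg j = B.deg j + 1 - B.deg i by ring] at this
      obtain ⟨c, hc⟩ := Int.even_mul_pred_self (B.deg i)
      rw [tm_balanced _ hm (B.mem i), D.dmat, dualDiff, neg_smul, map_neg, LinearMap.neg_apply,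
        smul_assoc, (tm M N).map_smul, LinearMap.smul_apply, smul_neg, smul_neg, smul_smul, smul_smul,
        ← negOne_add, ← negOne_add, negOne_congr (n := 0)
          (B.deg i * B.deg j + B.deg i - c) (by linear_combination -hc),
        zpow_zero, one_smul, add_neg_cancel])
    (by
      simp only [map_sum, ρ_tm, B.ρ_b, B'.ρ_b, LinearMap.sum_apply, pairH_tmul, D.mat]
      rw [Finset.sum_comm, TensorProduct.sum_tmul]
      refine Finset.sum_congr rfl fun k _ => ?_
      rw [Finset.sum_comm]
      -- Invariance of the coevaluation element is the identity `h S(h) = 1`, read off entry by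
      -- entry.
      simp only [← TensorProduct.tmul_sum, ← Matrix.mul_apply, B.isMatCoaction.mul_antipode]
      rw [Finset.sum_eq_single k]
      · rw [Matrix.one_apply_eq]
      · intro i _ hi
        rw [Matrix.one_apply_ne hi, TensorProduct.tmul_zero]
      · simp)

theorem coev_ofA_one : (coev D).toLin (ofA 1) = ∑ i, tm M N (B.b i) (B'.b i) :=
  (ofCycle_ofA _ _ _ _ _).trans (one_smul _ _)

/-- Dual bases define a duality. -/
theorem exactPairing : Nonempty (ExactPairing M N) := ⟨{
  coevaluation' := coev D
  evaluation' := ev D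
  coevaluation_evaluation' := by
    rw [← cancel_epi (ρ_ N).inv]
    refine B'.hom_ext fun k => ?_
    change (tensorHom (ev D) (𝟙 N)).toLin ((assocInv N M N).toLin
      ((tensorHom (𝟙 N) (coev D)).toLin (tm N (unit A) (B'.b k) (ofA 1)))) =
        (leftUnitorInv N).toLin ((rightUnitorHom N).toLin (tm N (unit A) (B'.b k) (ofA 1)))
    rw [tensorHom_tm, coev_ofA_one, rightUnitorHom_tm, ract_one, leftUnitorInv_apply]
    simp only [map_sum, id_apply, assocInv_tm, tensorHom_tm, ev_tm, evLin_b_b]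
    rw [Finset.sum_eq_single k]
    · rw [if_pos rfl]
    · intro i _ hi
      rw [if_neg hi, map_zero, map_zero, LinearMap.zero_apply]
    · simp
  evaluation_coevaluation' := by
    rw [← cancel_epi (λ_ M).inv]
    refine B.hom_ext fun k => ?_
    change (tensorHom (𝟙 M) (ev D)).toLin ((assocHom M N M).toLin
      ((tensorHom (coev D) (𝟙 M)).toLin (tm (unit A) M (ofA 1) (B.b k)))) =
        (rightUnitorInv M).toLin ((leftUnitorHom M).toLin (tm (unit A) M (ofA 1) (B.b k)))
    rw [tensorHom_tm, coev_ofA_one, leftUnitorHom_tm, one_smul, rightUnitorInv_apply]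
    simp only [map_sum, LinearMap.sum_apply, id_apply, assocHom_tm, tensorHom_tm, ev_tm, evLin_b_b]
    rw [Finset.sum_eq_single k]
    · rw [if_pos rfl]
    · intro i _ hi
      rw [if_neg hi.symm, map_zero, map_zero]
    · simp }⟩

end DGMod.HBasis

end

/-! ### Dualities under monoidal functors; finite cell modules are rigid -/

noncomputable section

open MonoidalCategory

namespace CategoryTheory

open Category Functor.LaxMonoidal Functor.OplaxMonoidal

variable {C D : Type*} [Category* C] [Category* D] [MonoidalCategory C] [MonoidalCategory D]

/-- Monoidal functors preserve dualities. -/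
abbrev ExactPairing.map (F : C ⥤ D) [F.Monoidal] (X Y : C) [ExactPairing X Y] :
    ExactPairing (F.obj X) (F.obj Y) where
  coevaluation' := ε F ≫ F.map (η_ X Y) ≫ δ F X Y
  evaluation' := μ F Y X ≫ F.map (ε_ X Y) ≫ η F
  coevaluation_evaluation' := by
    have h := congrArg F.map (ExactPairing.coevaluation_evaluation (X := X) (Y := Y))
    simp only [Functor.map_comp] at h
    have e := congrArg (fun f => F.obj Y ◁ ε F ≫ μ F Y (𝟙_ C) ≫ f ≫ δ F (𝟙_ C) Y ≫ η F ▷ F.obj Y) h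
    simp only [Functor.Monoidal.map_whiskerLeft, Functor.Monoidal.map_whiskerRight,
      Functor.Monoidal.map_associator_inv, assoc, Functor.Monoidal.μ_δ_assoc] at e
    simpa using e
  evaluation_coevaluation' := by
    have h := congrArg F.map (ExactPairing.evaluation_coevaluation (X := X) (Y := Y))
    simp only [Functor.map_comp] at h
    have e := congrArg (fun f => ε F ▷ F.obj X ≫ μ F (𝟙_ C) X ≫ f ≫ δ F X (𝟙_ C) ≫ F.obj X ◁ η F) h
    simp only [Functor.Monoidal.map_whiskerLeft, Functor.Monoidal.map_whiskerRight,
      Functor.Monoidal.map_associator, assoc, Functor.Monoidal.μ_δ_assoc] at e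
    simpa using e

/-- A morphism through which the coevaluation of a duality factors has a section. -/
theorem ExactPairing.exists_section {X Y F : C} [ExactPairing X Y] (f : F ⟶ X)
    (d : 𝟙_ C ⟶ F ⊗ Y) (h : d ≫ f ▷ Y = η_ X Y) : ∃ s : X ⟶ F, s ≫ f = 𝟙 X := by
  -- The section sends `X` through `d` to `F ⊗ Y ⊗ X` and then evaluates. By naturality `f` can be
  -- moved in front of the evaluation, where it completes `d` to the coevaluation, and a triangle
  -- identity remains.
  refine ⟨(λ_ X).inv ≫ d ▷ X ≫ (α_ F Y X).hom ≫ F ◁ ε_ X Y ≫ (ρ_ F).hom, ?_⟩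
  have e := ExactPairing.evaluation_coevaluation (X := X) (Y := Y)
  rw [← h] at e
  simp only [comp_whiskerRight, assoc] at e ⊢
  rw [← rightUnitor_naturality, whisker_exchange_assoc, ← associator_naturality_left_assoc,
    reassoc_of% e]
  simp

end CategoryTheory

variable {H : Type u} [CommRing H] [HopfAlgebra ℚ H] {A : CDGA H}

namespace DGMod

variable (A) in
/-- The localization functor on flat dg modules. -/
abbrev QFlat : (flat A).FullSubcategory ⥤ DFlat A :=
  Localization.Monoidal.toMonoidalCategory (quasiIsoFlat A).Q (quasiIsoFlat A) (Iso.refl _)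

variable (A) in
/-- The localization functors are compatible. -/
def QFlatCompIso : QFlat A ⋙ flatToD A ≅ (flat A).ι ⋙ toDCat A :=
  Localization.fac _ (quasiIsoFlat_isInvertedBy (A := A)) (QFlat A)

/-- The duality exists already for dg modules and holds between flat ones. It is inherited by the
full subcategory of flat modules and preserved by the monoidal localization functor. -/
theorem isRigid_of_finiteD {X : DCat A} (h : finiteD A X) : IsRigid X := by
  obtain ⟨M, ⟨c, hc⟩, ⟨e⟩⟩ := h
  obtain ⟨ι, _, _, ⟨B⟩⟩ := CellStructure.exists_hBasis c
  obtain ⟨N, B', D⟩ := B.exists_isDual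
  obtain ⟨p⟩ := HBasis.exactPairing D
  let M' : (flat A).FullSubcategory := ⟨M, B.flat⟩
  let N' : (flat A).FullSubcategory := ⟨N, B'.flat⟩
  have : ExactPairing ((flat A).ι.obj M') ((flat A).ι.obj N') := p
  have : ExactPairing M' N' := .ofFullyFaithful (flat A).ι M' N'
  exact ⟨(QFlat A).obj M', (QFlat A).obj N', ⟨.map (QFlat A) M' N'⟩,
    ⟨(QFlatCompIso A).app M' ≪≫ e.symm⟩⟩

end DGMod

end

/-! ### The cylinder of the unit -/

noncomputable section

open MonoidalCategory

variable {H : Type u} [CommRing H] [HopfAlgebra ℚ H] {A : CDGA H}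

namespace DGMod

variable {M N : DGMod A}

/-- A morphism of dg modules with a contraction is a quasi-isomorphism. -/
theorem IsQuasiIso.of_contraction (f : M ⟶ N) (s : N → M) (K : M → M)
    (hs : ∀ y, M.str.d (s y) = s (N.str.d y)) (hs₀ : s 0 = 0) (hf : ∀ y, f.toLin (s y) = y)
    (hK₀ : K 0 = 0) (hK : ∀ x, M.str.d (K x) + K (M.str.d x) = x - s (f.toLin x)) :
    IsQuasiIso f where
  injective x hx y hy := by
    have := hK x
    rw [hx, hK₀, add_zero, hy, ← hs] at this
    exact ⟨K x + s y, by rw [map_add, this, sub_add_cancel]⟩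
  surjective y hy := ⟨s y, 0, by rw [hs, hy, hs₀], by rw [hf, map_zero, add_zero]⟩

end DGMod

section

variable {ι : Type u} [Fintype ι] [DecidableEq ι] {deg : ι → ℤ}

theorem Twist.exists_hom_ofMat {h : Matrix ι ι H} (hh : IsMatCoaction deg h) {θ : Matrix ι ι A}
    (hθ : IsMatDiff deg h θ) {N : DGMod A} (v : ι → N) (hv : ∀ i, v i ∈ N.str.gr (deg i))
    (hρ : ∀ j, N.str.ρ (v j) = ∑ i, v i ⊗ₜ h i j) (hd : ∀ j, N.str.d (v j) = ∑ i, θ i j • v i) :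
    ∃ f : (Twist.ofMat hh hθ).toMod ⟶ N,
      ∀ a i, f.toLin ((Twist.ofMat hh hθ).gen a (Pi.single i 1)) = a • v i := by
  let g : (ι → ℚ) →ₗ[ℚ] N := Fintype.linearCombination ℚ v
  have hg : ∀ i, g (Pi.single i 1) = v i := fun i => by
    rw [Fintype.linearCombination_apply_single, one_smul]
  obtain ⟨f, hf⟩ := (Twist.ofMat hh hθ).exists_hom (g := g) (fun n y hy => by
    refine Submodule.sum_mem _ fun i _ => ?_
    by_cases hi : deg i = n
    · exact Submodule.smul_mem _ _ (hi ▸ hv i)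
    · rw [hy i hi, zero_smul]; exact zero_mem _) (fun φ y => by
    refine LinearMap.congr_fun (f := coact N.str.ρ φ ∘ₗ g) (g := g ∘ₗ coact (matCoaction h) φ)
      (hom_ext_single fun j => ?_) y
    rw [LinearMap.comp_apply, LinearMap.comp_apply, hg, coact_apply, coact_apply, hρ,
      matCoaction_single]
    simp only [map_sum, slice_tmul, map_smul, hg]) (fun n y _ => by
    refine LinearMap.congr_fun (f := (Twist.ofMat hh hθ).ext 0 g ∘ₗ (Twist.ofMat hh hθ).tau)
      (g := N.str.d ∘ₗ g) (hom_ext_single fun j => ?_) y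
    rw [LinearMap.comp_apply, LinearMap.comp_apply, hg, hd, show (Twist.ofMat hh hθ).tau
      (Pi.single j 1) = ∑ i, (Twist.ofMat hh hθ).gen (θ i j) (Pi.single i 1) from
        matTau_single θ j, map_sum]
    simp only [ext_gen, CDGA.twist_zero, hg])
  exact ⟨f, fun a i => by rw [hf, hg]⟩

theorem isMatCoaction_one (deg : ι → ℤ) : IsMatCoaction deg (1 : Matrix ι ι H) where
  counit i j := by
    rw [Matrix.one_apply]
    simp only [eq_comm (a := j)]
    split_ifs <;> simp
  comul i j := by
    rw [Finset.sum_eq_single j]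
    · simp only [Matrix.one_apply_eq]
      rw [Matrix.one_apply]
      split_ifs <;> simp [Algebra.TensorProduct.one_def]
    · intro l _ hl
      rw [Matrix.one_apply_ne hl, TensorProduct.tmul_zero]
    · simp
  of_ne i j e := Matrix.one_apply_ne fun h => e (by rw [h])

end

theorem coact_matCoaction_one {ι : Type u} [Fintype ι] [DecidableEq ι] (φ : H →ₗ[ℚ] ℚ)
    (y : ι → ℚ) : coact (matCoaction (1 : Matrix ι ι H)) φ y = φ 1 • y := by
  rw [coact_matCoaction]
  ext i
  simp [Matrix.mulVec, dotProduct, Matrix.map_apply, Matrix.one_apply, apply_ite φ]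

namespace Cylinder

/-- The degrees of the generators of the cylinder: `none` is the interval, and its boundary points
are the other generators. -/
def deg : Option (Option PUnit.{u + 1}) → ℤ
  | none => -1
  | some _ => 0

/-- The matrix of the differential of the cylinder. -/
def mat (A : CDGA H) : Matrix (Option (Option PUnit.{u + 1})) (Option (Option PUnit.{u + 1})) A
  | some none, none => -1
  | some (some _), none => 1
  | _, _ => 0

theorem isMatDiff : IsMatDiff deg 1 (mat A) where
  mem := by
    rintro (_ | _ | _) (_ | _ | _) <;>
      first | exact zero_mem _ | exact A.one_mem | exact neg_mem A.one_mem
  d := by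
    rintro (_ | _ | _) (_ | _ | _) <;>
      simp [mat, Fintype.sum_option, DGMod.d_one]
  ρ := by
    rintro (_ | _ | _) (_ | _ | _) <;>
      simp [mat, Fintype.sum_option, Matrix.one_apply, A.ρ_one, TensorProduct.neg_tmul]

variable (A) in
/-- The cylinder of `A`. -/
def twist : Twist A (Option (Option PUnit.{u + 1}) → ℚ) :=
  Twist.ofMat (isMatCoaction_one deg) isMatDiff

variable (A) in
/-- The basis of the cylinder. -/
def hBasis : DGMod.HBasis (Option (Option PUnit.{u + 1})) (twist A).toMod :=
  Twist.hBasis (isMatCoaction_one deg) isMatDiff (fun | none => 1 | some _ => 0) (by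
    rintro (_ | _ | _) (_ | _ | _) h <;> first | rfl | exact absurd h Nat.zero_lt_one.not_ge)

/-- The generators of the cylinder. -/
def b (i : Option (Option PUnit.{u + 1})) : (twist A).toMod := (twist A).gen 1 (Pi.single i 1)

theorem b_mem (i : Option (Option PUnit.{u + 1})) : b (A := A) i ∈ (twist A).toMod.str.gr (deg i) :=
  (twist A).gen_one_mem (GComplex.single_mem_ofMat (isMatCoaction_one deg) i)

theorem d_b (i : Option (Option PUnit.{u + 1})) :
    (twist A).toMod.str.d (b i) = ∑ j, mat A j i • b j := by
  refine ((twist A).d_gen_one _).trans ((matTau_single (mat A) i).trans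
    (Finset.sum_congr rfl fun j _ => ?_))
  exact (twist A).gen_eq_smul (mat A j i) _

theorem ρ_b (i : Option (Option PUnit.{u + 1})) :
    (twist A).toMod.str.ρ (b i) = b i ⊗ₜ 1 := by
  have hb : ∀ j, (hBasis A).b j = b j := (twist A).basis_apply
  rw [← hb, (hBasis A).ρ_b, Finset.sum_eq_single i]
  · exact congrArg _ (Matrix.one_apply_eq i)
  · intro j _ hj
    exact (congrArg _ (Matrix.one_apply_ne hj)).trans (TensorProduct.tmul_zero _ _)
  · simp

theorem d_b_some (i : Option PUnit.{u + 1}) : (twist A).toMod.str.d (b (some i)) = 0 := by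
  rw [d_b]
  exact Finset.sum_eq_zero fun j _ => by rcases j with _ | _ | _ <;> exact zero_smul _ _

theorem d_b_none : (twist A).toMod.str.d (b none) = b (some (some ⟨⟩)) - b (some none) := by
  rw [d_b, Fintype.sum_option, Fintype.sum_option, Fintype.sum_unique]
  change (0 : A) • _ + ((-1 : A) • _ + (1 : A) • b (some (some ⟨⟩))) = _
  rw [zero_smul, neg_smul, one_smul, one_smul, zero_add, neg_add_eq_sub]

/-- The inclusions of the boundary of the cylinder. -/
def incl (i : Option PUnit.{u + 1}) : DGMod.unit A ⟶ (twist A).toMod :=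
  DGMod.ofCycle (b (some i)) (b_mem (some i)) (d_b_some i) (ρ_b _)

theorem incl_ofA_one (i : Option PUnit.{u + 1}) :
    (incl (A := A) i).toLin (DGMod.ofA 1) = b (some i) := one_smul _ _

/-- The universal property of the cylinder: a morphism out of it amounts to two invariant cocycles
of degree zero and an invariant element whose boundary is their difference. -/
theorem exists_hom {N : DGMod A} {x y z : N} (hx : x ∈ N.str.gr 0) (hy : y ∈ N.str.gr 0)
    (hz : z ∈ N.str.gr (-1)) (dx : N.str.d x = 0) (dy : N.str.d y = 0) (dz : N.str.d z = y - x)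
    (ρx : N.str.ρ x = x ⊗ₜ 1) (ρy : N.str.ρ y = y ⊗ₜ 1) (ρz : N.str.ρ z = z ⊗ₜ 1) :
    ∃ f : (twist A).toMod ⟶ N, f.toLin (b none) = z ∧ f.toLin (b (some none)) = x ∧
      f.toLin (b (some (some ⟨⟩))) = y := by
  let v : Option (Option PUnit.{u + 1}) → N := fun | none => z | some none => x | some (some _) => y
  obtain ⟨f, hf⟩ := Twist.exists_hom_ofMat (isMatCoaction_one deg) (isMatDiff (A := A)) v
    (by rintro (_ | _ | _) <;> assumption)
    (by rintro (_ | _ | _) <;> simp [Fintype.sum_option, Matrix.one_apply, v, ρx, ρy, ρz])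
    (by rintro (_ | _ | _) <;> simp [Fintype.sum_option, mat, v, dx, dy, dz, sub_eq_neg_add])
  exact ⟨f, (hf 1 _).trans (one_smul _ _), (hf 1 _).trans (one_smul _ _),
    (hf 1 _).trans (one_smul _ _)⟩

theorem exists_proj : ∃ p : (twist A).toMod ⟶ DGMod.unit A, (∀ i, incl i ≫ p = 𝟙 _) ∧
    DGMod.IsQuasiIso p := by
  have h₁ : (DGMod.unit A).str.d (DGMod.ofA 1) = 0 := by
    rw [DGMod.d_ofA, DGMod.d_one, map_zero]
  obtain ⟨p, hp, hp₀, hp₁⟩ := exists_hom (A := A) (N := DGMod.unit A) (x := DGMod.ofA 1)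
    (y := DGMod.ofA 1) (z := 0) (DGMod.ofA_mem A.one_mem) (DGMod.ofA_mem A.one_mem) (zero_mem _)
    h₁ h₁ (by rw [map_zero, sub_self]) DGMod.ρ_ofA_one DGMod.ρ_ofA_one
    (by rw [map_zero, TensorProduct.zero_tmul])
  have hi : ∀ i, incl i ≫ p = 𝟙 _ := by
    intro i
    refine DGMod.unit_hom_ext ?_
    rw [DGMod.comp_toLin, LinearMap.comp_apply, incl_ofA_one]
    obtain _ | _ := i
    · exact hp₀
    · exact hp₁
  refine ⟨p, hi, ?_⟩
  -- The contraction sends the second endpoint to the interval and the other generators to zero;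
  -- with it, `d K + K d` is the identity minus the projection to the first endpoint.
  let g : (Option (Option PUnit.{u + 1}) → ℚ) →ₗ[ℚ] (twist A).toMod :=
    (LinearMap.proj (some (some ⟨⟩))).smulRight (b none)
  have hg : DGMod.IsGLin (-1) ((twist A).ext (-1) g) := (twist A).isGLin_ext (fun n y hy => by
    by_cases h : n = 0
    · subst h
      exact Submodule.smul_mem _ _ (b_mem none)
    · have : y (some (some ⟨⟩)) = 0 := hy _ (Ne.symm h)
      rw [LinearMap.smulRight_apply, LinearMap.proj_apply, this, zero_smul]
      exact zero_mem _) (fun φ y => by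
    change coact (twist A).toMod.str.ρ φ (y (some (some ⟨⟩)) • b none) =
      (coact (matCoaction (1 : Matrix _ _ H)) φ y) (some (some ⟨⟩)) • b none
    rw [map_smul, coact_apply, ρ_b, slice_tmul, coact_matCoaction_one, smul_smul, mul_comm]
    rfl)
  have hK : ∀ j, (twist A).ext (-1) g (b j) = g (Pi.single j 1) := fun j =>
    (twist A).ext_gen_one (-1) g _
  have hK₀ : (twist A).ext (-1) g (b none) = 0 := by
    rw [hK]; exact zero_smul _ _
  have hK₁ : (twist A).ext (-1) g (b (some none)) = 0 := by
    rw [hK]; exact zero_smul _ _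
  have hK₂ : (twist A).ext (-1) g (b (some (some ⟨⟩))) = b none := by
    rw [hK]; exact one_smul _ _
  have e₁ : (-1 : ℚ) ^ (-1 : ℤ) = -1 := by norm_num
  have key := (twist A).ext_eq (f := DGMod.bdry (-1) ((twist A).ext (-1) g))
    (f' := LinearMap.id - (p ≫ incl none).toLin.restrictScalars ℚ) hg.d_comm
    ((𝟙 _ : (twist A).toMod ⟶ _).isGLin.sub (p ≫ incl none).isGLin) (fun n y _ => by
    refine LinearMap.congr_fun (f := DGMod.bdry (-1) ((twist A).ext (-1) g) ∘ₗ (twist A).gen 1)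
      (g := (LinearMap.id - (p ≫ incl none).toLin.restrictScalars ℚ) ∘ₗ (twist A).gen 1)
      (hom_ext_single fun j => ?_) y
    change DGMod.bdry (-1) ((twist A).ext (-1) g) (b j) = b j - (incl none).toLin (p.toLin (b j))
    rw [DGMod.bdry_apply, e₁, neg_one_smul, sub_neg_eq_add]
    rcases j with _ | _ | _
    · rw [hK₀, d_b_none, map_sub, hK₁, hK₂, hp, map_zero, map_zero, zero_add]
    · rw [hK₁, d_b_some, hp₀, incl_ofA_one, map_zero, map_zero, sub_self, zero_add]
    · rw [hK₂, d_b_some, d_b_none, hp₁, incl_ofA_one, map_zero, add_zero])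
  refine .of_contraction p (incl none).toLin ((twist A).ext (-1) g) (fun y => ((incl none).d y).symm)
    (map_zero _) (fun y => congrArg (fun f : DGMod.unit A ⟶ DGMod.unit A => f.toLin y) (hi none))
    (map_zero _) fun x => ?_
  have := LinearMap.congr_fun key x
  rw [DGMod.bdry_apply, e₁, neg_one_smul, sub_neg_eq_add] at this
  exact this

end Cylinder

namespace DGMod

variable {X : DGMod A}

theorem flat_unit : flat A (unit A) := (flat A).prop_unit

/-- Homotopic morphisms from the unit to a flat dg module agree in the derived category. -/
theorem QFlat_map_eq (hX : flat A X) {f g : unit A ⟶ X} (h : Homotopic f g) :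
    (QFlat A).map (X := ⟨unit A, flat_unit⟩) (Y := ⟨X, hX⟩) ⟨f⟩ = (QFlat A).map ⟨g⟩ := by
  obtain ⟨h, hh, e⟩ := homotopic_iff.1 h
  have hd : ∀ f : unit A ⟶ X, X.str.d (f.toLin (ofA 1)) = 0 := fun f => by
    rw [← f.d, d_ofA, d_one, map_zero, map_zero]
  have hρ : ∀ f : unit A ⟶ X, X.str.ρ (f.toLin (ofA 1)) = f.toLin (ofA 1) ⊗ₜ 1 := fun f => by
    rw [f.ρ, ρ_ofA_one]
    rfl
  obtain ⟨k, -, k₀, k₁⟩ := Cylinder.exists_hom (N := X) (x := g.toLin (ofA 1))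
    (y := f.toLin (ofA 1)) (z := h (ofA 1)) (g.mem (ofA_mem A.one_mem))
    (f.mem (ofA_mem A.one_mem)) (hh.mem 0 _ (ofA_mem A.one_mem)) (hd g) (hd f)
    (by rw [e, d_ofA, d_one, map_zero, map_zero, add_zero]) (hρ g) (hρ f) (by
      refine (equivariant_iff (f := h) (ρ := (unit A).str.ρ) (ρ' := X.str.ρ)).2 hh.coact _ |>.trans ?_
      rw [ρ_ofA_one]
      rfl)
  have hk : ∀ (i : Option PUnit.{u + 1}) (f : unit A ⟶ X),
      k.toLin (Cylinder.b (some i)) = f.toLin (ofA 1) → Cylinder.incl i ≫ k = f := by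
    intro i f hf
    refine unit_hom_ext ?_
    rw [comp_toLin, LinearMap.comp_apply, Cylinder.incl_ofA_one, hf]
  obtain ⟨p, hp, hq⟩ := Cylinder.exists_proj (A := A)
  let U : (flat A).FullSubcategory := ⟨unit A, flat_unit⟩
  let C : (flat A).FullSubcategory := ⟨(Cylinder.twist A).toMod, (Cylinder.hBasis A).flat⟩
  let X' : (flat A).FullSubcategory := ⟨X, hX⟩
  let i (j) : U ⟶ C := ⟨Cylinder.incl j⟩
  let k' : C ⟶ X' := ⟨k⟩
  let p' : C ⟶ U := ⟨p⟩
  have : IsIso ((QFlat A).map p') := Localization.inverts (QFlat A) (quasiIsoFlat A) p' hq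
  -- Both endpoint inclusions are sections of `p`, which becomes invertible, so they become equal.
  -- The flat derived category is a localization of dg modules and not of homotopy classes, which is
  -- why the cylinder, itself flat, is needed.
  have hi : (QFlat A).map (i none) = (QFlat A).map (i (some ⟨⟩)) := by
    rw [← cancel_mono ((QFlat A).map p'), ← Functor.map_comp, ← Functor.map_comp]
    congr 1
    exact ObjectProperty.hom_ext _ ((hp none).trans (hp _).symm)
  have h₁ : (⟨f⟩ : U ⟶ X') = i (some ⟨⟩) ≫ k' := ObjectProperty.hom_ext _ (hk _ f k₁).symm
  have h₀ : (⟨g⟩ : U ⟶ X') = i none ≫ k' := ObjectProperty.hom_ext _ (hk _ g k₀).symm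
  change (QFlat A).map (⟨f⟩ : U ⟶ X') = (QFlat A).map (⟨g⟩ : U ⟶ X')
  rw [h₀, h₁, Functor.map_comp, Functor.map_comp, hi]

end DGMod

end

/-! ### Shifted sums, free modules on complexes, and iterated syzygies -/

noncomputable section

variable {H : Type u} [CommRing H] [HopfAlgebra ℚ H] {A : CDGA H}

namespace GComplex

/-- The sum of the shifts `M n [n]` of graded representations. -/
abbrev ShiftSum (M : ℕ → DGMod A) : Type u := DirectSum ℕ fun n => (M n : Type u)

variable (M : ℕ → DGMod A)

/-- The inclusion of a summand. -/
abbrev sι (n : ℕ) : M n →ₗ[ℚ] ShiftSum M := DirectSum.lof ℚ ℕ (fun n => (M n : Type u)) n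

/-- The projection to a summand. -/
abbrev sπ (n : ℕ) : ShiftSum M →ₗ[ℚ] M n := DirectSum.component ℚ ℕ (fun n => (M n : Type u)) n

theorem sπ_sι_same (n : ℕ) (x : M n) : sπ M n (sι M n x) = x := DirectSum.component.lof_self _ _ _

theorem sπ_sι_of_ne {m n : ℕ} (h : m ≠ n) (x : M m) : sπ M n (sι M m x) = 0 := by
  rw [DirectSum.component.of, dif_neg h]

variable {M} in
theorem shiftSum_induction {p : ShiftSum M → Prop} (of : ∀ n x, p (sι M n x)) (zero : p 0)
    (add : ∀ x y, p x → p y → p (x + y)) (x : ShiftSum M) : p x :=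
  DirectSum.induction_on x zero of add

/-- The grading of the sum. -/
def shiftGr (m : ℤ) : Submodule ℚ (ShiftSum M) := ⨅ n : ℕ, ((M n).str.gr (m + n)).comap (sπ M n)

variable {M} in
theorem mem_shiftGr {m : ℤ} {x : ShiftSum M} :
    x ∈ shiftGr M m ↔ ∀ n : ℕ, sπ M n x ∈ (M n).str.gr (m + n) := Submodule.mem_iInf _

variable {M} in
theorem sι_mem {m : ℤ} {n : ℕ} {x : M n} (hx : x ∈ (M n).str.gr (m + n)) :
    sι M n x ∈ shiftGr M m := by
  refine mem_shiftGr.2 fun l => ?_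
  by_cases h : n = l
  · subst h
    rwa [sπ_sι_same]
  · rw [sπ_sι_of_ne M h]
    exact zero_mem _

variable {M} in
theorem shiftGr_le {m : ℤ} {W : Submodule ℚ (ShiftSum M)}
    (h : ∀ (n : ℕ), ∀ x ∈ (M n).str.gr (m + n), sι M n x ∈ W) : shiftGr M m ≤ W := by
  classical
  intro x hx
  rw [← DirectSum.sum_support_of x]
  exact Submodule.sum_mem _ fun n _ => h n _ (mem_shiftGr.1 hx n)

/-- The coaction on the sum. -/
def shiftCoaction : ShiftSum M →ₗ[ℚ] ShiftSum M ⊗[ℚ] H :=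
  DirectSum.toModule ℚ ℕ _ fun n => (sι M n).rTensor H ∘ₗ (M n).str.ρ

theorem shiftCoaction_sι (n : ℕ) (x : M n) :
    shiftCoaction M (sι M n x) = (sι M n).rTensor H ((M n).str.ρ x) :=
  DirectSum.toModule_lof _ _ _

theorem coact_sι (φ : H →ₗ[ℚ] ℚ) (n : ℕ) (x : M n) :
    coact (shiftCoaction M) φ (sι M n x) = sι M n (coact (M n).str.ρ φ x) := by
  rw [coact_apply, shiftCoaction_sι, slice_rTensor]
  rfl

/-- The sum of the shifts of graded representations, as a complex with differential zero. -/
def shiftSum : GComplex H (ShiftSum M) where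
  gr := shiftGr M
  isInternal := by
    refine isInternal_of_proj (fun m => DirectSum.toModule ℚ ℕ _ fun n =>
      sι M n ∘ₗ (M n).str.proj (m + n)) (fun x => ?_) fun m x hx m' => ?_
    · refine shiftSum_induction (p := fun x => x ∈ iSup (shiftGr M)) (fun n x => ?_) (zero_mem _)
        (fun _ _ => add_mem) x
      refine (M n).str.induction (p := fun x => sι M n x ∈ iSup (shiftGr M)) (fun m x hx => ?_)
        (by rw [map_zero]; exact zero_mem _)
        (fun _ _ h h' => by rw [map_add]; exact add_mem h h') x
      exact Submodule.mem_iSup_of_mem (m - n) (sι_mem (by rwa [sub_add_cancel]))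
    · have : shiftGr M m ≤ LinearMap.ker ((DirectSum.toModule ℚ ℕ _ fun n =>
          sι M n ∘ₗ (M n).str.proj (m' + n)) - if m = m' then LinearMap.id else 0) := by
        refine shiftGr_le fun n x hx => ?_
        rw [LinearMap.mem_ker, LinearMap.sub_apply, DirectSum.toModule_lof, LinearMap.comp_apply]
        by_cases h : m = m'
        · subst h
          rw [if_pos rfl, (M n).str.proj_same hx, LinearMap.id_apply, sub_self]
        · rw [if_neg h, (M n).str.proj_of_ne (by omega) hx, map_zero, LinearMap.zero_apply,
            sub_zero]
      have := this hx
      rw [LinearMap.mem_ker, LinearMap.sub_apply, sub_eq_zero] at this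
      rw [this]
      split_ifs <;> rfl
  d := 0
  d_mem _ := zero_mem _
  d_d _ := rfl
  ρ := shiftCoaction M
  isCoaction := by
    refine isCoaction_iff.2 ⟨fun x => ?_, fun φ ψ x => ?_⟩
    · refine shiftSum_induction (p := fun x => coact (shiftCoaction M) Coalgebra.counit x = x)
        (fun n x => ?_) (map_zero _) (fun _ _ h h' => by rw [map_add, h, h']) x
      rw [coact_sι, (M n).str.isCoaction.coact_counit]
    · refine shiftSum_induction (p := fun x => coact (shiftCoaction M) φ
        (coact (shiftCoaction M) ψ x) = coact (shiftCoaction M) (convol φ ψ) x)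
        (fun n x => ?_) (by simp only [map_zero]) (fun _ _ h h' => by simp only [map_add, h, h']) x
      rw [coact_sι, coact_sι, coact_sι, (M n).str.isCoaction.coact_coact]
  isSubrep m := isSubrep_iff.2 fun φ x hx => by
    have : shiftGr M m ≤ (shiftGr M m).comap (coact (shiftCoaction M) φ) :=
      shiftGr_le fun n x hx => by
        rw [Submodule.mem_comap, coact_sι]
        exact sι_mem ((M n).str.coact_mem φ hx)
    exact this hx
  ρ_d x := by simp

end GComplex

namespace DGMod

variable (M N : DGMod A)

/-- The differential on the free dg module on the complex `M`. -/
def freeTwist : Twist A M where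
  S := M.str
  τ := TensorProduct.mk ℚ A M 1 ∘ₗ M.str.d
  τ_mem n y hy := GComplex.tmul_mem_tensGr A.one_mem (M.str.d_mem hy) (zero_add _)
  τ_ρ y := by
    change pairH H (TensorProduct.mk ℚ A M) (A.str.ρ 1) (M.str.ρ (M.str.d y)) = _
    rw [A.ρ_one, M.str.ρ_d, DGMod.pairH_one_left, ← LinearMap.rTensor_comp_apply]
  d_τ y := by
    change (A.str.d.rTensor M + _) (1 ⊗ₜ M.str.d y) = _
    rw [LinearMap.add_apply, LinearMap.rTensor_tmul, d_one, TensorProduct.zero_tmul, zero_add,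
      LinearMap.comp_apply, LinearMap.rTensor_tmul, A.str.sgn_apply A.one_mem, zpow_zero, one_smul]
    change (1 : A) • (1 ⊗ₜ M.str.d (M.str.d y) : A ⊗[ℚ] M) = 0
    rw [M.str.d_d, TensorProduct.tmul_zero, smul_zero]

/-- The free dg module on the complex `M`. -/
abbrev free : DGMod A := (freeTwist M).toMod

/-- The inclusion of the generators. -/
def freeι : M →ₗ[ℚ] free M := (freeTwist M).gen 1

theorem d_freeι (x : M) : (free M).str.d (freeι M x) = freeι M (M.str.d x) :=
  (freeTwist M).d_gen_one x

theorem exists_freeAct : ∃ f : free M ⟶ M, ∀ a x, f.toLin ((freeTwist M).gen a x) = a • x := by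
  refine (freeTwist M).exists_hom (g := LinearMap.id) (fun n y hy => hy) (fun _ _ => rfl)
    fun n y _ => ?_
  change (freeTwist M).ext 0 LinearMap.id ((freeTwist M).gen 1 (M.str.d y)) = _
  rw [(freeTwist M).ext_gen_one]
  rfl

/-- The counit of the free dg module. -/
def freeAct : free M ⟶ M := (exists_freeAct M).choose

theorem freeAct_gen (a : A) (x : M) : (freeAct M).toLin ((freeTwist M).gen a x) = a • x :=
  (exists_freeAct M).choose_spec a x

theorem freeAct_freeι (x : M) : (freeAct M).toLin (freeι M x) = x :=
  (freeAct_gen M 1 x).trans (one_smul _ _)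

variable {M N} in
theorem isDGSub_ker (f : M ⟶ N) : IsDGSub M (LinearMap.ker f.toLin) where
  proj n x hx := by
    have := GComplex.proj_comm (f := f.toLin.restrictScalars ℚ) (k := 0) (S := M.str) (S' := N.str)
      (fun n x hx => by rw [add_zero]; exact f.mem hx) n x
    rw [LinearMap.restrictScalars_apply, LinearMap.mem_ker.1 hx, map_zero] at this
    exact this.symm
  d x hx := by rw [LinearMap.mem_ker, f.d, LinearMap.mem_ker.1 hx, map_zero]
  isSubrep := isSubrep_iff.2 fun φ x hx => by
    change f.toLin _ = 0
    rw [← Hom.coact, show f.toLin x = 0 from hx, map_zero]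

/-- The module of relations. -/
def syz : DGMod A := subMod (free M) _ (isDGSub_ker (freeAct M))

/-- The inclusion of the module of relations. -/
def syzι : syz M ⟶ free M := subι (free M) _ (isDGSub_ker (freeAct M))

theorem syzι_injective : Function.Injective (syzι M).toLin := subι_injective _

theorem freeAct_syzι (x : syz M) : (freeAct M).toLin ((syzι M).toLin x) = 0 := x.2

/-- The retraction to the module of relations. -/
def syzRetract : free M →ₗ[ℚ] syz M :=
  (LinearMap.id - freeι M ∘ₗ (freeAct M).toLin.restrictScalars ℚ).codRestrict
    ((LinearMap.ker (freeAct M).toLin).restrictScalars ℚ) fun x => by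
      change (freeAct M).toLin (x - freeι M ((freeAct M).toLin x)) = 0
      rw [map_sub, freeAct_freeι, sub_self]

theorem syzι_syzRetract (x : free M) :
    (syzι M).toLin (syzRetract M x) = x - freeι M ((freeAct M).toLin x) := rfl

theorem syzRetract_syzι (x : syz M) : syzRetract M ((syzι M).toLin x) = x := by
  refine syzι_injective M ?_
  rw [syzι_syzRetract, freeAct_syzι, map_zero, sub_zero]

/-- The retraction `x ↦ x - 1 ⊗ act(x)` is not `A`-linear. It commutes with the differentials
because the inclusion of the generators and the action both do, and this suffices for a contraction.
-/
theorem d_syzRetract (x : free M) :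
    (syz M).str.d (syzRetract M x) = syzRetract M ((free M).str.d x) := by
  refine syzι_injective M ?_
  rw [(syzι M).d, syzι_syzRetract, syzι_syzRetract, map_sub, d_freeι, (freeAct M).d]

/-- The iterated modules of relations. -/
def syzygy : ℕ → DGMod A
  | 0 => M
  | n + 1 => syz (syzygy n)

/-- The inclusion of the module of relations. -/
def rel (n : ℕ) : syzygy M (n + 1) ⟶ free (syzygy M n) := syzι (syzygy M n)

theorem freeAct_rel (n : ℕ) (x : syzygy M (n + 1)) :
    (freeAct (syzygy M n)).toLin ((rel M n).toLin x) = 0 := freeAct_syzι _ x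

/-- The retraction to the module of relations. -/
def relRetract (n : ℕ) : free (syzygy M n) →ₗ[ℚ] syzygy M (n + 1) := syzRetract (syzygy M n)

theorem rel_relRetract (n : ℕ) (x : free (syzygy M n)) :
    (rel M n).toLin (relRetract M n x) = x - freeι _ ((freeAct (syzygy M n)).toLin x) := rfl

theorem relRetract_rel (n : ℕ) (x : syzygy M (n + 1)) :
    relRetract M n ((rel M n).toLin x) = x := syzRetract_syzι _ x

theorem d_relRetract (n : ℕ) (x : free (syzygy M n)) : (syzygy M (n + 1)).str.d (relRetract M n x) =
    relRetract M n ((free (syzygy M n)).str.d x) := d_syzRetract _ x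

end DGMod

end

/-! ### The differential of the bar resolution -/

noncomputable section

variable {H : Type u} [CommRing H] [HopfAlgebra ℚ H] {A : CDGA H}

namespace DGMod.Bar

open GComplex

variable (M : DGMod A)

/-- The space of generators of the bar resolution. -/
abbrev Gen : Type u := ShiftSum (syzygy M)

/-- The inclusions of the summands of the bar resolution. -/
def j (n : ℕ) : free (syzygy M n) →ₗ[ℚ] A ⊗[ℚ] Gen M :=
  TensorProduct.map (A.twist n) (sι (syzygy M) n)

theorem j_gen (n : ℕ) (a : A) (y : syzygy M n) :
    j M n ((freeTwist (syzygy M n)).gen a y) = A.twist n a ⊗ₜ sι (syzygy M) n y := rfl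

theorem j_freeι (n : ℕ) (y : syzygy M n) :
    j M n (freeι _ y) = 1 ⊗ₜ sι (syzygy M) n y := by
  rw [freeι, j_gen, CDGA.twist_one]

theorem j_smul (n : ℕ) {p : ℤ} {a : A} (ha : a ∈ A.str.gr p) (x : free (syzygy M n)) :
    j M n (a • x) = (-1 : ℚ) ^ (p * n) • a • j M n x := by
  refine (freeTwist _).induction (p := fun x => j M n (a • x) = (-1 : ℚ) ^ (p * n) • a • j M n x)
    ?_ (by simp) (fun s t hs ht => by simp only [smul_add, map_add, hs, ht]) x
  intro i l b hb y _
  rw [Twist.smul_gen, j_gen, j_gen, CDGA.twist_mul, CDGA.twist_apply ha, smul_mul_assoc]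
  exact (TensorProduct.smul_tmul' _ _ _).symm.trans
    (congrArg _ (TensorProduct.smul_tmul' a _ _).symm)

theorem j_mem (n : ℕ) {q m : ℤ} (h : q = m + n) {x : free (syzygy M n)}
    (hx : x ∈ (free (syzygy M n)).str.gr q) :
    j M n x ∈ tensGr A.str (shiftSum (syzygy M)) m := by
  have : tensGr A.str (syzygy M n).str q ≤
      (tensGr A.str (shiftSum (syzygy M)) m).comap (j M n) :=
    tensGr_le fun p r a y ha hy e => tmul_mem_tensGr (CDGA.twist_mem ha n)
      (sι_mem (m := r - n) (by rwa [sub_add_cancel])) (by omega)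
  exact this hx

theorem ρ_j (n : ℕ) (x : free (syzygy M n)) :
    tensCoaction A.str (shiftSum (syzygy M)) (j M n x) =
      (j M n).rTensor H ((free (syzygy M n)).str.ρ x) := by
  refine (freeTwist _).induction (p := fun x => tensCoaction A.str (shiftSum (syzygy M)) (j M n x) =
    (j M n).rTensor H ((free (syzygy M n)).str.ρ x)) ?_ (by simp)
    (fun s t hs ht => by simp only [map_add, hs, ht]) x
  intro i l b _ y _
  have h₁ : A.str.ρ (A.twist n b) = (A.twist n).rTensor H (A.str.ρ b) :=
    (equivariant_iff (f := A.twist n) (ρ := A.str.ρ) (ρ' := A.str.ρ)).2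
      (fun φ a => CDGA.coact_twist φ n a) b
  rw [j_gen, tensCoaction_tmul, h₁]
  refine Eq.trans ?_ (pairH_map (e := (TensorProduct.map (A.twist n) (sι (syzygy M) n)))
    (b := TensorProduct.mk ℚ A (syzygy M n)) (b' := TensorProduct.mk ℚ A (Gen M))
    (f := A.twist n) (g := sι (syzygy M) n) (fun a y => rfl) _ _).symm
  exact congrArg _ (shiftCoaction_sι _ n y)

/-- The part of the differential of the bar resolution which changes the summand. -/
def k : ∀ n : ℕ, syzygy M n →ₗ[ℚ] A ⊗[ℚ] Gen M
  | 0 => 0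
  | n + 1 => j M n ∘ₗ (rel M n).toLin.restrictScalars ℚ

theorem k_succ (n : ℕ) (y : syzygy M (n + 1)) :
    k M (n + 1) y = j M n ((rel M n).toLin y) := rfl

theorem k_smul (n : ℕ) {p : ℤ} {a : A} (ha : a ∈ A.str.gr p) (y : syzygy M n) :
    k M n (a • y) = (-1 : ℚ) ^ (p * n + p) • a • k M n y := by
  cases n with
  | zero => simp [k]
  | succ n =>
    rw [k_succ, k_succ, map_smul, j_smul M n ha, negOne_congr (m := p * (n + 1 : ℕ) + p) (n := p * n) p (by push_cast; ring)]

theorem k_mem (n : ℕ) {m : ℤ} {y : syzygy M n} (hy : y ∈ (syzygy M n).str.gr (m + n)) :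
    k M n y ∈ tensGr A.str (shiftSum (syzygy M)) (m + 1) := by
  cases n with
  | zero => exact zero_mem _
  | succ n => exact j_mem M n (by push_cast; ring) ((rel M n).mem hy)

theorem ρ_k (n : ℕ) (y : syzygy M n) : tensCoaction A.str (shiftSum (syzygy M)) (k M n y) =
    (k M n).rTensor H ((syzygy M n).str.ρ y) := by
  cases n with
  | zero => simp [k]
  | succ n =>
    rw [k_succ, ρ_j, (rel M n).ρ]
    exact (LinearMap.rTensor_comp_apply H _ _ _).symm

/-- The differential of the bar resolution on the generators. -/
def τ : Gen M →ₗ[ℚ] A ⊗[ℚ] Gen M :=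
  DirectSum.toModule ℚ ℕ _ fun n =>
    (-1 : ℚ) ^ (n : ℤ) • (TensorProduct.mk ℚ A (Gen M) 1 ∘ₗ sι (syzygy M) n ∘ₗ (syzygy M n).str.d) +
      k M n

theorem τ_sι (n : ℕ) (y : syzygy M n) : τ M (sι (syzygy M) n y) =
    (-1 : ℚ) ^ (n : ℤ) • (1 ⊗ₜ sι (syzygy M) n ((syzygy M n).str.d y)) + k M n y :=
  DirectSum.toModule_lof _ _ _

/-- The differential of the bar resolution. -/
def D : A ⊗[ℚ] Gen M →ₗ[ℚ] A ⊗[ℚ] Gen M :=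
  A.str.d.rTensor _ + smulLift (τ M) ∘ₗ A.str.sgn.rTensor _

theorem D_tmul {p : ℤ} {a : A} (ha : a ∈ A.str.gr p) (y : Gen M) :
    D M (a ⊗ₜ y) = A.str.d a ⊗ₜ y + (-1 : ℚ) ^ p • a • τ M y := by
  rw [D, LinearMap.add_apply, LinearMap.comp_apply, LinearMap.rTensor_tmul, LinearMap.rTensor_tmul,
    A.str.sgn_apply ha, smulLift, TensorProduct.lift.tmul]
  congr 1
  exact smul_assoc ((-1 : ℚ) ^ p) a (τ M y)

theorem D_one_tmul (y : Gen M) : D M (1 ⊗ₜ y) = τ M y := by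
  rw [D_tmul M A.one_mem, d_one, TensorProduct.zero_tmul, zpow_zero, one_smul, one_smul, zero_add]

/-- On the `n`-th summand the total differential is `(-1) ^ n` times the internal one plus the
composite `A ⊗ Ω ^ n → Ω ^ n → A ⊗ Ω ^ (n - 1)`. The twist by `n` in `j` is the sign of the shift,
which makes the formula hold for all coefficients. -/
theorem D_j (n : ℕ) (x : free (syzygy M n)) : D M (j M n x) =
    (-1 : ℚ) ^ (n : ℤ) • j M n ((free (syzygy M n)).str.d x) +
      k M n ((freeAct (syzygy M n)).toLin x) := by
  refine (freeTwist _).induction (p := fun x => D M (j M n x) =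
    (-1 : ℚ) ^ (n : ℤ) • j M n ((free (syzygy M n)).str.d x) +
      k M n ((freeAct (syzygy M n)).toLin x)) ?_ (by simp)
    (fun s t hs ht => by simp only [map_add, smul_add, hs, ht]; abel) x
  intro p l a ha y _
  have e : (freeTwist (syzygy M n)).tau y = freeι _ ((syzygy M n).str.d y) := rfl
  rw [Twist.d_gen _ ha, j_gen, CDGA.twist_apply ha, ← TensorProduct.smul_tmul', map_smul,
    D_tmul M ha, τ_sι, map_add, j_gen, CDGA.twist_apply (A.str.d_mem ha), map_smul, e,
    j_smul M n ha, j_freeι, freeAct_gen, k_smul M n ha, negOne_add (p * n) p, add_mul, one_mul,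
    negOne_add (p * n) n]
  have hv := negOne_sq n
  generalize (-1 : ℚ) ^ (n : ℤ) = v at *
  generalize (-1 : ℚ) ^ (p * n) = s
  generalize (-1 : ℚ) ^ p = u
  rw [← TensorProduct.smul_tmul']
  generalize A.str.d a ⊗ₜ[ℚ] (sι (syzygy M) n) y = z
  generalize (1 ⊗ₜ[ℚ] (sι (syzygy M) n) ((syzygy M n).str.d y) : A ⊗[ℚ] Gen M) = t
  rw [smul_add a, smul_comm a v t]
  simp only [smul_add, smul_smul]
  rw [show v * (s * v) = s by linear_combination s * hv, ← add_assoc]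
  congr 3
  ring

/-- Passing to the previous summand changes the parity of `n`, and the second component vanishes
because relations act by zero. The opposite sign makes the total differential square to zero. -/
theorem D_k (n : ℕ) (y : syzygy M n) :
    D M (k M n y) = -(-1 : ℚ) ^ (n : ℤ) • k M n ((syzygy M n).str.d y) := by
  cases n with
  | zero => simp [k]
  | succ n =>
    rw [k_succ, D_j, freeAct_rel, map_zero, add_zero, k_succ, ← (rel M n).d, Nat.cast_succ,
      negOne_succ, neg_neg]

theorem D_τ (y : Gen M) : D M (τ M y) = 0 := by
  refine shiftSum_induction (p := fun y => D M (τ M y) = 0) (fun n y => ?_) (by simp)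
    (fun _ _ h h' => by rw [map_add, map_add, h, h', add_zero]) y
  rw [τ_sι, map_add, map_smul, D_one_tmul, τ_sι, (syzygy M n).str.d_d, map_zero,
    TensorProduct.tmul_zero, smul_zero, zero_add, D_k, ← add_smul, add_neg_cancel, zero_smul]

/-- The data of the bar resolution. -/
def twist : Twist A (Gen M) where
  S := shiftSum (syzygy M)
  τ := τ M
  τ_mem m y hy := by
    have : shiftGr (syzygy M) m ≤ (tensGr A.str (shiftSum (syzygy M)) (m + 1)).comap (τ M) :=
      shiftGr_le fun n y hy => by
        rw [Submodule.mem_comap, τ_sι]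
        refine add_mem (Submodule.smul_mem _ _ (tmul_mem_tensGr A.one_mem
          (sι_mem (m := m + 1) ?_) (zero_add _))) (k_mem M n hy)
        have := (syzygy M n).str.d_mem hy
        rwa [add_right_comm] at this
    exact this hy
  τ_ρ y := by
    refine shiftSum_induction (p := fun y => tensCoaction A.str (shiftSum (syzygy M)) (τ M y) =
      (τ M).rTensor H ((shiftSum (syzygy M)).ρ y)) (fun n y => ?_) (by simp)
      (fun _ _ h h' => by simp only [map_add, h, h']) y
    have e : (shiftSum (syzygy M)).ρ (sι _ n y) = _ := shiftCoaction_sι _ n y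
    have e' : (shiftSum (syzygy M)).ρ (sι _ n ((syzygy M n).str.d y)) = _ := shiftCoaction_sι _ n _
    rw [τ_sι, map_add, map_smul, ρ_k, tensCoaction_tmul, A.ρ_one, pairH_one_left, e, e',
      (syzygy M n).str.ρ_d, ← LinearMap.rTensor_comp_apply, ← LinearMap.rTensor_comp_apply,
      ← LinearMap.rTensor_comp_apply, ← LinearMap.smul_apply, ← LinearMap.rTensor_smul,
      ← LinearMap.add_apply, ← LinearMap.rTensor_add]
    congr 2
    exact LinearMap.ext fun y => (τ_sι M n y).symm
  d_τ := D_τ M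

end DGMod.Bar

end

/-! ### The bar resolution resolves -/

noncomputable section

variable {H : Type u} [CommRing H] [HopfAlgebra ℚ H] {A : CDGA H}

theorem CDGA.twist_twist (k : ℤ) (a : A) : A.twist k (A.twist k a) = a := by
  refine A.str.induction (p := fun a => A.twist k (A.twist k a) = a) ?_ (by simp)
    (fun a b h h' => by rw [map_add, map_add, h, h']) a
  intro p a ha
  rw [CDGA.twist_apply ha, map_smul, CDGA.twist_apply ha, smul_smul, negOne_sq, one_smul]

namespace DGMod.Bar

open GComplex

variable (M : DGMod A)

/-- The bar resolution. -/
abbrev res : DGMod A := (twist M).toMod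

theorem induction {p : A ⊗[ℚ] Gen M → Prop} (hj : ∀ n x, p (j M n x)) (zero : p 0)
    (add : ∀ s t, p s → p t → p (s + t)) (t : A ⊗[ℚ] Gen M) : p t := by
  induction t using TensorProduct.induction_on with
  | zero => exact zero
  | add s t hs ht => exact add _ _ hs ht
  | tmul a y =>
    refine shiftSum_induction (p := fun y => p (a ⊗ₜ y)) (fun n y => ?_)
      (by rwa [TensorProduct.tmul_zero])
      (fun _ _ h h' => by rw [TensorProduct.tmul_add]; exact add _ _ h h') y
    have := hj n ((freeTwist (syzygy M n)).gen (A.twist n a) y)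
    rwa [j_gen, CDGA.twist_twist] at this

/-- The augmentation on the generators. -/
def aug₀ : Gen M →ₗ[ℚ] M := sπ (syzygy M) 0

theorem aug₀_zero (x : M) : aug₀ M (sι (syzygy M) 0 x) = x := sπ_sι_same (syzygy M) 0 x

theorem aug₀_succ (n : ℕ) (x : syzygy M (n + 1)) : aug₀ M (sι (syzygy M) (n + 1) x) = 0 :=
  sπ_sι_of_ne (syzygy M) n.succ_ne_zero x

/-- The augmentation is projection to the summand `n = 0` followed by the action. It is a chain map
because the relations in the summand `n = 1` lie in the kernel of the action. -/
theorem exists_aug : ∃ f : res M ⟶ M, ∀ a y, f.toLin ((twist M).gen a y) = a • aug₀ M y := by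
  refine (twist M).exists_hom (g := aug₀ M) (fun n y hy => ?_) (fun φ y => ?_) (fun m y _ => ?_)
  · have := mem_shiftGr.1 hy 0
    rwa [Nat.cast_zero, add_zero] at this
  · refine shiftSum_induction (p := fun y => coact M.str.ρ φ (aug₀ M y) =
      aug₀ M (coact (shiftCoaction (syzygy M)) φ y)) (fun n y => ?_) (by simp only [map_zero])
      (fun _ _ h h' => by simp only [map_add, h, h']) y
    rw [coact_sι]
    cases n with
    | zero => exact (congrArg _ (aug₀_zero M y)).trans (aug₀_zero M _).symm
    | succ n => rw [aug₀_succ, aug₀_succ, map_zero]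
  · let E : A ⊗[ℚ] Gen M →ₗ[ℚ] M := (twist M).ext 0 (aug₀ M)
    have hE : ∀ a y, E (a ⊗ₜ y) = a • aug₀ M y := fun a y =>
      congrArg (· • aug₀ M y) (CDGA.twist_zero a)
    have h0 : ∀ x, E (j M 0 x) = (freeAct M).toLin x := fun x => by
      refine (freeTwist M).induction (p := fun x => E (j M 0 x) = (freeAct M).toLin x)
        (fun _ _ a _ y _ => ?_) ?_ (fun _ _ h h' => ?_) x
      · refine (hE _ _).trans ?_
        rw [freeAct_gen, Nat.cast_zero, CDGA.twist_zero, aug₀_zero]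
      · exact (congrArg _ (map_zero (j M 0))).trans ((map_zero _).trans (map_zero _).symm)
      · refine (congrArg _ (map_add (j M 0) _ _)).trans ((map_add E _ _).trans ?_)
        rw [map_add, h, h']
    have h1 : ∀ n x, E (j M (n + 1) x) = 0 := fun n x => by
      refine (freeTwist _).induction (p := fun x => E (j M (n + 1) x) = 0)
        (fun _ _ a _ y _ => ?_) (by simp) (fun _ _ h h' => by rw [map_add, map_add, h, h', add_zero]) x
      refine (hE _ _).trans ?_
      rw [aug₀_succ, smul_zero]
    refine shiftSum_induction (p := fun y => E (τ M y) = M.str.d (aug₀ M y)) (fun n y => ?_)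
      (by simp only [map_zero]) (fun _ _ h h' => by simp only [map_add, h, h']) y
    rw [τ_sι, map_add, map_smul, hE, one_smul]
    rcases n with _ | _ | n
    · rw [Nat.cast_zero, zpow_zero, one_smul, show k M 0 y = 0 from rfl, map_zero, add_zero]
      exact (aug₀_zero M _).trans (congrArg M.str.d (aug₀_zero M y).symm)
    · rw [aug₀_succ, aug₀_succ, smul_zero, map_zero, zero_add, k_succ, h0]
      exact freeAct_rel M 0 y
    · rw [aug₀_succ, aug₀_succ, smul_zero, map_zero, zero_add, k_succ, h1]

/-- The augmentation of the bar resolution. -/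
def aug : res M ⟶ M := (exists_aug M).choose

theorem aug_gen (a : A) (y : Gen M) : (aug M).toLin ((twist M).gen a y) = a • aug₀ M y :=
  (exists_aug M).choose_spec a y

theorem aug_j_zero (x : free M) : (aug M).toLin (j M 0 x) = (freeAct M).toLin x := by
  refine (freeTwist M).induction (p := fun x => (aug M).toLin (j M 0 x) = (freeAct M).toLin x)
    (fun _ _ a _ y _ => ?_) ?_ (fun _ _ h h' => ?_) x
  · refine (aug_gen M _ _).trans ?_
    rw [freeAct_gen, Nat.cast_zero, CDGA.twist_zero, aug₀_zero]
  · exact (congrArg _ (map_zero (j M 0))).trans ((map_zero _).trans (map_zero _).symm)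
  · refine (congrArg _ (map_add (j M 0) _ _)).trans (((aug M).toLin.map_add _ _).trans ?_)
    rw [map_add, h, h']

theorem aug_j_succ (n : ℕ) (x : free (syzygy M (n + 1))) : (aug M).toLin (j M (n + 1) x) = 0 := by
  refine (freeTwist _).induction (p := fun x => (aug M).toLin (j M (n + 1) x) = 0)
    (fun _ _ a _ y _ => ?_) ?_ (fun _ _ h h' => ?_) x
  · refine (aug_gen M _ _).trans ?_
    rw [aug₀_succ, smul_zero]
  · exact (congrArg _ (map_zero (j M (n + 1)))).trans (map_zero _)
  · refine (congrArg _ (map_add (j M (n + 1)) _ _)).trans (((aug M).toLin.map_add _ _).trans ?_)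
    rw [h, h', add_zero]

/-- The contraction, with values in the generators. -/
def contr₀ : A ⊗[ℚ] Gen M →ₗ[ℚ] Gen M :=
  TensorProduct.lift (LinearMap.flip (DirectSum.toModule ℚ ℕ _ fun n => LinearMap.flip
    (TensorProduct.curry (sι (syzygy M) (n + 1) ∘ₗ relRetract M n ∘ₗ
      (A.twist n).rTensor (syzygy M n)))))

theorem contr₀_tmul (n : ℕ) (a : A) (y : syzygy M n) : contr₀ M (a ⊗ₜ sι (syzygy M) n y) =
    sι (syzygy M) (n + 1) (relRetract M n ((freeTwist (syzygy M n)).gen (A.twist n a) y)) := by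
  rw [contr₀, TensorProduct.lift.tmul, LinearMap.flip_apply, DirectSum.toModule_lof]
  rfl

theorem contr₀_j (n : ℕ) (x : free (syzygy M n)) :
    contr₀ M (j M n x) = sι (syzygy M) (n + 1) (relRetract M n x) := by
  refine (freeTwist _).induction (p := fun x => contr₀ M (j M n x) =
    sι (syzygy M) (n + 1) (relRetract M n x)) (fun _ _ a _ y _ => ?_) (by simp only [map_zero])
    (fun _ _ h h' => by simp only [map_add, h, h']) x
  rw [j_gen, contr₀_tmul, CDGA.twist_twist]

/-- Each sequence `Ω ^ (n + 1) → A ⊗ Ω ^ n → Ω ^ n` splits as complexes of vector spaces, through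
`relRetract` and `freeι`. The splittings assemble to a contraction of the total complex onto `M`; no
linearity or equivariance is required of it. -/
theorem isQuasiIso_aug : IsQuasiIso (aug M) := by
  let K : A ⊗[ℚ] Gen M →ₗ[ℚ] A ⊗[ℚ] Gen M := TensorProduct.mk ℚ A (Gen M) 1 ∘ₗ contr₀ M
  let s : M →ₗ[ℚ] A ⊗[ℚ] Gen M := TensorProduct.mk ℚ A (Gen M) 1 ∘ₗ sι (syzygy M) 0
  let e : A ⊗[ℚ] Gen M →ₗ[ℚ] M := (aug M).toLin.restrictScalars ℚ
  have hK : ∀ n x, K (j M n x) = 1 ⊗ₜ sι (syzygy M) (n + 1) (relRetract M n x) := fun n x =>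
    congrArg (TensorProduct.mk ℚ A (Gen M) 1) (contr₀_j M n x)
  have key : ∀ t, D M (K t) + K (D M t) = t - s (e t) := by
    refine induction M (p := fun t => D M (K t) + K (D M t) = t - s (e t)) (fun n x => ?_)
      (by simp only [map_zero, sub_zero, add_zero]) (fun t t' h h' => ?_)
    · rw [hK, D_one_tmul, τ_sι, k_succ, rel_relRetract, map_sub, j_freeι, D_j, map_add, map_smul,
        hK, d_relRetract, Nat.cast_succ, negOne_succ]
      -- The term `1 ⊗ act(x)` left over on the summand `n` cancels against the contraction of `k
      -- (act x)`, since `relRetract` splits `rel`. For `n = 0` there is no such term, and it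
      -- remains as the projection to `M`.
      cases n with
      | zero =>
        rw [show e (j M 0 x) = _ from aug_j_zero M x,
          show k M 0 ((freeAct (syzygy M 0)).toLin x) = 0 from rfl, map_zero]
        change _ = j M 0 x - (1 ⊗ₜ sι (syzygy M) 0 ((freeAct (syzygy M 0)).toLin x))
        module
      | succ n =>
        rw [show e (j M (n + 1) x) = _ from aug_j_succ M n x, map_zero, k_succ, hK, relRetract_rel]
        module
    · simp only [map_add]
      rw [add_sub_add_comm, ← h, ← h']
      abel
  refine .of_contraction (aug M) s K (fun y => ?_) (map_zero s) (fun y => ?_) (map_zero K) key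
  · refine (D_one_tmul M _).trans ((τ_sι M 0 y).trans ?_)
    rw [Nat.cast_zero, zpow_zero, one_smul]
    exact add_zero _
  · exact (aug_gen M 1 _).trans ((one_smul _ _).trans (aug₀_zero M y))

end DGMod.Bar

end

/-! ### Finite cell submodules of `A ⊗ Y` -/

noncomputable section

variable {H : Type u} [CommRing H] [HopfAlgebra ℚ H] {A : CDGA H}

namespace GComplex

variable {X Y : Type u} [AddCommGroup X] [Module ℚ X] [AddCommGroup Y] [Module ℚ Y]
variable {S : GComplex H X} {S' : GComplex H Y}

theorem IsGraded.map {W : Submodule ℚ X} (hW : S.IsGraded W) {f : X →ₗ[ℚ] Y} {k : ℤ}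
    (hf : ∀ n, ∀ x ∈ S.gr n, f x ∈ S'.gr (n + k))
    (hc : ∀ φ x, coact S'.ρ φ (f x) = f (coact S.ρ φ x)) : S'.IsGraded (W.map f) :=
  ⟨hW.isSubrep.map hc, by
    rintro n _ ⟨x, hx, rfl⟩
    have := proj_comm hf (n - k) x
    rw [sub_add_cancel] at this
    exact ⟨_, hW.proj (n - k) x hx, this.symm⟩⟩

variable (S) in
theorem exists_isGraded (x : X) :
    ∃ W : Submodule ℚ X, FiniteDimensional ℚ W ∧ S.IsGraded W ∧ x ∈ W := by
  refine S.induction (p := fun x => ∃ W : Submodule ℚ X, FiniteDimensional ℚ W ∧ S.IsGraded W ∧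
    x ∈ W) (fun n x hx => ?_) ⟨⊥, inferInstance, isGraded_bot, zero_mem _⟩ ?_ x
  · exact ⟨orbit S.ρ x, inferInstance, isGraded_of_le (S.isCoaction.isSubrep_orbit x)
      ((S.isSubrep n).orbit_le hx), S.isCoaction.mem_orbit x⟩
  · rintro x y ⟨W, _, hW, hx⟩ ⟨W', _, hW', hy⟩
    exact ⟨W ⊔ W', inferInstance, hW.sup hW', add_mem (Submodule.mem_sup_left hx)
      (Submodule.mem_sup_right hy)⟩

variable (S) in
-- By local finiteness `x` lies in a finite-dimensional graded subrepresentation `W`, and `W + d W`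
-- is stable under `d` because `d ^ 2 = 0`.
theorem exists_isGraded_d_mem (x : X) : ∃ W : Submodule ℚ X, FiniteDimensional ℚ W ∧
    S.IsGraded W ∧ (∀ y ∈ W, S.d y ∈ W) ∧ x ∈ W := by
  obtain ⟨W, _, hW, hx⟩ := S.exists_isGraded x
  refine ⟨W ⊔ W.map S.d, inferInstance,
    hW.sup (hW.map (S' := S) (fun _ _ h => S.d_mem h) S.coact_d), fun y hy => ?_,
    Submodule.mem_sup_left hx⟩
  obtain ⟨z, hz, _, ⟨z', _, rfl⟩, rfl⟩ := Submodule.mem_sup.1 hy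
  rw [map_add, S.d_d, add_zero]
  exact Submodule.mem_sup_right ⟨z, hz, rfl⟩

/-- A graded retraction to a graded subspace. -/
theorem IsGraded.exists_retraction {W : Submodule ℚ X} (hW : S.IsGraded W) :
    ∃ q : X →ₗ[ℚ] W, (∀ x : W, q x = x) ∧ ∀ n, ∀ x ∈ S.gr n, q x ∈ hW.str.gr n := by
  obtain ⟨q, hq⟩ := LinearMap.exists_leftInverse_of_injective W.subtype
    (LinearMap.ker_eq_bot.2 W.injective_subtype)
  have hq : ∀ x : W, q x = x := LinearMap.congr_fun hq
  refine ⟨S.homPart hW.str 0 q, fun x => ?_, fun n x hx => ?_⟩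
  · refine hW.str.induction (p := fun x : W => S.homPart hW.str 0 q x = x) (fun n x hx => ?_)
      (by simp) (fun x y h h' => by rw [Submodule.coe_add, map_add, h, h']) x
    refine (S.homPart_apply hW.str 0 q (n := n) hx).trans ?_
    rw [add_zero]
    exact (congrArg _ (hq x)).trans (hW.str.proj_same hx)
  · have := S.homPart_mem hW.str 0 q hx
    rwa [add_zero] at this

end GComplex

namespace Twist

variable {Y : Type u} [AddCommGroup Y] [Module ℚ Y] {T : Twist A Y}

variable (T) in
/-- The finite-dimensional subrepresentations which generate dg submodules. -/
structure IsGood (X : Submodule ℚ Y) : Prop where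
  finite : FiniteDimensional ℚ X
  graded : T.S.IsGraded X
  mem : ∀ y ∈ X, T.τ y ∈ X.baseChange A

theorem isGood_bot : T.IsGood ⊥ :=
  ⟨inferInstance, GComplex.isGraded_bot, fun y hy => by
    rw [(Submodule.mem_bot ℚ).1 hy, map_zero]; exact zero_mem _⟩

theorem IsGood.sup {X X' : Submodule ℚ Y} (h : T.IsGood X) (h' : T.IsGood X') :
    T.IsGood (X ⊔ X') := by
  have := h.finite
  have := h'.finite
  refine ⟨inferInstance, h.graded.sup h'.graded, fun y hy => ?_⟩
  obtain ⟨x, hx, z, hz, rfl⟩ := Submodule.mem_sup.1 hy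
  rw [map_add]
  exact add_mem (Submodule.baseChange_mono A le_sup_left (h.mem x hx))
    (Submodule.baseChange_mono A le_sup_right (h'.mem z hz))

namespace IsGood

variable {X : Submodule ℚ Y} (h : T.IsGood X)

/-- A graded retraction. -/
def retr : Y →ₗ[ℚ] X := h.graded.exists_retraction.choose

theorem retr_coe (x : X) : h.retr x = x := h.graded.exists_retraction.choose_spec.1 x

theorem retr_mem {n : ℤ} {y : Y} (hy : y ∈ T.S.gr n) : h.retr y ∈ h.graded.str.gr n :=
  h.graded.exists_retraction.choose_spec.2 n y hy

theorem lTensor_retr {t : A ⊗[ℚ] Y} (ht : t ∈ X.baseChange A) :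
    X.subtype.lTensor A (h.retr.lTensor A t) = t := by
  obtain ⟨t, rfl⟩ := ht
  change X.subtype.lTensor A (h.retr.lTensor A (X.subtype.lTensor A t)) = X.subtype.lTensor A t
  rw [← LinearMap.lTensor_comp_apply _ h.retr, show h.retr ∘ₗ X.subtype = LinearMap.id from
    LinearMap.ext h.retr_coe, LinearMap.lTensor_id, LinearMap.id_apply]

/-- The differential on the generators of the dg submodule. -/
def subτ : X →ₗ[ℚ] A ⊗[ℚ] X := h.retr.lTensor A ∘ₗ T.τ ∘ₗ X.subtype

theorem lTensor_subτ (x : X) : X.subtype.lTensor A (h.subτ x) = T.τ x :=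
  h.lTensor_retr (h.mem x x.2)


theorem lTensor_injective : Function.Injective (X.subtype.lTensor A) :=
  Module.Flat.lTensor_preserves_injective_linearMap _ X.injective_subtype

theorem lTensor_retr_mem {n : ℤ} {t : A ⊗[ℚ] Y} (ht : t ∈ GComplex.tensGr A.str T.S n) :
    h.retr.lTensor A t ∈ GComplex.tensGr A.str h.graded.str n := by
  have : GComplex.tensGr A.str T.S n ≤
      (GComplex.tensGr A.str h.graded.str n).comap (h.retr.lTensor A) :=
    GComplex.tensGr_le fun p q a y ha hy e => GComplex.tmul_mem_tensGr ha (h.retr_mem hy) e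
  exact this ht

theorem lTensor_tensCoaction (t : A ⊗[ℚ] X) :
    (X.subtype.lTensor A).rTensor H (GComplex.tensCoaction A.str h.graded.str t) =
      GComplex.tensCoaction A.str T.S (X.subtype.lTensor A t) := by
  induction t using TensorProduct.induction_on with
  | zero => simp
  | add s t hs ht => simp only [map_add, hs, ht]
  | tmul a x =>
    rw [GComplex.tensCoaction_tmul, LinearMap.lTensor_tmul, GComplex.tensCoaction_tmul,
      DGMod.pairH_map (b' := TensorProduct.mk ℚ A Y) (f := LinearMap.id) (g := X.subtype)
        (fun a x => rfl), LinearMap.rTensor_id, LinearMap.id_apply]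
    congr 1
    exact h.graded.isSubrep.rTensor_restrict x

theorem lTensor_smulLift (t : A ⊗[ℚ] X) : X.subtype.lTensor A (smulLift h.subτ t) =
    smulLift T.τ (X.subtype.lTensor A t) := by
  induction t using TensorProduct.induction_on with
  | zero => simp
  | add s t hs ht => simp only [map_add, hs, ht]
  | tmul a x =>
    change (X.subtype.baseChange A) (a • h.subτ x) = a • T.τ x
    rw [map_smul]
    exact congrArg _ (h.lTensor_subτ x)

/-- The differential on the dg submodule generated by a good subspace. -/
def sub : Twist A X where
  S := h.graded.str
  τ := h.subτ
  τ_mem n x hx := h.lTensor_retr_mem (T.τ_mem n x hx)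
  τ_ρ x := by
    -- `A ⊗ X → A ⊗ Y` stays injective after tensoring with `H`, so the identity may be checked in
    -- the ambient module, where it is an axiom of `T`.
    refine Module.Flat.rTensor_preserves_injective_linearMap (M := H) _
      (lTensor_injective (A := A) (X := X)) ?_
    rw [h.lTensor_tensCoaction, h.lTensor_subτ, T.τ_ρ, ← LinearMap.rTensor_comp_apply,
      show X.subtype.lTensor A ∘ₗ h.subτ = T.τ ∘ₗ X.subtype from LinearMap.ext h.lTensor_subτ,
      LinearMap.rTensor_comp_apply]
    congr 1
    exact (h.graded.isSubrep.rTensor_restrict x).symm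
  d_τ x := by
    refine lTensor_injective (A := A) (X := X) ?_
    have := T.d_τ x
    rw [← h.lTensor_subτ] at this
    rw [map_zero, ← this, LinearMap.add_apply, LinearMap.add_apply, map_add, LinearMap.comp_apply,
      LinearMap.comp_apply, h.lTensor_smulLift]
    generalize h.subτ x = t
    congr 1
    · rw [← LinearMap.comp_apply, ← LinearMap.comp_apply, LinearMap.lTensor_comp_rTensor,
        LinearMap.rTensor_comp_lTensor]
    · congr 1
      rw [← LinearMap.comp_apply, ← LinearMap.comp_apply, LinearMap.lTensor_comp_rTensor,
        LinearMap.rTensor_comp_lTensor]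

theorem isFiniteCell {w : H →ₐc[ℚ] ℚ[T;T⁻¹]} (hc : IsCentralCochar w)
    (hA : A.IsAdamsConnected w) : IsFiniteCell h.sub.toMod := by
  have := h.finite
  exact h.sub.isFreeOn.isFiniteCell hA hc

theorem exists_incl : ∃ f : h.sub.toMod ⟶ T.toMod,
    ∀ a x, f.toLin (h.sub.gen a x) = T.gen a x := by
  obtain ⟨f, hf⟩ := h.sub.exists_hom (g := T.gen 1 ∘ₗ X.subtype) (fun n x hx => T.gen_one_mem hx)
    (fun φ x => (T.coact_gen_one φ x).trans
      (congrArg (T.gen 1) (h.graded.isSubrep.coact_restrict φ x).symm)) (fun n x _ => by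
    have : ∀ t, h.sub.ext 0 (T.gen 1 ∘ₗ X.subtype) t = X.subtype.lTensor A t := fun t => by
      refine h.sub.induction (p := fun t => h.sub.ext 0 (T.gen 1 ∘ₗ X.subtype) t =
        X.subtype.lTensor A t) (fun _ _ a _ x _ => ?_) ?_ (fun s t hs ht => ?_) t
      · rw [ext_gen, CDGA.twist_zero]
        exact (T.gen_eq_smul a x).symm
      · rw [map_zero]
        exact (map_zero (X.subtype.lTensor A)).symm
      · rw [map_add, hs, ht]
        exact (map_add (X.subtype.lTensor A) s t).symm
    rw [this]
    exact (h.lTensor_subτ x).trans (T.d_gen_one x).symm)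
  exact ⟨f, fun a x => (hf a x).trans (T.gen_eq_smul a x).symm⟩

/-- The inclusion of the dg submodule generated by a good subspace. -/
def incl : h.sub.toMod ⟶ T.toMod := h.exists_incl.choose

theorem incl_gen (a : A) (x : X) : h.incl.toLin (h.sub.gen a x) = T.gen a x :=
  h.exists_incl.choose_spec a x

/-- The retraction to the dg submodule generated by a good subspace, which does not respect the
differential. -/
def retrLin : T.toMod →ₗ[A] h.sub.toMod := h.retr.baseChange A

theorem retrLin_mem {n : ℤ} {t : T.toMod} (ht : t ∈ T.toMod.str.gr n) :
    h.retrLin t ∈ h.sub.toMod.str.gr n := h.lTensor_retr_mem ht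

theorem retrLin_incl (t : h.sub.toMod) : h.retrLin (h.incl.toLin t) = t := by
  refine h.sub.induction (p := fun t => h.retrLin (h.incl.toLin t) = t) (fun _ _ a _ x _ => ?_)
    (by simp only [map_zero]) (fun s t hs ht => by rw [map_add, map_add, hs, ht]) t
  rw [incl_gen]
  exact congrArg (h.sub.gen a) (h.retr_coe x)

variable {N : DGMod A}

theorem retrLin_balanced : DGMod.Balanced
    ((DGMod.tm h.sub.toMod N) ∘ₗ (h.retrLin.restrictScalars ℚ)) := by
  intro p q a x y ha hx
  refine (DGMod.tm_balanced _ ha (h.retrLin_mem hx)).trans ?_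
  rw [LinearMap.comp_apply, LinearMap.restrictScalars_apply,
    h.retrLin.map_smul]

/-- The graded retraction of `Y` to `X` gives an `A`-linear retraction of the modules. It need not
be compatible with `d` or with `G`, but it is balanced and hence induces a left inverse after
tensoring with `N`. -/
theorem tensorHom_incl_injective :
    Function.Injective (DGMod.tensorHom h.incl (𝟙 N)).toLin := by
  refine Function.LeftInverse.injective (g := DGMod.mlift _ (h.retrLin_balanced (N := N))) fun z => ?_
  refine DGMod.tm_induction (p := fun z => DGMod.mlift _ (h.retrLin_balanced (N := N))
    ((DGMod.tensorHom h.incl (𝟙 N)).toLin z) = z) (fun x y => ?_) (by simp only [map_zero])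
    (fun s t hs ht => by rw [map_add, map_add, hs, ht]) z
  rw [DGMod.tensorHom_tm, DGMod.mlift_tm, LinearMap.comp_apply, LinearMap.restrictScalars_apply,
    retrLin_incl]
  rfl

end IsGood

end Twist

end

/-! ### The bar resolution as a union of finite cell modules; factoring morphisms from the unit -/

noncomputable section

open MonoidalCategory

variable {H : Type u} [CommRing H] [HopfAlgebra ℚ H] {A : CDGA H}

namespace DGMod.Bar

open GComplex

variable {M : DGMod A}

theorem exists_isGood_of_free {n : ℕ}
    (h : ∀ y : syzygy M n, ∃ X, (twist M).IsGood X ∧ sι (syzygy M) n y ∈ X)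
    (x : free (syzygy M n)) : ∃ X, (twist M).IsGood X ∧ j M n x ∈ X.baseChange A := by
  refine (freeTwist _).induction (p := fun x => ∃ X, (twist M).IsGood X ∧ j M n x ∈ X.baseChange A)
    (fun _ _ a _ y _ => ?_) ⟨⊥, Twist.isGood_bot, by rw [map_zero]; exact zero_mem _⟩ ?_ x
  · obtain ⟨X, hX, hy⟩ := h y
    exact ⟨X, hX, Submodule.tmul_mem_baseChange_of_mem _ hy⟩
  · rintro s t ⟨X, hX, hs⟩ ⟨X', hX', ht⟩
    refine ⟨X ⊔ X', hX.sup hX', ?_⟩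
    rw [map_add]
    exact add_mem (Submodule.baseChange_mono A le_sup_left hs)
      (Submodule.baseChange_mono A le_sup_right ht)

/-- `y` lies in a finite-dimensional graded `W` stable under `d`. If a good `X` supports the values
of `k` on `W`, then `W + X` is good, because `τ` on `W` involves only `d W` and `k W`. -/
theorem exists_isGood_of_k {n : ℕ}
    (h : ∀ y : syzygy M n, ∃ X, (twist M).IsGood X ∧ k M n y ∈ X.baseChange A) (y : syzygy M n) :
    ∃ X, (twist M).IsGood X ∧ sι (syzygy M) n y ∈ X := by
  obtain ⟨W, _, hW, hd, hy⟩ := (syzygy M n).str.exists_isGraded_d_mem y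
  have hk : ∀ W : Submodule ℚ (syzygy M n), W.FG →
      ∃ X, (twist M).IsGood X ∧ ∀ w ∈ W, k M n w ∈ X.baseChange A := by
    intro W hfg
    induction W, hfg using Submodule.fg_induction with
    | singleton x =>
      obtain ⟨X, hX, hx⟩ := h x
      refine ⟨X, hX, fun w hw => ?_⟩
      obtain ⟨c, rfl⟩ := Submodule.mem_span_singleton.1 hw
      rw [map_smul]
      exact ((X.baseChange A).restrictScalars ℚ).smul_mem c hx
    | sup W W' _ _ h₁ h₂ =>
      obtain ⟨X, hX, hs⟩ := h₁
      obtain ⟨X', hX', ht⟩ := h₂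
      refine ⟨X ⊔ X', hX.sup hX', fun w hw => ?_⟩
      obtain ⟨u, hu, v, hv, rfl⟩ := Submodule.mem_sup.1 hw
      rw [map_add]
      exact add_mem (Submodule.baseChange_mono A le_sup_left (hs u hu))
        (Submodule.baseChange_mono A le_sup_right (ht v hv))
  obtain ⟨X, hX, hX'⟩ := hk W (Module.Finite.iff_fg.1 inferInstance)
  have := hX.finite
  have hi : ∀ m, ∀ x ∈ (syzygy M n).str.gr m,
      sι (syzygy M) n x ∈ (shiftSum (syzygy M)).gr (m + -(n : ℤ)) :=
    fun m x hx => sι_mem (by rwa [neg_add_cancel_right])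
  refine ⟨W.map (sι (syzygy M) n) ⊔ X, ⟨inferInstance, (hW.map hi (coact_sι (syzygy M) · n)).sup
    hX.graded, fun z hz => ?_⟩, Submodule.mem_sup_left ⟨y, hy, rfl⟩⟩
  obtain ⟨_, ⟨w, hw, rfl⟩, x, hx, rfl⟩ := Submodule.mem_sup.1 hz
  rw [map_add]
  refine add_mem ?_ (Submodule.baseChange_mono A le_sup_right (hX.mem x hx))
  change τ M _ ∈ _
  rw [τ_sι]
  refine add_mem ?_ (Submodule.baseChange_mono A le_sup_right (hX' w hw))
  exact Submodule.smul_mem (Submodule.restrictScalars ℚ (Submodule.baseChange A _)) _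
    (Submodule.tmul_mem_baseChange_of_mem _ (Submodule.mem_sup_left ⟨_, hd w hw, rfl⟩))

/-- Induction on the syzygy: `k` on the summand `n + 1` takes values in the summand `n`, where
finitely many generators are already contained in a good subspace. -/
theorem exists_isGood_sι (n : ℕ) :
    ∀ y : syzygy M n, ∃ X, (twist M).IsGood X ∧ sι (syzygy M) n y ∈ X := by
  induction n with
  | zero => exact exists_isGood_of_k fun y => ⟨⊥, Twist.isGood_bot, zero_mem _⟩
  | succ n ih => exact exists_isGood_of_k fun y => exists_isGood_of_free ih _

/-- The bar resolution is the union of its finite cell submodules. -/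
theorem exists_isGood (y : Gen M) : ∃ X, (twist M).IsGood X ∧ y ∈ X := by
  refine shiftSum_induction (p := fun y => ∃ X, (twist M).IsGood X ∧ y ∈ X) exists_isGood_sι
    ⟨⊥, Twist.isGood_bot, zero_mem _⟩ ?_ y
  rintro s t ⟨X, hX, hs⟩ ⟨X', hX', ht⟩
  exact ⟨X ⊔ X', hX.sup hX', add_mem (Submodule.mem_sup_left hs) (Submodule.mem_sup_right ht)⟩

end DGMod.Bar

namespace Twist

variable {Y : Type u} [AddCommGroup Y] [Module ℚ Y] {T : Twist A Y} {N : DGMod A}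

/-- An element of a tensor product involves finitely many generators, and good subspaces form a
directed family, so one of them supports the whole element. -/
theorem exists_mem_range_tensorHom_incl (hT : ∀ y, ∃ X, T.IsGood X ∧ y ∈ X)
    (z : DGMod.tensor T.toMod N) : ∃ (X : _) (h : T.IsGood X) (t : _),
      (DGMod.tensorHom h.incl (𝟙 N)).toLin t = z := by
  let R (X : Submodule ℚ Y) : Submodule ℚ (DGMod.tensor T.toMod N) :=
    Submodule.span ℚ {z | ∃ a, ∃ x ∈ X, ∃ n, z = DGMod.tm T.toMod N (T.gen a x) n}
  have hR : ∀ {X X' : Submodule ℚ Y}, X ≤ X' → R X ≤ R X' := fun hX => by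
    refine Submodule.span_mono ?_
    rintro _ ⟨a, x, hx, n, rfl⟩
    exact ⟨a, x, hX hx, n, rfl⟩
  have hs : ∀ {s t}, (∃ X, T.IsGood X ∧ s ∈ R X) → (∃ X, T.IsGood X ∧ t ∈ R X) →
      ∃ X, T.IsGood X ∧ s + t ∈ R X := by
    rintro s t ⟨X, hX, hs⟩ ⟨X', hX', ht⟩
    exact ⟨X ⊔ X', hX.sup hX', add_mem (hR le_sup_left hs) (hR le_sup_right ht)⟩
  have key : ∃ X, T.IsGood X ∧ z ∈ R X := by
    refine DGMod.tm_induction (p := fun z => ∃ X, T.IsGood X ∧ z ∈ R X) (fun t n => ?_)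
      ⟨⊥, isGood_bot, zero_mem _⟩ (fun _ _ => hs) z
    refine T.induction (p := fun t => ∃ X, T.IsGood X ∧ DGMod.tm T.toMod N t n ∈ R X)
      (fun _ _ a _ y _ => ?_) ⟨⊥, isGood_bot, by rw [map_zero]; exact zero_mem _⟩
      (fun s t h h' => by rw [map_add]; exact hs h h') t
    obtain ⟨X, hX, hy⟩ := hT y
    exact ⟨X, hX, Submodule.subset_span ⟨a, y, hy, n, rfl⟩⟩
  obtain ⟨X, hX, hz⟩ := key
  have : R X ≤ LinearMap.range ((DGMod.tensorHom hX.incl (𝟙 N)).toLin.restrictScalars ℚ) := by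
    refine Submodule.span_le.2 ?_
    rintro _ ⟨a, x, hx, n, rfl⟩
    refine ⟨DGMod.tm _ N (hX.sub.gen a ⟨x, hx⟩) n, ?_⟩
    refine (DGMod.tensorHom_tm _ _ _ _).trans ?_
    rw [hX.incl_gen]
    rfl
  obtain ⟨t, ht⟩ := this hz
  exact ⟨X, hX, t, ht⟩

end Twist

namespace DGMod

variable {M N : DGMod A}

/-- Invariant cycles lift along injective morphisms. -/
theorem exists_lift_of_injective (f : M ⟶ N) (hf : Function.Injective f.toLin) (g : unit A ⟶ N)
    {t : M} (ht : f.toLin t = g.toLin (ofA 1)) : ∃ g' : unit A ⟶ M, g' ≫ f = g := by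
  have h₀ : t ∈ M.str.gr 0 := by
    have := GComplex.proj_comm (f := f.toLin.restrictScalars ℚ) (k := 0) (S := M.str) (S' := N.str)
      (fun n x hx => by rw [add_zero]; exact f.mem hx) 0 t
    rw [add_zero, LinearMap.restrictScalars_apply, ht, N.str.proj_same (g.mem (ofA_mem A.one_mem)),
      ← ht] at this
    rw [hf this]
    exact M.str.proj_mem 0 t
  have hd : M.str.d t = 0 := hf (by rw [f.d, ht, ← g.d, d_ofA, d_one, map_zero, map_zero, map_zero])
  have hρ : M.str.ρ t = t ⊗ₜ 1 := by
    refine eq_of_slice fun φ => hf ?_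
    rw [slice_tmul]
    change f.toLin (coact M.str.ρ φ t) = _
    rw [← Hom.coact, ht, Hom.coact, coact_apply, ρ_ofA_one, slice_tmul,
      LinearMap.map_smul_of_tower, ← ht, LinearMap.map_smul_of_tower]
  refine ⟨ofCycle t h₀ hd hρ, unit_hom_ext ?_⟩
  rw [comp_toLin, LinearMap.comp_apply, ofCycle_ofA, one_smul, ht]

theorem isFiniteCell_unit {w : H →ₐc[ℚ] ℚ[T;T⁻¹]} (hc : IsCentralCochar w)
    (hA : A.IsAdamsConnected w) : IsFiniteCell (unit A) := by
  let V : Submodule ℚ (unit A) := Submodule.span ℚ {ofA 1}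
  have hV : ∀ φ, ∀ v ∈ V, coact (unit A).str.ρ φ v = φ 1 • v := by
    intro φ v hv
    obtain ⟨c, rfl⟩ := Submodule.mem_span_singleton.1 hv
    rw [map_smul, coact_apply, ρ_ofA_one, slice_tmul, smul_comm]
  let e : V := ⟨ofA 1, Submodule.mem_span_singleton_self _⟩
  have ht : ∀ t : A ⊗[ℚ] V, ∃ a, t = a ⊗ₜ e := by
    intro t
    induction t using TensorProduct.induction_on with
    | zero => exact ⟨0, (TensorProduct.zero_tmul _ _).symm⟩
    | add s t hs ht =>
      obtain ⟨a, rfl⟩ := hs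
      obtain ⟨b, rfl⟩ := ht
      exact ⟨a + b, (TensorProduct.add_tmul _ _ _).symm⟩
    | tmul a v =>
      obtain ⟨c, hc⟩ := Submodule.mem_span_singleton.1 v.2
      exact ⟨c • a, by rw [TensorProduct.smul_tmul]; congr 1; exact Subtype.ext hc.symm⟩
  have he : ∀ a : A, liftA (A := A) V.subtype (a ⊗ₜ e) = ofA a := fun a => by
    rw [liftA_tmul]
    exact (smul_ofA a 1).trans (by rw [mul_one])
  have hf : IsFreeOn (unit A) V := by
    refine ⟨inferInstance, GComplex.isGraded_of_le (m := 0) (isSubrep_iff.2 fun φ v hv => ?_)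
      ((Submodule.span_singleton_le_iff_mem _ _).2 (ofA_mem A.one_mem)), fun s t h => ?_, fun x => ?_⟩
    · rw [hV φ v hv]
      exact Submodule.smul_mem _ _ hv
    · obtain ⟨a, rfl⟩ := ht s
      obtain ⟨b, rfl⟩ := ht t
      rw [he, he] at h
      exact congrArg (· ⊗ₜ e) (show a = b from h)
    · obtain ⟨a, rfl⟩ := ofA_surjective x
      exact ⟨a ⊗ₜ e, he a⟩
  exact hf.isFiniteCell hA hc

/-- A morphism from the unit to `M ⊗ N`, for `N` flat, factors up to homotopy through `F ⊗ N` for a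
finite cell module `F` over `M`. -/
theorem exists_factor_tensor (hH : IsReductive H) {w : H →ₐc[ℚ] ℚ[T;T⁻¹]} (hc : IsCentralCochar w)
    (hA : A.IsAdamsConnected w) (hN : flat A N) (g : unit A ⟶ tensor M N) :
    ∃ (F : DGMod A) (f : F ⟶ M) (g' : unit A ⟶ tensor F N), IsFiniteCell F ∧
      Homotopic (g' ≫ tensorHom f (𝟙 N)) g := by
  have hq : IsQuasiIso (tensorHom (Bar.aug M) (𝟙 N)) := hN.2 _ (Bar.isQuasiIso_aug M)
  -- `N` is flat, so the resolution of `M` remains a quasi-isomorphism after tensoring with `N`. The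
  -- unit is a finite cell module and lifts along it up to homotopy; the lift is determined by the
  -- image of `1`, a single element.
  obtain ⟨k, hk⟩ := exists_lift_homotopic hH hq (isFiniteCell_unit hc hA) g
  obtain ⟨X, h, t, ht⟩ := Twist.exists_mem_range_tensorHom_incl Bar.exists_isGood (k.toLin (ofA 1))
  obtain ⟨g', hg'⟩ := exists_lift_of_injective _ h.tensorHom_incl_injective k ht
  refine ⟨h.sub.toMod, h.incl ≫ Bar.aug M, g', h.isFiniteCell hc hA, ?_⟩
  have e : tensorHom (h.incl ≫ Bar.aug M) (𝟙 N) =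
      tensorHom h.incl (𝟙 N) ≫ tensorHom (Bar.aug M) (𝟙 N) :=
    MonoidalCategory.comp_whiskerRight h.incl (Bar.aug M) N
  rwa [e, ← Category.assoc, hg']

end DGMod

end

/-! ### Rigid objects come from finite cell modules -/

noncomputable section

open MonoidalCategory

variable {H : Type u} [CommRing H] [HopfAlgebra ℚ H] {A : CDGA H}

namespace DGMod

open Functor.LaxMonoidal Functor.OplaxMonoidal

theorem flat_of_isFiniteCell {M : DGMod A} (hM : IsFiniteCell M) : flat A M := by
  obtain ⟨c, hc⟩ := hM
  obtain ⟨ι, _, _, ⟨B⟩⟩ := CellStructure.exists_hBasis c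
  exact B.flat

variable {w : H →ₐc[ℚ] ℚ[T;T⁻¹]}

/-- The lifting criterion for morphisms out of the unit asks for lifts only up to equality after
localization; lifts up to homotopy qualify, since homotopic morphisms from the unit to a flat module
agree there. -/
theorem exists_map_QFlat (hH : IsReductive H) (hc : IsCentralCochar w) (hA : A.IsAdamsConnected w)
    {N : (flat A).FullSubcategory} (f : (QFlat A).obj (𝟙_ _) ⟶ (QFlat A).obj N) :
    ∃ g : 𝟙_ _ ⟶ N, (QFlat A).map g = f := by
  refine exists_map_Q (quasiIsoFlat A) (F := 𝟙_ _) (fun N N' v hv f => ?_) f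
  obtain ⟨g, hg⟩ := exists_lift_homotopic (M := unit A) hH hv (isFiniteCell_unit hc hA) f.hom
  exact ⟨⟨g⟩, QFlat_map_eq N'.property hg⟩

/-- The coevaluation is represented by a morphism of dg modules `A → p ⊗ p'`, which factors up to
homotopy through `F ⊗ p'` for a finite cell module `F → p`. Duality turns the factorization into a
section of `F → p`, and a retract of a finite cell module is finite. -/
theorem finiteD_of_isRigid (hH : IsReductive H) (hc : IsCentralCochar w)
    (hA : A.IsAdamsConnected w) {X : DCat A} (hX : IsRigid X) : finiteD A X := by
  obtain ⟨P, P', ⟨hP⟩, ⟨e⟩⟩ := hX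
  let p := (QFlat A).objPreimage P
  let p' := (QFlat A).objPreimage P'
  let i : (QFlat A).obj p ≅ P := (QFlat A).objObjPreimageIso P
  let _ : ExactPairing ((QFlat A).obj p) ((QFlat A).obj p') :=
    exactPairingCongr i ((QFlat A).objObjPreimageIso P')
  -- The structure maps of the monoidal functor turn the coevaluation into a morphism between images
  -- of flat dg modules, so that it can be represented.
  obtain ⟨g, hg⟩ := exists_map_QFlat hH hc hA
    (η (QFlat A) ≫ η_ ((QFlat A).obj p) ((QFlat A).obj p') ≫ μ (QFlat A) p p')
  obtain ⟨F, f, g', hF, h⟩ := exists_factor_tensor hH hc hA p'.property g.hom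
  let F' : (flat A).FullSubcategory := ⟨F, flat_of_isFiniteCell hF⟩
  let f' : F' ⟶ p := ⟨f⟩
  let d : 𝟙_ (flat A).FullSubcategory ⟶ F' ⊗ p' := ⟨g'⟩
  -- The homotopy becomes an equality because its source is the unit and its target `p ⊗ p'` is
  -- flat.
  have hd : (QFlat A).map (d ≫ f' ▷ p') = (QFlat A).map g := QFlat_map_eq (p ⊗ p').property h
  obtain ⟨s, hs⟩ := ExactPairing.exists_section ((QFlat A).map f')
    (ε (QFlat A) ≫ (QFlat A).map d ≫ δ (QFlat A) F' p') (by
      rw [Category.assoc, Category.assoc, δ_natural_left, ← Functor.map_comp_assoc, hd, hg]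
      simp)
  refine finiteD_of_retract hH hc hA hF
    { i := e.inv ≫ (flatToD A).map (i.inv ≫ s) ≫ (QFlatCompIso A).hom.app F'
      r := (QFlatCompIso A).inv.app F' ≫ (flatToD A).map ((QFlat A).map f' ≫ i.hom) ≫ e.hom
      retract := ?_ }
  have : (flatToD A).map (i.inv ≫ s) ≫ (flatToD A).map ((QFlat A).map f' ≫ i.hom) = 𝟙 _ := by
    rw [← Functor.map_comp, Category.assoc, reassoc_of% hs, i.inv_hom_id,
      CategoryTheory.Functor.map_id]
  simp only [Category.assoc]
  erw [Iso.hom_inv_id_app_assoc]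
  rw [reassoc_of% this, e.inv_hom_id]

end DGMod

end

theorem mainTheorem6 {H : Type u} [CommRing H] [HopfAlgebra ℚ H] [Algebra.FiniteType ℚ H]
    (hH : IsReductive H) (w : H →ₐc[ℚ] ℚ[T;T⁻¹]) (hw : Function.Surjective w)
    (hc : IsCentralCochar w) (A : CDGA H) (hA : A.IsAdamsConnected w) :
    (∀ M : DCat A, IsRigid M ↔ finiteD A M) ∧
    (∃ h : ∀ X : (cellSummandK A).FullSubcategory,
        finiteD A (((cellSummandK A).ι ⋙ (quasiIsoK A).Q).obj X),
      ((finiteD A).lift ((cellSummandK A).ι ⋙ (quasiIsoK A).Q) h).IsEquivalence) ∧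
    IsIdempotentComplete (finiteD A).FullSubcategory := by
  exact ⟨fun X => ⟨DGMod.finiteD_of_isRigid hH hc hA, DGMod.isRigid_of_finiteD⟩,
    ⟨fun X => DGMod.finiteD_of_cellSummandK hH hc hA X.property,
      DGMod.isEquivalence_cellSummandK hH hc hA _⟩,
    DGMod.isIdempotentComplete_finiteD hH hc hA⟩
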